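/- Let $0<q<1$, $0\le s\le 1$ and let $N\in\frac12\mathbb{Z}$, $N\neq 0$. Write $[x]=(q^x-q^{-x})/(q-q^{-1})$. Let $\mathcal{A}(S^2_{qs})$ be the unital complex $*$-algebra generated by $A=A^*$, $B$, $B^*$ with relations $$AB=q^2BA,\qquad BB^*+(A+s^2)(A-1)=0,\qquad B^*B+(q^2A+s^2)(q^2A-1)=0 ,$$ and put $x_1=(q[2])^{1/2}B$, $x_0=-q[2]A+(1-s^2)$. For $M=\pm N$ let $\mathcal{H}_M$ be the Hilbert space with orthonormal basis $|l,m;M\rangle$, $l-|N|\in\mathbb{N}$, $l-|m|\in\mathbb{N}$ (where $0\in\mathbb{N}$; vectors with labels out of range are read as $0$), and let $\mathcal{H}=\mathcal{H}_{-N}\oplus\mathcal{H}_N$ with grading $\gamma=1\oplus-1$. Then there is a $*$-representation of $\mathcal{A}(S^2_{qs})$ by bounded operators on $\mathcal{H}$ such that for $M=\pm N$ $$x_1|l,m;M\rangle=q^{-l+m}\sqrt{[l+m+1][l+m+2]}\,\alpha_{M,l+1}|l+1,m+1;M\rangle-q^{m+2}\sqrt{[2][l-m][l+m+1]}\,\beta_{M,l}|l,m+1;M\rangle-q^{l+m+1}\sqrt{[l-m][l-m-1]}\,\alpha_{M,l}|l-1,m+1;M\rangle,$$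 $$x_0|l,m;M\rangle=a_{l,m}|l+1,m;M\rangle+\bigl([2l]-q^{l+m+1}[2][l-m]\bigr)\beta_{M,l}|l,m;M\rangle+a_{l-1,m}|l-1,m;M\rangle,$$ with $a_{l,m}=q^m\sqrt{[2][l-m+1][l+m+1]}\,\alpha_{M,l+1}$ and $$\alpha_{M,l}=\frac{1}{[2l]}\sqrt{\frac{[2][l+M][l-M]}{[2l-1][2l+1]}}\sqrt{(q^{l+M}+q^{-(l+M)}s^2)(q^{l-M}s^2+q^{-(l-M)})},$$ $$\beta_{M,l}=\frac{\bigl([2l]-q^{l+M+1}[2][l-M]\bigr)(1-s^2)+q[2][2M]s^2}{q^2[2l][2l+2]} .$$ Let $D$ be the self-adjoint operator on $\mathcal{H}$ with $D|l,m;\pm N\rangle=(l-|N|+1)|l,m;\mp N\rangle$, on its maximal domain; its absolute value is $|D|\,|l,m;\pm N\rangle=(l-|N|+1)|l,m;\pm N\rangle$. Then: 1. $(\mathcal{A}(S^2_{qs}),\mathcal{H},D,\gamma)$ is an even spectral triple: $D$ is self-adjoint, $D+i$ has a compact inverse, $[D,a]$ is bounded for all $a\in\mathcal{A}(S^2_{qs})$,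 and $\gamma=\gamma^*$, $\gamma^2=1$, $\gamma D=-D\gamma$, $\gamma a=a\gamma$. It is regular: $a$ and $[D,a]$ belong to $\bigcap_j\mathrm{dom}\,\delta^j$ for all $a\in\mathcal{A}(S^2_{qs})$, where $\delta=[|D|,\cdot\,]$. 2. Its metric dimension is $2$: the singular values $\mu_n$ of $|D|^{-2}$ are $O(1/n)$ and $\frac{1}{\log n}\sum_{k\le n}\mu_k$ converges to a positive limit (the Dixmier trace of $|D|^{-2}$). 3. Its dimension spectrum is $\Sigma=\{1,2\}$. That is, let $\Psi^0$ be the algebra generated by the operators $\delta^k(a)$ and $\delta^k([D,a])$ with $k\ge 0$ and $a\in\mathcal{A}(S^2_{qs})$. For each $T\in\Psi^0$ the operator $T|D|^{-z}$ is of trace class for $\mathrm{Re}\,z>2$, and the function $\zeta_T(z)=\mathrm{Tr}(T|D|^{-z})$ is holomorphic there and has a meromorphic extension to $\mathbb{C}$; the set of all poles of all these extensions, $T\in\Psi^0$, is exactly $\{1,2\}$. All these poles are simple. -/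

import Mathlib

open Filter Topology
open scoped InnerProductSpace

noncomputable section

namespace Podles

/-! ### The coordinate algebra of the Podleś sphere -/

/-- The symbols `A`, `B`, `B*`. -/
inductive Gen where
  | A : Gen
  | B : Gen
  | Bstar : Gen

/-- The involution on symbols: `A* = A`, and `B`, `B*` are exchanged. -/
def Gen.adj : Gen → Gen
  | .A => .A
  | .B => .Bstar
  | .Bstar => .B

/-- The free unital complex algebra on `A`, `B`, `B*`. -/
abbrev Free : Type := FreeAlgebra ℂ Gen

/-- The defining relations `AB = q²BA`, `BB* + (A + s²)(A - 1) = 0`,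
`B*B + (q²A + s²)(q²A - 1) = 0`, together with the adjoint `B*A = q²AB*` of the first one
(the other two are self-adjoint). -/
inductive Rel (q s : ℝ) : Free → Free → Prop where
  | AB : Rel q s
      (FreeAlgebra.ι ℂ Gen.A * FreeAlgebra.ι ℂ Gen.B)
      (((q : ℂ) ^ 2) • (FreeAlgebra.ι ℂ Gen.B * FreeAlgebra.ι ℂ Gen.A))
  | BstarA : Rel q s
      (FreeAlgebra.ι ℂ Gen.Bstar * FreeAlgebra.ι ℂ Gen.A)
      (((q : ℂ) ^ 2) • (FreeAlgebra.ι ℂ Gen.A * FreeAlgebra.ι ℂ Gen.Bstar))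
  | BBstar : Rel q s
      (FreeAlgebra.ι ℂ Gen.B * FreeAlgebra.ι ℂ Gen.Bstar
        + (FreeAlgebra.ι ℂ Gen.A + ((s : ℂ) ^ 2) • 1) * (FreeAlgebra.ι ℂ Gen.A - 1)) 0
  | BstarB : Rel q s
      (FreeAlgebra.ι ℂ Gen.Bstar * FreeAlgebra.ι ℂ Gen.B
        + (((q : ℂ) ^ 2) • FreeAlgebra.ι ℂ Gen.A + ((s : ℂ) ^ 2) • 1)
          * (((q : ℂ) ^ 2) • FreeAlgebra.ι ℂ Gen.A - 1)) 0

/-- The unital complex algebra `𝒜(S²_qs)` with generators `A`, `B`, `B*` and the relations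
`Rel q s`. -/
abbrev Alg (q s : ℝ) : Type := RingQuot (Rel q s)

/-- The class of a generator in `𝒜(S²_qs)`. -/
def gen (q s : ℝ) (g : Gen) : Alg q s := RingQuot.mkAlgHom ℂ (Rel q s) (FreeAlgebra.ι ℂ g)

/-- The opposite ring of a complex algebra with the complex conjugate scalar action; an algebra
homomorphism into it is an antilinear antihomomorphism. -/
def ConjOp (R : Type) : Type := Rᵐᵒᵖ

instance (R : Type) [Ring R] : Ring (ConjOp R) := inferInstanceAs (Ring Rᵐᵒᵖ)

instance (R : Type) [Ring R] [Algebra ℂ R] : Algebra ℂ (ConjOp R) :=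
  RingHom.toAlgebra' ((algebraMap ℂ Rᵐᵒᵖ).comp (starRingEnd ℂ)) (fun c x => by
    exact Algebra.commutes (A := Rᵐᵒᵖ) (starRingEnd ℂ c) x)

namespace ConjOp

variable {R : Type}

/-- The element of the conjugate opposite algebra given by `x`. -/
def mk (x : R) : ConjOp R := MulOpposite.op x

/-- The underlying element. -/
def out (x : ConjOp R) : R := MulOpposite.unop (α := R) x

theorem out_inj {x y : ConjOp R} (h : out x = out y) : x = y :=
  MulOpposite.unop_injective (α := R) h

theorem out_mk (x : R) : out (mk x) = x := rfl

variable [Ring R]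

theorem out_mul (x y : ConjOp R) : out (x * y) = out y * out x := rfl

theorem out_add (x y : ConjOp R) : out (x + y) = out x + out y := rfl

theorem out_sub (x y : ConjOp R) : out (x - y) = out x - out y := rfl

theorem out_one : out (1 : ConjOp R) = 1 := rfl

theorem out_zero : out (0 : ConjOp R) = 0 := rfl

variable [Algebra ℂ R]

theorem out_algebraMap (c : ℂ) :
    out (algebraMap ℂ (ConjOp R) c) = algebraMap ℂ R (starRingEnd ℂ c) := rfl

theorem out_smul (c : ℂ) (x : ConjOp R) : out (c • x) = (starRingEnd ℂ c) • out x := by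
  rw [Algebra.smul_def, out_mul, out_algebraMap, Algebra.smul_def, Algebra.commutes]

end ConjOp

theorem gen_AB (q s : ℝ) :
    gen q s .A * gen q s .B = ((q : ℂ) ^ 2) • (gen q s .B * gen q s .A) := by
  simpa [gen] using RingQuot.mkAlgHom_rel ℂ (Rel.AB (q := q) (s := s))

theorem gen_BstarA (q s : ℝ) :
    gen q s .Bstar * gen q s .A = ((q : ℂ) ^ 2) • (gen q s .A * gen q s .Bstar) := by
  simpa [gen] using RingQuot.mkAlgHom_rel ℂ (Rel.BstarA (q := q) (s := s))

theorem gen_BBstar (q s : ℝ) :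
    gen q s .B * gen q s .Bstar
      + (gen q s .A + ((s : ℂ) ^ 2) • 1) * (gen q s .A - 1) = 0 := by
  simpa [gen] using RingQuot.mkAlgHom_rel ℂ (Rel.BBstar (q := q) (s := s))

theorem gen_BstarB (q s : ℝ) :
    gen q s .Bstar * gen q s .B
      + (((q : ℂ) ^ 2) • gen q s .A + ((s : ℂ) ^ 2) • 1)
        * (((q : ℂ) ^ 2) • gen q s .A - 1) = 0 := by
  simpa [gen] using RingQuot.mkAlgHom_rel ℂ (Rel.BstarB (q := q) (s := s))

/-- The antilinear antihomomorphism `Free → 𝒜(S²_qs)` sending a symbol to the class of its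
adjoint. -/
def freeStar (q s : ℝ) : Free →ₐ[ℂ] ConjOp (Alg q s) :=
  FreeAlgebra.lift ℂ (fun g => ConjOp.mk (gen q s g.adj))

theorem freeStar_gen (q s : ℝ) (g : Gen) :
    freeStar q s (FreeAlgebra.ι ℂ g) = ConjOp.mk (gen q s g.adj) := by
  unfold freeStar
  exact FreeAlgebra.lift_ι_apply _ _

theorem freeStar_rel (q s : ℝ) {x y : Free} (h : Rel q s x y) :
    freeStar q s x = freeStar q s y := by
  apply ConjOp.out_inj
  cases h with
  | AB =>
    simpa [freeStar_gen, ConjOp.out_mul, ConjOp.out_smul, ConjOp.out_mk, Gen.adj]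
      using gen_BstarA q s
  | BstarA =>
    simpa [freeStar_gen, ConjOp.out_mul, ConjOp.out_smul, ConjOp.out_mk, Gen.adj]
      using gen_AB q s
  | BBstar =>
    simp only [map_add, map_sub, map_mul, map_smul, map_one, map_zero, freeStar_gen,
      ConjOp.out_mul, ConjOp.out_add, ConjOp.out_sub, ConjOp.out_smul, ConjOp.out_mk,
      ConjOp.out_one, ConjOp.out_zero, Gen.adj, map_pow, Complex.conj_ofReal]
    rw [← gen_BBstar q s]
    simp only [mul_add, add_mul, mul_sub, sub_mul, smul_mul_assoc, mul_smul_comm, one_mul,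
      mul_one, smul_sub]
    abel
  | BstarB =>
    simp only [map_add, map_sub, map_mul, map_smul, map_one, map_zero, freeStar_gen,
      ConjOp.out_mul, ConjOp.out_add, ConjOp.out_sub, ConjOp.out_smul, ConjOp.out_mk,
      ConjOp.out_one, ConjOp.out_zero, Gen.adj, map_pow, Complex.conj_ofReal]
    rw [← gen_BstarB q s]
    simp only [mul_add, add_mul, mul_sub, sub_mul, smul_mul_assoc, mul_smul_comm, one_mul,
      mul_one, smul_add, smul_sub]
    rw [smul_comm ((s : ℂ) ^ 2) ((q : ℂ) ^ 2) (gen q s Gen.A)]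
    abel

/-- The involution of `𝒜(S²_qs)` as an antilinear antihomomorphism. -/
def starHom (q s : ℝ) : Alg q s →ₐ[ℂ] ConjOp (Alg q s) :=
  RingQuot.liftAlgHom ℂ ⟨freeStar q s, fun _ _ h => freeStar_rel q s h⟩

theorem starHom_gen (q s : ℝ) (g : Gen) :
    starHom q s (gen q s g) = ConjOp.mk (gen q s g.adj) := by
  unfold starHom gen
  rw [RingQuot.liftAlgHom_mkAlgHom_apply]
  exact freeStar_gen q s g

/-- The square of the involution, as an algebra homomorphism. -/
def starSq (q s : ℝ) : Alg q s →ₐ[ℂ] Alg q s where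
  toFun x := ConjOp.out (starHom q s (ConjOp.out (starHom q s x)))
  map_one' := by simp [ConjOp.out_one]
  map_mul' x y := by simp [ConjOp.out_mul]
  map_zero' := by simp [ConjOp.out_zero]
  map_add' x y := by simp [ConjOp.out_add]
  commutes' c := by simp [ConjOp.out_algebraMap]

theorem starSq_eq (q s : ℝ) : starSq q s = AlgHom.id ℂ (Alg q s) := by
  refine RingQuot.ringQuot_ext' ℂ _ _ ?_
  apply FreeAlgebra.hom_ext
  funext g
  change ConjOp.out (starHom q s (ConjOp.out (starHom q s (gen q s g)))) = gen q s g
  rw [starHom_gen, ConjOp.out_mk, starHom_gen, ConjOp.out_mk]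
  cases g <;> rfl

/-- The `*`-structure of `𝒜(S²_qs)`: antilinear, antimultiplicative, `A* = A`, and `B*` is the
adjoint of `B`. -/
instance (q s : ℝ) : StarRing (Alg q s) where
  star x := ConjOp.out (starHom q s x)
  star_involutive x := DFunLike.congr_fun (starSq_eq q s) x
  star_mul x y := by
    change ConjOp.out (starHom q s (x * y)) = _
    rw [map_mul, ConjOp.out_mul]
  star_add x y := by
    change ConjOp.out (starHom q s (x + y)) = _
    rw [map_add, ConjOp.out_add]

theorem star_gen (q s : ℝ) (g : Gen) : star (gen q s g) = gen q s g.adj := by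
  change ConjOp.out (starHom q s (gen q s g)) = _
  rw [starHom_gen, ConjOp.out_mk]

end Podles

/-! ### Spectral triples -/

namespace SpecTriple

variable {H : Type} [NormedAddCommGroup H] [InnerProductSpace ℂ H] [CompleteSpace H]

/-- The commutator `[D, T]` of an unbounded operator with a bounded one is defined on `dom D`
and extends to the bounded operator `S`. -/
def IsComm (D : H →ₗ.[ℂ] H) (T S : H →L[ℂ] H) : Prop :=
  ∀ v : D.domain, ∃ h : T v ∈ D.domain, D ⟨T v, h⟩ - T (D v) = S v

/-- `(𝒜, H, D)` is a spectral triple, with representation `π`. -/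
structure IsSpectralTriple {𝒜 : Type} [Ring 𝒜] [StarRing 𝒜] [Algebra ℂ 𝒜]
    (π : 𝒜 →⋆ₐ[ℂ] (H →L[ℂ] H)) (D : H →ₗ.[ℂ] H) : Prop where
  dense : Dense (D.domain : Set H)
  selfAdjoint : IsSelfAdjoint D
  /-- `D + i` has a compact inverse `R`. -/
  compact_resolvent : ∃ R : H →L[ℂ] H, IsCompactOperator R ∧
    (∀ v : H, ∃ h : R v ∈ D.domain, D ⟨R v, h⟩ + Complex.I • R v = v) ∧
    (∀ v : D.domain, R (D v + Complex.I • (v : H)) = v)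
  bounded_comm : ∀ a : 𝒜, ∃ S : H →L[ℂ] H, IsComm D (π a) S

/-- `γ` is a grading operator making `(𝒜, H, D)` even. -/
structure IsGrading {𝒜 : Type} [Ring 𝒜] [StarRing 𝒜] [Algebra ℂ 𝒜]
    (π : 𝒜 →⋆ₐ[ℂ] (H →L[ℂ] H)) (D : H →ₗ.[ℂ] H) (γ : H →L[ℂ] H) : Prop where
  selfAdjoint : IsSelfAdjoint γ
  sq_eq_one : γ * γ = 1
  anticomm : ∀ v : D.domain, ∃ h : γ v ∈ D.domain, D ⟨γ v, h⟩ = -γ (D v)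
  comm : ∀ a : 𝒜, π a * γ = γ * π a

/-- `P = |D|`: the positive self-adjoint operator with `P² = D²`, equality of unbounded operators
including their domains. -/
structure IsAbs (D P : H →ₗ.[ℂ] H) : Prop where
  dense : Dense (P.domain : Set H)
  selfAdjoint : IsSelfAdjoint P
  nonneg : ∀ v : P.domain, 0 ≤ (⟪(v : H), P v⟫_ℂ).re
  sq_eq : ∀ v w : H,
    (∃ (h : v ∈ P.domain) (h' : P ⟨v, h⟩ ∈ P.domain), P ⟨P ⟨v, h⟩, h'⟩ = w) ↔
    (∃ (h : v ∈ D.domain) (h' : D ⟨v, h⟩ ∈ D.domain), D ⟨D ⟨v, h⟩, h'⟩ = w)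

/-- `OP⁰ = ⋂ⱼ dom δʲ` for the derivation `δ = [P, ·]`, `P = |D|`. -/
def OP0 (P : H →ₗ.[ℂ] H) : Set (H →L[ℂ] H) :=
  {T | ∃ δT : ℕ → (H →L[ℂ] H), δT 0 = T ∧ ∀ j, IsComm P (δT j) (δT (j + 1))}

/-- Regularity: `𝒜 ∪ [D, 𝒜] ⊆ OP⁰`, with `P = |D|`. -/
def IsRegular {𝒜 : Type} [Ring 𝒜] [StarRing 𝒜] [Algebra ℂ 𝒜]
    (π : 𝒜 →⋆ₐ[ℂ] (H →L[ℂ] H)) (D P : H →ₗ.[ℂ] H) : Prop :=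
  ∀ a : 𝒜, π a ∈ OP0 P ∧ ∀ S : H →L[ℂ] H, IsComm D (π a) S → S ∈ OP0 P

/-- The set `⋃ₖ δᵏ(𝒜 ∪ [D, 𝒜])`, with `P = |D|`. -/
inductive PsiGen {𝒜 : Type} [Ring 𝒜] [StarRing 𝒜] [Algebra ℂ 𝒜]
    (π : 𝒜 →⋆ₐ[ℂ] (H →L[ℂ] H)) (D P : H →ₗ.[ℂ] H) : (H →L[ℂ] H) → Prop where
  | of (a : 𝒜) : PsiGen π D P (π a)
  | comm (a : 𝒜) (S : H →L[ℂ] H) : IsComm D (π a) S → PsiGen π D P S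
  | delta (T S : H →L[ℂ] H) : PsiGen π D P T → IsComm P T S → PsiGen π D P S

/-- The algebra `Ψ⁰` generated by `⋃ₖ δᵏ(𝒜 ∪ [D, 𝒜])`. -/
def Psi0 {𝒜 : Type} [Ring 𝒜] [StarRing 𝒜] [Algebra ℂ 𝒜]
    (π : 𝒜 →⋆ₐ[ℂ] (H →L[ℂ] H)) (D P : H →ₗ.[ℂ] H) : Subalgebra ℂ (H →L[ℂ] H) :=
  Algebra.adjoin ℂ {T | PsiGen π D P T}

/-- `R = P^(-z)` for a positive `P` with compact inverse: `R` is the bounded operator acting as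
`x^(-z)` on each eigenspace of `P` with eigenvalue `x > 0`. -/
def IsNegPow (P : H →ₗ.[ℂ] H) (z : ℂ) (R : H →L[ℂ] H) : Prop :=
  ∀ (v : P.domain) (x : ℝ), 0 < x → P v = (x : ℂ) • (v : H) → R v = ((x : ℂ) ^ (-z)) • (v : H)

open Classical in
/-- The operator `P^(-z)`; it exists when `0 ≤ Re z`, for `P` bounded below by `1` with compact
inverse, and is then unique, as the eigenvectors of `P` span a dense subspace. -/
def negPow (P : H →ₗ.[ℂ] H) (z : ℂ) : H →L[ℂ] H :=
  if h : ∃ R, IsNegPow P z R then h.choose else 0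

/-- The singular values `μ₁(T) ≥ μ₂(T) ≥ …`, numbered from `0`: the infimum, over the subspaces
`V` of dimension `n`, of `sup {‖T v‖ : v ⊥ V, ‖v‖ = 1}`. -/
def singularValue (T : H →L[ℂ] H) (n : ℕ) : ℝ :=
  ⨅ V : {V : Submodule ℂ H // FiniteDimensional ℂ V ∧ Module.finrank ℂ V = n},
    ‖T ∘L (V.1ᗮ).subtypeL‖

/-- The trace class `ℒ¹`. -/
def IsTraceClass (T : H →L[ℂ] H) : Prop := Summable (singularValue T)

/-- The trace, computed in an orthonormal basis (for `T` of trace class it does not depend on the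
basis). -/
def trace {ι : Type} (b : HilbertBasis ι ℂ H) (T : H →L[ℂ] H) : ℂ := ∑' i, ⟪b i, T (b i)⟫_ℂ

/-- The positive operator `T` is in the Dixmier ideal `ℒ^(1,∞)`, is measurable, and has Dixmier
trace `L`. -/
def HasDixmierTrace (T : H →L[ℂ] H) (L : ℝ) : Prop :=
  (singularValue T =O[atTop] fun n : ℕ => 1 / ((n : ℝ) + 1)) ∧
  Tendsto (fun n : ℕ => (∑ k ∈ Finset.range n, singularValue T k) / Real.log n) atTop (𝓝 L)

/-- `d` is the metric dimension, with `P = |D|`: the operator `|D|^(-d)` is in the Dixmier ideal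
and its Dixmier trace is positive. -/
def IsMetricDim (P : H →ₗ.[ℂ] H) (d : ℝ) : Prop :=
  0 < d ∧ ∃ L : ℝ, 0 < L ∧ HasDixmierTrace (negPow P d) L

/-- `ζ_T(z) = Tr(T |D|^(-z))`, with `P = |D|`. -/
def zeta {ι : Type} (b : HilbertBasis ι ℂ H) (P : H →ₗ.[ℂ] H) (T : H →L[ℂ] H) (z : ℂ) : ℂ :=
  trace b (T * negPow P z)

/-- `f` is a meromorphic extension to `ℂ` of `ζ_T`, which is defined on `Re z > d`. -/
def IsZetaExtension {ι : Type} (b : HilbertBasis ι ℂ H) (P : H →ₗ.[ℂ] H) (d : ℝ)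
    (T : H →L[ℂ] H) (f : ℂ → ℂ) : Prop :=
  MeromorphicOn f Set.univ ∧ ∀ z : ℂ, d < z.re → f z = zeta b P T z

/-- `Σ` is the dimension spectrum of a regular spectral triple of metric dimension `d`, with
`P = |D|`: for all `T ∈ Ψ⁰`, the function `ζ_T` is defined and holomorphic for `Re z > d` and has a
meromorphic extension to `ℂ`, and the countable set `Σ` is the union of the poles of all these
extensions. -/
structure IsDimensionSpectrum {𝒜 : Type} [Ring 𝒜] [StarRing 𝒜] [Algebra ℂ 𝒜] {ι : Type}
    (b : HilbertBasis ι ℂ H) (π : 𝒜 →⋆ₐ[ℂ] (H →L[ℂ] H)) (D P : H →ₗ.[ℂ] H) (d : ℝ)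
    (Sigma : Set ℂ) : Prop where
  traceClass : ∀ T ∈ Psi0 π D P, ∀ z : ℂ, d < z.re →
    IsNegPow P z (negPow P z) ∧ IsTraceClass (T * negPow P z)
  holomorphic : ∀ T ∈ Psi0 π D P, DifferentiableOn ℂ (zeta b P T) {z | d < z.re}
  extension : ∀ T ∈ Psi0 π D P, ∃ f, IsZetaExtension b P d T f
  countable : Sigma.Countable
  eq_poles : Sigma = {z | ∃ T ∈ Psi0 π D P, ∃ f, IsZetaExtension b P d T f ∧
    meromorphicOrderAt f z < 0}

/-- All the poles of the functions `ζ_T`, `T ∈ Ψ⁰`, are simple. -/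
def HasSimplePoles {𝒜 : Type} [Ring 𝒜] [StarRing 𝒜] [Algebra ℂ 𝒜] {ι : Type}
    (b : HilbertBasis ι ℂ H) (π : 𝒜 →⋆ₐ[ℂ] (H →L[ℂ] H)) (D P : H →ₗ.[ℂ] H) (d : ℝ) : Prop :=
  ∀ T ∈ Psi0 π D P, ∀ f, IsZetaExtension b P d T f → ∀ z : ℂ,
    meromorphicOrderAt f z < 0 → meromorphicOrderAt f z = -1

end SpecTriple

/-! ### Spinors and the Dirac operator -/

namespace Podles

/-- `[x] = (q^x - q^(-x)) / (q - q⁻¹)`. -/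
def qnum (q x : ℝ) : ℝ := (q ^ x - q ^ (-x)) / (q - q⁻¹)

/-- The pair `(l, m)` satisfies `l - |N| ∈ ℕ` and `l - |m| ∈ ℕ`. -/
def IsLabel (N : ℝ) (p : ℝ × ℝ) : Prop :=
  (∃ a : ℕ, p.1 - |N| = a) ∧ ∃ b : ℕ, p.1 - |p.2| = b

/-- Labels `((l, m), ε)` of the basis vectors `|l, m; εN⟩`, `ε = ±1`. -/
abbrev Idx (N : ℝ) : Type := {p : ℝ × ℝ // IsLabel N p} × ℤˣ

/-- The Hilbert space `ℋ_N ⊕ ℋ_{-N}` with orthonormal basis `|l, m; ±N⟩`. -/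
abbrev Spinors (N : ℝ) : Type := lp (fun _ : Idx N => ℂ) 2

/-- The orthonormal basis `|l, m; ±N⟩`. -/
def basis (N : ℝ) : HilbertBasis (Idx N) ℂ (Spinors N) :=
  HilbertBasis.ofRepr (LinearIsometryEquiv.refl ℂ (Spinors N))

open Classical in
/-- The vector `|l, m; εN⟩`, read as `0` when `(l, m)` is out of range. -/
def ket (N l m : ℝ) (ε : ℤˣ) : Spinors N :=
  if h : IsLabel N (l, m) then basis N (⟨(l, m), h⟩, ε) else 0

/-- The coefficient `α_{N,l}(s)`. -/
def alphaCoef (q s N l : ℝ) : ℝ :=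
  1 / qnum q (2 * l)
    * √(qnum q 2 * qnum q (l + N) * qnum q (l - N) / (qnum q (2 * l - 1) * qnum q (2 * l + 1)))
    * √((q ^ (l + N) + q ^ (-(l + N)) * s ^ 2) * (q ^ (l - N) * s ^ 2 + q ^ (-(l - N))))

/-- The coefficient `β_{N,l}(s)`. -/
def betaCoef (q s N l : ℝ) : ℝ :=
  ((qnum q (2 * l) - q ^ (l + N + 1) * qnum q 2 * qnum q (l - N)) * (1 - s ^ 2)
      + q * qnum q 2 * qnum q (2 * N) * s ^ 2)
    / (q ^ 2 * qnum q (2 * l) * qnum q (2 * l + 2))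

/-- `Ã⁺_{l,m}`. -/
def APlus (q s N l m : ℝ) : ℝ :=
  q ^ m * √(qnum q 2 * qnum q (l - m + 1) * qnum q (l + m + 1)) * alphaCoef q s N (l + 1)

/-- `Ã⁰_{l,m}`. -/
def AZero (q s N l m : ℝ) : ℝ :=
  (qnum q (2 * l) - q ^ (l + m + 1) * qnum q 2 * qnum q (l - m)) * betaCoef q s N l

/-- `B̃⁺_{l,m}`. -/
def BPlus (q s N l m : ℝ) : ℝ :=
  q ^ (-l + m) * √(qnum q (l + m + 1) * qnum q (l + m + 2)) * alphaCoef q s N (l + 1)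

/-- `B̃⁰_{l,m}`. -/
def BZero (q s N l m : ℝ) : ℝ :=
  -(q ^ (m + 2)) * √(qnum q 2 * qnum q (l - m) * qnum q (l + m + 1)) * betaCoef q s N l

/-- `B̃⁻_{l,m}`. -/
def BMinus (q s N l m : ℝ) : ℝ :=
  -(q ^ (l + m + 1)) * √(qnum q (l - m) * qnum q (l - m - 1)) * alphaCoef q s N l

/-- The generator `x₁ = (q[2])^{1/2} B`. -/
def x1 (q s : ℝ) : Alg q s := (√(q * qnum q 2) : ℂ) • gen q s .B

/-- The generator `x₀ = -q[2] A + (1 - s²)`. -/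
def x0 (q s : ℝ) : Alg q s :=
  (-(q * qnum q 2 : ℝ) : ℂ) • gen q s .A + ((1 - s ^ 2 : ℝ) : ℂ) • 1

/-- `π` is the representation of `𝒜(S²_qs)` on `ℋ_N ⊕ ℋ_{-N}`, given on the generators
`x₁`, `x₀` by their matrix coefficients; the action of `x₋₁ = -q⁻¹ x₁*` is then determined. -/
structure IsSpinorRep (q s N : ℝ) (π : Alg q s →⋆ₐ[ℂ] (Spinors N →L[ℂ] Spinors N)) : Prop where
  x1_ket : ∀ (l m : ℝ) (ε : ℤˣ), IsLabel N (l, m) →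
    π (x1 q s) (ket N l m ε) =
      (BPlus q s (((ε : ℤ) : ℝ) * N) l m : ℂ) • ket N (l + 1) (m + 1) ε
      + (BZero q s (((ε : ℤ) : ℝ) * N) l m : ℂ) • ket N l (m + 1) ε
      + (BMinus q s (((ε : ℤ) : ℝ) * N) l m : ℂ) • ket N (l - 1) (m + 1) ε
  x0_ket : ∀ (l m : ℝ) (ε : ℤˣ), IsLabel N (l, m) →
    π (x0 q s) (ket N l m ε) =
      (APlus q s (((ε : ℤ) : ℝ) * N) l m : ℂ) • ket N (l + 1) m ε
      + (AZero q s (((ε : ℤ) : ℝ) * N) l m : ℂ) • ket N l m ε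
      + (APlus q s (((ε : ℤ) : ℝ) * N) (l - 1) m : ℂ) • ket N (l - 1) m ε

/-- The closed unbounded operator `e_i ↦ w (σ⁻¹ i) • e_(σ⁻¹ i)` on `ℓ²(ι)`, that is
`(v_i) ↦ (w_i v_(σ i))`, on its maximal domain. -/
def weightedShift {ι : Type} (w : ι → ℝ) (σ : ι ≃ ι) :
    lp (fun _ : ι => ℂ) 2 →ₗ.[ℂ] lp (fun _ : ι => ℂ) 2 where
  domain :=
    { carrier := {v | Memℓp (fun i => (w i : ℂ) * v (σ i)) 2}
      zero_mem' := by
        have h : (fun i => (w i : ℂ) * (0 : lp (fun _ : ι => ℂ) 2) (σ i)) = fun _ => 0 := by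
          funext i; simp
        change Memℓp _ 2
        rw [h]
        exact zero_memℓp
      add_mem' := by
        intro a b ha hb
        have h : (fun i => (w i : ℂ) * (a + b) (σ i))
            = (fun i => (w i : ℂ) * a (σ i)) + fun i => (w i : ℂ) * b (σ i) := by
          funext i; simp [mul_add]
        change Memℓp _ 2
        rw [h]
        exact Memℓp.add ha hb
      smul_mem' := by
        intro c a ha
        have h : (fun i => (w i : ℂ) * (c • a) (σ i)) = c • fun i => (w i : ℂ) * a (σ i) := by
          funext i; simp; ring
        change Memℓp _ 2
        rw [h]
        exact Memℓp.const_smul ha c }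
  toFun :=
    { toFun := fun v => ⟨fun i => (w i : ℂ) * (v : lp (fun _ : ι => ℂ) 2) (σ i), v.2⟩
      map_add' := by
        intro a b
        ext i
        change (w i : ℂ) * ((a : lp (fun _ : ι => ℂ) 2) (σ i) + (b : lp (fun _ : ι => ℂ) 2) (σ i))
          = (w i : ℂ) * (a : lp (fun _ : ι => ℂ) 2) (σ i)
            + (w i : ℂ) * (b : lp (fun _ : ι => ℂ) 2) (σ i)
        ring
      map_smul' := by
        intro c a
        ext i
        change (w i : ℂ) * (c * (a : lp (fun _ : ι => ℂ) 2) (σ i))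
          = c * ((w i : ℂ) * (a : lp (fun _ : ι => ℂ) 2) (σ i))
        ring }

/-- The exchange `|l, m; εN⟩ ↔ |l, m; -εN⟩` of labels. -/
def flip (N : ℝ) : Idx N ≃ Idx N where
  toFun i := (i.1, -i.2)
  invFun i := (i.1, -i.2)
  left_inv i := by simp
  right_inv i := by simp

/-- The eigenvalue `l - |N| + 1`. -/
def eigenvalue (N : ℝ) (i : Idx N) : ℝ := i.1.1.1 - |N| + 1

/-- The Dirac operator `D |l, m; ±N⟩ = (l - |N| + 1) |l, m; ∓N⟩`, self-adjoint on its maximal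
domain. -/
def dirac (N : ℝ) : Spinors N →ₗ.[ℂ] Spinors N := weightedShift (eigenvalue N) (flip N)

/-- The operator `|D| |l, m; ±N⟩ = (l - |N| + 1) |l, m; ±N⟩`. -/
def diracAbs (N : ℝ) : Spinors N →ₗ.[ℂ] Spinors N :=
  weightedShift (eigenvalue N) (Equiv.refl (Idx N))

end Podles

end

/-! Far out in `l` the generators have a simple shape. Both `α_{M,l}` and `β_{M,l}` are `q^(2l)`
times quantities whose limits do not depend on the sign of `M`. Once the growth of the `q`-numbers
is cancelled, a matrix coefficient at `|l, m⟩` is, up to `O(q^l)`, a function of `l + m` alone, the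
same on both summands, and this function converges exponentially fast as `l + m → ∞` (`SymCoef`).

`HasSymbol` states this for operators: finite propagation, `[T, V]` exponentially small in `l` for
`V : |l, m⟩ ↦ |l + 1, m - 1⟩`, and `[T, Y]` exponentially small in `l + m` for `Y : |l, m⟩ ↦ |l, m +
1⟩`. `HasScalarSymbol` adds that the commutator with the exchange `F` of the two summands is small
in `l`. The Leibniz rule makes these classes algebras, and `δ` preserves symbols because `V` and `Y`
are homogeneous for it. As `D = F|D|`, one has `[D, T] = F δ(T) + [F, T]|D|`, and the exponential
decay of `[F, T]` absorbs the growth of `|D|`. So commutators are bounded, the triple is regular,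
and all of `Ψ⁰` has a symbol (`hasSymbol_of_mem_psi0`).

The trace of such a `T` over the eigenspace of `|D|` for `j + 1` is `a(j + 1) + b` up to an
exponentially small error (`exists_affine_asymptotics`). Hence `ζ_T(z) = a ζ(z - 1) + b ζ(z)` plus
an entire function, with at most simple poles, at `2` and `1`. The pole at `2` occurs for `T = 1`.
The pole at `1` occurs for the square of `q[2]A`: its diagonal entries are sums of squares, decay in
`l + m`, and stay away from zero at `m = -l` (`exists_residue_sq`). The metric dimension follows
from the multiplicities: `μ_m = 2/(m + 1) + O(m^(-3/2))`.

The representation exists because its relations reduce, component by component, to three identities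
between the coefficients: a first-order recursion for `β`, one for `α²`, and an expression of `α²`
through `β` (`betaCoef_succ_sub`, `alphaCoef_sq_succ_sub`, `alphaCoef_sq_eq_betaCoef`). -/

noncomputable section

namespace Podles

/-! ### Operators on `ℓ²(ι)` and their matrix entries -/

section EllTwo

variable {ι : Type}

/-- The Hilbert space `ℓ²(ι)`. -/
abbrev L2 (ι : Type) : Type := lp (fun _ : ι => ℂ) 2

/-- The standard orthonormal basis of `ℓ²(ι)`. -/
def stdBasis (ι : Type) : HilbertBasis ι ℂ (L2 ι) :=
  HilbertBasis.ofRepr (LinearIsometryEquiv.refl ℂ (L2 ι))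

theorem inner_stdBasis (i : ι) (v : L2 ι) : ⟪stdBasis ι i, v⟫_ℂ = v i := by
  rw [← HilbertBasis.repr_apply_apply]; rfl

theorem stdBasis_apply_self (i : ι) : stdBasis ι i i = 1 := by
  rw [← inner_stdBasis, inner_self_eq_norm_sq_to_K, (stdBasis ι).orthonormal.1 i]; simp

theorem stdBasis_apply_ne {i j : ι} (h : i ≠ j) : stdBasis ι j i = 0 := by
  rw [← inner_stdBasis]; exact (stdBasis ι).orthonormal.2 h

open Classical in
theorem stdBasis_apply (i j : ι) : stdBasis ι j i = if i = j then 1 else 0 := by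
  split_ifs with h
  · rw [h, stdBasis_apply_self]
  · exact stdBasis_apply_ne h

theorem norm_stdBasis (i : ι) : ‖stdBasis ι i‖ = 1 := (stdBasis ι).orthonormal.1 i

theorem norm_apply_le (v : L2 ι) (i : ι) : ‖v i‖ ≤ ‖v‖ := lp.norm_apply_le_norm (by simp) v i

theorem sum_sq_le (v : L2 ι) (s : Finset ι) : ∑ i ∈ s, ‖v i‖ ^ 2 ≤ ‖v‖ ^ 2 := by
  have := lp.sum_rpow_le_norm_rpow (p := 2) (by simp) v s
  simpa using this

theorem norm_le_of_sum_sq_le (v : L2 ι) {C : ℝ} (hC : 0 ≤ C)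
    (h : ∀ s : Finset ι, ∑ i ∈ s, ‖v i‖ ^ 2 ≤ C ^ 2) : ‖v‖ ≤ C :=
  lp.norm_le_of_forall_sum_le (p := 2) (by simp) hC fun s => by simpa using h s

theorem memℓp_two_of_sum_le {f : ι → ℂ} {C : ℝ} (h : ∀ s : Finset ι, ∑ i ∈ s, ‖f i‖ ^ 2 ≤ C) :
    Memℓp f 2 :=
  memℓp_gen' (C := C) fun s => by simpa using h s

theorem memℓp_two_iff {f : ι → ℂ} : Memℓp f 2 ↔ Summable fun i => ‖f i‖ ^ 2 := by
  rw [memℓp_gen_iff (by simp)]; simp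

theorem memℓp_of_apply_eq {f : ι → ℂ} {u : L2 ι} (h : ∀ i, f i = u i) : Memℓp f 2 := by
  rw [funext h]; exact u.2

theorem memℓp_two_comp (σ : ι ≃ ι) {f : ι → ℂ} :
    Memℓp (fun i => f (σ i)) 2 ↔ Memℓp f 2 := by
  rw [memℓp_two_iff, memℓp_two_iff]
  exact σ.summable_iff (f := fun i => ‖f i‖ ^ 2)

theorem norm_le_mul_of_apply_le (u v : L2 ι) {C : ℝ} (hC : 0 ≤ C) (h : ∀ i, ‖u i‖ ≤ C * ‖v i‖) :
    ‖u‖ ≤ C * ‖v‖ := by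
  refine norm_le_of_sum_sq_le u (by positivity) fun s => ?_
  calc ∑ i ∈ s, ‖u i‖ ^ 2 ≤ ∑ i ∈ s, C ^ 2 * ‖v i‖ ^ 2 := by
        refine Finset.sum_le_sum fun i _ => ?_
        rw [← mul_pow]
        exact pow_le_pow_left₀ (norm_nonneg _) (h i) 2
    _ ≤ (C * ‖v‖) ^ 2 := by
        rw [← Finset.mul_sum, mul_pow]
        exact mul_le_mul_of_nonneg_left (sum_sq_le v s) (by positivity)

/-- The matrix entry `⟪e_i, T e_j⟫`. -/
def ent (T : L2 ι →L[ℂ] L2 ι) (i j : ι) : ℂ := T (stdBasis ι j) i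

theorem clm_ext {E : Type} [NormedAddCommGroup E] [NormedSpace ℂ E] {T S : L2 ι →L[ℂ] E}
    (h : ∀ j, T (stdBasis ι j) = S (stdBasis ι j)) : T = S := by
  refine ContinuousLinearMap.ext_on
    (Submodule.dense_iff_topologicalClosure_eq_top.2 (stdBasis ι).dense_span) ?_
  rintro _ ⟨j, rfl⟩
  exact h j

theorem ent_ext {T S : L2 ι →L[ℂ] L2 ι} (h : ∀ i j, ent T i j = ent S i j) : T = S :=
  clm_ext fun j => lp.ext (funext fun i => h i j)

theorem ent_add (T S : L2 ι →L[ℂ] L2 ι) (i j : ι) : ent (T + S) i j = ent T i j + ent S i j := rfl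

theorem ent_sub (T S : L2 ι →L[ℂ] L2 ι) (i j : ι) : ent (T - S) i j = ent T i j - ent S i j := rfl

theorem ent_smul (c : ℂ) (T : L2 ι →L[ℂ] L2 ι) (i j : ι) : ent (c • T) i j = c * ent T i j := rfl

theorem ent_one_self (i : ι) : ent (1 : L2 ι →L[ℂ] L2 ι) i i = 1 := stdBasis_apply_self i

theorem ent_one_ne {i j : ι} (h : i ≠ j) : ent (1 : L2 ι →L[ℂ] L2 ι) i j = 0 := stdBasis_apply_ne h

theorem ent_star (T : L2 ι →L[ℂ] L2 ι) (i j : ι) : ent (star T) i j = starRingEnd ℂ (ent T j i) := by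
  rw [ent, ent, ← inner_stdBasis, ContinuousLinearMap.star_eq_adjoint,
    ContinuousLinearMap.adjoint_inner_right, ← inner_stdBasis, inner_conj_symm]

theorem norm_ent_le (T : L2 ι →L[ℂ] L2 ι) (i j : ι) : ‖ent T i j‖ ≤ ‖T‖ := by
  refine (norm_apply_le _ i).trans ((T.le_opNorm _).trans ?_)
  rw [norm_stdBasis, mul_one]

theorem apply_eq_sum (T : L2 ι →L[ℂ] L2 ι) (i : ι) (s : Finset ι)
    (h : ∀ j ∉ s, ent T i j = 0) (v : L2 ι) : T v i = ∑ j ∈ s, ent T i j * v j := by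
  classical
  have key : (lp.evalCLM ℂ (fun _ : ι => ℂ) 2 i).comp T
      = ∑ j ∈ s, ent T i j • lp.evalCLM ℂ (fun _ : ι => ℂ) 2 j := by
    refine clm_ext fun j => ?_
    rw [_root_.sum_apply]
    change ent T i j = ∑ x ∈ s, ent T i x * stdBasis ι j x
    by_cases hj : j ∈ s
    · rw [Finset.sum_eq_single j, stdBasis_apply_self, mul_one]
      · intro b _ hb
        rw [stdBasis_apply_ne hb, mul_zero]
      · exact fun h => absurd hj h
    · rw [h j hj, Finset.sum_eq_zero]
      intro x hx
      rw [stdBasis_apply_ne (ne_of_mem_of_not_mem hx hj), mul_zero]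
  have := DFunLike.congr_fun key v
  rw [_root_.sum_apply] at this
  exact this

theorem apply_stdBasis_eq_sum (T : L2 ι →L[ℂ] L2 ι) (j : ι) (s : Finset ι)
    (h : ∀ i ∉ s, ent T i j = 0) : T (stdBasis ι j) = ∑ i ∈ s, ent T i j • stdBasis ι i := by
  classical
  refine lp.ext (funext fun i => ?_)
  have : (↑(∑ x ∈ s, ent T x j • stdBasis ι x) : ι → ℂ) i
      = ∑ x ∈ s, ent T x j * stdBasis ι x i := by
    rw [lp.coeFn_sum, Finset.sum_apply]; rfl
  rw [this]
  by_cases hi : i ∈ s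
  · rw [Finset.sum_eq_single i, stdBasis_apply_self, mul_one]; · rfl
    · intro b _ hb
      rw [stdBasis_apply_ne (Ne.symm hb), mul_zero]
    · exact fun h => absurd hi h
  · rw [Finset.sum_eq_zero]
    · exact h i hi
    · intro x hx
      rw [stdBasis_apply_ne (ne_of_mem_of_not_mem hx hi).symm, mul_zero]

theorem ent_mul (S T : L2 ι →L[ℂ] L2 ι) (i j : ι) (s : Finset ι) (h : ∀ x ∉ s, ent T x j = 0) :
    ent (S * T) i j = ∑ x ∈ s, ent S i x * ent T x j := by
  change S (T (stdBasis ι j)) i = _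
  rw [apply_stdBasis_eq_sum T j s h, map_sum, lp.coeFn_sum, Finset.sum_apply]
  refine Finset.sum_congr rfl fun x _ => ?_
  rw [map_smul]
  exact mul_comm _ _

/-- The Schur test: a bounded kernel supported near the diagonal is the matrix of a bounded
operator. -/
theorem exists_op_of_kernel (nb : ι → Finset ι) (symm : ∀ i j, i ∈ nb j ↔ j ∈ nb i) (c : ℕ)
    (hc : ∀ i, (nb i).card ≤ c) (K : ι → ι → ℂ) {C : ℝ} (hK : ∀ i j, ‖K i j‖ ≤ C)
    (h0 : ∀ i j, j ∉ nb i → K i j = 0) :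
    ∃ T : L2 ι →L[ℂ] L2 ι, (∀ v i, T v i = ∑ j ∈ nb i, K i j * v j) ∧ ∀ i j, ent T i j = K i j := by
  classical
  rcases isEmpty_or_nonempty ι with hι | ⟨⟨i0⟩⟩
  · exact ⟨0, fun v i => hι.elim i, fun i => hι.elim i⟩
  have hC : 0 ≤ C := (norm_nonneg _).trans (hK i0 i0)
  -- Cauchy–Schwarz in each row, then an exchange of the two sums: by `symm`, an index `j` lies in
  -- `nb i` for at most `c` values of `i`.
  have bound : ∀ (v : L2 ι) (s : Finset ι),
      ∑ i ∈ s, ‖∑ j ∈ nb i, K i j * v j‖ ^ 2 ≤ (c * C * ‖v‖) ^ 2 := by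
    intro v s
    have h1 : ∀ i, ‖∑ j ∈ nb i, K i j * v j‖ ^ 2 ≤ c * C ^ 2 * ∑ j ∈ nb i, ‖v j‖ ^ 2 := by
      intro i
      calc ‖∑ j ∈ nb i, K i j * v j‖ ^ 2 ≤ (∑ j ∈ nb i, C * ‖v j‖) ^ 2 := by
            refine pow_le_pow_left₀ (norm_nonneg _) ((norm_sum_le _ _).trans ?_) 2
            refine Finset.sum_le_sum fun j _ => ?_
            rw [norm_mul]
            exact mul_le_mul_of_nonneg_right (hK i j) (norm_nonneg _)
        _ ≤ (nb i).card * ∑ j ∈ nb i, (C * ‖v j‖) ^ 2 := sq_sum_le_card_mul_sum_sq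
        _ ≤ c * ∑ j ∈ nb i, (C * ‖v j‖) ^ 2 := by
            refine mul_le_mul_of_nonneg_right (by exact_mod_cast hc i) ?_
            exact Finset.sum_nonneg fun j _ => sq_nonneg _
        _ = c * C ^ 2 * ∑ j ∈ nb i, ‖v j‖ ^ 2 := by
            simp_rw [mul_pow, ← Finset.mul_sum]; ring
    have h2 : ∑ i ∈ s, ∑ j ∈ nb i, ‖v j‖ ^ 2 ≤ c * ‖v‖ ^ 2 := by
      calc ∑ i ∈ s, ∑ j ∈ nb i, ‖v j‖ ^ 2
          = ∑ j ∈ s.biUnion nb, ∑ i ∈ s.filter (fun i => j ∈ nb i), ‖v j‖ ^ 2 := by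
            refine Finset.sum_comm' fun i j => ?_
            simp only [Finset.mem_biUnion, Finset.mem_filter]
            exact ⟨fun h => ⟨h, i, h⟩, fun h => h.1⟩
        _ ≤ ∑ j ∈ s.biUnion nb, c * ‖v j‖ ^ 2 := by
            refine Finset.sum_le_sum fun j _ => ?_
            rw [Finset.sum_const, nsmul_eq_mul]
            refine mul_le_mul_of_nonneg_right ?_ (sq_nonneg _)
            have : s.filter (fun i => j ∈ nb i) ⊆ nb j := fun i hi =>
              (symm i j).2 (Finset.mem_filter.1 hi).2
            exact_mod_cast (Finset.card_le_card this).trans (hc j)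
        _ ≤ c * ‖v‖ ^ 2 := by
            rw [← Finset.mul_sum]
            exact mul_le_mul_of_nonneg_left (sum_sq_le v _) (by positivity)
    calc ∑ i ∈ s, ‖∑ j ∈ nb i, K i j * v j‖ ^ 2
        ≤ ∑ i ∈ s, c * C ^ 2 * ∑ j ∈ nb i, ‖v j‖ ^ 2 := Finset.sum_le_sum fun i _ => h1 i
      _ ≤ c * C ^ 2 * (c * ‖v‖ ^ 2) := by
          rw [← Finset.mul_sum]
          exact mul_le_mul_of_nonneg_left h2 (by positivity)
      _ = (c * C * ‖v‖) ^ 2 := by ring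
  let L : L2 ι →ₗ[ℂ] L2 ι :=
    { toFun := fun v => ⟨fun i => ∑ j ∈ nb i, K i j * v j, memℓp_two_of_sum_le (bound v)⟩
      map_add' := fun v w => by
        ext i
        change ∑ j ∈ nb i, K i j * (v j + w j)
          = ∑ j ∈ nb i, K i j * v j + ∑ j ∈ nb i, K i j * w j
        simp_rw [mul_add, Finset.sum_add_distrib]
      map_smul' := fun a v => by
        ext i
        change ∑ j ∈ nb i, K i j * (a * v j) = a * ∑ j ∈ nb i, K i j * v j
        rw [Finset.mul_sum]
        exact Finset.sum_congr rfl fun j _ => by ring }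
  have hL : ∀ v, ‖L v‖ ≤ c * C * ‖v‖ := fun v =>
    norm_le_of_sum_sq_le _ (by positivity) (bound v)
  refine ⟨L.mkContinuous _ hL, fun v i => rfl, fun i j => ?_⟩
  change ∑ x ∈ nb i, K i x * stdBasis ι j x = K i j
  by_cases hj : j ∈ nb i
  · rw [Finset.sum_eq_single j, stdBasis_apply_self, mul_one]
    · intro b _ hb
      rw [stdBasis_apply_ne hb, mul_zero]
    · exact fun h => absurd hj h
  · rw [h0 i j hj, Finset.sum_eq_zero]
    intro x hx
    rw [stdBasis_apply_ne (ne_of_mem_of_not_mem hx hj), mul_zero]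

theorem exists_diagonal (w : ι → ℂ) {C : ℝ} (hw : ∀ i, ‖w i‖ ≤ C) :
    ∃ T : L2 ι →L[ℂ] L2 ι, ∀ v i, T v i = w i * v i := by
  classical
  rcases isEmpty_or_nonempty ι with hι | ⟨⟨i0⟩⟩
  · exact ⟨0, fun v i => hι.elim i⟩
  obtain ⟨T, hT, -⟩ := exists_op_of_kernel (fun i => {i})
    (fun i j => by simp [eq_comm]) 1 (fun i => by simp) (fun i j => if i = j then w i else 0)
    (C := C) (fun i j => by
      split_ifs
      · exact hw i
      · simpa using (norm_nonneg _).trans (hw i0)) (fun i j h => by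
        rw [if_neg]; rintro rfl; simp at h)
  exact ⟨T, fun v i => by rw [hT]; simp⟩

theorem exists_permutation (σ : ι ≃ ι) : ∃ T : L2 ι →L[ℂ] L2 ι, ∀ v i, T v i = v (σ i) := by
  have hm : ∀ v : L2 ι, Memℓp (fun i => v (σ i)) 2 := fun v => (memℓp_two_comp σ).2 v.2
  let L : L2 ι →ₗ[ℂ] L2 ι :=
    { toFun := fun v => ⟨fun i => v (σ i), hm v⟩
      map_add' := fun v w => rfl
      map_smul' := fun a v => rfl }
  refine ⟨L.mkContinuous 1 fun v => ?_, fun v i => rfl⟩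
  rw [one_mul]
  refine norm_le_of_sum_sq_le _ (norm_nonneg _) fun s => ?_
  change ∑ i ∈ s, ‖v (σ i)‖ ^ 2 ≤ _
  refine le_trans (le_of_eq ?_) (sum_sq_le v (s.map σ.toEmbedding))
  rw [Finset.sum_map]; rfl

end EllTwo

/-! ### Weighted shifts as unbounded operators -/

section WeightedShift

open SpecTriple

variable {ι : Type} {w : ι → ℝ} {σ : ι ≃ ι}

theorem mem_weightedShift_domain {v : L2 ι} :
    v ∈ (weightedShift w σ).domain ↔ Memℓp (fun i => (w i : ℂ) * v (σ i)) 2 := Iff.rfl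

theorem weightedShift_apply (v : (weightedShift w σ).domain) (i : ι) :
    weightedShift w σ v i = (w i : ℂ) * (v : L2 ι) (σ i) := rfl

theorem stdBasis_mem_domain (j : ι) : stdBasis ι j ∈ (weightedShift w σ).domain := by
  classical
  rw [mem_weightedShift_domain]
  refine memℓp_two_iff.2 (summable_of_ne_finset_zero (s := {σ.symm j}) fun i hi => ?_)
  rw [stdBasis_apply_ne, mul_zero, norm_zero, zero_pow two_ne_zero]
  rintro rfl
  simp at hi

theorem weightedShift_stdBasis (hw : ∀ i, w (σ i) = w i) (hσ : ∀ i, σ (σ i) = i) (j : ι) :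
    weightedShift w σ ⟨stdBasis ι j, stdBasis_mem_domain j⟩ = (w j : ℂ) • stdBasis ι (σ j) := by
  classical
  refine lp.ext (funext fun i => ?_)
  rw [weightedShift_apply]
  change (w i : ℂ) * stdBasis ι j (σ i) = (w j : ℂ) * stdBasis ι (σ j) i
  by_cases h : i = σ j
  · rw [h, hσ, stdBasis_apply_self, stdBasis_apply_self, hw]
  · rw [stdBasis_apply_ne h, stdBasis_apply_ne, mul_zero, mul_zero]
    intro h2
    exact h (by rw [← h2, hσ])

theorem dense_weightedShift_domain : Dense ((weightedShift w σ).domain : Set (L2 ι)) := by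
  have h : Submodule.span ℂ (Set.range (stdBasis ι)) ≤ (weightedShift w σ).domain := by
    rw [Submodule.span_le]
    rintro _ ⟨j, rfl⟩
    exact stdBasis_mem_domain j
  exact (Submodule.dense_iff_topologicalClosure_eq_top.2 (stdBasis ι).dense_span).mono h

theorem inner_eq_tsum (u v : L2 ι) : ⟪u, v⟫_ℂ = ∑' i, ⟪u i, v i⟫_ℂ := lp.inner_eq_tsum u v

/-- Symmetry is a reindexing by the involution `σ`. Self-adjointness then amounts to the adjoint
having no larger domain, which holds because the domain is maximal. -/
theorem isSelfAdjoint_weightedShift (hw : ∀ i, w (σ i) = w i) (hσ : ∀ i, σ (σ i) = i) :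
    IsSelfAdjoint (weightedShift w σ) := by
  have hd := dense_weightedShift_domain (w := w) (σ := σ)
  have hsym : ∀ x y : (weightedShift w σ).domain,
      ⟪weightedShift w σ x, (y : L2 ι)⟫_ℂ = ⟪(x : L2 ι), weightedShift w σ y⟫_ℂ := by
    intro x y
    rw [inner_eq_tsum, inner_eq_tsum, ← σ.tsum_eq]
    refine tsum_congr fun i => ?_
    rw [weightedShift_apply, weightedShift_apply, hw, hσ]
    simp only [RCLike.inner_apply, map_mul, Complex.conj_ofReal]
    ring
  have hle : weightedShift w σ ≤ (weightedShift w σ).adjoint :=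
    LinearPMap.IsFormalAdjoint.le_adjoint hd fun x y => hsym x y
  have hdom : (weightedShift w σ).adjoint.domain ≤ (weightedShift w σ).domain := by
    intro v hv
    -- Pairing with basis vectors shows that the adjoint is given by the same formula, so the
    -- square-summability required by the domain comes for free.
    have hv' : ∀ j, ((weightedShift w σ).adjoint ⟨v, hv⟩ : L2 ι) j = (w j : ℂ) * v (σ j) := by
      intro j
      have h := LinearPMap.adjoint_isFormalAdjoint hd ⟨v, hv⟩ ⟨stdBasis ι j, stdBasis_mem_domain j⟩
      rw [weightedShift_stdBasis hw hσ] at h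
      change ⟪_, stdBasis ι j⟫_ℂ = ⟪v, _⟫_ℂ at h
      rw [inner_smul_right, ← inner_conj_symm, inner_stdBasis, ← inner_conj_symm,
        inner_stdBasis] at h
      have h2 := congrArg (starRingEnd ℂ) h
      simpa using h2
    rw [mem_weightedShift_domain]
    exact memℓp_of_apply_eq fun j => (hv' j).symm
  rw [LinearPMap.isSelfAdjoint_def]
  exact (LinearPMap.eq_of_le_of_domain_eq hle (le_antisymm hle.1 hdom)).symm

/-- The two operators differ by the unitary permutation `σ`, which preserves `w` and therefore the
domains. In the square the two copies of `σ` cancel. -/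
theorem isAbs_weightedShift (h0 : ∀ i, 0 ≤ w i) (hw : ∀ i, w (σ i) = w i)
    (hσ : ∀ i, σ (σ i) = i) : IsAbs (weightedShift w σ) (weightedShift w (Equiv.refl ι)) := by
  have hdom : ∀ v : L2 ι, v ∈ (weightedShift w (Equiv.refl ι)).domain ↔
      v ∈ (weightedShift w σ).domain := by
    intro v
    rw [mem_weightedShift_domain, mem_weightedShift_domain,
      ← memℓp_two_comp σ (f := fun i => (w i : ℂ) * v (Equiv.refl ι i))]
    simp only [Equiv.refl_apply, hw]
  refine ⟨dense_weightedShift_domain, isSelfAdjoint_weightedShift (fun _ => rfl) fun _ => rfl,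
    fun v => ?_, fun v w' => ?_⟩
  · rw [inner_eq_tsum, Complex.re_tsum]
    · refine tsum_nonneg fun i => ?_
      rw [weightedShift_apply]
      simp only [RCLike.inner_apply, Equiv.refl_apply]
      rw [mul_assoc, Complex.mul_conj]
      rw [← Complex.ofReal_mul, Complex.ofReal_re]
      exact mul_nonneg (h0 i) (Complex.normSq_nonneg _)
    · exact lp.summable_inner _ _
  · have hsq : ∀ (h1 : v ∈ (weightedShift w (Equiv.refl ι)).domain)
        (h2 : v ∈ (weightedShift w σ).domain) (i : ι),
        (weightedShift w σ ⟨v, h2⟩ : L2 ι) i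
          = (weightedShift w (Equiv.refl ι) ⟨v, h1⟩ : L2 ι) (σ i) := by
      intro h1 h2 i
      rw [weightedShift_apply, weightedShift_apply, hw]; rfl
    constructor
    · rintro ⟨h, h', rfl⟩
      have k : v ∈ (weightedShift w σ).domain := (hdom v).1 h
      have hs := hsq h k
      refine ⟨k, ?_, ?_⟩
      · rw [mem_weightedShift_domain]
        rw [mem_weightedShift_domain] at h'
        convert h' using 2 with i
        rw [hs, hσ]; rfl
      · refine lp.ext (funext fun i => ?_)
        change (w i : ℂ) * (weightedShift w σ ⟨v, k⟩ : L2 ι) (σ i) = (w i : ℂ) * _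
        rw [hs, hσ]; rfl
    · rintro ⟨k, k', rfl⟩
      have h : v ∈ (weightedShift w (Equiv.refl ι)).domain := (hdom v).2 k
      have hs := hsq h k
      refine ⟨h, ?_, ?_⟩
      · rw [mem_weightedShift_domain]
        rw [mem_weightedShift_domain] at k'
        convert k' using 2 with i
        rw [hs, hσ]; rfl
      · refine lp.ext (funext fun i => ?_)
        change (w i : ℂ) * _ = (w i : ℂ) * (weightedShift w σ ⟨v, k⟩ : L2 ι) (σ i)
        rw [hs, hσ]; rfl

-- The operator is the norm limit of its finite-rank truncations to the finite sets where `‖c i‖ ≥ ε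
-- / 2`.
open Classical in
theorem isCompactOperator_diagonal {c : ι → ℂ} (hc : Tendsto (fun i => ‖c i‖) cofinite (𝓝 0))
    (T : L2 ι →L[ℂ] L2 ι) (hT : ∀ v i, T v i = c i * v i) : IsCompactOperator T := by
  refine isClosed_setOfPred_isCompactOperator.closure_subset (Metric.mem_closure_iff.2 ?_)
  intro ε hε
  have hfin : {i | ¬ ‖c i‖ < ε / 2}.Finite := hc.eventually (gt_mem_nhds (half_pos hε))
  let s := hfin.toFinset
  let F : L2 ι →L[ℂ] L2 ι :=
    ∑ i ∈ s, (lp.evalCLM ℂ (fun _ : ι => ℂ) 2 i).smulRight (c i • stdBasis ι i)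
  have hF : ∀ v i, F v i = if i ∈ s then c i * v i else 0 := by
    intro v i
    have h1 : F v = ∑ j ∈ s, v j • (c j • stdBasis ι j) := by
      simp only [F, _root_.sum_apply]; rfl
    rw [h1, lp.coeFn_sum, Finset.sum_apply]
    have h2 : ∀ j, (v j • (c j • stdBasis ι j) : L2 ι) i = if i = j then c i * v i else 0 := by
      intro j
      change v j * (c j * stdBasis ι j i) = _
      rw [stdBasis_apply]
      split_ifs with h
      · subst h; ring
      · simp
    simp_rw [h2]
    rw [Finset.sum_ite_eq]
  refine ⟨F, ?_, ?_⟩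
  · change IsCompactOperator F
    have : ∀ t : Finset ι, IsCompactOperator (∑ i ∈ t,
        (lp.evalCLM ℂ (fun _ : ι => ℂ) 2 i).smulRight (c i • stdBasis ι i) : L2 ι →L[ℂ] L2 ι) := by
      intro t
      induction t using Finset.induction_on with
      | empty => simpa using isCompactOperator_zero
      | insert a t ha ih =>
        rw [Finset.sum_insert ha]
        refine IsCompactOperator.add ?_ ih
        have h := isCompactOperator_of_locallyCompactSpace_rng
          (ContinuousLinearMap.toSpanSingleton ℂ (c a • stdBasis ι a))
        exact h.comp_clm (lp.evalCLM ℂ (fun _ : ι => ℂ) 2 a)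
    exact this s
  · rw [dist_eq_norm]
    refine lt_of_le_of_lt (ContinuousLinearMap.opNorm_le_bound _ (half_pos hε).le fun v => ?_)
      (half_lt_self hε)
    refine norm_le_mul_of_apply_le _ _ (half_pos hε).le fun i => ?_
    change ‖T v i - F v i‖ ≤ _
    rw [hT, hF]
    split_ifs with h
    · simp only [sub_self, norm_zero]; positivity
    · rw [sub_zero, norm_mul]
      refine mul_le_mul_of_nonneg_right ?_ (norm_nonneg _)
      by_contra hcon
      exact h (hfin.mem_toFinset.2 fun h' => hcon h'.le)

/-- The inverse is `(D - i)(D² + 1)⁻¹`: a diagonal operator times the permutation, plus another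
diagonal operator. Both diagonals are bounded by `w⁻¹`, which tends to zero, so both terms are
compact. -/
theorem exists_compact_resolvent (hw : ∀ i, w (σ i) = w i) (hσ : ∀ i, σ (σ i) = i)
    (h1 : ∀ i, 1 ≤ w i) (hlim : Tendsto w cofinite atTop) :
    ∃ R : L2 ι →L[ℂ] L2 ι, IsCompactOperator R ∧
      (∀ v : L2 ι, ∃ h : R v ∈ (weightedShift w σ).domain,
        weightedShift w σ ⟨R v, h⟩ + Complex.I • R v = v) ∧
      (∀ v : (weightedShift w σ).domain,
        R (weightedShift w σ v + Complex.I • (v : L2 ι)) = v) := by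
  have hpos : ∀ i, 0 < w i := fun i => lt_of_lt_of_le one_pos (h1 i)
  have hsum : ∀ i, (1 : ℝ) ≤ w i ^ 2 + 1 := fun i => by nlinarith [h1 i]
  have hne : ∀ i, ((w i : ℂ) ^ 2 + 1) ≠ 0 := fun i => by
    have : (w i ^ 2 + 1 : ℝ) ≠ 0 := by positivity
    exact_mod_cast this
  have hnorm : ∀ i, ‖((w i : ℂ) ^ 2 + 1)‖ = w i ^ 2 + 1 := fun i => by
    have : ((w i : ℂ) ^ 2 + 1) = ((w i ^ 2 + 1 : ℝ) : ℂ) := by push_cast; ring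
    rw [this, Complex.norm_real, Real.norm_of_nonneg (by positivity)]
  have b1 : ∀ i, ‖(w i : ℂ) / ((w i : ℂ) ^ 2 + 1)‖ ≤ (w i)⁻¹ := fun i => by
    rw [norm_div, hnorm, Complex.norm_real, Real.norm_of_nonneg (hpos i).le,
      div_le_iff₀ (by positivity), mul_add, sq, ← mul_assoc, inv_mul_cancel₀ (hpos i).ne']
    have := inv_nonneg.2 (hpos i).le
    linarith
  have b2 : ∀ i, ‖-Complex.I / ((w i : ℂ) ^ 2 + 1)‖ ≤ (w i)⁻¹ := fun i => by
    rw [norm_div, hnorm, norm_neg, Complex.norm_I, ← one_div]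
    exact one_div_le_one_div_of_le (hpos i) (by nlinarith [h1 i])
  have b3 : ∀ i, (w i)⁻¹ ≤ 1 := fun i => inv_le_one_of_one_le₀ (h1 i)
  have t0 : Tendsto (fun i => (w i)⁻¹) cofinite (𝓝 0) := tendsto_inv_atTop_zero.comp hlim
  obtain ⟨T1, hT1⟩ := exists_diagonal _ fun i => (b1 i).trans (b3 i)
  obtain ⟨T2, hT2⟩ := exists_diagonal _ fun i => (b2 i).trans (b3 i)
  obtain ⟨S, hS⟩ := exists_permutation σ
  have hR : ∀ v i, (T1 * S + T2) v i
      = (w i : ℂ) / ((w i : ℂ) ^ 2 + 1) * v (σ i) + -Complex.I / ((w i : ℂ) ^ 2 + 1) * v i := by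
    intro v i
    change T1 (S v) i + T2 v i = _
    rw [hT1, hT2, hS]
  refine ⟨T1 * S + T2, ?_, ?_, ?_⟩
  · refine IsCompactOperator.add ?_ ?_
    · exact (isCompactOperator_diagonal (squeeze_zero (fun _ => norm_nonneg _) b1 t0) T1
        hT1).comp_clm S
    · exact isCompactOperator_diagonal (squeeze_zero (fun _ => norm_nonneg _) b2 t0) T2 hT2
  · intro v
    have key : ∀ i, (w i : ℂ) * (T1 * S + T2) v (σ i) = v i - Complex.I * (T1 * S + T2) v i := by
      intro i
      rw [hR, hR, hw, hσ]
      field_simp [hne i]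
      linear_combination (v i) * -Complex.I_sq
    have hmem : (T1 * S + T2) v ∈ (weightedShift w σ).domain := by
      rw [mem_weightedShift_domain]
      exact memℓp_of_apply_eq (u := v - Complex.I • (T1 * S + T2) v) key
    refine ⟨hmem, lp.ext (funext fun i => ?_)⟩
    change weightedShift w σ ⟨_, hmem⟩ i + Complex.I * (T1 * S + T2) v i = v i
    rw [weightedShift_apply]
    change (w i : ℂ) * (T1 * S + T2) v (σ i) + _ = _
    rw [key]; ring
  · intro v
    refine lp.ext (funext fun i => ?_)
    rw [hR]
    change _ * (weightedShift w σ v (σ i) + Complex.I * (v : L2 ι) (σ i))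
      + _ * (weightedShift w σ v i + Complex.I * (v : L2 ι) i) = (v : L2 ι) i
    rw [weightedShift_apply, weightedShift_apply, hw, hσ]
    field_simp [hne i]
    linear_combination ((v : L2 ι) i) * -Complex.I_sq

theorem IsComm.unique {D : L2 ι →ₗ.[ℂ] L2 ι} (hD : ∀ j, stdBasis ι j ∈ D.domain)
    {T S S' : L2 ι →L[ℂ] L2 ι} (h : IsComm D T S) (h' : IsComm D T S') : S = S' := by
  refine clm_ext fun j => ?_
  obtain ⟨_, e⟩ := h ⟨_, hD j⟩
  obtain ⟨_, e'⟩ := h' ⟨_, hD j⟩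
  rw [← e, ← e']

end WeightedShift

end Podles

end

/-! ### Labels and operators of finite propagation -/

noncomputable section

namespace Podles

/-! ### Labels -/

section Labels

variable {N : ℝ}

/-- The label `l`. -/
def lev (i : Idx N) : ℝ := i.1.1.1

/-- The label `m`. -/
def mag (i : Idx N) : ℝ := i.1.1.2

theorem idx_ext {i i' : Idx N} (h1 : lev i = lev i') (h2 : mag i = mag i') (h3 : i.2 = i'.2) :
    i = i' :=
  Prod.ext (Subtype.ext (Prod.ext h1 h2)) h3

theorem eigenvalue_eq (i : Idx N) : eigenvalue N i = lev i - |N| + 1 := rfl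

theorem abs_le_lev (i : Idx N) : |N| ≤ lev i := by
  obtain ⟨a, ha⟩ := i.1.2.1
  have : (0 : ℝ) ≤ a := a.cast_nonneg
  change |N| ≤ i.1.1.1
  linarith

theorem lev_nonneg (i : Idx N) : 0 ≤ lev i := (abs_nonneg N).trans (abs_le_lev i)

theorem abs_mag_le (i : Idx N) : |mag i| ≤ lev i := by
  obtain ⟨b, hb⟩ := i.1.2.2
  have : (0 : ℝ) ≤ b := b.cast_nonneg
  change |i.1.1.2| ≤ i.1.1.1
  linarith

theorem lev_add_mag_nonneg (i : Idx N) : 0 ≤ lev i + mag i := by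
  have := (abs_le.1 (abs_mag_le i)).1
  linarith

theorem lev_sub_mag_nonneg (i : Idx N) : 0 ≤ lev i - mag i := by
  have := (abs_le.1 (abs_mag_le i)).2
  linarith

theorem one_le_eigenvalue (i : Idx N) : 1 ≤ eigenvalue N i := by
  rw [eigenvalue_eq]; linarith [abs_le_lev i]

variable [hN : Fact (∃ k : ℤ, N = (k : ℝ) / 2)]

/-- Since `2|N|` is a natural number, `2l` is an integer, and `l - |m|` is the smaller of `l + m`
and `l - m`, whose sum is `2l`. The symmetric form is easier to shift. -/
theorem isLabel_iff {l m : ℝ} : IsLabel N (l, m) ↔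
    (∃ a : ℕ, l - |N| = a) ∧ (∃ b : ℕ, l + m = b) ∧ ∃ c : ℕ, l - m = c := by
  obtain ⟨k, hk⟩ := hN.out
  have hk' : 2 * |N| = (k.natAbs : ℝ) := by
    rw [hk, abs_div, abs_two, Nat.cast_natAbs, Int.cast_abs]; ring
  constructor
  · rintro ⟨⟨a, ha⟩, b, hb⟩
    have hab : (b : ℝ) ≤ 2 * a + k.natAbs := by
      have h := abs_nonneg m
      dsimp only at ha hb
      linarith
    have hab' : b ≤ 2 * a + k.natAbs := by exact_mod_cast hab
    have hc : ((2 * a + k.natAbs - b : ℕ) : ℝ) = 2 * l - b := by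
      rw [Nat.cast_sub hab']; push_cast; dsimp only at ha; linarith
    dsimp only at hb
    refine ⟨⟨a, ha⟩, ?_⟩
    rcases abs_cases m with ⟨h, -⟩ | ⟨h, -⟩
    · exact ⟨⟨_, by rw [hc]; linarith⟩, b, by linarith⟩
    · exact ⟨⟨b, by linarith⟩, _, by rw [hc]; linarith⟩
  · rintro ⟨⟨a, ha⟩, ⟨b, hb⟩, c, hc⟩
    refine ⟨⟨a, ha⟩, ?_⟩
    rcases abs_cases m with ⟨h, -⟩ | ⟨h, -⟩
    · exact ⟨c, by dsimp only; linarith⟩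
    · exact ⟨b, by dsimp only; linarith⟩

theorem label_spec (i : Idx N) :
    (∃ a : ℕ, lev i - |N| = a) ∧ (∃ b : ℕ, lev i + mag i = b) ∧ ∃ c : ℕ, lev i - mag i = c :=
  isLabel_iff.1 i.1.2

theorem exists_int_lev_sub (i i' : Idx N) : ∃ a : ℤ, lev i' - lev i = a := by
  obtain ⟨⟨a, ha⟩, -⟩ := label_spec i
  obtain ⟨⟨a', ha'⟩, -⟩ := label_spec i'
  exact ⟨a' - a, by push_cast; linarith⟩

theorem exists_int_mag_sub (i i' : Idx N) : ∃ a : ℤ, mag i' - mag i = a := by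
  obtain ⟨⟨a, ha⟩, ⟨b, hb⟩, -⟩ := label_spec i
  obtain ⟨⟨a', ha'⟩, ⟨b', hb'⟩, -⟩ := label_spec i'
  exact ⟨b' - a' - (b - a), by push_cast; linarith⟩

end Labels

/-! ### Operators of finite propagation -/

section Propagation

variable {N : ℝ}

/-- The labels of `i` and `i'` differ by at most `d`. -/
def Near (d : ℕ) (i' i : Idx N) : Prop := |lev i' - lev i| ≤ d ∧ |mag i' - mag i| ≤ d

theorem Near.symm {d : ℕ} {i' i : Idx N} (h : Near d i' i) : Near d i i' :=
  ⟨by rw [abs_sub_comm]; exact h.1, by rw [abs_sub_comm]; exact h.2⟩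

theorem Near.refl (d : ℕ) (i : Idx N) : Near d i i := by simp [Near]

theorem Near.mono {d d' : ℕ} (hd : d ≤ d') {i' i : Idx N} (h : Near d i' i) : Near d' i' i := by
  have : (d : ℝ) ≤ d' := by exact_mod_cast hd
  exact ⟨h.1.trans this, h.2.trans this⟩

theorem Near.trans {d d' : ℕ} {i'' i' i : Idx N} (h' : Near d' i'' i') (h : Near d i' i) :
    Near (d' + d) i'' i := by
  constructor
  · push_cast; exact (abs_sub_le _ (lev i') _).trans (add_le_add h'.1 h.1)
  · push_cast; exact (abs_sub_le _ (mag i') _).trans (add_le_add h'.2 h.2)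

/-- The matrix of `T` is supported in the band of width `d`. -/
def FP (d : ℕ) (T : Spinors N →L[ℂ] Spinors N) : Prop :=
  ∀ i' i, ¬ Near d i' i → ent T i' i = 0

theorem FP.mono {d d' : ℕ} (hd : d ≤ d') {T : Spinors N →L[ℂ] Spinors N} (h : FP d T) : FP d' T :=
  fun i' i hn => h i' i fun hn' => hn (hn'.mono hd)

theorem FP.add {d d' : ℕ} {T T' : Spinors N →L[ℂ] Spinors N} (h : FP d T) (h' : FP d' T') :
    FP (d + d') (T + T') := fun i' i hn => by
  rw [ent_add, h.mono (Nat.le_add_right d d') i' i hn, h'.mono (Nat.le_add_left d' d) i' i hn,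
    add_zero]

theorem FP.sub {d d' : ℕ} {T T' : Spinors N →L[ℂ] Spinors N} (h : FP d T) (h' : FP d' T') :
    FP (d + d') (T - T') := fun i' i hn => by
  rw [ent_sub, h.mono (Nat.le_add_right d d') i' i hn, h'.mono (Nat.le_add_left d' d) i' i hn,
    sub_zero]

theorem FP.smul {d : ℕ} {T : Spinors N →L[ℂ] Spinors N} (c : ℂ) (h : FP d T) : FP d (c • T) :=
  fun i' i hn => by rw [ent_smul, h i' i hn, mul_zero]

theorem FP.one : FP 0 (1 : Spinors N →L[ℂ] Spinors N) := fun i' i hn => by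
  refine ent_one_ne ?_
  rintro rfl
  exact hn (Near.refl 0 _)

variable [hN : Fact (∃ k : ℤ, N = (k : ℝ) / 2)]

theorem exists_nbhd (d : ℕ) (i : Idx N) :
    ∃ s : Finset (Idx N), (∀ i', i' ∈ s ↔ Near d i' i) ∧ s.card ≤ (2 * d + 1) ^ 2 * 2 := by
  classical
  -- Differences of labels are integers, so the floors lose nothing and `g` is injective into a box
  -- with `2d + 1` values for each label and `2` for the sign.
  let g : Idx N → ℤ × ℤ × ℤˣ := fun i' => (⌊lev i' - lev i⌋, ⌊mag i' - mag i⌋, i'.2)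
  let box : Finset (ℤ × ℤ × ℤˣ) := Finset.Icc (-(d : ℤ)) d ×ˢ Finset.Icc (-(d : ℤ)) d ×ˢ Finset.univ
  have hinj : Function.Injective g := by
    intro a b hab
    obtain ⟨x, hx⟩ := exists_int_lev_sub i a
    obtain ⟨x', hx'⟩ := exists_int_lev_sub i b
    obtain ⟨y, hy⟩ := exists_int_mag_sub i a
    obtain ⟨y', hy'⟩ := exists_int_mag_sub i b
    simp only [g, hx, hx', hy, hy', Int.floor_intCast, Prod.mk.injEq] at hab
    obtain ⟨rfl, rfl, h3⟩ := hab
    exact idx_ext (by linarith) (by linarith) h3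
  have hmaps : ∀ i', Near d i' i → g i' ∈ box := by
    intro i' h
    obtain ⟨x, hx⟩ := exists_int_lev_sub i i'
    obtain ⟨y, hy⟩ := exists_int_mag_sub i i'
    have h1 := abs_le.1 h.1
    have h2 := abs_le.1 h.2
    rw [hx] at h1
    rw [hy] at h2
    simp only [g, box, hx, hy, Int.floor_intCast, Finset.mem_product, Finset.mem_Icc,
      Finset.mem_univ, and_true]
    exact ⟨⟨by exact_mod_cast h1.1, by exact_mod_cast h1.2⟩,
      by exact_mod_cast h2.1, by exact_mod_cast h2.2⟩
  have hfin : {i' | Near d i' i}.Finite :=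
    Set.Finite.subset (box.finite_toSet.preimage hinj.injOn) fun i' h => hmaps i' h
  refine ⟨hfin.toFinset, fun i' => by simp, ?_⟩
  have h1 : hfin.toFinset.card ≤ box.card :=
    Finset.card_le_card_of_injOn g (fun i' h => hmaps i' (by simpa using h)) hinj.injOn
  refine h1.trans (le_of_eq ?_)
  simp only [box, Finset.card_product, Int.card_Icc, Finset.card_univ, Fintype.card_units_int]
  have : ((d : ℤ) + 1 - -(d : ℤ)).toNat = 2 * d + 1 := by omega
  rw [this]; ring

/-- The labels near `i`. -/
def nbhd (d : ℕ) (i : Idx N) : Finset (Idx N) := (exists_nbhd d i).choose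

theorem mem_nbhd {d : ℕ} {i' i : Idx N} : i' ∈ nbhd d i ↔ Near d i' i :=
  (exists_nbhd d i).choose_spec.1 i'

theorem card_nbhd_le (d : ℕ) (i : Idx N) : (nbhd d i).card ≤ (2 * d + 1) ^ 2 * 2 :=
  (exists_nbhd d i).choose_spec.2

theorem FP.apply_eq {d : ℕ} {T : Spinors N →L[ℂ] Spinors N} (h : FP d T) (v : Spinors N)
    (i : Idx N) : T v i = ∑ j ∈ nbhd d i, ent T i j * v j :=
  apply_eq_sum T i _ (fun j hj => h i j fun hn => hj (mem_nbhd.2 hn.symm)) v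

theorem FP.ent_mul {d : ℕ} {T : Spinors N →L[ℂ] Spinors N} (h : FP d T)
    (S : Spinors N →L[ℂ] Spinors N) (i' i : Idx N) :
    ent (S * T) i' i = ∑ x ∈ nbhd d i, ent S i' x * ent T x i :=
  Podles.ent_mul S T i' i _ fun x hx => h x i fun hn => hx (mem_nbhd.2 hn)

theorem FP.mul {d d' : ℕ} {T T' : Spinors N →L[ℂ] Spinors N} (h : FP d T) (h' : FP d' T') :
    FP (d + d') (T * T') := fun i' i hn => by
  rw [h'.ent_mul]
  refine Finset.sum_eq_zero fun x hx => ?_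
  rw [h i' x, zero_mul]
  exact fun hn' => hn (hn'.trans (mem_nbhd.1 hx))

theorem exists_op_of_band {d : ℕ} {K : Idx N → Idx N → ℂ} {C : ℝ} (hK : ∀ i' i, ‖K i' i‖ ≤ C)
    (h0 : ∀ i' i, ¬ Near d i' i → K i' i = 0) :
    ∃ T : Spinors N →L[ℂ] Spinors N, ∀ i' i, ent T i' i = K i' i := by
  obtain ⟨T, -, hT⟩ := exists_op_of_kernel (nbhd d)
    (fun i j => by rw [mem_nbhd, mem_nbhd]; exact ⟨Near.symm, Near.symm⟩) _ (card_nbhd_le d) K hK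
    fun i j hj => h0 i j fun hn => hj (mem_nbhd.2 hn.symm)
  exact ⟨T, hT⟩

end Propagation

end Podles

end

/-! ### The calculus of operators with a symbol -/

noncomputable section

namespace Podles

/-! ### Exponentially decaying matrices -/

/-- One of the two factors `√r ^ x` of `r ^ x` absorbs the linear growth, by `1 + y ≤ exp y`. -/
theorem exists_mul_rpow_le {r : ℝ} (h0 : 0 < r) (h1 : r < 1) :
    ∃ C, 0 ≤ C ∧ ∀ x : ℝ, 0 ≤ x → (x + 1) * r ^ x ≤ C * √r ^ x := by
  have hs0 : 0 < √r := Real.sqrt_pos.2 h0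
  have hs1 : √r < 1 := by rw [Real.sqrt_lt' one_pos]; simpa using h1
  have hc : 0 < -Real.log √r := neg_pos.2 (Real.log_neg hs0 hs1)
  refine ⟨(-Real.log √r)⁻¹ + 1, by positivity, fun x hx => ?_⟩
  have e1 : r ^ x = √r ^ x * √r ^ x := by
    rw [← Real.mul_rpow hs0.le hs0.le, Real.mul_self_sqrt h0.le]
  have e2 : x * √r ^ x ≤ (-Real.log √r)⁻¹ := by
    rw [Real.rpow_def_of_pos hs0, ← mul_le_mul_iff_right₀ hc, mul_inv_cancel₀ hc.ne']
    have := Real.add_one_le_exp (-(Real.log √r * x))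
    have h2 := Real.exp_pos (Real.log √r * x)
    calc -Real.log √r * (x * Real.exp (Real.log √r * x))
        ≤ Real.exp (-(Real.log √r * x)) * Real.exp (Real.log √r * x) := by
          rw [← mul_assoc]
          exact mul_le_mul_of_nonneg_right (by linarith) h2.le
      _ = 1 := by rw [← Real.exp_add]; simp
  have e3 : √r ^ x ≤ 1 := Real.rpow_le_one hs0.le hs1.le hx
  have e4 : 0 ≤ √r ^ x := Real.rpow_nonneg hs0.le x
  rw [e1, ← mul_assoc]
  exact mul_le_mul_of_nonneg_right (by linarith) e4

section Decay

variable {N : ℝ}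

/-- A nonnegative function on labels, Lipschitz for `Near`. -/
structure IsWeight (h : Idx N → ℝ) : Prop where
  nonneg : ∀ i, 0 ≤ h i
  le_add : ∀ (d : ℕ) (i' i : Idx N), Near d i' i → h i ≤ h i' + 2 * d

theorem isWeight_lev : IsWeight (lev : Idx N → ℝ) :=
  ⟨lev_nonneg, fun d i' i h => by
    have := (abs_le.1 h.1).1
    have : (0 : ℝ) ≤ d := d.cast_nonneg
    linarith⟩

theorem isWeight_lev_add_mag : IsWeight (fun i : Idx N => lev i + mag i) :=
  ⟨lev_add_mag_nonneg, fun d i' i h => by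
    have := (abs_le.1 h.1).1
    have := (abs_le.1 h.2).1
    linarith⟩

/-- The matrix entries of `T` decay exponentially in the weight `h`. -/
def Decay (h : Idx N → ℝ) (T : Spinors N →L[ℂ] Spinors N) : Prop :=
  ∃ C r : ℝ, 0 ≤ C ∧ 0 < r ∧ r < 1 ∧ ∀ i' i, ‖ent T i' i‖ ≤ C * r ^ h i

theorem Decay.mono_weight {h h' : Idx N → ℝ} {c : ℝ} (hc : 0 < c) (hh : ∀ i, c * h' i ≤ h i)
    {T : Spinors N →L[ℂ] Spinors N} (hT : Decay h T) : Decay h' T := by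
  obtain ⟨C, r, hC, hr0, hr1, hb⟩ := hT
  refine ⟨C, r ^ c, hC, Real.rpow_pos_of_pos hr0 c, Real.rpow_lt_one hr0.le hr1 hc, fun i' i => ?_⟩
  refine (hb i' i).trans (mul_le_mul_of_nonneg_left ?_ hC)
  rw [← Real.rpow_mul hr0.le]
  exact Real.rpow_le_rpow_of_exponent_ge hr0 hr1.le (hh i)

theorem Decay.add {h : Idx N → ℝ} (hw : IsWeight h) {S T : Spinors N →L[ℂ] Spinors N}
    (hS : Decay h S) (hT : Decay h T) : Decay h (S + T) := by
  obtain ⟨C, r, hC, hr0, hr1, hb⟩ := hS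
  obtain ⟨C', r', hC', hr0', hr1', hb'⟩ := hT
  refine ⟨C + C', max r r', add_nonneg hC hC', lt_max_of_lt_left hr0, max_lt hr1 hr1',
    fun i' i => ?_⟩
  rw [ent_add, add_mul]
  refine (norm_add_le _ _).trans (add_le_add ((hb i' i).trans ?_) ((hb' i' i).trans ?_))
  · exact mul_le_mul_of_nonneg_left
      (Real.rpow_le_rpow hr0.le (le_max_left _ _) (hw.nonneg i)) hC
  · exact mul_le_mul_of_nonneg_left
      (Real.rpow_le_rpow hr0'.le (le_max_right _ _) (hw.nonneg i)) hC'

theorem Decay.of_ent_le {h : Idx N → ℝ} {S T : Spinors N →L[ℂ] Spinors N} {K : ℝ} (hK : 0 ≤ K)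
    (hle : ∀ i' i, ‖ent S i' i‖ ≤ K * ‖ent T i' i‖) (hT : Decay h T) : Decay h S := by
  obtain ⟨C, r, hC, hr0, hr1, hb⟩ := hT
  refine ⟨K * C, r, mul_nonneg hK hC, hr0, hr1, fun i' i => (hle i' i).trans ?_⟩
  rw [mul_assoc]
  exact mul_le_mul_of_nonneg_left (hb i' i) hK

theorem Decay.smul {h : Idx N → ℝ} (c : ℂ) {T : Spinors N →L[ℂ] Spinors N}
    (hT : Decay h T) : Decay h (c • T) :=
  hT.of_ent_le (norm_nonneg c) fun i' i => by rw [ent_smul, norm_mul]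

theorem Decay.sub {h : Idx N → ℝ} (hw : IsWeight h) {S T : Spinors N →L[ℂ] Spinors N}
    (hS : Decay h S) (hT : Decay h T) : Decay h (S - T) := by
  have : S - T = S + (-1 : ℂ) • T := by simp [sub_eq_add_neg]
  rw [this]
  exact hS.add hw (hT.smul _)

theorem Decay.zero {h : Idx N → ℝ} : Decay h (0 : Spinors N →L[ℂ] Spinors N) :=
  ⟨0, 1 / 2, le_rfl, by norm_num, by norm_num, fun i' i => by simp [ent]⟩

/-- Since `m ≤ l`, the weight `l` is at least half of `l + m`. -/
theorem Decay.lev_add_mag {T : Spinors N →L[ℂ] Spinors N} (h : Decay lev T) :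
    Decay (fun i => lev i + mag i) T :=
  h.mono_weight (c := 1 / 2) (by norm_num) fun i => by
    have := lev_sub_mag_nonneg i
    linarith

variable [hN : Fact (∃ k : ℤ, N = (k : ℝ) / 2)]

/-- Decay is measured at the source label, which belongs to the right factor. So `S` need only be
bounded; the propagation of `T` limits the number of terms. -/
theorem Decay.mul_left {h : Idx N → ℝ} {d : ℕ} (S : Spinors N →L[ℂ] Spinors N)
    {T : Spinors N →L[ℂ] Spinors N} (hT : FP d T) (h' : Decay h T) : Decay h (S * T) := by
  obtain ⟨C, r, hC, hr0, hr1, hb⟩ := h'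
  have hS := norm_nonneg S
  refine ⟨((2 * d + 1) ^ 2 * 2 : ℕ) * ‖S‖ * C, r, by positivity, hr0, hr1, fun i' i => ?_⟩
  rw [hT.ent_mul]
  refine (norm_sum_le _ _).trans ((Finset.sum_le_card_nsmul _ _ (‖S‖ * (C * r ^ h i)) ?_).trans ?_)
  · intro x _
    rw [norm_mul]
    exact mul_le_mul (norm_ent_le S i' x) (hb x i) (norm_nonneg _) hS
  · rw [nsmul_eq_mul]
    have h1 : ((nbhd d i).card : ℝ) ≤ ((2 * d + 1) ^ 2 * 2 : ℕ) := by
      exact_mod_cast card_nbhd_le d i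
    have h2 : 0 ≤ ‖S‖ * (C * r ^ h i) := by positivity
    exact (mul_le_mul_of_nonneg_right h1 h2).trans (le_of_eq (by ring))

/-- Here the decay is known at the intermediate label. Its weight differs from that of the source by
at most `2d`, which costs the constant `r^(-2d)`. -/
theorem Decay.mul_right {h : Idx N → ℝ} (hw : IsWeight h) {d : ℕ}
    {S : Spinors N →L[ℂ] Spinors N} (h' : Decay h S)
    {T : Spinors N →L[ℂ] Spinors N} (hT : FP d T) : Decay h (S * T) := by
  obtain ⟨C, r, hC, hr0, hr1, hb⟩ := h'
  have hTn := norm_nonneg T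
  refine ⟨((2 * d + 1) ^ 2 * 2 : ℕ) * (C * (r ^ (2 * d : ℝ))⁻¹ * ‖T‖), r, by positivity, hr0, hr1,
    fun i' i => ?_⟩
  rw [hT.ent_mul]
  refine (norm_sum_le _ _).trans ((Finset.sum_le_card_nsmul _ _
    (C * (r ^ (2 * d : ℝ))⁻¹ * ‖T‖ * r ^ h i) ?_).trans ?_)
  · intro x hx
    rw [norm_mul]
    have h1 : r ^ h x ≤ (r ^ (2 * d : ℝ))⁻¹ * r ^ h i := by
      rw [← Real.rpow_neg hr0.le, ← Real.rpow_add hr0]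
      refine Real.rpow_le_rpow_of_exponent_ge hr0 hr1.le ?_
      linarith [hw.le_add d x i (mem_nbhd.1 hx)]
    calc ‖ent S i' x‖ * ‖ent T x i‖ ≤ C * ((r ^ (2 * d : ℝ))⁻¹ * r ^ h i) * ‖T‖ :=
          mul_le_mul ((hb i' x).trans (mul_le_mul_of_nonneg_left h1 hC)) (norm_ent_le T x i)
            (norm_nonneg _) (by positivity)
      _ = _ := by ring
  · rw [nsmul_eq_mul]
    have h1 : ((nbhd d i).card : ℝ) ≤ ((2 * d + 1) ^ 2 * 2 : ℕ) := by
      exact_mod_cast card_nbhd_le d i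
    have h2 : 0 ≤ C * (r ^ (2 * d : ℝ))⁻¹ * ‖T‖ * r ^ h i := by positivity
    exact (mul_le_mul_of_nonneg_right h1 h2).trans (le_of_eq (by ring))

end Decay

/-! ### The reference shifts -/

section Shifts

variable {N : ℝ}

/-- `U` raises `l` by `a`. -/
def HasDegree (a : ℝ) (U : Spinors N →L[ℂ] Spinors N) : Prop :=
  ∀ i' i, ent U i' i ≠ 0 → lev i' = lev i + a

/-- `S = [|D|, T]`, in terms of matrix entries. -/
def IsDelta (T S : Spinors N →L[ℂ] Spinors N) : Prop :=
  ∀ i' i, ent S i' i = ((lev i' - lev i : ℝ) : ℂ) * ent T i' i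

theorem IsDelta.fp {d : ℕ} {T S : Spinors N →L[ℂ] Spinors N} (h : IsDelta T S) (hT : FP d T) :
    FP d S := fun i' i hn => by rw [h, hT i' i hn, mul_zero]

/-- The exchange of the two summands of `ℋ`. -/
def flipOp (N : ℝ) : Spinors N →L[ℂ] Spinors N := (exists_permutation (flip N)).choose

theorem flipOp_apply (v : Spinors N) (i : Idx N) : flipOp N v i = v (flip N i) :=
  (exists_permutation (flip N)).choose_spec v i

theorem flip_flip (i : Idx N) : flip N (flip N i) = i := by simp [flip]

theorem lev_flip (i : Idx N) : lev (flip N i) = lev i := rfl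

theorem mag_flip (i : Idx N) : mag (flip N i) = mag i := rfl

theorem ent_flipOp_ne {i' i : Idx N} (h : flip N i' ≠ i) : ent (flipOp N) i' i = 0 := by
  rw [ent, flipOp_apply, stdBasis_apply_ne h]

theorem ent_flipOp_mul (T : Spinors N →L[ℂ] Spinors N) (i' i : Idx N) :
    ent (flipOp N * T) i' i = ent T (flip N i') i := flipOp_apply _ _

theorem flipOp_stdBasis (i : Idx N) : flipOp N (stdBasis _ i) = stdBasis _ (flip N i) := by
  refine lp.ext (funext fun j => ?_)
  rw [flipOp_apply]
  by_cases h : j = flip N i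
  · rw [h, flip_flip, stdBasis_apply_self, stdBasis_apply_self]
  · rw [stdBasis_apply_ne h, stdBasis_apply_ne]
    rintro rfl
    exact h (flip_flip j).symm

theorem ent_mul_flipOp (T : Spinors N →L[ℂ] Spinors N) (i' i : Idx N) :
    ent (T * flipOp N) i' i = ent T i' (flip N i) := by
  change T (flipOp N (stdBasis _ i)) i' = _
  rw [flipOp_stdBasis]; rfl

theorem fp_flipOp : FP 0 (flipOp N) := fun i' i hn => ent_flipOp_ne fun h => hn (by
  rw [← h]; simp [Near, lev_flip, mag_flip])

variable [hN : Fact (∃ k : ℤ, N = (k : ℝ) / 2)]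

open Classical in
theorem exists_shift (a b : ℝ) : ∃ T : Spinors N →L[ℂ] Spinors N, ∀ i' i,
    ent T i' i = if lev i' = lev i + a ∧ mag i' = mag i + b ∧ i'.2 = i.2 then 1 else 0 := by
  obtain ⟨d, hd⟩ := exists_nat_ge (max |a| |b|)
  refine exists_op_of_band (d := d) (C := 1) (fun i' i => ?_) fun i' i hn => ?_
  · split_ifs <;> simp
  · rw [if_neg]
    rintro ⟨h1, h2, -⟩
    refine hn ⟨?_, ?_⟩
    · rw [h1, add_sub_cancel_left]; exact (le_max_left _ _).trans hd
    · rw [h2, add_sub_cancel_left]; exact (le_max_right _ _).trans hd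

/-- The shift `|l, m⟩ ↦ |l + a, m + b⟩`, zero where the target is out of range. -/
def shift (N : ℝ) [hN : Fact (∃ k : ℤ, N = (k : ℝ) / 2)] (a b : ℝ) : Spinors N →L[ℂ] Spinors N :=
  (exists_shift a b).choose

open Classical in
theorem ent_shift (a b : ℝ) (i' i : Idx N) : ent (shift N a b) i' i =
    if lev i' = lev i + a ∧ mag i' = mag i + b ∧ i'.2 = i.2 then 1 else 0 :=
  (exists_shift a b).choose_spec i' i

theorem hasDegree_shift (a b : ℝ) : HasDegree a (shift N a b) := fun i' i h => by
  classical
  rw [ent_shift] at h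
  by_contra hn
  exact h (if_neg fun h' => hn h'.1)

theorem fp_shift (a b : ℝ) {d : ℕ} (ha : |a| ≤ d) (hb : |b| ≤ d) : FP d (shift N a b) := by
  classical
  intro i' i hn
  rw [ent_shift, if_neg]
  rintro ⟨h1, h2, -⟩
  refine hn ⟨?_, ?_⟩
  · rwa [h1, add_sub_cancel_left]
  · rwa [h2, add_sub_cancel_left]

theorem fp_shift_V : FP 1 (shift N 1 (-1)) := fp_shift _ _ (by simp) (by simp)

theorem fp_shift_Y : FP 1 (shift N 0 1) := fp_shift _ _ (by simp) (by simp)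

theorem flipOp_shift (a b : ℝ) : flipOp N * shift N a b = shift N a b * flipOp N := by
  classical
  refine ent_ext fun i' i => ?_
  rw [ent_flipOp_mul, ent_mul_flipOp, ent_shift, ent_shift]
  refine if_congr ?_ rfl rfl
  rw [lev_flip, lev_flip, mag_flip, mag_flip]
  have : (flip N i').2 = i.2 ↔ i'.2 = (flip N i).2 := by
    change -i'.2 = i.2 ↔ i'.2 = -i.2
    exact neg_eq_iff_eq_neg
  rw [this]

/-- Within the band the factor `l' - l` is at most `d`, so the new entries are again a bounded band
matrix. -/
theorem exists_delta {d : ℕ} {T : Spinors N →L[ℂ] Spinors N} (hT : FP d T) :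
    ∃ S, IsDelta T S := by
  refine exists_op_of_band (d := d) (C := d * ‖T‖) (fun i' i => ?_) fun i' i hn => ?_
  · by_cases h : Near d i' i
    · rw [norm_mul, Complex.norm_real]
      exact mul_le_mul h.1 (norm_ent_le T i' i) (norm_nonneg _) d.cast_nonneg
    · rw [hT i' i h, mul_zero, norm_zero]
      positivity
  · rw [hT i' i hn, mul_zero]

/-- This is the derivation property with `δ(U) = aU`: `[δ(T), U] = δ([T, U]) - a [T, U]`. -/
theorem IsDelta.ent_commutator {d d' : ℕ} {a : ℝ} {T S U : Spinors N →L[ℂ] Spinors N}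
    (h : IsDelta T S) (hT : FP d T) (hU : FP d' U) (ha : HasDegree a U) (i' i : Idx N) :
    ent (S * U - U * S) i' i = ((lev i' - lev i - a : ℝ) : ℂ) * ent (T * U - U * T) i' i := by
  rw [ent_sub, ent_sub, hU.ent_mul, hU.ent_mul, hT.ent_mul, (h.fp hT).ent_mul, mul_sub,
    Finset.mul_sum, Finset.mul_sum]
  congr 1
  · refine Finset.sum_congr rfl fun x _ => ?_
    rw [h]
    by_cases h0 : ent U x i = 0
    · rw [h0]; ring
    · have e : lev i' - lev x = lev i' - lev i - a := by rw [ha x i h0]; ring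
      rw [e]; ring
  · refine Finset.sum_congr rfl fun x _ => ?_
    rw [h]
    by_cases h0 : ent U i' x = 0
    · rw [h0]; ring
    · have e : lev x - lev i = lev i' - lev i - a := by rw [ha i' x h0]; ring
      rw [e]; ring

theorem IsDelta.decay_commutator {w : Idx N → ℝ} {d d' : ℕ} {a : ℝ}
    {T S U : Spinors N →L[ℂ] Spinors N}
    (h : IsDelta T S) (hT : FP d T) (hU : FP d' U) (ha : HasDegree a U)
    (hd : Decay w (T * U - U * T)) : Decay w (S * U - U * S) := by
  have hfp : FP (d + d' + (d' + d)) (T * U - U * T) := (hT.mul hU).sub (hU.mul hT)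
  refine hd.of_ent_le (K := (d + d' + (d' + d) : ℕ) + |a|) (by positivity) fun i' i => ?_
  rw [h.ent_commutator hT hU ha, norm_mul, Complex.norm_real]
  by_cases hn : Near (d + d' + (d' + d)) i' i
  · refine mul_le_mul_of_nonneg_right ?_ (norm_nonneg _)
    exact (abs_sub _ _).trans (add_le_add_left hn.1 _)
  · rw [hfp i' i hn]; simp

end Shifts

/-! ### The operators with a symbol -/

section Symbol

variable {N : ℝ} [hN : Fact (∃ k : ℤ, N = (k : ℝ) / 2)]

/-- Operators of finite propagation whose matrix entries are, up to exponentially small errors,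
independent of `l` for fixed `l + m`, and independent of `m` for large `l + m`. -/
structure HasSymbol (T : Spinors N →L[ℂ] Spinors N) : Prop where
  fp : ∃ d, FP d T
  decay_lev : Decay lev (T * shift N 1 (-1) - shift N 1 (-1) * T)
  decay_add : Decay (fun i => lev i + mag i) (T * shift N 0 1 - shift N 0 1 * T)

theorem HasSymbol.add {S T : Spinors N →L[ℂ] Spinors N} (hS : HasSymbol S) (hT : HasSymbol T) :
    HasSymbol (S + T) := by
  obtain ⟨d, hd⟩ := hS.fp
  obtain ⟨d', hd'⟩ := hT.fp
  refine ⟨⟨_, hd.add hd'⟩, ?_, ?_⟩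
  · convert hS.decay_lev.add isWeight_lev hT.decay_lev using 1; noncomm_ring
  · convert hS.decay_add.add isWeight_lev_add_mag hT.decay_add using 1; noncomm_ring

theorem HasSymbol.smul (c : ℂ) {T : Spinors N →L[ℂ] Spinors N} (hT : HasSymbol T) :
    HasSymbol (c • T) := by
  obtain ⟨d, hd⟩ := hT.fp
  refine ⟨⟨_, hd.smul c⟩, ?_, ?_⟩
  · convert hT.decay_lev.smul c using 1
    rw [smul_sub, smul_mul_assoc, mul_smul_comm]
  · convert hT.decay_add.smul c using 1
    rw [smul_sub, smul_mul_assoc, mul_smul_comm]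

theorem HasSymbol.one : HasSymbol (1 : Spinors N →L[ℂ] Spinors N) :=
  ⟨⟨0, FP.one⟩, by simpa using Decay.zero, by simpa using Decay.zero⟩

/-- By the Leibniz rule `[ST, U] = S[T, U] + [S, U]T`, and decaying operators absorb operators of
finite propagation on both sides. -/
theorem HasSymbol.mul {S T : Spinors N →L[ℂ] Spinors N} (hS : HasSymbol S) (hT : HasSymbol T) :
    HasSymbol (S * T) := by
  obtain ⟨d, hd⟩ := hS.fp
  obtain ⟨d', hd'⟩ := hT.fp
  have key : ∀ U : Spinors N →L[ℂ] Spinors N,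
      S * T * U - U * (S * T) = S * (T * U - U * T) + (S * U - U * S) * T := by
    intro U; noncomm_ring
  refine ⟨⟨_, hd.mul hd'⟩, ?_, ?_⟩
  · rw [key]
    exact (hT.decay_lev.mul_left S ((hd'.mul fp_shift_V).sub (fp_shift_V.mul hd'))).add isWeight_lev
      (hS.decay_lev.mul_right isWeight_lev hd')
  · rw [key]
    exact (hT.decay_add.mul_left S ((hd'.mul fp_shift_Y).sub (fp_shift_Y.mul hd'))).add
      isWeight_lev_add_mag (hS.decay_add.mul_right isWeight_lev_add_mag hd')

theorem hasSymbol_flipOp : HasSymbol (flipOp N) := by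
  refine ⟨⟨0, fp_flipOp⟩, ?_, ?_⟩
  · rw [flipOp_shift, sub_self]; exact Decay.zero
  · rw [flipOp_shift, sub_self]; exact Decay.zero

/-- The case of vanishing symbol: both terms of each commutator decay. It covers the error term of
`[D, T]`. -/
theorem Decay.hasSymbol {d : ℕ} {T : Spinors N →L[ℂ] Spinors N} (hT : FP d T)
    (h : Decay lev T) : HasSymbol T := by
  refine ⟨⟨d, hT⟩, ?_, ?_⟩
  · exact (h.mul_right isWeight_lev fp_shift_V).sub isWeight_lev (h.mul_left _ hT)
  · exact ((h.mul_right isWeight_lev fp_shift_Y).sub isWeight_lev (h.mul_left _ hT)).lev_add_mag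

theorem HasSymbol.delta {T S : Spinors N →L[ℂ] Spinors N} (hT : HasSymbol T) (h : IsDelta T S) :
    HasSymbol S := by
  obtain ⟨d, hd⟩ := hT.fp
  exact ⟨⟨d, h.fp hd⟩, h.decay_commutator hd fp_shift_V (hasDegree_shift _ _) hT.decay_lev,
    h.decay_commutator hd fp_shift_Y (hasDegree_shift _ _) hT.decay_add⟩

/-- Operators with a symbol which is the same on both summands of `ℋ`. -/
structure HasScalarSymbol (T : Spinors N →L[ℂ] Spinors N) : Prop extends HasSymbol T where
  decay_flip : Decay lev (T * flipOp N - flipOp N * T)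

theorem HasScalarSymbol.add {S T : Spinors N →L[ℂ] Spinors N} (hS : HasScalarSymbol S)
    (hT : HasScalarSymbol T) : HasScalarSymbol (S + T) := by
  refine ⟨hS.toHasSymbol.add hT.toHasSymbol, ?_⟩
  convert hS.decay_flip.add isWeight_lev hT.decay_flip using 1; noncomm_ring

theorem HasScalarSymbol.smul (c : ℂ) {T : Spinors N →L[ℂ] Spinors N} (hT : HasScalarSymbol T) :
    HasScalarSymbol (c • T) := by
  refine ⟨hT.toHasSymbol.smul c, ?_⟩
  convert hT.decay_flip.smul c using 1
  rw [smul_sub, smul_mul_assoc, mul_smul_comm]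

theorem HasScalarSymbol.one : HasScalarSymbol (1 : Spinors N →L[ℂ] Spinors N) :=
  ⟨HasSymbol.one, by simpa using Decay.zero⟩

theorem HasScalarSymbol.mul {S T : Spinors N →L[ℂ] Spinors N} (hS : HasScalarSymbol S)
    (hT : HasScalarSymbol T) : HasScalarSymbol (S * T) := by
  obtain ⟨d', hd'⟩ := hT.fp
  refine ⟨hS.toHasSymbol.mul hT.toHasSymbol, ?_⟩
  have key : S * T * flipOp N - flipOp N * (S * T)
      = S * (T * flipOp N - flipOp N * T) + (S * flipOp N - flipOp N * S) * T := by
    noncomm_ring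
  rw [key]
  exact (hT.decay_flip.mul_left S ((hd'.mul fp_flipOp).sub (fp_flipOp.mul hd'))).add isWeight_lev
    (hS.decay_flip.mul_right isWeight_lev hd')

end Symbol

/-! ### Commutators with the Dirac operator -/

section Commutators

open SpecTriple

variable {N : ℝ}

theorem IsComm.isDelta {T S : Spinors N →L[ℂ] Spinors N} (h : IsComm (diracAbs N) T S) :
    IsDelta T S := by
  intro i' i
  obtain ⟨h1, h2⟩ := h ⟨stdBasis _ i, stdBasis_mem_domain i⟩
  have h3 : (diracAbs N ⟨stdBasis _ i, stdBasis_mem_domain i⟩)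
      = (eigenvalue N i : ℂ) • stdBasis (Idx N) i :=
    weightedShift_stdBasis (fun _ => rfl) (fun _ => rfl) i
  rw [h3, map_smul] at h2
  have h4 := congrArg (fun u : Spinors N => u i') h2
  change (eigenvalue N i' : ℂ) * ent T i' i - (eigenvalue N i : ℂ) * ent T i' i = ent S i' i at h4
  rw [← h4, eigenvalue_eq, eigenvalue_eq]
  push_cast
  ring

theorem stdBasis_mem_dirac_domain (j : Idx N) : stdBasis _ j ∈ (dirac N).domain :=
  stdBasis_mem_domain j

variable [hN : Fact (∃ k : ℤ, N = (k : ℝ) / 2)]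

theorem isComm_diracAbs {d : ℕ} {T S : Spinors N →L[ℂ] Spinors N} (hT : FP d T)
    (h : IsDelta T S) : IsComm (diracAbs N) T S := by
  intro v
  have key : ∀ i, (eigenvalue N i : ℂ) * T v i = (S v + T (diracAbs N v) : Spinors N) i := by
    intro i
    change _ = S v i + T (diracAbs N v) i
    rw [hT.apply_eq, hT.apply_eq, (h.fp hT).apply_eq, Finset.mul_sum, ← Finset.sum_add_distrib]
    refine Finset.sum_congr rfl fun x _ => ?_
    have : (diracAbs N v : Spinors N) x = (eigenvalue N x : ℂ) * (v : Spinors N) x := rfl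
    rw [this, h, eigenvalue_eq, eigenvalue_eq]
    push_cast
    ring
  refine ⟨memℓp_of_apply_eq (u := S v + T (diracAbs N v)) key, lp.ext (funext fun i => ?_)⟩
  change (eigenvalue N i : ℂ) * T v i - T (diracAbs N v) i = S v i
  rw [key]
  exact add_sub_cancel_right _ _

/-- `δ` keeps the width of the band, so it can be iterated indefinitely; regularity needs nothing
more than finite propagation. -/
theorem FP.mem_OP0 {d : ℕ} {T : Spinors N →L[ℂ] Spinors N} (hT : FP d T) :
    T ∈ OP0 (diracAbs N) := by
  choose! f hf using fun (S : Spinors N →L[ℂ] Spinors N) (hS : FP d S) => exists_delta hS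
  have hfp : ∀ j, FP d (f^[j] T) := by
    intro j
    induction j with
    | zero => exact hT
    | succ j ih => rw [Function.iterate_succ_apply']; exact (hf _ ih).fp ih
  refine ⟨fun j => f^[j] T, rfl, fun j => ?_⟩
  change IsComm (diracAbs N) (f^[j] T) (f^[j + 1] T)
  rw [Function.iterate_succ_apply']
  exact isComm_diracAbs (hfp j) (hf _ (hfp j))

/-- The product `E|D|` is still bounded and decaying, because passing from `r` to `√r` absorbs the
linear growth of the eigenvalues. -/
theorem exists_mul_abs {d : ℕ} {E : Spinors N →L[ℂ] Spinors N} (hE : FP d E) (h : Decay lev E) :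
    ∃ S, FP d S ∧ Decay lev S ∧ ∀ i' i, ent S i' i = ent E i' i * (eigenvalue N i : ℂ) := by
  obtain ⟨C, r, hC, hr0, hr1, hb⟩ := h
  obtain ⟨C', hC', hb'⟩ := exists_mul_rpow_le hr0 hr1
  have hs0 : 0 < √r := Real.sqrt_pos.2 hr0
  have hs1 : √r < 1 := by rw [Real.sqrt_lt' one_pos]; simpa using hr1
  have bound : ∀ i' i, ‖ent E i' i * (eigenvalue N i : ℂ)‖ ≤ C * C' * √r ^ lev i := by
    intro i' i
    rw [norm_mul, Complex.norm_real, Real.norm_of_nonneg (by linarith [one_le_eigenvalue i])]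
    have h1 : eigenvalue N i ≤ lev i + 1 := by
      rw [eigenvalue_eq]; linarith [abs_nonneg N]
    calc ‖ent E i' i‖ * eigenvalue N i ≤ C * r ^ lev i * (lev i + 1) :=
          mul_le_mul (hb i' i) h1 (by linarith [one_le_eigenvalue i]) (by positivity)
      _ = C * ((lev i + 1) * r ^ lev i) := by ring
      _ ≤ C * (C' * √r ^ lev i) := mul_le_mul_of_nonneg_left (hb' _ (lev_nonneg i)) hC
      _ = _ := by ring
  obtain ⟨S, hS⟩ := exists_op_of_band (d := d) (C := C * C') (fun i' i => (bound i' i).trans (by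
    have := Real.rpow_le_one hs0.le hs1.le (lev_nonneg i)
    have h2 : 0 ≤ C * C' := by positivity
    nlinarith)) fun i' i hn => by rw [hE i' i hn, zero_mul]
  refine ⟨S, fun i' i hn => by rw [hS, hE i' i hn, zero_mul],
    ⟨C * C', √r, by positivity, hs0, hs1, fun i' i => ?_⟩, hS⟩
  rw [hS]
  exact bound i' i

/-- With `F` the exchange and `D = F|D|`, the commutator is `F[|D|, T] + (FT - TF)|D|`. The second
term is bounded only because `T` acts almost identically on the two summands. -/
theorem HasScalarSymbol.exists_isComm_dirac {T : Spinors N →L[ℂ] Spinors N}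
    (hT : HasScalarSymbol T) : ∃ S, HasSymbol S ∧ IsComm (dirac N) T S := by
  obtain ⟨d, hd⟩ := hT.fp
  obtain ⟨S1, hS1⟩ := exists_delta hd
  have hE : FP (0 + d + (d + 0)) (flipOp N * T - T * flipOp N) :=
    (fp_flipOp.mul hd).sub (hd.mul fp_flipOp)
  have hdec : Decay lev (flipOp N * T - T * flipOp N) := by
    convert hT.decay_flip.smul (-1) using 1
    simp
  obtain ⟨S2, hfp2, hdec2, hS2⟩ := exists_mul_abs hE hdec
  refine ⟨flipOp N * S1 + S2, (hasSymbol_flipOp.mul (hT.toHasSymbol.delta hS1)).add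
    (hdec2.hasSymbol hfp2), fun v => ?_⟩
  have hv : (v : Spinors N) ∈ (diracAbs N).domain := by
    change Memℓp (fun i => (eigenvalue N i : ℂ) * (v : Spinors N) i) 2
    rw [← memℓp_two_comp (flip N)]
    exact v.2
  obtain ⟨h1, h2⟩ := isComm_diracAbs hd hS1 ⟨v, hv⟩
  have e1 : dirac N v = flipOp N (diracAbs N ⟨v, hv⟩) := by
    refine lp.ext (funext fun i => ?_)
    rw [flipOp_apply]; rfl
  have e2 : S2 v = (flipOp N * T - T * flipOp N) (diracAbs N ⟨v, hv⟩) := by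
    refine lp.ext (funext fun i => ?_)
    rw [hfp2.apply_eq, hE.apply_eq]
    refine Finset.sum_congr rfl fun x _ => ?_
    rw [hS2, mul_assoc]; rfl
  have h3 : T v ∈ (dirac N).domain := by
    have h1' : Memℓp (fun i => (eigenvalue N i : ℂ) * T v i) 2 := h1
    exact (memℓp_two_comp (flip N) (f := fun i => (eigenvalue N i : ℂ) * T v i)).2 h1'
  have e3 : dirac N ⟨T v, h3⟩ = flipOp N (diracAbs N ⟨T v, h1⟩) := by
    refine lp.ext (funext fun i => ?_)
    rw [flipOp_apply]; rfl
  refine ⟨h3, ?_⟩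
  rw [e3, e1, eq_add_of_sub_eq h2]
  change _ = flipOp N (S1 v) + S2 v
  rw [e2, map_add]
  change _ = flipOp N (S1 v) + (flipOp N (T _) - T (flipOp N _))
  abel

theorem hasSymbol_of_psiGen {𝒜 : Type} [Ring 𝒜] [StarRing 𝒜] [Algebra ℂ 𝒜]
    {π : 𝒜 →⋆ₐ[ℂ] (Spinors N →L[ℂ] Spinors N)} (hπ : ∀ a, HasScalarSymbol (π a))
    {T : Spinors N →L[ℂ] Spinors N} (hT : PsiGen π (dirac N) (diracAbs N) T) : HasSymbol T := by
  induction hT with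
  | of a => exact (hπ a).toHasSymbol
  | comm a S hS =>
    obtain ⟨S', hS', hc⟩ := (hπ a).exists_isComm_dirac
    -- The given `S` is an arbitrary bounded extension of the commutator; uniqueness identifies it
    -- with the one that has a symbol.
    rwa [IsComm.unique stdBasis_mem_dirac_domain hS hc]
  | delta T S _ hS ih => exact ih.delta (IsComm.isDelta hS)

theorem hasSymbol_of_mem_psi0 {𝒜 : Type} [Ring 𝒜] [StarRing 𝒜] [Algebra ℂ 𝒜]
    {π : 𝒜 →⋆ₐ[ℂ] (Spinors N →L[ℂ] Spinors N)} (hπ : ∀ a, HasScalarSymbol (π a))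
    {T : Spinors N →L[ℂ] Spinors N} (hT : T ∈ Psi0 π (dirac N) (diracAbs N)) : HasSymbol T := by
  induction hT using Algebra.adjoin_induction with
  | mem x hx => exact hasSymbol_of_psiGen hπ hx
  | algebraMap c => rw [Algebra.algebraMap_eq_smul_one]; exact HasSymbol.one.smul c
  | add x y _ _ hx hy => exact hx.add hy
  | mul x y _ _ hx hy => exact hx.mul hy

theorem isRegular_of_hasScalarSymbol {𝒜 : Type} [Ring 𝒜] [StarRing 𝒜] [Algebra ℂ 𝒜]
    {π : 𝒜 →⋆ₐ[ℂ] (Spinors N →L[ℂ] Spinors N)} (hπ : ∀ a, HasScalarSymbol (π a)) :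
    IsRegular π (dirac N) (diracAbs N) := by
  refine fun a => ⟨?_, fun S hS => ?_⟩
  · obtain ⟨d, hd⟩ := (hπ a).fp
    exact hd.mem_OP0
  · obtain ⟨d, hd⟩ := (hasSymbol_of_psiGen hπ (PsiGen.comm a S hS)).fp
    exact hd.mem_OP0

end Commutators

end Podles

end

noncomputable section

namespace Podles

/-! ### Dirichlet series with almost affine coefficients -/

section Dirichlet

theorem exists_limit_of_geometric {x : ℕ → ℂ} {C r : ℝ} (hr : r < 1)
    (h : ∀ n, ‖x (n + 1) - x n‖ ≤ C * r ^ n) :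
    ∃ L, ∀ n, ‖x n - L‖ ≤ C / (1 - r) * r ^ n := by
  have h' : ∀ n, dist (x n) (x (n + 1)) ≤ C * r ^ n := fun n => by
    rw [dist_comm, dist_eq_norm]; exact h n
  obtain ⟨L, hL⟩ := cauchySeq_tendsto_of_complete (cauchySeq_of_le_geometric r C hr h')
  refine ⟨L, fun n => ?_⟩
  have := dist_le_of_le_geometric_of_tendsto r C hr h' hL n
  rw [dist_eq_norm] at this
  exact this.trans (le_of_eq (by ring))

theorem exists_nat_mul_pow_le {r : ℝ} (h0 : 0 < r) (h1 : r < 1) :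
    ∃ C, 0 ≤ C ∧ ∀ n : ℕ, ((n : ℝ) + 1) * r ^ n ≤ C * √r ^ n := by
  obtain ⟨C, hC, h⟩ := exists_mul_rpow_le h0 h1
  exact ⟨C, hC, fun n => by simpa using h n n.cast_nonneg⟩

/-- Row `j + 1` has two entries more than row `j`. The common entries change by `O(r^j)` each, and
there are `O(j)` of them; the new ones lie at the end of the row, where the values converge to some
`A`. So the row sums grow by `2A` per step up to an exponentially small, hence summable, error. -/
theorem exists_affine_asymptotics (n : ℕ) (t : ℕ → ℕ → ℂ) {C r : ℝ} (hC : 0 ≤ C) (h0 : 0 < r)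
    (h1 : r < 1)
    (hj : ∀ j k, k ≤ 2 * j + n → ‖t (j + 1) k - t j k‖ ≤ C * r ^ j)
    (hk : ∀ j k, k + 1 ≤ 2 * j + n → ‖t j (k + 1) - t j k‖ ≤ C * r ^ k) :
    ∃ (a b : ℂ) (C' ρ : ℝ), 0 ≤ C' ∧ 0 < ρ ∧ ρ < 1 ∧ ∀ j : ℕ,
      ‖∑ k ∈ Finset.range (2 * j + n + 1), t j k - (a * (j + 1) + b)‖ ≤ C' * ρ ^ j := by
  set s : ℕ → ℂ := fun j => ∑ k ∈ Finset.range (2 * j + n + 1), t j k with hs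
  have pow_le : ∀ j e : ℕ, j ≤ e → r ^ e ≤ r ^ j := fun j e h => pow_le_pow_of_le_one h0.le h1.le h
  have cpow_le : ∀ j e : ℕ, j ≤ e → C * r ^ e ≤ C * r ^ j := fun j e h =>
    mul_le_mul_of_nonneg_left (pow_le j e h) hC
  -- The values at the end of the rows converge.
  have step : ∀ j, ‖t (j + 1) (2 * (j + 1) + n) - t j (2 * j + n)‖ ≤ 3 * C * r ^ j := by
    intro j
    have a1 := hk (j + 1) (2 * j + n + 1) (by omega)
    have a2 := hk (j + 1) (2 * j + n) (by omega)
    have a3 := hj j (2 * j + n) le_rfl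
    have e1 := cpow_le j (2 * j + n + 1) (by omega)
    have e2 := cpow_le j (2 * j + n) (by omega)
    have e : t (j + 1) (2 * (j + 1) + n) - t j (2 * j + n)
        = (t (j + 1) (2 * j + n + 1 + 1) - t (j + 1) (2 * j + n + 1))
          + (t (j + 1) (2 * j + n + 1) - t (j + 1) (2 * j + n))
          + (t (j + 1) (2 * j + n) - t j (2 * j + n)) := by
      rw [show 2 * (j + 1) + n = 2 * j + n + 1 + 1 by ring]; ring
    rw [e]
    refine (norm_add₃_le).trans ?_
    linarith
  obtain ⟨A, hA⟩ := exists_limit_of_geometric (x := fun j => t j (2 * j + n)) h1 step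
  obtain ⟨K, hK, hKb⟩ := exists_nat_mul_pow_le h0 h1
  set ρ := √r with hρ
  have hρ0 : 0 < ρ := Real.sqrt_pos.2 h0
  have hρ1 : ρ < 1 := by rw [hρ, Real.sqrt_lt' one_pos]; simpa using h1
  have hrρ : r ≤ ρ := by
    rw [hρ]; exact Real.le_sqrt_of_sq_le (by nlinarith)
  have hD : 0 ≤ 3 * C / (1 - r) := div_nonneg (by linarith) (by linarith)
  -- The increments of the row sums converge.
  have inc : ∀ j, ‖s (j + 1) - s j - 2 * A‖
      ≤ ((n + 2) * C * K + (2 * (3 * C / (1 - r)) + C)) * ρ ^ j := by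
    intro j
    -- Each of the two new entries is compared with `A`; the last but one is the last one minus one
    -- horizontal difference.
    have e : s (j + 1) - s j - 2 * A
        = ∑ k ∈ Finset.range (2 * j + n + 1), (t (j + 1) k - t j k)
          + ((t (j + 1) (2 * (j + 1) + n) - A) + (t (j + 1) (2 * (j + 1) + n) - A)
            - (t (j + 1) (2 * j + n + 1 + 1) - t (j + 1) (2 * j + n + 1))) := by
      have h2 : s (j + 1) = ∑ k ∈ Finset.range (2 * j + n + 1), t (j + 1) k
          + t (j + 1) (2 * j + n + 1) + t (j + 1) (2 * j + n + 1 + 1) := by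
        rw [hs]
        change ∑ k ∈ Finset.range (2 * (j + 1) + n + 1), t (j + 1) k = _
        rw [show 2 * (j + 1) + n + 1 = 2 * j + n + 1 + 1 + 1 by ring, Finset.sum_range_succ,
          Finset.sum_range_succ]
      rw [h2, Finset.sum_sub_distrib, show 2 * (j + 1) + n = 2 * j + n + 1 + 1 by ring]
      change _ + _ + _ - ∑ k ∈ Finset.range (2 * j + n + 1), t j k - _ = _
      ring
    have b1 : ‖∑ k ∈ Finset.range (2 * j + n + 1), (t (j + 1) k - t j k)‖
        ≤ (n + 2) * C * K * ρ ^ j := by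
      refine (norm_sum_le _ _).trans ((Finset.sum_le_card_nsmul _ _ (C * r ^ j) ?_).trans ?_)
      · intro k hk'
        exact hj j k (by have := Finset.mem_range.1 hk'; omega)
      · rw [Finset.card_range, nsmul_eq_mul]
        have h3 : ((2 * j + n + 1 : ℕ) : ℝ) ≤ (n + 2) * ((j : ℝ) + 1) := by
          push_cast
          have : (0 : ℝ) ≤ n * j := by positivity
          nlinarith
        calc ((2 * j + n + 1 : ℕ) : ℝ) * (C * r ^ j)
            ≤ (n + 2) * ((j : ℝ) + 1) * (C * r ^ j) :=
              mul_le_mul_of_nonneg_right h3 (by positivity)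
          _ = (n + 2) * C * (((j : ℝ) + 1) * r ^ j) := by ring
          _ ≤ (n + 2) * C * (K * ρ ^ j) := mul_le_mul_of_nonneg_left (hKb j) (by positivity)
          _ = _ := by ring
    have hrj : r ^ j ≤ ρ ^ j := pow_le_pow_left₀ h0.le hrρ j
    have b2 : ‖t (j + 1) (2 * (j + 1) + n) - A‖ ≤ 3 * C / (1 - r) * ρ ^ j := by
      refine (hA (j + 1)).trans (mul_le_mul_of_nonneg_left ?_ hD)
      exact (pow_le j (j + 1) (by omega)).trans hrj
    have b3 : ‖t (j + 1) (2 * j + n + 1 + 1) - t (j + 1) (2 * j + n + 1)‖ ≤ C * ρ ^ j :=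
      (hk (j + 1) (2 * j + n + 1) (by omega)).trans
        ((cpow_le j _ (by omega)).trans (mul_le_mul_of_nonneg_left hrj hC))
    rw [e]
    refine (norm_add_le _ _).trans ?_
    refine (add_le_add b1 ((norm_sub_le _ _).trans (add_le_add ((norm_add_le _ _).trans
      (add_le_add b2 b2)) b3))).trans (le_of_eq (by ring))
  have hC3 : 0 ≤ (n + 2) * C * K + (2 * (3 * C / (1 - r)) + C) := by positivity
  obtain ⟨B, hB⟩ := exists_limit_of_geometric (x := fun j : ℕ => s j - 2 * A * j) hρ1 (fun j => by
    have := inc j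
    have e : s (j + 1) - 2 * A * (j + 1 : ℕ) - (s j - 2 * A * j) = s (j + 1) - s j - 2 * A := by
      push_cast; ring
    rw [e]
    exact this)
  -- The limit `B` belongs to the expansion `2Aj + B`; rewriting it in powers of the eigenvalue `j +
  -- 1` shifts the constant by `-2A`.
  refine ⟨2 * A, B - 2 * A, ((n + 2) * C * K + (2 * (3 * C / (1 - r)) + C)) / (1 - ρ), ρ,
    div_nonneg hC3 (by linarith), hρ0, hρ1, fun j => ?_⟩
  have := hB j
  have e : s j - (2 * A * (j + 1) + (B - 2 * A)) = s j - 2 * A * j - B := by ring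
  change ‖s j - _‖ ≤ _
  rw [e]
  exact this

/-- The singularity of `ζ(z) - 1/(z - 1)` at `1` is removable; the limit there is the
Euler–Mascheroni constant. -/
theorem exists_entire_riemannZeta_sub : ∃ h : ℂ → ℂ, Differentiable ℂ h ∧
    ∀ z, z ≠ 1 → riemannZeta z = (z - 1)⁻¹ + h z := by
  classical
  let f : ℂ → ℂ := fun s => riemannZeta s - 1 / (s - 1)
  let h : ℂ → ℂ := Function.update f 1 (Real.eulerMascheroniConstant : ℂ)
  have hne : ∀ z, z ≠ 1 → h z = f z := fun z hz => Function.update_of_ne hz _ _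
  have hd : ∀ z, z ≠ 1 → DifferentiableAt ℂ h z := by
    intro z hz
    have h1 : DifferentiableAt ℂ f z := by
      refine (differentiableAt_riemannZeta hz).sub ?_
      exact (differentiableAt_const _).div (by fun_prop) (sub_ne_zero.2 hz)
    refine h1.congr_of_eventuallyEq ?_
    filter_upwards [isOpen_ne.mem_nhds hz] with w hw
    exact hne w hw
  have hc : ContinuousAt h 1 := by
    rw [continuousAt_update_same]
    exact tendsto_riemannZeta_sub_one_div
  have ha : AnalyticAt ℂ h 1 := by
    refine Complex.analyticAt_of_differentiable_on_punctured_nhds_of_continuousAt ?_ hc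
    filter_upwards [self_mem_nhdsWithin] with w hw
    exact hd w hw
  refine ⟨h, fun z => ?_, fun z hz => ?_⟩
  · by_cases hz : z = 1
    · rw [hz]; exact ha.differentiableAt
    · exact hd z hz
  · rw [hne z hz]
    simp only [f]
    rw [one_div]; ring

theorem norm_natCast_add_one_cpow (j : ℕ) (z : ℂ) :
    ‖((j : ℂ) + 1) ^ z‖ = ((j : ℝ) + 1) ^ z.re := by
  have : ((j : ℂ) + 1) = ((j + 1 : ℕ) : ℂ) := by push_cast; rfl
  rw [this, Complex.norm_natCast_cpow_of_pos (Nat.succ_pos j)]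
  push_cast; rfl

theorem summable_natCast_add_one_cpow {z : ℂ} (hz : 1 < z.re) :
    Summable fun j : ℕ => ((j : ℂ) + 1) ^ (-z) := by
  refine Summable.of_norm ?_
  simp_rw [norm_natCast_add_one_cpow, Complex.neg_re]
  have := (summable_nat_add_iff 1).2 (Real.summable_nat_rpow_inv.2 hz)
  refine this.congr fun j => ?_
  rw [Real.rpow_neg (by positivity)]
  push_cast; rfl

theorem tsum_natCast_add_one_cpow {z : ℂ} (hz : 1 < z.re) :
    ∑' j : ℕ, ((j : ℂ) + 1) ^ (-z) = riemannZeta z := by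
  rw [zeta_eq_tsum_one_div_nat_add_one_cpow hz]
  exact tsum_congr fun j => by rw [Complex.cpow_neg, one_div]

theorem summable_pow_mul_rpow {ρ : ℝ} (h0 : 0 < ρ) (h1 : ρ < 1) (x : ℝ) :
    Summable fun j : ℕ => ρ ^ j * ((j : ℝ) + 1) ^ x := by
  obtain ⟨k, hk⟩ := exists_nat_ge x
  have hs := (summable_nat_add_iff 1).2 (summable_pow_mul_geometric_of_norm_lt_one k
    (r := ρ) (by rwa [Real.norm_of_nonneg h0.le]))
  refine Summable.of_nonneg_of_le (fun j => by positivity) (fun j => ?_) (hs.mul_left ρ⁻¹)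
  have h2 : ((j : ℝ) + 1) ^ x ≤ ((j : ℝ) + 1) ^ k := by
    rw [← Real.rpow_natCast]
    exact Real.rpow_le_rpow_of_exponent_le (by linarith [j.cast_nonneg (α := ℝ)]) hk
  have h3 : ρ⁻¹ * (((j + 1 : ℕ) : ℝ) ^ k * ρ ^ (j + 1)) = ρ ^ j * ((j : ℝ) + 1) ^ k := by
    push_cast
    rw [pow_succ]
    field_simp
  rw [h3]
  exact mul_le_mul_of_nonneg_left h2 (by positivity)

/-- Geometric decay beats every power of `j + 1`, uniformly on the half-plane to the right of `Re z
- 1`, which contains `z`. -/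
theorem differentiable_tsum_geometric {e : ℕ → ℂ} {C ρ : ℝ} (hC : 0 ≤ C) (h0 : 0 < ρ) (h1 : ρ < 1)
    (he : ∀ j, ‖e j‖ ≤ C * ρ ^ j) :
    Differentiable ℂ fun z : ℂ => ∑' j : ℕ, e j * ((j : ℂ) + 1) ^ (-z) := by
  intro z
  set U : Set ℂ := {w | z.re - 1 < w.re} with hU
  have hUo : IsOpen U := isOpen_lt continuous_const Complex.continuous_re
  have hd : DifferentiableOn ℂ (fun z : ℂ => ∑' j : ℕ, e j * ((j : ℂ) + 1) ^ (-z)) U := by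
    refine Complex.differentiableOn_tsum_of_summable_norm
      ((summable_pow_mul_rpow h0 h1 (-(z.re - 1))).mul_left C) (fun j => ?_) hUo fun j w hw => ?_
    · have : ((j : ℂ) + 1) ≠ 0 := by exact_mod_cast Nat.succ_ne_zero j
      refine DifferentiableOn.const_mul ?_ _
      intro w _
      exact (DifferentiableAt.const_cpow (by fun_prop) (Or.inl this)).differentiableWithinAt
    · rw [norm_mul, norm_natCast_add_one_cpow, ← mul_assoc]
      refine mul_le_mul (he j) ?_ (by positivity) (by positivity)
      refine Real.rpow_le_rpow_of_exponent_le (by linarith [j.cast_nonneg (α := ℝ)]) ?_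
      rw [Complex.neg_re]
      have : z.re - 1 < w.re := hw
      linarith
  exact hd.differentiableAt (hUo.mem_nhds (by simp [hU]))

/-- `Z` is, on `Re z > 2`, a function with at most simple poles, at `1` and `2`, with residues `b`
and `a`. -/
def HasPoleExpansion (Z : ℂ → ℂ) (a b : ℂ) : Prop :=
  ∃ g : ℂ → ℂ, Differentiable ℂ g ∧
    ∀ z : ℂ, 2 < z.re → Z z = a * (z - 2)⁻¹ + b * (z - 1)⁻¹ + g z

/-- The affine part of the coefficients contributes `a ζ(z - 1) + b ζ(z)` with Riemann's `ζ`; the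
error contributes an entire Dirichlet series. -/
theorem hasPoleExpansion_of_affine {s : ℕ → ℂ} {a b : ℂ} {C ρ : ℝ} (hC : 0 ≤ C) (h0 : 0 < ρ)
    (h1 : ρ < 1) (hs : ∀ j : ℕ, ‖s j - (a * (j + 1) + b)‖ ≤ C * ρ ^ j) :
    HasPoleExpansion (fun z => ∑' j : ℕ, s j * ((j : ℂ) + 1) ^ (-z)) a b := by
  obtain ⟨h, hh, hz⟩ := exists_entire_riemannZeta_sub
  refine ⟨fun z => a * h (z - 1) + b * h z
    + ∑' j : ℕ, (s j - (a * (j + 1) + b)) * ((j : ℂ) + 1) ^ (-z), ?_, fun z hz2 => ?_⟩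
  · have := differentiable_tsum_geometric hC h0 h1 hs
    have h2 : Differentiable ℂ fun z : ℂ => h (z - 1) := hh.comp (by fun_prop)
    exact ((h2.const_mul a).add (hh.const_mul b)).add this
  · have e1 : ∀ j : ℕ, s j * ((j : ℂ) + 1) ^ (-z) = a * ((j : ℂ) + 1) ^ (-(z - 1))
        + b * ((j : ℂ) + 1) ^ (-z) + (s j - (a * (j + 1) + b)) * ((j : ℂ) + 1) ^ (-z) := by
      intro j
      have hne : ((j : ℂ) + 1) ≠ 0 := by exact_mod_cast Nat.succ_ne_zero j
      rw [show -(z - 1) = -z + 1 by ring, Complex.cpow_add _ _ hne, Complex.cpow_one]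
      ring
    have hr1 : 1 < (z - 1).re := by rw [Complex.sub_re, Complex.one_re]; linarith
    have hr2 : 1 < z.re := by linarith
    have s1 := (summable_natCast_add_one_cpow hr1).mul_left a
    have s2 := (summable_natCast_add_one_cpow hr2).mul_left b
    have s3 : Summable fun j : ℕ => (s j - (a * (j + 1) + b)) * ((j : ℂ) + 1) ^ (-z) := by
      refine Summable.of_norm_bounded ((summable_pow_mul_rpow h0 h1 (-z.re)).mul_left C)
        fun j => ?_
      rw [norm_mul, norm_natCast_add_one_cpow, Complex.neg_re, ← mul_assoc]
      exact mul_le_mul_of_nonneg_right (hs j) (by positivity)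
    simp_rw [e1]
    rw [(s1.add s2).tsum_add s3, s1.tsum_add s2, tsum_mul_left, tsum_mul_left,
      tsum_natCast_add_one_cpow hr1, tsum_natCast_add_one_cpow hr2,
      hz (z - 1) (by intro h; rw [h] at hr1; simp at hr1),
      hz z (by intro h; rw [h] at hr2; simp at hr2), show z - 1 - 1 = z - 2 by ring]
    ring

theorem HasPoleExpansion.differentiableOn {Z : ℂ → ℂ} {a b : ℂ} (h : HasPoleExpansion Z a b) :
    DifferentiableOn ℂ Z {z | 2 < z.re} := by
  obtain ⟨g, hg, hZ⟩ := h
  refine DifferentiableOn.congr (f := fun z => a * (z - 2)⁻¹ + b * (z - 1)⁻¹ + g z) ?_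
    fun z hz => hZ z hz
  intro z hz
  have hz' : 2 < z.re := hz
  have h1 : z - 2 ≠ 0 := by
    intro h
    rw [sub_eq_zero.1 h] at hz'
    simp at hz'
  have h2 : z - 1 ≠ 0 := by
    intro h
    rw [sub_eq_zero.1 h] at hz'
    norm_num at hz'
  have d1 : DifferentiableAt ℂ (fun z : ℂ => (z - 2)⁻¹) z :=
    (differentiableAt_id.sub (differentiableAt_const _)).inv h1
  have d2 : DifferentiableAt ℂ (fun z : ℂ => (z - 1)⁻¹) z :=
    (differentiableAt_id.sub (differentiableAt_const _)).inv h2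
  exact (((d1.const_mul a).add (d2.const_mul b)).add (hg z)).differentiableWithinAt

theorem meromorphicOrderAt_simple_pole {g : ℂ → ℂ} {x c : ℂ} (hg : AnalyticAt ℂ g x) (hc : c ≠ 0) :
    meromorphicOrderAt (fun z => c * (z - x)⁻¹ + g z) x = -1 := by
  have hm : MeromorphicAt (fun z => c * (z - x)⁻¹ + g z) x := by
    refine MeromorphicAt.add ?_ hg.meromorphicAt
    exact (MeromorphicAt.const c x).mul
      (((MeromorphicAt.id x).sub (MeromorphicAt.const x x)).inv)
  have := (meromorphicOrderAt_eq_int_iff (n := -1) hm).2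
    ⟨fun z => c + (z - x) * g z, by
      refine analyticAt_const.add (AnalyticAt.mul ?_ hg)
      exact analyticAt_id.sub analyticAt_const, by simpa using hc, by
      filter_upwards [self_mem_nhdsWithin] with z hz
      have hz' : z - x ≠ 0 := sub_ne_zero.2 hz
      rw [zpow_neg_one, smul_eq_mul]
      field_simp⟩
  exact_mod_cast this

theorem HasPoleExpansion.exists_extension {Z : ℂ → ℂ} {a b : ℂ} (h : HasPoleExpansion Z a b) :
    ∃ f : ℂ → ℂ, MeromorphicOn f Set.univ ∧ (∀ z : ℂ, 2 < z.re → f z = Z z) ∧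
      (a ≠ 0 → meromorphicOrderAt f 2 = -1) ∧ (b ≠ 0 → meromorphicOrderAt f 1 = -1) ∧
      ∀ z, meromorphicOrderAt f z < 0 → (z = 1 ∨ z = 2) ∧ meromorphicOrderAt f z = -1 := by
  obtain ⟨g, hg, hZ⟩ := h
  have hga : ∀ z, AnalyticAt ℂ g z := fun z => hg.analyticAt z
  have hinv : ∀ x c z : ℂ, z ≠ x → AnalyticAt ℂ (fun z => c * (z - x)⁻¹) z := fun x c z hz =>
    analyticAt_const.mul ((analyticAt_id.sub analyticAt_const).inv (sub_ne_zero.2 hz))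
  have hmer : ∀ x c z : ℂ, MeromorphicAt (fun z => c * (z - x)⁻¹) z := fun x c z =>
    (MeromorphicAt.const c z).mul (((MeromorphicAt.id z).sub (MeromorphicAt.const x z)).inv)
  let f : ℂ → ℂ := fun z => a * (z - 2)⁻¹ + b * (z - 1)⁻¹ + g z
  have e2 : f = fun z => a * (z - 2)⁻¹ + (b * (z - 1)⁻¹ + g z) := by
    funext z; simp only [f]; ring
  have e1 : f = fun z => b * (z - 1)⁻¹ + (a * (z - 2)⁻¹ + g z) := by
    funext z; simp only [f]; ring
  have o2 : a ≠ 0 → meromorphicOrderAt f 2 = -1 := fun ha => by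
    rw [e2]
    exact meromorphicOrderAt_simple_pole ((hinv 1 b 2 (by norm_num)).add (hga 2)) ha
  have o1 : b ≠ 0 → meromorphicOrderAt f 1 = -1 := fun hb => by
    rw [e1]
    exact meromorphicOrderAt_simple_pole ((hinv 2 a 1 (by norm_num)).add (hga 1)) hb
  refine ⟨f, fun z _ => ((hmer 2 a z).add (hmer 1 b z)).add (hga z).meromorphicAt,
    fun z hz => (hZ z hz).symm, o2, o1, fun z hz => ?_⟩
  by_cases h1 : z = 1
  · rw [h1] at hz ⊢
    by_cases hb : b = 0
    · refine absurd hz (not_lt.2 (AnalyticAt.meromorphicOrderAt_nonneg ?_))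
      rw [e1, hb]
      simp only [zero_mul, zero_add]
      exact (hinv 2 a 1 (by norm_num)).add (hga 1)
    · exact ⟨Or.inl rfl, o1 hb⟩
  by_cases h2 : z = 2
  · rw [h2] at hz ⊢
    by_cases ha : a = 0
    · refine absurd hz (not_lt.2 (AnalyticAt.meromorphicOrderAt_nonneg ?_))
      rw [e2, ha]
      simp only [zero_mul, zero_add]
      exact (hinv 1 b 2 (by norm_num)).add (hga 2)
    · exact ⟨Or.inr rfl, o2 ha⟩
  · exact absurd hz (not_lt.2 (AnalyticAt.meromorphicOrderAt_nonneg
      (((hinv 2 a z h2).add (hinv 1 b z h1)).add (hga z))))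

/-- The identity theorem for meromorphic functions. It makes poles and their orders independent of
the extension, over which the definition of the dimension spectrum quantifies. -/
theorem meromorphicOrderAt_eq_of_eqOn {f f' : ℂ → ℂ} {d : ℝ} (hf : MeromorphicOn f Set.univ)
    (hf' : MeromorphicOn f' Set.univ) (h : ∀ z : ℂ, d < z.re → f z = f' z) (z : ℂ) :
    meromorphicOrderAt f z = meromorphicOrderAt f' z := by
  have hs : MeromorphicOn (f - f') Set.univ := hf.sub hf'
  -- Order `⊤` means vanishing on a punctured neighbourhood; since `ℂ` is connected, this spreads
  -- from one point to all.
  have hx : meromorphicOrderAt (f - f') ((d + 1 : ℝ) : ℂ) = ⊤ := by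
    rw [meromorphicOrderAt_eq_top_iff]
    refine Filter.Eventually.filter_mono nhdsWithin_le_nhds ?_
    have : IsOpen {w : ℂ | d < w.re} := isOpen_lt continuous_const Complex.continuous_re
    filter_upwards [this.mem_nhds (by simp : ((d + 1 : ℝ) : ℂ) ∈ {w : ℂ | d < w.re})] with w hw
    simp [h w hw]
  have hz : meromorphicOrderAt (f - f') z = ⊤ := by
    by_contra hn
    exact hs.meromorphicOrderAt_ne_top_of_isPreconnected isPreconnected_univ (Set.mem_univ z)
      (Set.mem_univ _) hn hx
  refine meromorphicOrderAt_congr ?_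
  filter_upwards [meromorphicOrderAt_eq_top_iff.1 hz] with w hw
  exact sub_eq_zero.1 hw

end Dirichlet

end Podles

end

/-! ### The spectrum of `|D|`: singular values, complex powers, metric dimension -/

noncomputable section

namespace Podles

open SpecTriple

/-! ### Singular values of operators on `ℓ²(ι)` -/

section SingularValues

variable {ι : Type}

theorem singularValue_nonneg (T : L2 ι →L[ℂ] L2 ι) (n : ℕ) : 0 ≤ singularValue T n :=
  Real.iInf_nonneg fun V => norm_nonneg (T ∘L (V.1ᗮ).subtypeL)

theorem finrank_span_stdBasis (s : Finset ι) :
    Module.finrank ℂ (Submodule.span ℂ (Set.range fun i : s => stdBasis ι i)) = s.card := by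
  have h : LinearIndependent ℂ fun i : s => stdBasis ι i :=
    ((stdBasis ι).orthonormal.comp _ Subtype.val_injective).linearIndependent
  rw [finrank_span_eq_card h, Fintype.card_coe]

/-- The span of the basis vectors in `s` is one competitor in the infimum. -/
theorem singularValue_le {T : L2 ι →L[ℂ] L2 ι} {c : ℝ} (hc : 0 ≤ c) (s : Finset ι)
    (h : ∀ v : L2 ι, (∀ i ∈ s, v i = 0) → ‖T v‖ ≤ c * ‖v‖) : singularValue T s.card ≤ c := by
  have hfd : FiniteDimensional ℂ (Submodule.span ℂ (Set.range fun i : s => stdBasis ι i)) :=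
    FiniteDimensional.span_of_finite ℂ (Set.finite_range _)
  let V : {V : Submodule ℂ (L2 ι) // FiniteDimensional ℂ V ∧ Module.finrank ℂ V = s.card} :=
    ⟨_, hfd, finrank_span_stdBasis s⟩
  refine (ciInf_le ⟨0, ?_⟩ V).trans ?_
  · rintro _ ⟨W, rfl⟩
    exact norm_nonneg (T ∘L (W.1ᗮ).subtypeL)
  · refine ContinuousLinearMap.opNorm_le_bound _ hc fun v => ?_
    refine h v fun i hi => ?_
    rw [← inner_stdBasis]
    exact Submodule.inner_right_of_mem_orthogonal
      (Submodule.subset_span (Set.mem_range_self (⟨i, hi⟩ : s))) v.2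

/-- The min-max argument: an `(n + 1)`-dimensional space contains a nonzero vector orthogonal to any
given `n`-dimensional one. -/
theorem le_singularValue [Infinite ι] {T : L2 ι →L[ℂ] L2 ι} {c : ℝ} {n : ℕ} (s : Finset ι)
    (hs : s.card = n + 1)
    (h : ∀ v : L2 ι, (∀ i ∉ s, v i = 0) → c * ‖v‖ ≤ ‖T v‖) : c ≤ singularValue T n := by
  classical
  -- A competitor must exist: a real infimum over the empty family is `0` by convention, which would
  -- defeat a positive lower bound.
  have hne : Nonempty {V : Submodule ℂ (L2 ι) // FiniteDimensional ℂ V ∧ Module.finrank ℂ V = n} := by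
    obtain ⟨t, ht⟩ := Infinite.exists_subset_card_eq ι n
    exact ⟨⟨_, FiniteDimensional.span_of_finite ℂ (Set.finite_range _),
      ht ▸ finrank_span_stdBasis t⟩⟩
  refine le_ciInf fun V => ?_
  obtain ⟨V, hfd, hV⟩ := V
  let f : (s → ℂ) →ₗ[ℂ] V :=
    V.orthogonalProjectionOnto.toLinearMap ∘ₗ (Fintype.linearCombination ℂ fun i : s => stdBasis ι i)
  -- The projection of the `(n + 1)`-dimensional span onto `V` has a kernel; an element of it gives
  -- the vector orthogonal to `V`.
  have hker : LinearMap.ker f ≠ ⊥ := by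
    refine LinearMap.ker_ne_bot_of_finrank_lt ?_
    rw [hV, Module.finrank_fintype_fun_eq_card, Fintype.card_coe, hs]
    exact Nat.lt_succ_self n
  obtain ⟨x, hx, hx0⟩ := Submodule.exists_mem_ne_zero_of_ne_bot hker
  set v : L2 ι := Fintype.linearCombination ℂ (fun i : s => stdBasis ι i) x with hv
  have hvV : v ∈ Vᗮ := by
    rw [← Submodule.orthogonalProjectionOnto_eq_zero_iff]
    exact hx
  have hv0 : v ≠ 0 := by
    intro h0
    have hli : LinearIndependent ℂ fun i : s => stdBasis ι i :=
      ((stdBasis ι).orthonormal.comp _ Subtype.val_injective).linearIndependent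
    refine hx0 (funext fun i => ?_)
    rw [hv, Fintype.linearCombination_apply] at h0
    exact Fintype.linearIndependent_iff.1 hli x h0 i
  have hvs : ∀ i ∉ s, v i = 0 := by
    intro i hi
    rw [hv, Fintype.linearCombination_apply, lp.coeFn_sum, Finset.sum_apply]
    refine Finset.sum_eq_zero fun j _ => ?_
    change x j * stdBasis ι j i = 0
    rw [stdBasis_apply_ne, mul_zero]
    rintro rfl
    exact hi j.2
  have h1 := (T ∘L (Vᗮ).subtypeL).le_opNorm ⟨v, hvV⟩
  have h2 := h v hvs
  exact le_of_mul_le_mul_right (h2.trans h1) (norm_pos_iff.2 hv0)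

end SingularValues

/-! ### The eigenspaces of `|D|` -/

section Levels

variable {N : ℝ} [hN : Fact (∃ k : ℤ, N = (k : ℝ) / 2)]

theorem exists_two_mul_abs : ∃ n : ℕ, 2 * |N| = n := by
  obtain ⟨k, hk⟩ := hN.out
  exact ⟨k.natAbs, by rw [hk, abs_div, abs_two, Nat.cast_natAbs, Int.cast_abs]; ring⟩

/-- The label with `l = |N| + j`, `l + m = k`. -/
def mkIdx {n : ℕ} (hn : 2 * |N| = n) (j k : ℕ) (hk : k < 2 * j + n + 1) (ε : ℤˣ) : Idx N :=
  (⟨(j + |N|, k - j - |N|), isLabel_iff.2 ⟨⟨j, by ring⟩, ⟨k, by ring⟩, 2 * j + n - k, by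
    rw [Nat.cast_sub (by omega)]; push_cast; linarith⟩⟩, ε)

variable {n : ℕ} (hn : 2 * |N| = n)

theorem lev_mkIdx (j k : ℕ) (hk : k < 2 * j + n + 1) (ε : ℤˣ) :
    lev (mkIdx hn j k hk ε) = j + |N| := rfl

theorem mag_mkIdx (j k : ℕ) (hk : k < 2 * j + n + 1) (ε : ℤˣ) :
    mag (mkIdx hn j k hk ε) = k - j - |N| := rfl

theorem exists_eq_mkIdx (i : Idx N) : ∃ j k, ∃ hk : k < 2 * j + n + 1, ∃ ε, i = mkIdx hn j k hk ε := by
  obtain ⟨⟨a, ha⟩, ⟨b, hb⟩, c, hc⟩ := label_spec i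
  have h : (b : ℝ) ≤ 2 * a + n := by
    have : (0 : ℝ) ≤ c := c.cast_nonneg
    linarith
  have h' : b ≤ 2 * a + n := by exact_mod_cast h
  refine ⟨a, b, by omega, i.2, idx_ext ?_ ?_ rfl⟩
  · rw [lev_mkIdx]; linarith
  · rw [mag_mkIdx]; linarith

/-- Labels grouped by the eigenvalue of `|D|`. -/
def levelEquiv : (Σ j : ℕ, Fin (2 * j + n + 1) × ℤˣ) ≃ Idx N :=
  Equiv.ofBijective (fun x => mkIdx hn x.1 x.2.1 x.2.1.2 x.2.2) (by
    constructor
    · rintro ⟨j, k, ε⟩ ⟨j', k', ε'⟩ h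
      have h1 : (j : ℝ) + |N| = j' + |N| := congrArg lev h
      have h2 : ((k : ℕ) : ℝ) - j - |N| = (k' : ℕ) - j' - |N| := congrArg mag h
      have h3 : ε = ε' := congrArg Prod.snd h
      have h4 : j = j' := by exact_mod_cast add_right_cancel h1
      subst h4
      have h5 : (k : ℕ) = k' := by
        have : ((k : ℕ) : ℝ) = (k' : ℕ) := by linarith
        exact_mod_cast this
      rw [Fin.ext h5, h3]
    · intro i
      obtain ⟨j, k, hk, ε, rfl⟩ := exists_eq_mkIdx hn i
      exact ⟨⟨j, ⟨k, hk⟩, ε⟩, rfl⟩)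

theorem levelEquiv_apply (j : ℕ) (x : Fin (2 * j + n + 1) × ℤˣ) :
    levelEquiv hn ⟨j, x⟩ = mkIdx hn j x.1 x.1.2 x.2 := rfl

theorem eigenvalue_levelEquiv (j : ℕ) (x : Fin (2 * j + n + 1) × ℤˣ) :
    eigenvalue N (levelEquiv hn ⟨j, x⟩) = j + 1 := by
  rw [levelEquiv_apply, eigenvalue_eq, lev_mkIdx]; ring

/-- The labels with `|D|`-eigenvalue at most `p`. -/
def lowLevels (p : ℕ) : Finset (Idx N) :=
  ((Finset.range p).sigma fun j => (Finset.univ : Finset (Fin (2 * j + n + 1) × ℤˣ))).map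
    (levelEquiv hn).toEmbedding

/-- Level `j` has `2j + n + 1` values of `m` and two signs. This quadratic growth is the source of
the metric dimension `2`. -/
theorem card_lowLevels (p : ℕ) : (lowLevels hn p).card = 2 * p ^ 2 + 2 * n * p := by
  rw [lowLevels, Finset.card_map, Finset.card_sigma]
  simp only [Finset.card_univ, Fintype.card_prod, Fintype.card_fin, Fintype.card_units_int]
  induction p with
  | zero => simp
  | succ p ih => rw [Finset.sum_range_succ, ih]; ring

theorem exists_level (i : Idx N) : ∃ j x, i = levelEquiv hn ⟨j, x⟩ :=
  ⟨((levelEquiv hn).symm i).1, ((levelEquiv hn).symm i).2, by simp⟩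

theorem mem_lowLevels {p j : ℕ} {x : Fin (2 * j + n + 1) × ℤˣ} :
    levelEquiv hn ⟨j, x⟩ ∈ lowLevels hn p ↔ j < p := by
  simp [lowLevels]

theorem eigenvalue_le_of_mem {p : ℕ} {i : Idx N} (h : i ∈ lowLevels hn p) :
    eigenvalue N i ≤ p := by
  obtain ⟨j, x, rfl⟩ := exists_level hn i
  rw [mem_lowLevels] at h
  rw [eigenvalue_levelEquiv]
  exact_mod_cast h

theorem le_eigenvalue_of_notMem {p : ℕ} {i : Idx N} (h : i ∉ lowLevels hn p) :
    (p : ℝ) + 1 ≤ eigenvalue N i := by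
  obtain ⟨j, x, rfl⟩ := exists_level hn i
  rw [mem_lowLevels, not_lt] at h
  rw [eigenvalue_levelEquiv]
  have : (p : ℝ) ≤ j := by exact_mod_cast h
  linarith

theorem infinite_idx : Infinite (Idx N) := by
  obtain ⟨n, hn⟩ := exists_two_mul_abs (N := N)
  refine Infinite.of_injective (fun j : ℕ => mkIdx hn j 0 (by omega) 1) fun j j' h => ?_
  have h1 : (j : ℝ) + |N| = j' + |N| := congrArg lev h
  exact_mod_cast add_right_cancel h1

theorem tendsto_eigenvalue : Tendsto (eigenvalue N) cofinite atTop := by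
  obtain ⟨n, hn⟩ := exists_two_mul_abs (N := N)
  rw [tendsto_atTop]
  intro b
  obtain ⟨p, hp⟩ := exists_nat_ge b
  refine Set.Finite.subset (lowLevels hn p).finite_toSet fun i hi => ?_
  by_contra h
  have := le_eigenvalue_of_notMem hn h
  exact hi (by change b ≤ eigenvalue N i; linarith)

/-- For each `m` there is a unique `P` such that the `m`-th smallest eigenvalue is `P`. -/
theorem exists_level_bounds (n m : ℕ) : ∃ p : ℕ, 2 * p ^ 2 + 2 * n * p ≤ m ∧
    m + 1 ≤ 2 * (p + 1) ^ 2 + 2 * n * (p + 1) := by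
  have hex : ∃ P : ℕ, m < 2 * P ^ 2 + 2 * n * P := ⟨m + 1, by nlinarith⟩
  classical
  have h1 := Nat.find_spec hex
  have h2 : Nat.find hex ≠ 0 := by
    intro h0
    rw [h0] at h1
    simp at h1
  obtain ⟨p, hp⟩ := Nat.exists_eq_succ_of_ne_zero h2
  rw [hp] at h1
  have h3 := Nat.find_min hex (m := p) (by omega)
  exact ⟨p, by omega, h1⟩

end Levels

/-! ### Complex powers of `|D|` -/

section Powers

variable {N : ℝ}

theorem norm_eigenvalue_cpow (i : Idx N) (z : ℂ) :
    ‖(eigenvalue N i : ℂ) ^ (-z)‖ = eigenvalue N i ^ (-z.re) := by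
  rw [Complex.norm_cpow_eq_rpow_re_of_pos (by linarith [one_le_eigenvalue i]), Complex.neg_re]

theorem IsNegPow.apply {z : ℂ} {R : Spinors N →L[ℂ] Spinors N}
    (h : IsNegPow (diracAbs N) z R) (i : Idx N) :
    R (stdBasis _ i) = ((eigenvalue N i : ℂ) ^ (-z)) • stdBasis _ i := by
  refine h ⟨stdBasis _ i, stdBasis_mem_domain i⟩ (eigenvalue N i)
    (by linarith [one_le_eigenvalue i]) ?_
  exact weightedShift_stdBasis (fun _ => rfl) (fun _ => rfl) i

theorem exists_isNegPow {z : ℂ} (hz : 0 ≤ z.re) :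
    ∃ R : Spinors N →L[ℂ] Spinors N, IsNegPow (diracAbs N) z R ∧
      ∀ v i, R v i = (eigenvalue N i : ℂ) ^ (-z) * v i := by
  obtain ⟨R, hR⟩ := exists_diagonal (fun i : Idx N => (eigenvalue N i : ℂ) ^ (-z)) (C := 1)
    (fun i => by
      rw [norm_eigenvalue_cpow]
      exact Real.rpow_le_one_of_one_le_of_nonpos (one_le_eigenvalue i) (by linarith))
  refine ⟨R, fun v x hx hv => lp.ext (funext fun i => ?_), hR⟩
  rw [hR]
  have h1 : (eigenvalue N i : ℂ) * (v : Spinors N) i = x * (v : Spinors N) i :=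
    congrArg (fun u : Spinors N => u i) hv
  change _ = (x : ℂ) ^ (-z) * (v : Spinors N) i
  -- An eigenvector lives on the coordinates whose eigenvalue is `x`; elsewhere both sides vanish.
  by_cases h0 : (v : Spinors N) i = 0
  · rw [h0, mul_zero, mul_zero]
  · rw [mul_right_cancel₀ h0 h1]

theorem isNegPow_negPow {z : ℂ} (hz : 0 ≤ z.re) :
    IsNegPow (diracAbs N) z (negPow (diracAbs N) z) := by
  have h : ∃ R, IsNegPow (diracAbs N) z R := (exists_isNegPow hz).imp fun _ h => h.1
  rw [negPow, dif_pos h]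
  exact h.choose_spec

/-- `negPow` is chosen by its values on eigenvectors only; since the basis consists of eigenvectors,
it must be the diagonal operator. -/
theorem negPow_apply {z : ℂ} (hz : 0 ≤ z.re) (v : Spinors N) (i : Idx N) :
    negPow (diracAbs N) z v i = (eigenvalue N i : ℂ) ^ (-z) * v i := by
  obtain ⟨R, hR, hRa⟩ := exists_isNegPow (N := N) hz
  have : negPow (diracAbs N) z = R := clm_ext fun j => by
    rw [IsNegPow.apply (isNegPow_negPow hz), IsNegPow.apply hR]
  rw [this, hRa]

theorem zeta_eq_tsum (T : Spinors N →L[ℂ] Spinors N) {z : ℂ} (hz : 0 ≤ z.re) :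
    zeta (basis N) (diracAbs N) T z = ∑' i, ent T i i * (eigenvalue N i : ℂ) ^ (-z) := by
  refine tsum_congr fun i => ?_
  change ⟪stdBasis _ i, T (negPow (diracAbs N) z (stdBasis _ i))⟫_ℂ = _
  rw [IsNegPow.apply (isNegPow_negPow hz), map_smul, inner_smul_right, inner_stdBasis]
  exact mul_comm _ _

theorem norm_le_of_apply_le' (u v : Spinors N) {c : ℝ} (hc : 0 < c)
    (h : ∀ i, c * ‖v i‖ ≤ ‖u i‖) : c * ‖v‖ ≤ ‖u‖ := by
  have := norm_le_mul_of_apply_le v u (inv_nonneg.2 hc.le) fun i => by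
    rw [← div_eq_inv_mul, le_div_iff₀ hc, mul_comm]; exact h i
  rwa [← div_eq_inv_mul, le_div_iff₀ hc, mul_comm] at this

variable [hN : Fact (∃ k : ℤ, N = (k : ℝ) / 2)]

/-- When `m` is at least the number of labels below level `p`, a set of size `m` can remove them
all, and only eigenvalues from `p + 1` on remain. -/
theorem singularValue_mul_negPow_le {n : ℕ} (hn : 2 * |N| = n) (T : Spinors N →L[ℂ] Spinors N)
    {z : ℂ} (hz : 0 ≤ z.re) {p m : ℕ} (h : 2 * p ^ 2 + 2 * n * p ≤ m) :
    singularValue (T * negPow (diracAbs N) z) m ≤ ‖T‖ * ((p : ℝ) + 1) ^ (-z.re) := by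
  have := infinite_idx (N := N)
  rw [← card_lowLevels hn] at h
  obtain ⟨t, ht, rfl⟩ := Infinite.exists_superset_card_eq (lowLevels hn p) m h
  refine singularValue_le (by positivity) t fun v hv => ?_
  refine (T.le_opNorm _).trans ?_
  rw [mul_assoc]
  refine mul_le_mul_of_nonneg_left ?_ (norm_nonneg _)
  refine norm_le_mul_of_apply_le _ _ (by positivity) fun i => ?_
  refine (congrArg norm (negPow_apply hz v i)).trans_le ?_
  rw [norm_mul]
  by_cases hi : i ∈ t
  · rw [hv i hi]; simp
  · refine mul_le_mul_of_nonneg_right ?_ (norm_nonneg _)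
    rw [norm_eigenvalue_cpow]
    exact Real.rpow_le_rpow_of_nonpos (by positivity)
      (le_eigenvalue_of_notMem hn fun h' => hi (ht h')) (by linarith)

theorem le_singularValue_negPow {n : ℕ} (hn : 2 * |N| = n)
    {z : ℂ} (hz : 0 ≤ z.re) {p m : ℕ} (h : m + 1 ≤ 2 * (p + 1) ^ 2 + 2 * n * (p + 1)) :
    ((p : ℝ) + 1) ^ (-z.re) ≤ singularValue (negPow (diracAbs N) z) m := by
  have := infinite_idx (N := N)
  rw [← card_lowLevels hn] at h
  obtain ⟨t, ht, hc⟩ := Finset.exists_subset_card_eq h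
  refine le_singularValue t hc fun v hv => ?_
  refine norm_le_of_apply_le' _ _ (by positivity) fun i => ?_
  rw [negPow_apply hz, norm_mul]
  by_cases hi : i ∈ t
  · refine mul_le_mul_of_nonneg_right ?_ (norm_nonneg _)
    rw [norm_eigenvalue_cpow]
    have h2 := eigenvalue_le_of_mem hn (ht hi)
    push_cast at h2
    exact Real.rpow_le_rpow_of_nonpos (by linarith [one_le_eigenvalue i]) h2 (by linarith)
  · rw [hv i hi]; simp

/-- The level `p` of the `m`-th eigenvalue satisfies `m + 1 ≤ (2n + 2)(p + 1)²`, so the singular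
values are `O(m^(-Re z / 2))`, which is summable. -/
theorem isTraceClass_mul_negPow (T : Spinors N →L[ℂ] Spinors N) {z : ℂ} (hz : 2 < z.re) :
    IsTraceClass (T * negPow (diracAbs N) z) := by
  obtain ⟨n, hn⟩ := exists_two_mul_abs (N := N)
  have hs : Summable fun m : ℕ => ‖T‖ * ((2 * n + 2 : ℝ) ^ (z.re / 2)
      * (((m + 1 : ℕ) : ℝ) ^ (z.re / 2))⁻¹) := by
    refine ((Summable.mul_left _ ?_).mul_left _)
    exact (summable_nat_add_iff 1).2 (Real.summable_nat_rpow_inv.2 (by linarith))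
  refine Summable.of_nonneg_of_le (fun m => singularValue_nonneg _ m) (fun m => ?_) hs
  obtain ⟨p, hp1, hp2⟩ := exists_level_bounds n m
  refine (singularValue_mul_negPow_le hn T (by linarith) hp1).trans ?_
  refine mul_le_mul_of_nonneg_left ?_ (norm_nonneg _)
  have h1 : ((m + 1 : ℕ) : ℝ) ≤ (2 * n + 2) * ((p : ℝ) + 1) ^ 2 := by
    have h2 : ((m + 1 : ℕ) : ℝ) ≤ ((2 * (p + 1) ^ 2 + 2 * n * (p + 1) : ℕ) : ℝ) := by
      exact_mod_cast hp2
    push_cast at h2 ⊢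
    have h3 : (0 : ℝ) ≤ n * (p * (p + 1)) := by positivity
    nlinarith
  have h4 : ((p : ℝ) + 1) ^ (-z.re) = (((p : ℝ) + 1) ^ 2) ^ (-(z.re / 2)) := by
    rw [← Real.rpow_natCast, ← Real.rpow_mul (by positivity)]
    congr 1; push_cast; ring
  have h5 : (((m + 1 : ℕ) : ℝ) ^ (z.re / 2)) ≤
      (2 * n + 2 : ℝ) ^ (z.re / 2) * (((p : ℝ) + 1) ^ 2) ^ (z.re / 2) := by
    rw [← Real.mul_rpow (by positivity) (by positivity)]
    exact Real.rpow_le_rpow (by positivity) h1 (by linarith)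
  have h6 : 0 < ((m + 1 : ℕ) : ℝ) ^ (z.re / 2) := Real.rpow_pos_of_pos (by positivity) _
  have h7 : 0 < (((p : ℝ) + 1) ^ 2) ^ (z.re / 2) := Real.rpow_pos_of_pos (by positivity) _
  rw [h4, Real.rpow_neg (by positivity), ← div_eq_mul_inv, le_div_iff₀ h6, inv_mul_le_iff₀ h7,
    mul_comm]
  exact h5

/-! ### The metric dimension -/

/-- The singular value is exactly `P⁻²`, where `P` is the eigenvalue at position `m`, and `m + 1 =
2P² + O(P)` by the count of labels. The difference is thus `O(1 / (P(m + 1)))`, with `P` of the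
order of `√(m + 1)`. -/
theorem abs_singularValue_sub_le {n : ℕ} (hn : 2 * |N| = n) (m : ℕ) :
    |singularValue (negPow (diracAbs N) ((2 : ℝ) : ℂ)) m - 2 * ((m : ℝ) + 1)⁻¹|
      ≤ (2 * n + 4) * √(2 * n + 2) * ((((m + 1 : ℕ) : ℝ)) ^ (3 / 2 : ℝ))⁻¹ := by
  have hz : (0 : ℝ) ≤ (((2 : ℝ) : ℂ)).re := by simp
  obtain ⟨p, hp1, hp2⟩ := exists_level_bounds n m
  have hn0 : (0 : ℝ) ≤ n := n.cast_nonneg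
  have u1 := singularValue_mul_negPow_le hn 1 hz hp1
  have u2 := le_singularValue_negPow hn hz hp2
  rw [one_mul] at u1
  have hone : ‖(1 : Spinors N →L[ℂ] Spinors N)‖ ≤ 1 := ContinuousLinearMap.norm_id_le
  have h1 : (2 : ℝ) * p ^ 2 + 2 * n * p ≤ m := by exact_mod_cast hp1
  have h2 : (m : ℝ) + 1 ≤ 2 * (p + 1) ^ 2 + 2 * n * (p + 1) := by exact_mod_cast hp2
  have hp0 : (0 : ℝ) ≤ p := p.cast_nonneg
  set P : ℝ := (p : ℝ) + 1 with hP
  have hpP : (p : ℝ) = P - 1 := by rw [hP]; ring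
  have hP1 : 1 ≤ P := by linarith
  have hPpos : 0 < P := by linarith
  have hpow : P ^ (-(((2 : ℝ) : ℂ)).re) = (P ^ 2)⁻¹ := by
    rw [Complex.ofReal_re, Real.rpow_neg hPpos.le, Real.rpow_two]
  rw [hpow] at u1 u2
  have hsv : singularValue (negPow (diracAbs N) ((2 : ℝ) : ℂ)) m = (P ^ 2)⁻¹ := by
    refine le_antisymm (u1.trans ?_) u2
    exact (mul_le_mul_of_nonneg_right hone (by positivity)).trans (le_of_eq (one_mul _))
  set M : ℝ := (m : ℝ) + 1 with hM
  have hMpos : 0 < M := by positivity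
  have hcast : ((m + 1 : ℕ) : ℝ) = M := by push_cast; rfl
  have hM32 : M ^ (3 / 2 : ℝ) = M * √M := by
    rw [Real.sqrt_eq_rpow, ← Real.rpow_one_add' hMpos.le (by norm_num)]; norm_num
  have hw : 0 < √M := Real.sqrt_pos.2 hMpos
  have hwP : √M ≤ √(2 * n + 2) * P := by
    refine Real.sqrt_le_iff.2 ⟨by positivity, ?_⟩
    rw [mul_pow, Real.sq_sqrt (by positivity)]
    nlinarith [mul_nonneg hn0 (mul_nonneg hPpos.le (sub_nonneg.2 hP1))]
  rw [hpP] at h1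
  -- From `2(P - 1)² + 2n(P - 1) ≤ m` and `M ≤ 2P² + 2nP`; the loss is linear in `P`.
  have hdiff : |M - 2 * P ^ 2| ≤ (2 * n + 4) * P := by
    rw [abs_le]
    constructor
    · nlinarith
    · nlinarith
  rw [hsv, hcast, hM32]
  have e : (P ^ 2)⁻¹ - 2 * M⁻¹ = (M - 2 * P ^ 2) / (P ^ 2 * M) := by
    field_simp
  rw [e, abs_div, abs_of_pos (show 0 < P ^ 2 * M by positivity)]
  calc |M - 2 * P ^ 2| / (P ^ 2 * M) ≤ (2 * n + 4) * P / (P ^ 2 * M) := by gcongr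
    _ = (2 * n + 4) * (√M / (P * (M * √M))) := by field_simp
    _ ≤ (2 * n + 4) * (√(2 * n + 2) * P / (P * (M * √M))) := by gcongr
    _ = (2 * n + 4) * √(2 * n + 2) * (M * √M)⁻¹ := by field_simp

/-- The singular values differ from `2 / (m + 1)` by a summable sequence, so their partial sums are
`2 log n + O(1)` and the Dixmier trace is `2`. -/
theorem isMetricDim_two : IsMetricDim (diracAbs N) 2 := by
  obtain ⟨n, hn⟩ := exists_two_mul_abs (N := N)
  set μ := singularValue (negPow (diracAbs N) ((2 : ℝ) : ℂ)) with hμ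
  have hb := abs_singularValue_sub_le (N := N) hn
  set K : ℝ := (2 * n + 4) * √(2 * n + 2) with hK
  have hK0 : 0 ≤ K := by positivity
  refine ⟨two_pos, 2, two_pos, ?_, ?_⟩
  · refine Asymptotics.IsBigO.of_bound (2 + K) (Eventually.of_forall fun m => ?_)
    have hM : (0 : ℝ) < (m : ℝ) + 1 := by positivity
    have h1 : (((m + 1 : ℕ) : ℝ) ^ (3 / 2 : ℝ))⁻¹ ≤ ((m : ℝ) + 1)⁻¹ := by
      refine inv_anti₀ hM ?_
      have h2 : (1 : ℝ) ≤ (m + 1 : ℕ) := by exact_mod_cast Nat.succ_pos m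
      calc ((m : ℝ) + 1) = ((m + 1 : ℕ) : ℝ) ^ (1 : ℝ) := by rw [Real.rpow_one]; push_cast; rfl
        _ ≤ _ := Real.rpow_le_rpow_of_exponent_le h2 (by norm_num)
    have h3 := abs_le.1 (hb m)
    have h4 := singularValue_nonneg (negPow (diracAbs N) ((2 : ℝ) : ℂ)) m
    rw [Real.norm_of_nonneg h4, one_div, Real.norm_of_nonneg (by positivity), add_mul]
    have h5 := mul_le_mul_of_nonneg_left h1 hK0
    linarith [h3.2]
  · have hs : Summable fun m : ℕ => μ m - 2 * ((m : ℝ) + 1)⁻¹ := by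
      refine Summable.of_norm_bounded
        (((summable_nat_add_iff 1).2 (Real.summable_nat_rpow_inv.2
          (by norm_num : (1 : ℝ) < 3 / 2))).mul_left K) fun m => ?_
      rw [Real.norm_eq_abs]
      exact hb m
    have t1 := hs.hasSum.tendsto_sum_nat
    have t2 := Real.tendsto_harmonic_sub_log
    have tlog : Tendsto (fun n : ℕ => Real.log n) atTop atTop :=
      Real.tendsto_log_atTop.comp tendsto_natCast_atTop_atTop
    -- The partial sums minus `2 log n` converge, so after division by `log n` they vanish in the
    -- limit.
    have t3 := (t1.add (t2.const_mul 2)).div_atTop tlog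
    have t4 := t3.add_const 2
    rw [zero_add] at t4
    refine t4.congr' ?_
    filter_upwards [tlog.eventually_gt_atTop 0] with k hk
    have e : ∑ i ∈ Finset.range k, (μ i - 2 * ((i : ℝ) + 1)⁻¹)
        = ∑ i ∈ Finset.range k, μ i - 2 * (harmonic k : ℝ) := by
      rw [Finset.sum_sub_distrib, ← Finset.mul_sum, harmonic]
      push_cast
      rfl
    rw [e]
    field_simp
    ring

end Powers

end Podles

end

/-! ### Zeta functions from traces over the eigenspaces of `|D|` -/

noncomputable section

namespace Podles

open SpecTriple

/-! ### Traces of operators with a symbol -/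

section RowSums

variable {N : ℝ} [hN : Fact (∃ k : ℤ, N = (k : ℝ) / 2)]

theorem shift_stdBasis {a b : ℝ} {i i₁ : Idx N} (h1 : lev i₁ = lev i + a) (h2 : mag i₁ = mag i + b)
    (h3 : i₁.2 = i.2) : shift N a b (stdBasis _ i) = stdBasis _ i₁ := by
  classical
  refine lp.ext (funext fun x => ?_)
  change ent (shift N a b) x i = _
  rw [ent_shift]
  by_cases hx : x = i₁
  · rw [hx, if_pos ⟨h1, h2, h3⟩, stdBasis_apply_self]
  · rw [stdBasis_apply_ne hx, if_neg]
    rintro ⟨g1, g2, g3⟩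
    exact hx (idx_ext (g1.trans h1.symm) (g2.trans h2.symm) (g3.trans h3.symm))

theorem shift_apply {a b : ℝ} {i i₁ : Idx N} (h1 : lev i₁ = lev i + a) (h2 : mag i₁ = mag i + b)
    (h3 : i₁.2 = i.2) (v : Spinors N) : shift N a b v i₁ = v i := by
  classical
  rw [apply_eq_sum (shift N a b) i₁ {i}, Finset.sum_singleton, ent_shift, if_pos ⟨h1, h2, h3⟩,
    one_mul]
  intro x hx
  rw [ent_shift, if_neg]
  rintro ⟨g1, g2, g3⟩
  refine hx (Finset.mem_singleton.2 (idx_ext ?_ ?_ ?_))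
  · linarith
  · linarith
  · rw [← g3, h3]

/-- This is how the symbol conditions reach traces: a commutator with a shift records how the
diagonal entries vary along it. -/
theorem ent_commutator_shift (T : Spinors N →L[ℂ] Spinors N) {a b : ℝ} {i i₁ : Idx N}
    (h1 : lev i₁ = lev i + a) (h2 : mag i₁ = mag i + b) (h3 : i₁.2 = i.2) :
    ent (T * shift N a b - shift N a b * T) i₁ i = ent T i₁ i₁ - ent T i i := by
  rw [ent_sub]
  congr 1
  · change T (shift N a b (stdBasis _ i)) i₁ = _
    rw [shift_stdBasis h1 h2 h3]; rfl
  · exact shift_apply h1 h2 h3 _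

variable {n : ℕ} (hn : 2 * |N| = n)

/-- The trace of `T` over the eigenspace of `|D|` for the eigenvalue `j + 1`. -/
def rowSum (T : Spinors N →L[ℂ] Spinors N) (j : ℕ) : ℂ :=
  ∑ x : Fin (2 * j + n + 1) × ℤˣ, ent T (levelEquiv hn ⟨j, x⟩) (levelEquiv hn ⟨j, x⟩)

theorem rowSum_one (j : ℕ) :
    rowSum hn (1 : Spinors N →L[ℂ] Spinors N) j = 4 * (j + 1) + (2 * n - 2) := by
  simp only [rowSum, ent_one_self, Finset.sum_const, Finset.card_univ, Fintype.card_prod,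
    Fintype.card_fin, Fintype.card_units_int, nsmul_eq_mul]
  push_cast
  ring

/-- The diagonal entries, summed over the two signs, as a double sequence indexed by the level `j`
and `k = l + m`, padded by `0` outside the range. -/
theorem exists_rowSum_eq (T : Spinors N →L[ℂ] Spinors N) : ∃ t : ℕ → ℕ → ℂ,
    (∀ j, rowSum hn T j = ∑ k ∈ Finset.range (2 * j + n + 1), t j k) ∧
    ∀ j k (h : k < 2 * j + n + 1),
      t j k = ent T (mkIdx hn j k h 1) (mkIdx hn j k h 1)
        + ent T (mkIdx hn j k h (-1)) (mkIdx hn j k h (-1)) := by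
  refine ⟨fun j k => if h : k < 2 * j + n + 1 then
      ent T (mkIdx hn j k h 1) (mkIdx hn j k h 1)
        + ent T (mkIdx hn j k h (-1)) (mkIdx hn j k h (-1)) else 0, fun j => ?_, fun j k h => ?_⟩
  · rw [Finset.sum_range, rowSum, Fintype.sum_prod_type]
    refine Finset.sum_congr rfl fun k _ => ?_
    refine Eq.trans ?_ (dif_pos k.2).symm
    have : (Finset.univ : Finset ℤˣ) = {1, -1} := rfl
    rw [this, Finset.sum_pair (by decide)]
    rfl
  · exact dif_pos h

/-- The shift by `(1, -1)` moves to the next level at fixed `k = l + m`, and the shift by `(0, 1)`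
raises `k` within a level; these give the two hypotheses of `exists_affine_asymptotics`. -/
theorem HasSymbol.exists_rowSum {T : Spinors N →L[ℂ] Spinors N} (hT : HasSymbol T) :
    ∃ (a b : ℂ) (C ρ : ℝ), 0 ≤ C ∧ 0 < ρ ∧ ρ < 1 ∧
      ∀ j : ℕ, ‖rowSum hn T j - (a * (j + 1) + b)‖ ≤ C * ρ ^ j := by
  obtain ⟨t, ht1, ht2⟩ := exists_rowSum_eq hn T
  obtain ⟨C, r, hC, hr0, hr1, hb⟩ := hT.decay_lev
  obtain ⟨C', r', hC', hr0', hr1', hb'⟩ := hT.decay_add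
  set ρ := max r r' with hρ
  have hρ0 : 0 < ρ := lt_max_of_lt_left hr0
  have hρ1 : ρ < 1 := max_lt hr1 hr1'
  have hB : 0 ≤ 2 * max C C' := by positivity
  obtain ⟨a, b, K, σ, h⟩ := exists_affine_asymptotics n t hB hρ0 hρ1
    (fun j k hk => by
      have hk1 : k < 2 * j + n + 1 := by omega
      have hk2 : k < 2 * (j + 1) + n + 1 := by omega
      rw [ht2 j k hk1, ht2 (j + 1) k hk2, add_sub_add_comm]
      have key : ∀ ε, ‖ent T (mkIdx hn (j + 1) k hk2 ε) (mkIdx hn (j + 1) k hk2 ε)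
          - ent T (mkIdx hn j k hk1 ε) (mkIdx hn j k hk1 ε)‖ ≤ max C C' * ρ ^ j := by
        intro ε
        rw [← ent_commutator_shift T (a := 1) (b := -1) (i := mkIdx hn j k hk1 ε)
          (i₁ := mkIdx hn (j + 1) k hk2 ε)
          (by rw [lev_mkIdx, lev_mkIdx]; push_cast; ring)
          (by rw [mag_mkIdx, mag_mkIdx]; push_cast; ring) rfl]
        refine (hb _ _).trans ?_
        have h1 : r ^ lev (mkIdx hn j k hk1 ε) ≤ ρ ^ j := by
          rw [← Real.rpow_natCast]
          refine (Real.rpow_le_rpow hr0.le (le_max_left r r') (lev_nonneg _)).trans ?_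
          refine Real.rpow_le_rpow_of_exponent_ge hρ0 hρ1.le ?_
          rw [lev_mkIdx]; linarith [abs_nonneg N]
        exact mul_le_mul (le_max_left _ _) h1 (by positivity) (by positivity)
      refine (norm_add_le _ _).trans ((add_le_add (key 1) (key (-1))).trans (le_of_eq (by ring))))
    (fun j k hk => by
      have hk1 : k < 2 * j + n + 1 := by omega
      have hk2 : k + 1 < 2 * j + n + 1 := by omega
      rw [ht2 j k hk1, ht2 j (k + 1) hk2, add_sub_add_comm]
      have key : ∀ ε, ‖ent T (mkIdx hn j (k + 1) hk2 ε) (mkIdx hn j (k + 1) hk2 ε)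
          - ent T (mkIdx hn j k hk1 ε) (mkIdx hn j k hk1 ε)‖ ≤ max C C' * ρ ^ k := by
        intro ε
        rw [← ent_commutator_shift T (a := 0) (b := 1) (i := mkIdx hn j k hk1 ε)
          (i₁ := mkIdx hn j (k + 1) hk2 ε)
          (by rw [lev_mkIdx, lev_mkIdx]; ring)
          (by rw [mag_mkIdx, mag_mkIdx]; push_cast; ring) rfl]
        refine (hb' _ _).trans ?_
        have h1 : r' ^ (lev (mkIdx hn j k hk1 ε) + mag (mkIdx hn j k hk1 ε)) ≤ ρ ^ k := by
          rw [lev_mkIdx, mag_mkIdx, show (j : ℝ) + |N| + (k - j - |N|) = k by ring,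
            Real.rpow_natCast]
          exact pow_le_pow_left₀ hr0'.le (le_max_right r r') k
        exact mul_le_mul (le_max_right _ _) h1 (by positivity) (by positivity)
      refine (norm_add_le _ _).trans ((add_le_add (key 1) (key (-1))).trans (le_of_eq (by ring))))
  refine ⟨a, b, K, σ, h.1, h.2.1, h.2.2.1, fun j => ?_⟩
  rw [ht1]
  exact h.2.2.2 j

theorem summable_eigenvalue_rpow {x : ℝ} (hx : 2 < x) :
    Summable fun i : Idx N => eigenvalue N i ^ (-x) := by
  obtain ⟨n, hn⟩ := exists_two_mul_abs (N := N)
  rw [← (levelEquiv hn).summable_iff, summable_sigma_of_nonneg]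
  · refine ⟨fun j => Summable.of_finite, ?_⟩
    simp_rw [tsum_fintype, Function.comp_apply, eigenvalue_levelEquiv, Finset.sum_const,
      Finset.card_univ, Fintype.card_prod, Fintype.card_fin, Fintype.card_units_int, nsmul_eq_mul]
    have hs := ((summable_nat_add_iff 1).2 (Real.summable_nat_rpow_inv.2
      (show 1 < x - 1 by linarith))).mul_left (2 * ((n : ℝ) + 2))
    refine Summable.of_nonneg_of_le (fun j => by positivity) (fun j => ?_) hs
    have hj : (0 : ℝ) < (j : ℝ) + 1 := by positivity
    have h1 : (((2 * j + n + 1) * 2 : ℕ) : ℝ) ≤ 2 * ((n : ℝ) + 2) * ((j : ℝ) + 1) := by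
      push_cast
      have : (0 : ℝ) ≤ n * j := by positivity
      nlinarith
    have h2 : ((((j + 1 : ℕ) : ℝ)) ^ (x - 1))⁻¹ = ((j : ℝ) + 1) * ((j : ℝ) + 1) ^ (-x) := by
      rw [← Real.rpow_neg (by positivity), ← Real.rpow_one_add' (by positivity) (by linarith)]
      push_cast
      congr 1; ring
    rw [h2, ← mul_assoc]
    exact mul_le_mul_of_nonneg_right h1 (by positivity)
  · intro i
    exact Real.rpow_nonneg (by linarith [one_le_eigenvalue ((levelEquiv hn) i)]) _

/-- Absolute convergence for `Re z > 2` permits grouping the trace by eigenvalues. -/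
theorem zeta_eq_tsum_rowSum (T : Spinors N →L[ℂ] Spinors N) {z : ℂ} (hz : 2 < z.re) :
    zeta (basis N) (diracAbs N) T z = ∑' j : ℕ, rowSum hn T j * ((j : ℂ) + 1) ^ (-z) := by
  have hs : Summable fun i : Idx N => ent T i i * (eigenvalue N i : ℂ) ^ (-z) := by
    refine Summable.of_norm_bounded ((summable_eigenvalue_rpow hz).mul_left ‖T‖) fun i => ?_
    rw [norm_mul, norm_eigenvalue_cpow]
    refine mul_le_mul_of_nonneg_right (norm_ent_le T i i) (Real.rpow_nonneg ?_ _)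
    linarith [one_le_eigenvalue i]
  rw [zeta_eq_tsum T (by linarith), ← (levelEquiv hn).tsum_eq]
  have hs' := (levelEquiv hn).summable_iff.2 hs
  refine (Summable.tsum_sigma' (fun j => Summable.of_finite) hs').trans (tsum_congr fun j => ?_)
  rw [tsum_fintype, rowSum, Finset.sum_mul]
  refine Finset.sum_congr rfl fun x _ => ?_
  change ent T _ _ * ((eigenvalue N (levelEquiv hn ⟨j, x⟩) : ℝ) : ℂ) ^ (-z) = _
  rw [eigenvalue_levelEquiv]
  push_cast
  rfl

theorem hasPoleExpansion_zeta {T : Spinors N →L[ℂ] Spinors N} {a b : ℂ} {C ρ : ℝ} (hC : 0 ≤ C)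
    (h0 : 0 < ρ) (h1 : ρ < 1) (h : ∀ j : ℕ, ‖rowSum hn T j - (a * (j + 1) + b)‖ ≤ C * ρ ^ j) :
    HasPoleExpansion (zeta (basis N) (diracAbs N) T) a b := by
  obtain ⟨g, hg, hZ⟩ := hasPoleExpansion_of_affine hC h0 h1 h
  exact ⟨g, hg, fun z hz => (zeta_eq_tsum_rowSum hn T hz).trans (hZ z hz)⟩

theorem HasSymbol.exists_hasPoleExpansion {T : Spinors N →L[ℂ] Spinors N} (hT : HasSymbol T) :
    ∃ a b, HasPoleExpansion (zeta (basis N) (diracAbs N) T) a b := by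
  obtain ⟨n, hn⟩ := exists_two_mul_abs (N := N)
  obtain ⟨a, b, C, ρ, hC, h0, h1, h⟩ := hT.exists_rowSum hn
  exact ⟨a, b, hasPoleExpansion_zeta hn hC h0 h1 h⟩

theorem exists_hasPoleExpansion_one :
    ∃ b, HasPoleExpansion (zeta (basis N) (diracAbs N) 1) 4 b := by
  obtain ⟨n, hn⟩ := exists_two_mul_abs (N := N)
  refine ⟨2 * n - 2, hasPoleExpansion_zeta hn (C := 0) (ρ := 1 / 2) le_rfl (by norm_num)
    (by norm_num) fun j => ?_⟩
  rw [rowSum_one]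
  simp

/-- Decay in `l + m` bounds the row sums by a geometric series, which forces `a = 0`. The terms with
`l + m = 0` keep them away from zero, which excludes `b = 0`. -/
theorem HasSymbol.exists_residue_ne_zero {T : Spinors N →L[ℂ] Spinors N} (hT : HasSymbol T)
    {C r c j₀ : ℝ} (hC : 0 ≤ C) (hr0 : 0 < r) (hr1 : r < 1) (hc : 0 < c)
    (hle : ∀ i, ‖ent T i i‖ ≤ C * r ^ (lev i + mag i)) (hnonneg : ∀ i, 0 ≤ (ent T i i).re)
    (hge : ∀ i, lev i + mag i = 0 → j₀ ≤ lev i → c ≤ (ent T i i).re) :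
    ∃ a b, b ≠ 0 ∧ HasPoleExpansion (zeta (basis N) (diracAbs N) T) a b := by
  obtain ⟨n, hn⟩ := exists_two_mul_abs (N := N)
  obtain ⟨t, ht1, ht2⟩ := exists_rowSum_eq hn T
  obtain ⟨a, b, K, ρ, hK, h0, h1, h⟩ := hT.exists_rowSum hn
  refine ⟨a, b, ?_, hasPoleExpansion_zeta hn hK h0 h1 h⟩
  have bound : ∀ j, ‖rowSum hn T j‖ ≤ 2 * C * (1 - r)⁻¹ := by
    intro j
    rw [ht1]
    refine (norm_sum_le _ _).trans ?_
    have h2 : ∀ k ∈ Finset.range (2 * j + n + 1), ‖t j k‖ ≤ 2 * C * r ^ k := by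
      intro k hk
      have hk' := Finset.mem_range.1 hk
      rw [ht2 j k hk']
      have key : ∀ ε, ‖ent T (mkIdx hn j k hk' ε) (mkIdx hn j k hk' ε)‖ ≤ C * r ^ k := by
        intro ε
        refine (hle _).trans (le_of_eq ?_)
        rw [lev_mkIdx, mag_mkIdx, show (j : ℝ) + |N| + (k - j - |N|) = k by ring,
          Real.rpow_natCast]
      exact (norm_add_le _ _).trans ((add_le_add (key 1) (key (-1))).trans (le_of_eq (by ring)))
    refine (Finset.sum_le_sum h2).trans ?_
    rw [← Finset.mul_sum]
    refine mul_le_mul_of_nonneg_left ?_ (by positivity)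
    rw [← tsum_geometric_of_lt_one hr0.le hr1]
    exact (summable_geometric_of_lt_one hr0.le hr1).sum_le_tsum _ fun k _ => by positivity
  have pow_le : ∀ j : ℕ, K * ρ ^ j ≤ K := fun j =>
    mul_le_of_le_one_right hK (pow_le_one₀ h0.le h1.le)
  -- Otherwise `a(j + 1)` would outgrow the bounded row sums.
  have ha : a = 0 := by
    by_contra ha
    have ha' : 0 < ‖a‖ := norm_pos_iff.2 ha
    obtain ⟨j, hj⟩ := exists_nat_gt ((2 * C * (1 - r)⁻¹ + K + ‖b‖) / ‖a‖)
    rw [div_lt_iff₀ ha'] at hj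
    have e : a * ((j : ℂ) + 1) = rowSum hn T j - b - (rowSum hn T j - (a * (j + 1) + b)) := by ring
    have h2 : ‖a‖ * ((j : ℝ) + 1) ≤ 2 * C * (1 - r)⁻¹ + ‖b‖ + K := by
      have h3 : ‖a * ((j : ℂ) + 1)‖ = ‖a‖ * ((j : ℝ) + 1) := by
        rw [norm_mul]
        congr 1
        have : ((j : ℂ) + 1) = ((j + 1 : ℕ) : ℂ) := by push_cast; rfl
        rw [this, Complex.norm_natCast]; push_cast; rfl
      rw [← h3, e]
      refine (norm_sub_le _ _).trans (add_le_add ((norm_sub_le _ _).trans ?_) ?_)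
      · exact add_le_add (bound j) le_rfl
      · exact (h j).trans (pow_le j)
    nlinarith
  rintro rfl
  have hlim : Tendsto (fun j : ℕ => K * ρ ^ j) atTop (𝓝 0) := by
    simpa using (tendsto_pow_atTop_nhds_zero_of_lt_one h0.le h1).const_mul K
  obtain ⟨j₁, hj₁⟩ := exists_nat_ge j₀
  obtain ⟨j, hj, hjj⟩ := ((hlim.eventually (gt_mem_nhds hc)).and (eventually_ge_atTop j₁)).exists
  have h2 := h j
  rw [ha, zero_mul, zero_add, sub_zero] at h2
  have h3 : c ≤ (rowSum hn T j).re := by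
    rw [rowSum, Complex.re_sum]
    have hj₀ : j₀ ≤ j := hj₁.trans (by exact_mod_cast hjj)
    -- A single entry, the one with `k = l + m = 0` and sign `1`, already bounds the sum of
    -- nonnegative terms from below.
    refine (hge (levelEquiv hn ⟨j, (0, 1)⟩) ?_ ?_).trans
      (Finset.single_le_sum (f := fun x => (ent T (levelEquiv hn ⟨j, x⟩)
        (levelEquiv hn ⟨j, x⟩)).re) (fun x _ => hnonneg _) (Finset.mem_univ (0, 1)))
    · rw [levelEquiv_apply, lev_mkIdx, mag_mkIdx]; simp
    · rw [levelEquiv_apply, lev_mkIdx]; linarith [abs_nonneg N]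
  have h4 := (Complex.re_le_norm _).trans h2
  linarith

end RowSums

/-! ### The dimension spectrum -/

section DimensionSpectrum

variable {N : ℝ} [hN : Fact (∃ k : ℤ, N = (k : ℝ) / 2)]

theorem hasSimplePoles_of_hasScalarSymbol {𝒜 : Type} [Ring 𝒜] [StarRing 𝒜] [Algebra ℂ 𝒜]
    {π : 𝒜 →⋆ₐ[ℂ] (Spinors N →L[ℂ] Spinors N)} (hπ : ∀ a, HasScalarSymbol (π a)) :
    HasSimplePoles (basis N) π (dirac N) (diracAbs N) 2 := by
  intro T hT f hf z hz
  obtain ⟨a, b, h⟩ := (hasSymbol_of_mem_psi0 hπ hT).exists_hasPoleExpansion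
  obtain ⟨f', hf', he, -, -, ho⟩ := h.exists_extension
  have e := meromorphicOrderAt_eq_of_eqOn hf.1 hf' (d := 2)
    (fun w hw => (hf.2 w hw).trans (he w hw).symm) z
  rw [e] at hz ⊢
  exact (ho z hz).2

theorem isDimensionSpectrum_of_hasScalarSymbol {𝒜 : Type} [Ring 𝒜] [StarRing 𝒜] [Algebra ℂ 𝒜]
    {π : 𝒜 →⋆ₐ[ℂ] (Spinors N →L[ℂ] Spinors N)} (hπ : ∀ a, HasScalarSymbol (π a))
    (hone : ∃ T ∈ Psi0 π (dirac N) (diracAbs N), ∃ a b, b ≠ 0 ∧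
      HasPoleExpansion (zeta (basis N) (diracAbs N) T) a b) :
    IsDimensionSpectrum (basis N) π (dirac N) (diracAbs N) 2 {1, 2} := by
  have hext : ∀ T ∈ Psi0 π (dirac N) (diracAbs N), ∃ a b,
      HasPoleExpansion (zeta (basis N) (diracAbs N) T) a b :=
    fun T hT => (hasSymbol_of_mem_psi0 hπ hT).exists_hasPoleExpansion
  refine ⟨fun T _ z hz => ⟨isNegPow_negPow (by linarith), isTraceClass_mul_negPow T hz⟩,
    fun T hT => ?_, fun T hT => ?_, Set.Countable.insert _ (Set.countable_singleton _), ?_⟩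
  · obtain ⟨a, b, h⟩ := hext T hT
    exact h.differentiableOn
  · obtain ⟨a, b, h⟩ := hext T hT
    obtain ⟨f, hf, he, -⟩ := h.exists_extension
    exact ⟨f, hf, he⟩
  · refine Set.Subset.antisymm ?_ ?_
    · rintro z (rfl | rfl)
      · obtain ⟨T, hT, a, b, hb, h⟩ := hone
        obtain ⟨f, hf, he, -, ho, -⟩ := h.exists_extension
        exact ⟨T, hT, f, ⟨hf, he⟩, by rw [ho hb]; decide⟩
      · obtain ⟨b, h⟩ := exists_hasPoleExpansion_one (N := N)
        obtain ⟨f, hf, he, ho, -⟩ := h.exists_extension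
        exact ⟨1, one_mem _, f, ⟨hf, he⟩, by rw [ho (by norm_num)]; decide⟩
    · rintro z ⟨T, hT, f, hf, hz⟩
      obtain ⟨a, b, h⟩ := hext T hT
      obtain ⟨f', hf', he, -, -, ho⟩ := h.exists_extension
      have e := meromorphicOrderAt_eq_of_eqOn hf.1 hf' (d := 2)
        (fun w hw => (hf.2 w hw).trans (he w hw).symm) z
      rw [e] at hz
      exact (ho z hz).1

end DimensionSpectrum

end Podles

end

/-! ### Tridiagonal operators and coefficient criteria for a symbol -/

noncomputable section

namespace Podles

/-! ### Basis vectors -/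

section Kets

variable {N : ℝ}

theorem ket_of_isLabel {l m : ℝ} (h : IsLabel N (l, m)) (ε : ℤˣ) :
    ket N l m ε = stdBasis (Idx N) (⟨(l, m), h⟩, ε) := dif_pos h

theorem ket_of_not_isLabel {l m : ℝ} (h : ¬ IsLabel N (l, m)) (ε : ℤˣ) : ket N l m ε = 0 :=
  dif_neg h

theorem stdBasis_eq_ket (i : Idx N) : stdBasis (Idx N) i = ket N (lev i) (mag i) i.2 :=
  (ket_of_isLabel i.1.2 i.2).symm

theorem isLabel_idx (i : Idx N) : IsLabel N (lev i, mag i) := i.1.2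

open Classical in
theorem ket_apply (l m : ℝ) (ε : ℤˣ) (i : Idx N) :
    ket N l m ε i = if lev i = l ∧ mag i = m ∧ i.2 = ε then 1 else 0 := by
  by_cases h : IsLabel N (l, m)
  · rw [ket_of_isLabel h]
    by_cases hi : i = (⟨(l, m), h⟩, ε)
    · rw [hi, stdBasis_apply_self, if_pos ⟨rfl, rfl, rfl⟩]
    · rw [stdBasis_apply_ne hi, if_neg]
      rintro ⟨h1, h2, h3⟩
      exact hi (idx_ext h1 h2 h3)
  · rw [ket_of_not_isLabel h, if_neg]
    · rfl
    · rintro ⟨rfl, rfl, -⟩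
      exact h (isLabel_idx i)

theorem norm_ket_apply_le (l m : ℝ) (ε : ℤˣ) (i : Idx N) : ‖ket N l m ε i‖ ≤ 1 := by
  rw [ket_apply]; split_ifs <;> simp

theorem norm_three_kets_le (c₁ c₂ c₃ : ℝ) (l₁ l₂ l₃ m₁ m₂ m₃ : ℝ) (ε : ℤˣ) (i : Idx N) :
    ‖((c₁ : ℂ) • ket N l₁ m₁ ε + (c₂ : ℂ) • ket N l₂ m₂ ε + (c₃ : ℂ) • ket N l₃ m₃ ε : Spinors N) i‖
      ≤ |c₁| + |c₂| + |c₃| := by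
  have key : ∀ (c l m : ℝ), ‖(c : ℂ) * ket N l m ε i‖ ≤ |c| := by
    intro c l m
    rw [norm_mul, Complex.norm_real, Real.norm_eq_abs]
    exact mul_le_of_le_one_right (abs_nonneg c) (norm_ket_apply_le l m ε i)
  change ‖(c₁ : ℂ) * ket N l₁ m₁ ε i + (c₂ : ℂ) * ket N l₂ m₂ ε i + (c₃ : ℂ) * ket N l₃ m₃ ε i‖ ≤ _
  exact norm_add₃_le.trans (add_le_add (add_le_add (key _ _ _) (key _ _ _)) (key _ _ _))

theorem op_ext_ket {T S : Spinors N →L[ℂ] Spinors N}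
    (h : ∀ l m ε, IsLabel N (l, m) → T (ket N l m ε) = S (ket N l m ε)) : T = S :=
  clm_ext fun i => by rw [stdBasis_eq_ket]; exact h _ _ _ (isLabel_idx i)

theorem flipOp_ket (l m : ℝ) (ε : ℤˣ) : flipOp N (ket N l m ε) = ket N l m (-ε) := by
  by_cases h : IsLabel N (l, m)
  · rw [ket_of_isLabel h, ket_of_isLabel h, flipOp_stdBasis]; rfl
  · rw [ket_of_not_isLabel h, ket_of_not_isLabel h, map_zero]

variable [hN : Fact (∃ k : ℤ, N = (k : ℝ) / 2)]

theorem shift_ket {a b l m : ℝ} (h : IsLabel N (l, m)) (ε : ℤˣ) :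
    shift N a b (ket N l m ε) = ket N (l + a) (m + b) ε := by
  classical
  refine lp.ext (funext fun i => ?_)
  rw [ket_apply, ket_of_isLabel h]
  exact ent_shift a b i _

end Kets

/-! ### Tridiagonal operators -/

section Tridiagonal

variable {N : ℝ}

/-- `T` maps `|l, m⟩` to a combination of `|l + 1, m + e⟩`, `|l, m + e⟩`, `|l - 1, m + e⟩`. -/
def IsTri (T : Spinors N →L[ℂ] Spinors N) (e : ℝ) (p z n : ℤˣ → ℝ → ℝ → ℝ) : Prop :=
  ∀ (l m : ℝ) (ε : ℤˣ), IsLabel N (l, m) → T (ket N l m ε) =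
    (p ε l m : ℂ) • ket N (l + 1) (m + e) ε + (z ε l m : ℂ) • ket N l (m + e) ε
      + (n ε l m : ℂ) • ket N (l - 1) (m + e) ε

/-- The coefficients of transitions to labels out of range vanish. -/
structure Vanishing (N e : ℝ) (p z n : ℤˣ → ℝ → ℝ → ℝ) : Prop where
  up : ∀ ε l m, IsLabel N (l, m) → ¬ IsLabel N (l + 1, m + e) → p ε l m = 0
  diag : ∀ ε l m, IsLabel N (l, m) → ¬ IsLabel N (l, m + e) → z ε l m = 0
  down : ∀ ε l m, IsLabel N (l, m) → ¬ IsLabel N (l - 1, m + e) → n ε l m = 0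

open Classical in
theorem IsTri.ent_eq {T : Spinors N →L[ℂ] Spinors N} {e : ℝ} {p z n : ℤˣ → ℝ → ℝ → ℝ}
    (h : IsTri T e p z n) (i' i : Idx N) : ent T i' i =
      if mag i' = mag i + e ∧ i'.2 = i.2 then
        if lev i' = lev i + 1 then (p i.2 (lev i) (mag i) : ℂ)
        else if lev i' = lev i then (z i.2 (lev i) (mag i) : ℂ)
        else if lev i' = lev i - 1 then (n i.2 (lev i) (mag i) : ℂ) else 0
      else 0 := by
  rw [ent, stdBasis_eq_ket, h _ _ _ (isLabel_idx i)]
  change (p i.2 (lev i) (mag i) : ℂ) * ket N (lev i + 1) (mag i + e) i.2 i'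
    + (z i.2 (lev i) (mag i) : ℂ) * ket N (lev i) (mag i + e) i.2 i'
    + (n i.2 (lev i) (mag i) : ℂ) * ket N (lev i - 1) (mag i + e) i.2 i' = _
  rw [ket_apply, ket_apply, ket_apply]
  by_cases hm : mag i' = mag i + e ∧ i'.2 = i.2
  · simp only [hm.1, hm.2, and_true, and_self, if_true]
    by_cases h1 : lev i' = lev i + 1
    · have h2 : lev i' ≠ lev i := by intro h2; linarith
      have h3 : lev i' ≠ lev i - 1 := by intro h3; linarith
      rw [if_pos h1, if_neg h2, if_neg h3, if_pos h1]; simp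
    · rw [if_neg h1, if_neg h1]
      by_cases h2 : lev i' = lev i
      · have h3 : lev i' ≠ lev i - 1 := by intro h3; linarith
        rw [if_pos h2, if_neg h3, if_pos h2]; simp
      · rw [if_neg h2, if_neg h2]
        by_cases h3 : lev i' = lev i - 1
        · rw [if_pos h3, if_pos h3]; simp
        · rw [if_neg h3, if_neg h3]; simp
  · rw [if_neg hm, if_neg fun h => hm h.2, if_neg fun h => hm h.2, if_neg fun h => hm h.2]; simp

theorem IsTri.fp {T : Spinors N →L[ℂ] Spinors N} {e : ℝ} {p z n : ℤˣ → ℝ → ℝ → ℝ} (he : |e| ≤ 1)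
    (h : IsTri T e p z n) : FP 1 T := by
  classical
  intro i' i hn
  rw [h.ent_eq]
  split_ifs with h1 h2 h3 h4
  · exact absurd ⟨by rw [h2]; simp, by rw [h1.1]; simpa using he⟩ hn
  · exact absurd ⟨by rw [h3]; simp, by rw [h1.1]; simpa using he⟩ hn
  · exact absurd ⟨by rw [h4]; simp, by rw [h1.1]; simpa using he⟩ hn
  · rfl
  · rfl

/-- The coefficients are real, so the adjoint is the transpose: raising coefficients become lowering
ones, read at the shifted label. -/
theorem IsTri.star_eq {T T' : Spinors N →L[ℂ] Spinors N} {e e' : ℝ}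
    {p z n p' z' n' : ℤˣ → ℝ → ℝ → ℝ} (he : e' = -e)
    (h : IsTri T e p z n) (h' : IsTri T' e' p' z' n')
    (hp : ∀ ε l m, IsLabel N (l, m) → p' ε l m = n ε (l + 1) (m + e'))
    (hz : ∀ ε l m, IsLabel N (l, m) → z' ε l m = z ε l (m + e'))
    (hn : ∀ ε l m, IsLabel N (l, m) → n' ε l m = p ε (l - 1) (m + e')) : star T = T' := by
  classical
  refine ent_ext fun i' i => ?_
  rw [ent_star, h.ent_eq, h'.ent_eq, hp _ _ _ (isLabel_idx i), hz _ _ _ (isLabel_idx i),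
    hn _ _ _ (isLabel_idx i)]
  by_cases hm : mag i' = mag i + e' ∧ i'.2 = i.2
  · have hm' : mag i = mag i' + e ∧ i.2 = i'.2 := ⟨by rw [hm.1, he]; ring, hm.2.symm⟩
    rw [if_pos hm, if_pos hm', ← hm.1, hm.2]
    by_cases h1 : lev i' = lev i + 1
    · have g1 : lev i ≠ lev i' + 1 := by intro h; linarith
      have g2 : lev i ≠ lev i' := by intro h; linarith
      have g3 : lev i = lev i' - 1 := by linarith
      rw [if_pos h1, if_neg g1, if_neg g2, if_pos g3, ← h1, Complex.conj_ofReal]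
    · rw [if_neg h1]
      by_cases h2 : lev i' = lev i
      · have g1 : lev i ≠ lev i' + 1 := by intro h; linarith
        rw [if_pos h2, if_neg g1, if_pos h2.symm, ← h2, Complex.conj_ofReal]
      · rw [if_neg h2]
        by_cases h3 : lev i' = lev i - 1
        · have g1 : lev i = lev i' + 1 := by linarith
          rw [if_pos h3, if_pos g1, ← h3, Complex.conj_ofReal]
        · have g1 : lev i ≠ lev i' + 1 := fun h => h3 (by linarith)
          have g3 : lev i ≠ lev i' - 1 := fun h => h1 (by linarith)
          rw [if_neg h3, if_neg g1, if_neg (Ne.symm h2), if_neg g3, map_zero]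
  · have hm' : ¬ (mag i = mag i' + e ∧ i.2 = i'.2) := fun h =>
      hm ⟨by rw [h.1, he]; ring, h.2.symm⟩
    rw [if_neg hm, if_neg hm', map_zero]

/-- The formula for `T` is only available at labels in range. If the prefactor vanishes elsewhere it
may be used everywhere, so products can be computed without boundary cases. -/
theorem IsTri.smul_ket {T : Spinors N →L[ℂ] Spinors N} {e : ℝ} {p z n : ℤˣ → ℝ → ℝ → ℝ}
    (h : IsTri T e p z n) {c l m : ℝ} {ε : ℤˣ} (hc : ¬ IsLabel N (l, m) → c = 0) :
    (c : ℂ) • T (ket N l m ε) = ((c * p ε l m : ℝ) : ℂ) • ket N (l + 1) (m + e) ε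
      + ((c * z ε l m : ℝ) : ℂ) • ket N l (m + e) ε
      + ((c * n ε l m : ℝ) : ℂ) • ket N (l - 1) (m + e) ε := by
  by_cases hl : IsLabel N (l, m)
  · rw [h _ _ _ hl, smul_add, smul_add, smul_smul, smul_smul, smul_smul]
    push_cast
    rfl
  · rw [hc hl]
    simp

/-- `T` shifts `l` by at most `2` and `m` by `e`. -/
def IsPenta (T : Spinors N →L[ℂ] Spinors N) (e : ℝ) (c₂ c₁ c₀ d₁ d₂ : ℤˣ → ℝ → ℝ → ℝ) : Prop :=
  ∀ (l m : ℝ) (ε : ℤˣ), IsLabel N (l, m) → T (ket N l m ε) =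
    (c₂ ε l m : ℂ) • ket N (l + 2) (m + e) ε + (c₁ ε l m : ℂ) • ket N (l + 1) (m + e) ε
      + (c₀ ε l m : ℂ) • ket N l (m + e) ε + (d₁ ε l m : ℂ) • ket N (l - 1) (m + e) ε
      + (d₂ ε l m : ℂ) • ket N (l - 2) (m + e) ε

theorem IsTri.isPenta {T : Spinors N →L[ℂ] Spinors N} {e : ℝ} {p z n : ℤˣ → ℝ → ℝ → ℝ}
    (h : IsTri T e p z n) : IsPenta T e (fun _ _ _ => 0) p z n (fun _ _ _ => 0) := by
  intro l m ε hl
  rw [h l m ε hl]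
  simp

theorem IsTri.mul {S T : Spinors N →L[ℂ] Spinors N} {e e' f : ℝ} {p z n p' z' n' : ℤˣ → ℝ → ℝ → ℝ}
    (hS : IsTri S e' p' z' n') (hT : IsTri T e p z n) (hv : Vanishing N e p z n)
    (hf : f = e + e') :
    IsPenta (S * T) f (fun ε l m => p ε l m * p' ε (l + 1) (m + e))
      (fun ε l m => p ε l m * z' ε (l + 1) (m + e) + z ε l m * p' ε l (m + e))
      (fun ε l m => p ε l m * n' ε (l + 1) (m + e) + z ε l m * z' ε l (m + e)
        + n ε l m * p' ε (l - 1) (m + e))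
      (fun ε l m => z ε l m * n' ε l (m + e) + n ε l m * z' ε (l - 1) (m + e))
      (fun ε l m => n ε l m * n' ε (l - 1) (m + e)) := by
  intro l m ε hl
  change S (T (ket N l m ε)) = _
  rw [hT l m ε hl, map_add, map_add, map_smul, map_smul, map_smul,
    hS.smul_ket (hv.up ε l m hl), hS.smul_ket (hv.diag ε l m hl), hS.smul_ket (hv.down ε l m hl),
    show l + 1 + 1 = l + 2 by ring, show l - 1 - 1 = l - 2 by ring, add_sub_cancel_right,
    sub_add_cancel, show m + e + e' = m + f by rw [hf]; ring]
  push_cast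
  module

theorem IsPenta.add {S T : Spinors N →L[ℂ] Spinors N} {e : ℝ}
    {c₂ c₁ c₀ d₁ d₂ c₂' c₁' c₀' d₁' d₂' : ℤˣ → ℝ → ℝ → ℝ}
    (hS : IsPenta S e c₂ c₁ c₀ d₁ d₂) (hT : IsPenta T e c₂' c₁' c₀' d₁' d₂') :
    IsPenta (S + T) e (c₂ + c₂') (c₁ + c₁') (c₀ + c₀') (d₁ + d₁') (d₂ + d₂') := by
  intro l m ε hl
  change S (ket N l m ε) + T (ket N l m ε) = _
  rw [hS l m ε hl, hT l m ε hl]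
  simp only [Pi.add_apply]
  push_cast
  module

theorem IsPenta.smul {T : Spinors N →L[ℂ] Spinors N} {e : ℝ}
    {c₂ c₁ c₀ d₁ d₂ : ℤˣ → ℝ → ℝ → ℝ} (a : ℝ) (hT : IsPenta T e c₂ c₁ c₀ d₁ d₂) :
    IsPenta ((a : ℂ) • T) e (a • c₂) (a • c₁) (a • c₀) (a • d₁) (a • d₂) := by
  intro l m ε hl
  change (a : ℂ) • T (ket N l m ε) = _
  rw [hT l m ε hl]
  simp only [Pi.smul_apply, smul_eq_mul]
  push_cast
  module

theorem isPenta_one : IsPenta (1 : Spinors N →L[ℂ] Spinors N) 0 0 0 1 0 0 := by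
  intro l m ε _
  simp

/-- A coefficient matters only when its target is in range, so the scalar identities may assume both
labels valid. -/
theorem IsPenta.eq_zero {T : Spinors N →L[ℂ] Spinors N} {e : ℝ}
    {c₂ c₁ c₀ d₁ d₂ : ℤˣ → ℝ → ℝ → ℝ} (hT : IsPenta T e c₂ c₁ c₀ d₁ d₂)
    (h2 : ∀ ε l m, IsLabel N (l, m) → IsLabel N (l + 2, m + e) → c₂ ε l m = 0)
    (h1 : ∀ ε l m, IsLabel N (l, m) → IsLabel N (l + 1, m + e) → c₁ ε l m = 0)
    (h0 : ∀ ε l m, IsLabel N (l, m) → IsLabel N (l, m + e) → c₀ ε l m = 0)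
    (g1 : ∀ ε l m, IsLabel N (l, m) → IsLabel N (l - 1, m + e) → d₁ ε l m = 0)
    (g2 : ∀ ε l m, IsLabel N (l, m) → IsLabel N (l - 2, m + e) → d₂ ε l m = 0) : T = 0 := by
  refine op_ext_ket fun l m ε hl => ?_
  have key : ∀ (c l' m' : ℝ), (IsLabel N (l', m') → c = 0) → (c : ℂ) • ket N l' m' ε = 0 := by
    intro c l' m' h
    by_cases hl' : IsLabel N (l', m')
    · rw [h hl']; simp
    · rw [ket_of_not_isLabel hl', smul_zero]
  rw [hT l m ε hl, key _ _ _ (h2 ε l m hl), key _ _ _ (h1 ε l m hl), key _ _ _ (h0 ε l m hl),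
    key _ _ _ (g1 ε l m hl), key _ _ _ (g2 ε l m hl)]
  simp

/-! ### Coefficients with a symbol -/

/-- The coefficient `c` is, up to an error `O(q^l)`, a function of `l + m` alone, which converges
to `cinf` with rate `q^(l + m)`. -/
def SymCoef (N q : ℝ) (c : ℤˣ → ℝ → ℝ → ℝ) (cinf : ℝ) : Prop :=
  ∃ (f : ℝ → ℝ) (C : ℝ), 0 ≤ C ∧ ∀ ε l m, IsLabel N (l, m) →
    |c ε l m - f (l + m)| ≤ C * q ^ l ∧ |f (l + m) - cinf| ≤ C * q ^ (l + m)

theorem label_ineqs {l m : ℝ} (h : IsLabel N (l, m)) :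
    |N| ≤ l ∧ 0 ≤ l ∧ 0 ≤ l + m ∧ 0 ≤ l - m := by
  let i : Idx N := (⟨(l, m), h⟩, 1)
  exact ⟨abs_le_lev i, lev_nonneg i, lev_add_mag_nonneg i, lev_sub_mag_nonneg i⟩

theorem Decay.of_op_ket {w : ℝ → ℝ → ℝ} {T : Spinors N →L[ℂ] Spinors N} {C r : ℝ} (hC : 0 ≤ C)
    (h0 : 0 < r) (h1 : r < 1)
    (h : ∀ l m ε, IsLabel N (l, m) → ∀ i', ‖T (ket N l m ε) i'‖ ≤ C * r ^ w l m) :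
    Decay (fun i : Idx N => w (lev i) (mag i)) T :=
  ⟨C, r, hC, h0, h1, fun i' i => by
    rw [ent, stdBasis_eq_ket]
    exact h _ _ _ (isLabel_idx i) i'⟩

/-- The approximating function in `SymCoef` does not depend on the sign, so the two summands agree
up to `O(q^l)`. -/
theorem SymCoef.sub_flip {q : ℝ} {c : ℤˣ → ℝ → ℝ → ℝ} {cinf : ℝ}
    (h : SymCoef N q c cinf) : ∃ C, 0 ≤ C ∧ ∀ ε l m, IsLabel N (l, m) →
      |c (-ε) l m - c ε l m| ≤ C * q ^ l := by
  obtain ⟨f, C, hC, hb⟩ := h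
  refine ⟨2 * C, by positivity, fun ε l m hl => ?_⟩
  have h1 := (hb ε l m hl).1
  have h2 := (hb (-ε) l m hl).1
  have := abs_sub_le (c (-ε) l m) (f (l + m)) (c ε l m)
  rw [abs_sub_comm (f (l + m))] at this
  linarith

/-- A coefficient in front of a vanishing vector may be replaced by `0`, so a bound is needed only
where the target exists. -/
theorem smul_ket_of_or {c B l m : ℝ} {ε : ℤˣ} (hB : 0 ≤ B)
    (h : |c| ≤ B ∨ ∀ ε', ket N l m ε' = 0) :
    ∃ c' : ℝ, |c'| ≤ B ∧ (c : ℂ) • ket N l m ε = (c' : ℂ) • ket N l m ε := by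
  rcases h with h | h
  · exact ⟨c, h, rfl⟩
  · exact ⟨0, by simpa using hB, by simp [h]⟩

/-- Both error terms of `SymCoef` are controlled by one rate in `l + m`, because `(l + m) / 2 ≤ l`.
-/
theorem rpow_le_sqrt_rpow {q : ℝ} (hq0 : 0 < q) (hq1 : q < 1) {l m : ℝ} (hl : IsLabel N (l, m)) :
    q ^ l ≤ √q ^ (l + m) ∧ q ^ (l + m) ≤ √q ^ (l + m) := by
  obtain ⟨-, i1, i2, i3⟩ := label_ineqs hl
  rw [Real.sqrt_eq_rpow, ← Real.rpow_mul hq0.le]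
  exact ⟨Real.rpow_le_rpow_of_exponent_ge hq0 hq1.le (by linarith),
    Real.rpow_le_rpow_of_exponent_ge hq0 hq1.le (by linarith)⟩

theorem SymCoef.bounded {q : ℝ} (hq0 : 0 < q) (hq1 : q < 1) {c : ℤˣ → ℝ → ℝ → ℝ} {cinf : ℝ}
    (h : SymCoef N q c cinf) : ∃ C, ∀ ε l m, IsLabel N (l, m) → |c ε l m| ≤ C := by
  obtain ⟨f, C, hC, hb⟩ := h
  refine ⟨C + C + |cinf|, fun ε l m hl => ?_⟩
  obtain ⟨h1, h2⟩ := hb ε l m hl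
  obtain ⟨-, i1, i2, -⟩ := label_ineqs hl
  have e1 : C * q ^ l ≤ C := mul_le_of_le_one_right hC (Real.rpow_le_one hq0.le hq1.le i1)
  have e2 : C * q ^ (l + m) ≤ C := mul_le_of_le_one_right hC (Real.rpow_le_one hq0.le hq1.le i2)
  have : c ε l m = (c ε l m - f (l + m)) + (f (l + m) - cinf) + cinf := by ring
  rw [this]
  exact (abs_add_three _ _ _).trans (by linarith)

theorem SymCoef.abs_le_of_zero {q : ℝ} (hq0 : 0 < q) (hq1 : q < 1) {c : ℤˣ → ℝ → ℝ → ℝ}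
    (h : SymCoef N q c 0) : ∃ C, 0 ≤ C ∧ ∀ ε l m, IsLabel N (l, m) →
      |c ε l m| ≤ C * √q ^ (l + m) := by
  obtain ⟨f, C, hC, hb⟩ := h
  refine ⟨2 * C, by positivity, fun ε l m hl => ?_⟩
  obtain ⟨h1, h2⟩ := hb ε l m hl
  obtain ⟨e1, e2⟩ := rpow_le_sqrt_rpow hq0 hq1 hl
  have e4 := mul_le_mul_of_nonneg_left e1 hC
  have e5 := mul_le_mul_of_nonneg_left e2 hC
  rw [abs_le] at h1 h2 ⊢
  constructor <;> linarith

theorem ket_eq_zero_of_lt {l m : ℝ} (ε : ℤˣ) (h : l - m < 0) : ket N l m ε = 0 :=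
  ket_of_not_isLabel (fun hl => absurd (label_ineqs hl).2.2.2 (not_le.2 h)) ε

theorem IsTri.decay_flip {q : ℝ} {T : Spinors N →L[ℂ] Spinors N} {e : ℝ}
    {p z n : ℤˣ → ℝ → ℝ → ℝ} {P Z Q : ℝ} (hq0 : 0 < q) (hq1 : q < 1) (h : IsTri T e p z n)
    (hp : SymCoef N q p P) (hz : SymCoef N q z Z) (hn : SymCoef N q n Q) :
    Decay lev (T * flipOp N - flipOp N * T) := by
  obtain ⟨C₁, hC₁, b₁⟩ := hp.sub_flip
  obtain ⟨C₂, hC₂, b₂⟩ := hz.sub_flip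
  obtain ⟨C₃, hC₃, b₃⟩ := hn.sub_flip
  refine Decay.of_op_ket (w := fun l _ => l) (C := C₁ + C₂ + C₃) (by positivity) hq0 hq1
    fun l m ε hl i' => ?_
  have e1 : (T * flipOp N - flipOp N * T) (ket N l m ε)
      = ((p (-ε) l m - p ε l m : ℝ) : ℂ) • ket N (l + 1) (m + e) (-ε)
        + ((z (-ε) l m - z ε l m : ℝ) : ℂ) • ket N l (m + e) (-ε)
        + ((n (-ε) l m - n ε l m : ℝ) : ℂ) • ket N (l - 1) (m + e) (-ε) := by
    change T (flipOp N (ket N l m ε)) - flipOp N (T (ket N l m ε)) = _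
    rw [flipOp_ket, h _ _ _ hl, h _ _ _ hl, map_add, map_add, map_smul, map_smul, map_smul,
      flipOp_ket, flipOp_ket, flipOp_ket]
    push_cast
    module
  rw [e1]
  refine (norm_three_kets_le _ _ _ _ _ _ _ _ _ _ _).trans ?_
  have := b₁ ε l m hl
  have := b₂ ε l m hl
  have := b₃ ε l m hl
  linarith

theorem SymCoef.sub_Y {q : ℝ} (hq0 : 0 < q) (hq1 : q < 1) {c : ℤˣ → ℝ → ℝ → ℝ} {cinf : ℝ}
    (h : SymCoef N q c cinf) : ∃ C, 0 ≤ C ∧ ∀ ε l m, IsLabel N (l, m) → IsLabel N (l, m + 1) →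
      |c ε l (m + 1) - c ε l m| ≤ C * √q ^ (l + m) := by
  obtain ⟨f, C, hC, hb⟩ := h
  refine ⟨4 * C, by positivity, fun ε l m hl hl' => ?_⟩
  obtain ⟨h1, h2⟩ := hb ε l m hl
  obtain ⟨h3, h4⟩ := hb ε l (m + 1) hl'
  obtain ⟨e1, e2⟩ := rpow_le_sqrt_rpow hq0 hq1 hl
  have e3 : C * q ^ (l + (m + 1)) ≤ C * q ^ (l + m) := mul_le_mul_of_nonneg_left
    (Real.rpow_le_rpow_of_exponent_ge hq0 hq1.le (by linarith)) hC
  have e4 := mul_le_mul_of_nonneg_left e1 hC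
  have e5 := mul_le_mul_of_nonneg_left e2 hC
  rw [abs_le] at h1 h2 h3 h4 ⊢
  constructor <;> linarith

variable [hN : Fact (∃ k : ℤ, N = (k : ℝ) / 2)]

theorem exists_isTri {e : ℝ} {p z n : ℤˣ → ℝ → ℝ → ℝ} (he : |e| ≤ 1) {C : ℝ}
    (hp : ∀ ε l m, IsLabel N (l, m) → |p ε l m| ≤ C)
    (hz : ∀ ε l m, IsLabel N (l, m) → |z ε l m| ≤ C)
    (hn : ∀ ε l m, IsLabel N (l, m) → |n ε l m| ≤ C) :
    ∃ T : Spinors N →L[ℂ] Spinors N, IsTri T e p z n := by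
  classical
  let K : Idx N → Idx N → ℂ := fun i' i =>
      (p i.2 (lev i) (mag i) : ℂ) * ket N (lev i + 1) (mag i + e) i.2 i'
      + (z i.2 (lev i) (mag i) : ℂ) * ket N (lev i) (mag i + e) i.2 i'
      + (n i.2 (lev i) (mag i) : ℂ) * ket N (lev i - 1) (mag i + e) i.2 i'
  obtain ⟨T, hT⟩ := exists_op_of_band (d := 1) (K := K) (C := C + C + C) (fun i' i => by
    refine (norm_three_kets_le _ _ _ _ _ _ _ _ _ _ _).trans ?_
    exact add_le_add (add_le_add (hp _ _ _ (isLabel_idx i)) (hz _ _ _ (isLabel_idx i)))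
      (hn _ _ _ (isLabel_idx i))) (fun i' i hn' => by
    simp only [K, ket_apply]
    rw [if_neg, if_neg, if_neg]
    · simp
    · rintro ⟨h1, h2, -⟩
      exact hn' ⟨by rw [h1]; simp, by rw [h2]; simpa using he⟩
    · rintro ⟨h1, h2, -⟩
      exact hn' ⟨by rw [h1]; simp, by rw [h2]; simpa using he⟩
    · rintro ⟨h1, h2, -⟩
      exact hn' ⟨by rw [h1]; simp, by rw [h2]; simpa using he⟩)
  refine ⟨T, fun l m ε hl => lp.ext (funext fun i' => ?_)⟩
  rw [ket_of_isLabel hl]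
  exact hT i' (⟨(l, m), hl⟩, ε)

/-! ### Operators with tridiagonal coefficients having a symbol -/

theorem isLabel_V {l m : ℝ} (h : IsLabel N (l, m)) : IsLabel N (l + 1, m + -1) := by
  obtain ⟨⟨a, ha⟩, ⟨b, hb⟩, c, hc⟩ := isLabel_iff.1 h
  exact isLabel_iff.2 ⟨⟨a + 1, by push_cast; linarith⟩, ⟨b, by linarith⟩, c + 2,
    by push_cast; linarith⟩

section

variable {q : ℝ} {T : Spinors N →L[ℂ] Spinors N} {e : ℝ} {p z n : ℤˣ → ℝ → ℝ → ℝ} {P Z Q : ℝ}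

theorem SymCoef.sub_V (hq0 : 0 < q) (hq1 : q < 1) {c : ℤˣ → ℝ → ℝ → ℝ} {cinf : ℝ}
    (h : SymCoef N q c cinf) : ∃ C, 0 ≤ C ∧ ∀ ε l m, IsLabel N (l, m) →
      |c ε (l + 1) (m + -1) - c ε l m| ≤ C * q ^ l := by
  obtain ⟨f, C, hC, hb⟩ := h
  refine ⟨2 * C, by positivity, fun ε l m hl => ?_⟩
  have h1 := (hb ε l m hl).1
  have h2 := (hb ε _ _ (isLabel_V hl)).1
  rw [show l + 1 + (m + -1) = l + m by ring] at h2
  have h3 : C * q ^ (l + 1) ≤ C * q ^ l := mul_le_mul_of_nonneg_left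
    (Real.rpow_le_rpow_of_exponent_ge hq0 hq1.le (by linarith)) hC
  have := abs_sub_le (c ε (l + 1) (m + -1)) (f (l + m)) (c ε l m)
  rw [abs_sub_comm (f (l + m))] at this
  linarith

theorem isLabel_Y_iff {l m : ℝ} (h : IsLabel N (l, m)) : ¬ IsLabel N (l, m + 1) ↔ l = m := by
  obtain ⟨⟨a, ha⟩, ⟨b, hb⟩, c, hc⟩ := isLabel_iff.1 h
  constructor
  · intro hn
    by_contra hne
    have hc0 : c ≠ 0 := by
      rintro rfl
      apply hne
      push_cast at hc
      linarith
    obtain ⟨c', rfl⟩ := Nat.exists_eq_succ_of_ne_zero hc0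
    push_cast at hc
    exact hn (isLabel_iff.2 ⟨⟨a, ha⟩, ⟨b + 1, by push_cast; linarith⟩, c', by linarith⟩)
  · rintro rfl hn
    have := (label_ineqs hn).2.2.2
    linarith

/-- The estimate for the commutator with the shift in `m`: a coefficient of the transition by
`(a, e)`. -/
theorem SymCoef.commutator_Y (hq0 : 0 < q) (hq1 : q < 1) {c : ℤˣ → ℝ → ℝ → ℝ} {cinf a : ℝ}
    (h : SymCoef N q c cinf) (ha : cinf = 0 ∨ a = e) : ∃ C, 0 ≤ C ∧
      (∀ ε l m, IsLabel N (l, m) → IsLabel N (l, m + 1) →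
        |c ε l (m + 1) - c ε l m| ≤ C * √q ^ (l + m)) ∧
      (∀ ε l m, IsLabel N (l, m) → ¬ IsLabel N (l, m + 1) →
        |c ε l m| ≤ C * √q ^ (l + m) ∨ ∀ ε', ket N (l + a) (m + e + 1) ε' = 0) := by
  obtain ⟨C, hC, hb⟩ := h.sub_Y hq0 hq1
  -- At the edge `l = m` the shift annihilates the vector. Either the coefficient is small there, or
  -- the transition runs along the edge and the further shift leaves the range as well.
  rcases ha with rfl | rfl
  · obtain ⟨C', hC', hb'⟩ := h.abs_le_of_zero hq0 hq1
    have hs : ∀ x : ℝ, 0 ≤ √q ^ x := fun x => Real.rpow_nonneg (Real.sqrt_nonneg q) x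
    refine ⟨C + C', add_nonneg hC hC', fun ε l m hl hl' => (hb ε l m hl hl').trans ?_,
      fun ε l m hl _ => Or.inl ((hb' ε l m hl).trans ?_)⟩
    · exact mul_le_mul_of_nonneg_right (by linarith) (hs _)
    · exact mul_le_mul_of_nonneg_right (by linarith) (hs _)
  · refine ⟨C, hC, hb, fun ε l m hl hl' => Or.inr fun ε' => ket_eq_zero_of_lt ε' ?_⟩
    have := (isLabel_Y_iff hl).1 hl'
    linarith

theorem smul_shift_ket {a b c l m : ℝ} {ε : ℤˣ} (h : ¬ IsLabel N (l, m) → c = 0) :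
    (c : ℂ) • shift N a b (ket N l m ε) = (c : ℂ) • ket N (l + a) (m + b) ε := by
  by_cases hl : IsLabel N (l, m)
  · rw [shift_ket hl]
  · rw [h hl]; simp

theorem IsTri.shift_apply {a b : ℝ} (h : IsTri T e p z n) (hv : Vanishing N e p z n) {l m : ℝ}
    (hl : IsLabel N (l, m)) (ε : ℤˣ) : shift N a b (T (ket N l m ε))
      = (p ε l m : ℂ) • ket N (l + 1 + a) (m + e + b) ε + (z ε l m : ℂ) • ket N (l + a) (m + e + b) ε
      + (n ε l m : ℂ) • ket N (l - 1 + a) (m + e + b) ε := by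
  rw [h l m ε hl, map_add, map_add, map_smul, map_smul, map_smul, smul_shift_ket (hv.up ε l m hl),
    smul_shift_ket (hv.diag ε l m hl), smul_shift_ket (hv.down ε l m hl)]

/-- The shift by `(1, -1)` never leaves the range and preserves `l + m`, so only differences of
coefficients with the same approximating value occur. -/
theorem IsTri.decay_V (hq0 : 0 < q) (hq1 : q < 1) (h : IsTri T e p z n) (hv : Vanishing N e p z n)
    (hp : SymCoef N q p P) (hz : SymCoef N q z Z) (hn : SymCoef N q n Q) :
    Decay lev (T * shift N 1 (-1) - shift N 1 (-1) * T) := by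
  obtain ⟨C₁, hC₁, b₁⟩ := hp.sub_V hq0 hq1
  obtain ⟨C₂, hC₂, b₂⟩ := hz.sub_V hq0 hq1
  obtain ⟨C₃, hC₃, b₃⟩ := hn.sub_V hq0 hq1
  refine Decay.of_op_ket (w := fun l _ => l) (C := C₁ + C₂ + C₃) (by positivity) hq0 hq1
    fun l m ε hl i' => ?_
  have e1 : (T * shift N 1 (-1) - shift N 1 (-1) * T) (ket N l m ε)
      = ((p ε (l + 1) (m + -1) - p ε l m : ℝ) : ℂ) • ket N (l + 1 + 1) (m + e + -1) ε
        + ((z ε (l + 1) (m + -1) - z ε l m : ℝ) : ℂ) • ket N (l + 1) (m + e + -1) ε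
        + ((n ε (l + 1) (m + -1) - n ε l m : ℝ) : ℂ) • ket N (l - 1 + 1) (m + e + -1) ε := by
    change T (shift N 1 (-1) (ket N l m ε)) - shift N 1 (-1) (T (ket N l m ε)) = _
    rw [h.shift_apply hv hl, shift_ket hl, h _ _ _ (isLabel_V hl),
      show m + -1 + e = m + e + -1 by ring, show l + 1 - 1 = l - 1 + 1 by ring]
    push_cast
    module
  rw [e1]
  refine (norm_three_kets_le _ _ _ _ _ _ _ _ _ _ _).trans ?_
  have := b₁ ε l m hl
  have := b₂ ε l m hl
  have := b₃ ε l m hl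
  linarith

/-- The conditions on the limits handle the edge `l = m`: a nonzero limit is allowed only for a
transition that keeps `l - m`. -/
theorem IsTri.decay_Y (hq0 : 0 < q) (hq1 : q < 1) (h : IsTri T e p z n) (hv : Vanishing N e p z n)
    (hp : SymCoef N q p P) (hz : SymCoef N q z Z) (hn : SymCoef N q n Q)
    (hP : P = 0 ∨ 1 = e) (hZ : Z = 0 ∨ 0 = e) (hQ : Q = 0 ∨ -1 = e) :
    Decay (fun i => lev i + mag i) (T * shift N 0 1 - shift N 0 1 * T) := by
  obtain ⟨C₁, hC₁, b₁, b₁'⟩ := hp.commutator_Y hq0 hq1 hP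
  obtain ⟨C₂, hC₂, b₂, b₂'⟩ := hz.commutator_Y hq0 hq1 hZ
  obtain ⟨C₃, hC₃, b₃, b₃'⟩ := hn.commutator_Y hq0 hq1 hQ
  have hs0 : 0 < √q := Real.sqrt_pos.2 hq0
  have hs1 : √q < 1 := by rw [Real.sqrt_lt' one_pos]; simpa using hq1
  refine Decay.of_op_ket (w := fun l m => l + m) (C := C₁ + C₂ + C₃) (by positivity) hs0 hs1
    fun l m ε hl i' => ?_
  change ‖(T (shift N 0 1 (ket N l m ε)) - shift N 0 1 (T (ket N l m ε)) : Spinors N) i'‖ ≤ _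
  rw [h.shift_apply hv hl, shift_ket hl, add_zero, add_zero, add_zero]
  have hpos : 0 ≤ √q ^ (l + m) := Real.rpow_nonneg hs0.le _
  by_cases hl' : IsLabel N (l, m + 1)
  · have e1 : T (ket N l (m + 1) ε) - ((p ε l m : ℂ) • ket N (l + 1) (m + e + 1) ε
        + (z ε l m : ℂ) • ket N l (m + e + 1) ε + (n ε l m : ℂ) • ket N (l - 1) (m + e + 1) ε)
        = ((p ε l (m + 1) - p ε l m : ℝ) : ℂ) • ket N (l + 1) (m + e + 1) ε
        + ((z ε l (m + 1) - z ε l m : ℝ) : ℂ) • ket N l (m + e + 1) ε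
        + ((n ε l (m + 1) - n ε l m : ℝ) : ℂ) • ket N (l - 1) (m + e + 1) ε := by
      rw [h _ _ _ hl', show m + 1 + e = m + e + 1 by ring]
      push_cast
      module
    rw [e1]
    refine (norm_three_kets_le _ _ _ _ _ _ _ _ _ _ _).trans ?_
    have := b₁ ε l m hl hl'
    have := b₂ ε l m hl hl'
    have := b₃ ε l m hl hl'
    linarith
  -- At the edge one half of the commutator is zero, and the coefficients themselves, not their
  -- differences, must be small.
  · obtain ⟨c₁, k₁, e₁⟩ := smul_ket_of_or (ε := ε) (mul_nonneg hC₁ hpos) (b₁' ε l m hl hl')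
    obtain ⟨c₂, k₂, e₂⟩ := smul_ket_of_or (ε := ε) (mul_nonneg hC₂ hpos) (b₂' ε l m hl hl')
    obtain ⟨c₃, k₃, e₃⟩ := smul_ket_of_or (ε := ε) (mul_nonneg hC₃ hpos) (b₃' ε l m hl hl')
    rw [add_zero] at e₂
    rw [← sub_eq_add_neg] at e₃
    rw [ket_of_not_isLabel hl', map_zero, zero_sub, e₁, e₂, e₃]
    change ‖-((c₁ : ℂ) • ket N (l + 1) (m + e + 1) ε + (c₂ : ℂ) • ket N l (m + e + 1) ε
      + (c₃ : ℂ) • ket N (l - 1) (m + e + 1) ε : Spinors N) i'‖ ≤ _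
    rw [norm_neg]
    refine (norm_three_kets_le _ _ _ _ _ _ _ _ _ _ _).trans ?_
    linarith

theorem IsTri.hasScalarSymbol (hq0 : 0 < q) (hq1 : q < 1) (h : IsTri T e p z n)
    (he : |e| ≤ 1) (hv : Vanishing N e p z n)
    (hp : SymCoef N q p P) (hz : SymCoef N q z Z) (hn : SymCoef N q n Q)
    (hP : P = 0 ∨ 1 = e) (hZ : Z = 0 ∨ 0 = e) (hQ : Q = 0 ∨ -1 = e) : HasScalarSymbol T :=
  ⟨⟨⟨1, h.fp he⟩, h.decay_V hq0 hq1 hv hp hz hn, h.decay_Y hq0 hq1 hv hp hz hn hP hZ hQ⟩,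
    h.decay_flip hq0 hq1 hp hz hn⟩

end

end Tridiagonal

end Podles

end

noncomputable section

namespace Podles

/-! ### `q`-numbers -/

section QNumbers

variable {q : ℝ}

/-- The normalization `1 / (q⁻¹ - q)` of the `q`-numbers. -/
def qfac (q : ℝ) : ℝ := (q⁻¹ - q)⁻¹

theorem inv_sub_self_pos (hq0 : 0 < q) (hq1 : q < 1) : 0 < q⁻¹ - q := by
  have := (one_lt_inv₀ hq0).2 hq1
  linarith

theorem qfac_pos (hq0 : 0 < q) (hq1 : q < 1) : 0 < qfac q := inv_pos.2 (inv_sub_self_pos hq0 hq1)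

theorem qnum_eq (q x : ℝ) : qnum q x = qfac q * (q ^ (-x) - q ^ x) := by
  rw [qnum, qfac, show q ^ x - q ^ (-x) = -(q ^ (-x) - q ^ x) by ring,
    show q - q⁻¹ = -(q⁻¹ - q) by ring, neg_div_neg_eq, div_eq_inv_mul]

theorem qnum_eq_mul (hq0 : 0 < q) (x : ℝ) :
    qnum q x = qfac q * q ^ (-x) * (1 - q ^ (2 * x)) := by
  have h : q ^ (-x) * q ^ (2 * x) = q ^ x := by
    rw [← Real.rpow_add hq0]
    ring_nf
  rw [qnum_eq]
  linear_combination qfac q * h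

theorem qnum_two (hq0 : 0 < q) (hq1 : q < 1) : qnum q 2 = q + q⁻¹ := by
  have h := (inv_sub_self_pos hq0 hq1).ne'
  rw [qnum_eq, qfac, Real.rpow_neg hq0.le, Real.rpow_two, inv_mul_eq_iff_eq_mul₀ h]
  ring

theorem qnum_nonneg (hq0 : 0 < q) (hq1 : q < 1) {x : ℝ} (hx : 0 ≤ x) : 0 ≤ qnum q x := by
  rw [qnum_eq]
  exact mul_nonneg (qfac_pos hq0 hq1).le (sub_nonneg.2
    (Real.rpow_le_rpow_of_exponent_ge hq0 hq1.le (by linarith)))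

theorem qnum_pos (hq0 : 0 < q) (hq1 : q < 1) {x : ℝ} (hx : 0 < x) : 0 < qnum q x := by
  rw [qnum_eq]
  exact mul_pos (qfac_pos hq0 hq1) (sub_pos.2
    (Real.rpow_lt_rpow_of_exponent_gt hq0 hq1 (by linarith)))

/-- The factor `√(1 - q^(2x))` of `√[x]`. -/
def qroot (q x : ℝ) : ℝ := √(1 - q ^ (2 * x))

/-- Valid also for negative `x`, where both square roots are `0` by convention; such arguments occur
at the edges of the range. -/
theorem sqrt_qnum (hq0 : 0 < q) (hq1 : q < 1) (x : ℝ) :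
    √(qnum q x) = √(qfac q) * q ^ (-x / 2) * qroot q x := by
  have h1 := (qfac_pos hq0 hq1).le
  have h2 : 0 ≤ q ^ (-x) := Real.rpow_nonneg hq0.le _
  rw [qnum_eq_mul hq0, Real.sqrt_mul (mul_nonneg h1 h2), Real.sqrt_mul h1, qroot,
    Real.sqrt_eq_rpow (q ^ (-x)), ← Real.rpow_mul hq0.le]
  ring_nf

theorem abs_qroot_sub_one_le (hq0 : 0 < q) (x : ℝ) : |qroot q x - 1| ≤ q ^ (2 * x) := by
  have hu : 0 ≤ q ^ (2 * x) := Real.rpow_nonneg hq0.le _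
  rw [qroot]
  set u := q ^ (2 * x)
  have h1 : √(1 - u) ≤ 1 := Real.sqrt_le_one.2 (by linarith)
  rw [abs_sub_comm, abs_of_nonneg (by linarith)]
  by_cases h : u ≤ 1
  · have : 1 - u ≤ √(1 - u) := Real.le_sqrt_of_sq_le (by nlinarith)
    linarith
  -- For `u > 1` the distance to `1` is at most `1`, hence below `u`.
  · linarith [Real.sqrt_nonneg (1 - u)]

theorem sqrt_qnum_mul (hq0 : 0 < q) (hq1 : q < 1) {x : ℝ} (hx : 0 ≤ x) (y : ℝ) :
    √(qnum q x * qnum q y) = qfac q * q ^ (-(x + y) / 2) * (qroot q x * qroot q y) := by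
  rw [Real.sqrt_mul (qnum_nonneg hq0 hq1 hx), sqrt_qnum hq0 hq1, sqrt_qnum hq0 hq1,
    show -(x + y) / 2 = -x / 2 + -y / 2 by ring, Real.rpow_add hq0]
  linear_combination (q ^ (-x / 2) * q ^ (-y / 2) * qroot q x * qroot q y) *
    Real.mul_self_sqrt (qfac_pos hq0 hq1).le

end QNumbers

/-! ### Closure properties of coefficients with a symbol -/

section SymCoef

variable {N q : ℝ} {c c' : ℤˣ → ℝ → ℝ → ℝ} {a a' : ℝ}

theorem SymCoef.congr (h : SymCoef N q c a) (hc : ∀ ε l m, IsLabel N (l, m) → c' ε l m = c ε l m) :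
    SymCoef N q c' a := by
  obtain ⟨f, C, hC, hb⟩ := h
  exact ⟨f, C, hC, fun ε l m hl => by rw [hc ε l m hl]; exact hb ε l m hl⟩

theorem SymCoef.add (h : SymCoef N q c a) (h' : SymCoef N q c' a') :
    SymCoef N q (fun ε l m => c ε l m + c' ε l m) (a + a') := by
  obtain ⟨f, C, hC, hb⟩ := h
  obtain ⟨f', C', hC', hb'⟩ := h'
  refine ⟨fun k => f k + f' k, C + C', by positivity, fun ε l m hl => ⟨?_, ?_⟩⟩
  · rw [add_sub_add_comm, add_mul]
    exact (abs_add_le _ _).trans (add_le_add (hb ε l m hl).1 (hb' ε l m hl).1)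
  · rw [add_sub_add_comm, add_mul]
    exact (abs_add_le _ _).trans (add_le_add (hb ε l m hl).2 (hb' ε l m hl).2)

theorem symCoef_of_add {g : ℝ → ℝ} {C : ℝ} (hq0 : 0 < q)
    (h : ∀ k, 0 ≤ k → |g k - a| ≤ C * q ^ k) : SymCoef N q (fun _ l m => g (l + m)) a := by
  have hC : 0 ≤ C := by simpa using (abs_nonneg _).trans (h 0 le_rfl)
  exact ⟨g, C, hC, fun ε l m hl => ⟨by
    rw [sub_self, abs_zero]; exact mul_nonneg hC (Real.rpow_nonneg hq0.le _),
    h _ (label_ineqs hl).2.2.1⟩⟩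

theorem symCoef_of_lev {g : ℤˣ → ℝ → ℝ} {C : ℝ} (hC : 0 ≤ C) (hq0 : 0 < q)
    (h : ∀ ε l m, IsLabel N (l, m) → |g ε l - a| ≤ C * q ^ l) :
    SymCoef N q (fun ε l _ => g ε l) a :=
  ⟨fun _ => a, C, hC, fun ε l m hl => ⟨h ε l m hl, by
    rw [sub_self, abs_zero]; exact mul_nonneg hC (Real.rpow_nonneg hq0.le _)⟩⟩

theorem symCoef_const (hq0 : 0 < q) (a : ℝ) : SymCoef N q (fun _ _ _ => a) a :=
  symCoef_of_lev (g := fun _ _ => a) le_rfl hq0 fun _ _ _ _ => by simp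

theorem SymCoef.mul (hq0 : 0 < q) (hq1 : q < 1) (h : SymCoef N q c a) (h' : SymCoef N q c' a') :
    SymCoef N q (fun ε l m => c ε l m * c' ε l m) (a * a') := by
  obtain ⟨B, hB⟩ := h.bounded hq0 hq1
  obtain ⟨f, C, hC, hb⟩ := h
  obtain ⟨f', C', hC', hb'⟩ := h'
  -- The first two terms of the constant serve the estimate in `l`, the last two the estimate in `l
  -- + m`.
  refine ⟨fun k => f k * f' k, |B| * C' + C * (|a'| + C') + (|a| + C) * C' + C * |a'|,
    by positivity, fun ε l m hl => ?_⟩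
  obtain ⟨h1, h2⟩ := hb ε l m hl
  obtain ⟨h1', h2'⟩ := hb' ε l m hl
  obtain ⟨-, i1, i2, -⟩ := label_ineqs hl
  have p1 : 0 ≤ q ^ l := Real.rpow_nonneg hq0.le _
  have p2 : 0 ≤ q ^ (l + m) := Real.rpow_nonneg hq0.le _
  have e2 := Real.rpow_le_one hq0.le hq1.le i2
  have hf : |f (l + m)| ≤ |a| + C := by
    have := abs_sub_abs_le_abs_sub (f (l + m)) a
    nlinarith
  have hf' : |f' (l + m)| ≤ |a'| + C' := by
    have := abs_sub_abs_le_abs_sub (f' (l + m)) a'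
    nlinarith
  have hc : |c ε l m| ≤ |B| := (hB ε l m hl).trans (le_abs_self B)
  constructor
  · rw [show c ε l m * c' ε l m - f (l + m) * f' (l + m)
      = c ε l m * (c' ε l m - f' (l + m)) + (c ε l m - f (l + m)) * f' (l + m) by ring]
    refine (abs_add_le _ _).trans ?_
    rw [abs_mul, abs_mul]
    have k1 := mul_le_mul hc h1' (abs_nonneg _) (abs_nonneg _)
    have k2 := mul_le_mul h1 hf' (abs_nonneg _) (by positivity)
    have k3 : 0 ≤ ((|a| + C) * C' + C * |a'|) * q ^ l := by positivity
    linarith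
  · rw [show f (l + m) * f' (l + m) - a * a'
      = f (l + m) * (f' (l + m) - a') + (f (l + m) - a) * a' by ring]
    refine (abs_add_le _ _).trans ?_
    rw [abs_mul, abs_mul]
    have k1 := mul_le_mul hf h2' (abs_nonneg _) (by positivity)
    have k2 := mul_le_mul_of_nonneg_right h2 (abs_nonneg a')
    have k3 : 0 ≤ (|B| * C' + C * (|a'| + C')) * q ^ (l + m) := by positivity
    linarith

theorem SymCoef.const_mul (hq0 : 0 < q) (hq1 : q < 1) (b : ℝ) (h : SymCoef N q c a) :
    SymCoef N q (fun ε l m => b * c ε l m) (b * a) :=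
  (symCoef_const hq0 b).mul hq0 hq1 h

theorem symCoef_rpow (hq0 : 0 < q) : SymCoef N q (fun _ l m => q ^ (l + m)) 0 :=
  symCoef_of_add (C := 1) hq0 fun k _ => by
    rw [sub_zero, abs_of_nonneg (Real.rpow_nonneg hq0.le _), one_mul]

theorem symCoef_qroot_add (hq0 : 0 < q) (hq1 : q < 1) (b : ℝ) :
    SymCoef N q (fun _ l m => qroot q (l + m + b)) 1 :=
  symCoef_of_add (g := fun k => qroot q (k + b)) (C := q ^ (2 * b)) hq0 fun k hk => by
    refine (abs_qroot_sub_one_le hq0 _).trans ?_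
    rw [← Real.rpow_add hq0]
    exact Real.rpow_le_rpow_of_exponent_ge hq0 hq1.le (by linarith)

/-- The factor in `l - m` alone has no symbol, but its deviation from `1` is at most `q^(2(l - m +
b))`, and the product of this with `q^(l + m)` is `O(q^l)` because `m ≤ l`. -/
theorem symCoef_rpow_mul_qroot_sub (hq0 : 0 < q) (hq1 : q < 1) (b : ℝ) :
    SymCoef N q (fun _ l m => q ^ (l + m) * qroot q (l - m + b)) 0 := by
  have hb : 0 ≤ q ^ (2 * b) := Real.rpow_nonneg hq0.le _
  refine ⟨fun k => q ^ k, 1 + q ^ (2 * b), by positivity, fun ε l m hl => ?_⟩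
  obtain ⟨-, i1, i2, i3⟩ := label_ineqs hl
  have p1 : 0 ≤ q ^ l := Real.rpow_nonneg hq0.le _
  have p2 : 0 ≤ q ^ (l + m) := Real.rpow_nonneg hq0.le _
  constructor
  · rw [← mul_sub_one, abs_mul, abs_of_nonneg p2]
    refine (mul_le_mul_of_nonneg_left (abs_qroot_sub_one_le hq0 _) p2).trans ?_
    have : q ^ (l + m) * q ^ (2 * (l - m + b)) ≤ q ^ (2 * b) * q ^ l := by
      rw [← Real.rpow_add hq0, ← Real.rpow_add hq0]
      exact Real.rpow_le_rpow_of_exponent_ge hq0 hq1.le (by linarith)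
    linarith
  · rw [sub_zero, abs_of_nonneg p2]
    exact le_mul_of_one_le_left p2 (by linarith)

end SymCoef

end Podles

end

noncomputable section

namespace Podles

/-! ### The coefficients `α` and `β` as functions of `q^(2l)` -/

section AlphaBeta

variable {q s : ℝ}

/-- The function with `α_{M,l}² = u² alphaFun (q^M) u` for `u = q^(2l)`. -/
def alphaFun (q s t u : ℝ) : ℝ :=
  qnum q 2 * ((1 - u * t ^ 2) * (1 - u / t ^ 2)) * ((u * t + s ^ 2 / t) * (u * s ^ 2 / t + t))
    / (qfac q ^ 2 * (1 - u ^ 2) ^ 2 * ((1 - u ^ 2 / q ^ 2) * (1 - u ^ 2 * q ^ 2)))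

/-- The function with `β_{M,l} = u betaFun (q^M) u` for `u = q^(2l)`. -/
def betaFun (q s t u : ℝ) : ℝ :=
  ((1 - u ^ 2 - (1 + q ^ 2) * (t ^ 2 - u) * u) * (1 - s ^ 2)
      + u * (1 + q ^ 2) * (1 / t ^ 2 - t ^ 2) * s ^ 2)
    / (qfac q * ((1 - u ^ 2) * (1 - u ^ 2 * q ^ 4)))

theorem rpow_two_mul (hq0 : 0 < q) (x : ℝ) : q ^ (2 * x) = (q ^ x) ^ 2 := by
  rw [two_mul, Real.rpow_add hq0, sq]

theorem qnum_two_mul (hq0 : 0 < q) (l : ℝ) :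
    qnum q (2 * l) = qfac q * (q ^ (2 * l))⁻¹ * (1 - (q ^ (2 * l)) ^ 2) := by
  rw [qnum_eq_mul hq0, rpow_two_mul hq0 (2 * l), Real.rpow_neg hq0.le]

theorem qnum_two_mul_add (hq0 : 0 < q) (l : ℝ) (k : ℕ) :
    qnum q (2 * l + k)
      = qfac q * (q ^ (2 * l) * q ^ k)⁻¹ * (1 - (q ^ (2 * l)) ^ 2 * q ^ (2 * k)) := by
  rw [qnum_eq_mul hq0, rpow_two_mul hq0, Real.rpow_neg hq0.le, Real.rpow_add hq0,
    Real.rpow_natCast]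
  ring

theorem qnum_two_mul_sub_one (hq0 : 0 < q) (l : ℝ) :
    qnum q (2 * l - 1) = qfac q * (q ^ (2 * l) / q)⁻¹ * (1 - (q ^ (2 * l)) ^ 2 / q ^ 2) := by
  rw [qnum_eq_mul hq0, rpow_two_mul hq0, Real.rpow_neg hq0.le, Real.rpow_sub hq0, Real.rpow_one]
  ring

theorem qnum_add_mul_qnum_sub (hq0 : 0 < q) (l M : ℝ) :
    qnum q (l + M) * qnum q (l - M) = qfac q ^ 2 * (q ^ (2 * l))⁻¹
      * ((1 - q ^ (2 * l) * (q ^ M) ^ 2) * (1 - q ^ (2 * l) / (q ^ M) ^ 2)) := by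
  have hM := (Real.rpow_pos_of_pos hq0 M).ne'
  have hl := (Real.rpow_pos_of_pos hq0 l).ne'
  rw [qnum_eq, qnum_eq, Real.rpow_neg hq0.le, Real.rpow_neg hq0.le, Real.rpow_sub hq0,
    Real.rpow_add hq0, rpow_two_mul hq0]
  field_simp

theorem alphaCoef_nonneg (hq0 : 0 < q) (hq1 : q < 1) {M l : ℝ} (hl : 0 ≤ l) :
    0 ≤ alphaCoef q s M l :=
  mul_nonneg (mul_nonneg (one_div_nonneg.2 (qnum_nonneg hq0 hq1 (by linarith)))
    (Real.sqrt_nonneg _)) (Real.sqrt_nonneg _)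

/-- The bounds on `l` make every `q`-number under the roots nonnegative, `[2l - 1]` included. -/
theorem alphaCoef_sq_eq (hq0 : 0 < q) (hq1 : q < 1) {M l : ℝ} (hM : |M| ≤ l) (hl : 1 / 2 ≤ l) :
    alphaCoef q s M l ^ 2
      = 1 / qnum q (2 * l) ^ 2 * (qnum q 2 * (qnum q (l + M) * qnum q (l - M))
          / (qnum q (2 * l - 1) * qnum q (2 * l + 1)))
        * ((q ^ (l + M) + q ^ (-(l + M)) * s ^ 2) * (q ^ (l - M) * s ^ 2 + q ^ (-(l - M)))) := by
  obtain ⟨h1, h2⟩ := abs_le.1 hM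
  have h (x : ℝ) : 0 ≤ q ^ x := Real.rpow_nonneg hq0.le x
  have n {x : ℝ} (hx : 0 ≤ x) : 0 ≤ qnum q x := qnum_nonneg hq0 hq1 hx
  have e1 : 0 ≤ qnum q 2 * qnum q (l + M) * qnum q (l - M)
      / (qnum q (2 * l - 1) * qnum q (2 * l + 1)) :=
    div_nonneg (mul_nonneg (mul_nonneg (n (by norm_num)) (n (by linarith))) (n (by linarith)))
      (mul_nonneg (n (by linarith)) (n (by linarith)))
  have e2 : 0 ≤ (q ^ (l + M) + q ^ (-(l + M)) * s ^ 2) * (q ^ (l - M) * s ^ 2 + q ^ (-(l - M))) :=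
    mul_nonneg (add_nonneg (h _) (mul_nonneg (h _) (sq_nonneg s)))
      (add_nonneg (mul_nonneg (h _) (sq_nonneg s)) (h _))
  rw [alphaCoef, mul_pow, mul_pow, Real.sq_sqrt e1, Real.sq_sqrt e2, div_pow, one_pow,
    mul_assoc (qnum q 2)]

theorem one_sub_rpow_pos (hq0 : 0 < q) (hq1 : q < 1) {x : ℝ} (hx : 0 < x) : 0 < 1 - q ^ x :=
  sub_pos.2 (Real.rpow_lt_one hq0.le hq1 hx)

theorem alphaCoef_sq (hq0 : 0 < q) (hq1 : q < 1) {M l : ℝ} (hM : |M| ≤ l) (hl : 1 / 2 ≤ l) :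
    alphaCoef q s M l ^ 2 = (q ^ (2 * l)) ^ 2 * alphaFun q s (q ^ M) (q ^ (2 * l)) := by
  have hk := (qfac_pos hq0 hq1).ne'
  have ht := (Real.rpow_pos_of_pos hq0 M).ne'
  have hx := (Real.rpow_pos_of_pos hq0 l).ne'
  have hu := (Real.rpow_pos_of_pos hq0 (2 * l)).ne'
  have hp : (q ^ (l + M) + q ^ (-(l + M)) * s ^ 2) * (q ^ (l - M) * s ^ 2 + q ^ (-(l - M)))
      = (q ^ (2 * l))⁻¹ * ((q ^ (2 * l) * q ^ M + s ^ 2 / q ^ M)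
        * (q ^ (2 * l) * s ^ 2 / q ^ M + q ^ M)) := by
    rw [Real.rpow_neg hq0.le, Real.rpow_neg hq0.le, Real.rpow_sub hq0, Real.rpow_add hq0,
      rpow_two_mul hq0]
    field_simp
  have h1 := qnum_two_mul_add hq0 l 1
  rw [Nat.cast_one] at h1
  rw [alphaCoef_sq_eq hq0 hq1 hM hl, hp, qnum_add_mul_qnum_sub hq0, qnum_two_mul hq0, h1,
    qnum_two_mul_sub_one hq0, alphaFun]
  -- The denominators are made opaque because `Z` vanishes at `l = 1/2`; there both sides contain a
  -- division by zero and agree by convention.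
  generalize q ^ (2 * l) = u at *
  generalize q ^ M = t at *
  generalize 1 - u ^ 2 / q ^ 2 = Z
  generalize 1 - u ^ 2 = Y
  generalize 1 - u ^ 2 * q ^ (2 * 1) = W
  generalize qfac q = k at *
  field_simp

theorem betaCoef_eq (hq0 : 0 < q) (hq1 : q < 1) (M l : ℝ) :
    betaCoef q s M l = q ^ (2 * l) * betaFun q s (q ^ M) (q ^ (2 * l)) := by
  have hk := (qfac_pos hq0 hq1).ne'
  have ht := (Real.rpow_pos_of_pos hq0 M).ne'
  have hx := (Real.rpow_pos_of_pos hq0 l).ne'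
  have hu := (Real.rpow_pos_of_pos hq0 (2 * l)).ne'
  have h2 := qnum_two_mul_add hq0 l 2
  rw [Nat.cast_two] at h2
  have e1 : q ^ (l + M + 1) * qnum q 2 * qnum q (l - M)
      = qfac q * (1 + q ^ 2) * ((q ^ M) ^ 2 - q ^ (2 * l)) := by
    rw [qnum_eq q (l - M), qnum_two hq0 hq1, Real.rpow_neg hq0.le, Real.rpow_sub hq0,
      Real.rpow_add hq0, Real.rpow_add hq0, rpow_two_mul hq0, Real.rpow_one]
    field_simp
    ring
  have e2 : q * qnum q 2 * qnum q (2 * M)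
      = qfac q * (1 + q ^ 2) * (1 / (q ^ M) ^ 2 - (q ^ M) ^ 2) := by
    rw [qnum_eq q (2 * M), qnum_two hq0 hq1, Real.rpow_neg hq0.le, rpow_two_mul hq0]
    field_simp
    ring
  rw [betaCoef, e1, e2, h2, qnum_two_mul hq0, betaFun]
  generalize q ^ (2 * l) = u at *
  generalize q ^ M = t at *
  generalize 1 / t ^ 2 - t ^ 2 = v
  generalize qfac q = k at *
  field_simp

/-- Differentiability gives the estimate for large `a`; as `u` never vanishes, a larger constant
covers the finitely many other indices. -/
theorem isBigO_of_differentiableAt {F : ℝ → ℝ} (hF : DifferentiableAt ℝ F 0) {u : ℕ → ℝ}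
    (hu0 : ∀ a, 0 < u a) (hu : Tendsto u atTop (𝓝 0)) :
    ∃ C, 0 ≤ C ∧ ∀ a, |F (u a) - F 0| ≤ C * u a := by
  have h1 : (fun a => F (u a) - F 0) =O[atTop] fun a => u a := by
    simpa [Function.comp_def] using hF.isBigO_sub.comp_tendsto hu
  obtain ⟨C, hC, h⟩ := Asymptotics.bound_of_isBigO_nat_atTop h1
  refine ⟨C, hC.le, fun a => ?_⟩
  simpa [abs_of_pos (hu0 a)] using h (hu0 a).ne'

/-- The levels are `l = |N| + a` with `a` natural, so `q^(2l)` is a positive sequence tending to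
zero. -/
theorem exists_bound_of_differentiableAt (hq0 : 0 < q) (hq1 : q < 1) (N : ℝ) {F : ℝ → ℝ}
    (hF : DifferentiableAt ℝ F 0) :
    ∃ C, 0 ≤ C ∧ ∀ l m, IsLabel N (l, m) → |F (q ^ (2 * l)) - F 0| ≤ C * q ^ (2 * l) := by
  have e : ∀ a : ℕ, q ^ (2 * (|N| + a)) = q ^ (2 * |N|) * (q ^ 2) ^ a := fun a => by
    rw [mul_add, Real.rpow_add hq0, rpow_two_mul hq0 (a : ℝ), Real.rpow_natCast, ← pow_mul,
      ← pow_mul, mul_comm a]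
  obtain ⟨C, hC, h⟩ := isBigO_of_differentiableAt hF (u := fun a : ℕ => q ^ (2 * (|N| + a)))
    (fun a => Real.rpow_pos_of_pos hq0 _) (by
      simp only [e]
      simpa using (tendsto_pow_atTop_nhds_zero_of_lt_one (sq_nonneg q)
        (by nlinarith : q ^ 2 < 1)).const_mul (q ^ (2 * |N|)))
  refine ⟨C, hC, fun l m hl => ?_⟩
  obtain ⟨a, ha⟩ := hl.1
  have := h a
  rwa [show |N| + a = l by rw [← ha]; ring] at this

theorem differentiableAt_alphaFun (hq0 : 0 < q) (hq1 : q < 1) (t : ℝ) :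
    DifferentiableAt ℝ (alphaFun q s t) 0 := by
  have hk := (qfac_pos hq0 hq1).ne'
  unfold alphaFun
  refine DifferentiableAt.div (by fun_prop) (by fun_prop) ?_
  simpa using hk

theorem differentiableAt_betaFun (hq0 : 0 < q) (hq1 : q < 1) (t : ℝ) :
    DifferentiableAt ℝ (betaFun q s t) 0 := by
  have hk := (qfac_pos hq0 hq1).ne'
  unfold betaFun
  refine DifferentiableAt.div (by fun_prop) (by fun_prop) ?_
  simpa using hk

theorem alphaCoef_eq (hq0 : 0 < q) (hq1 : q < 1) {M l : ℝ} (hM : |M| ≤ l) (hl : 1 / 2 ≤ l) :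
    alphaCoef q s M l = q ^ (2 * l) * √(alphaFun q s (q ^ M) (q ^ (2 * l))) := by
  rw [← Real.sqrt_sq (alphaCoef_nonneg hq0 hq1 (by linarith) : 0 ≤ alphaCoef q s M l),
    alphaCoef_sq hq0 hq1 hM hl, Real.sqrt_mul (sq_nonneg _),
    Real.sqrt_sq (Real.rpow_nonneg hq0.le _)]

/-- Hölder continuity instead of differentiability, because the limit of `alphaFun` is zero when `s
= 0`. An error `O(q^(2l))` under the root becomes `O(q^l)`, which is still enough. -/
theorem abs_sqrt_sub_sqrt_le {x y : ℝ} (hy : 0 ≤ y) : |√x - √y| ≤ √|x - y| := by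
  rcases le_total 0 x with hx | hx
  · rw [← Real.sqrt_sq_eq_abs]
    refine Real.sqrt_le_sqrt ?_
    have h1 : |√x - √y| * |√x - √y| ≤ |√x - √y| * (√x + √y) := by
      refine mul_le_mul_of_nonneg_left ?_ (abs_nonneg _)
      exact abs_le.2 ⟨by linarith [Real.sqrt_nonneg x], by linarith [Real.sqrt_nonneg y]⟩
    have h2 : |x - y| = |√x - √y| * (√x + √y) := by
      rw [← abs_of_nonneg (add_nonneg (Real.sqrt_nonneg x) (Real.sqrt_nonneg y)), ← abs_mul,
        mul_comm, ← sq_sub_sq, Real.sq_sqrt hx, Real.sq_sqrt hy]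
    rw [h2, sq, ← abs_mul_abs_self]
    exact h1
  · rw [Real.sqrt_eq_zero_of_nonpos hx, zero_sub, abs_neg, abs_of_nonneg (Real.sqrt_nonneg y)]
    refine Real.sqrt_le_sqrt ?_
    rw [abs_of_nonpos (by linarith)]
    linarith

theorem half_le_abs {N : ℝ} (hN : ∃ k : ℤ, N = (k : ℝ) / 2) (hN0 : N ≠ 0) : 1 / 2 ≤ |N| := by
  obtain ⟨k, rfl⟩ := hN
  have hk : k ≠ 0 := by rintro rfl; simp at hN0
  have : (1 : ℝ) ≤ |(k : ℝ)| := by exact_mod_cast Int.one_le_abs hk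
  rw [abs_div, abs_two]
  linarith

theorem abs_sign_mul (ε : ℤˣ) (N : ℝ) : |((ε : ℤ) : ℝ) * N| = |N| := by
  rcases Int.units_eq_one_or ε with rfl | rfl <;> simp

/-- The limit does not involve `t = q^M`; this, with `betaFun_zero`, is why the two summands share a
symbol. -/
theorem alphaFun_zero {t : ℝ} (ht : 0 < t) :
    alphaFun q s t 0 = qnum q 2 * s ^ 2 / qfac q ^ 2 := by
  simp [alphaFun, ht.ne']

theorem sqrt_alphaFun_zero (hq0 : 0 < q) (hq1 : q < 1) (hs : 0 ≤ s) {t : ℝ} (ht : 0 < t) :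
    √(alphaFun q s t 0) = √(qnum q 2) / qfac q * s := by
  rw [alphaFun_zero ht, Real.sqrt_div' _ (sq_nonneg _), Real.sqrt_sq (qfac_pos hq0 hq1).le,
    Real.sqrt_mul (qnum_nonneg hq0 hq1 zero_le_two), Real.sqrt_sq hs]
  ring

theorem betaFun_zero (t : ℝ) : betaFun q s t 0 = (1 - s ^ 2) / qfac q := by
  simp [betaFun]

theorem exists_units_bound {P : ℤˣ → ℝ → Prop} (hmono : ∀ ε C C', C ≤ C' → P ε C → P ε C')
    (h : ∀ ε, ∃ C, 0 ≤ C ∧ P ε C) : ∃ C, 0 ≤ C ∧ ∀ ε, P ε C := by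
  obtain ⟨C, hC, h1⟩ := h 1
  obtain ⟨C', hC', h2⟩ := h (-1)
  refine ⟨max C C', le_max_of_le_left hC, fun ε => ?_⟩
  rcases Int.units_eq_one_or ε with rfl | rfl
  · exact hmono _ _ _ (le_max_left _ _) h1
  · exact hmono _ _ _ (le_max_right _ _) h2

/-- The normalized coefficient `q^(-2l) α_{εN,l}`. -/
def alphaNorm (q s N : ℝ) (ε : ℤˣ) (l : ℝ) : ℝ :=
  √(alphaFun q s (q ^ (((ε : ℤ) : ℝ) * N)) (q ^ (2 * l)))

/-- The normalized coefficient `q^(-2l) β_{εN,l}`. -/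
def betaNorm (q s N : ℝ) (ε : ℤˣ) (l : ℝ) : ℝ :=
  betaFun q s (q ^ (((ε : ℤ) : ℝ) * N)) (q ^ (2 * l))

theorem symCoef_betaNorm (hq0 : 0 < q) (hq1 : q < 1) (N : ℝ) :
    SymCoef N q (fun ε l _ => betaNorm q s N ε l) ((1 - s ^ 2) / qfac q) := by
  obtain ⟨C, hC, h⟩ := exists_units_bound (P := fun ε C => ∀ l m, IsLabel N (l, m) →
      |betaNorm q s N ε l - (1 - s ^ 2) / qfac q| ≤ C * q ^ (2 * l))
    (fun ε C C' hCC h l m hl => (h l m hl).trans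
      (mul_le_mul_of_nonneg_right hCC (Real.rpow_nonneg hq0.le _)))
    (fun ε => by
      have := exists_bound_of_differentiableAt hq0 hq1 N
        (differentiableAt_betaFun (s := s) hq0 hq1 (q ^ (((ε : ℤ) : ℝ) * N)))
      rwa [betaFun_zero] at this)
  refine symCoef_of_lev hC hq0 fun ε l m hl => (h ε l m hl).trans ?_
  exact mul_le_mul_of_nonneg_left (Real.rpow_le_rpow_of_exponent_ge hq0 hq1.le
    (by linarith [(label_ineqs hl).2.1])) hC

theorem exists_alphaNorm_bound (hq0 : 0 < q) (hq1 : q < 1) (hs : 0 ≤ s) (N : ℝ) :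
    ∃ C, 0 ≤ C ∧ ∀ ε l m, IsLabel N (l, m) →
      |alphaNorm q s N ε l - √(qnum q 2) / qfac q * s| ≤ C * q ^ l := by
  obtain ⟨C, hC, h⟩ := exists_units_bound (P := fun ε C => ∀ l m, IsLabel N (l, m) →
      |alphaFun q s (q ^ (((ε : ℤ) : ℝ) * N)) (q ^ (2 * l))
        - alphaFun q s (q ^ (((ε : ℤ) : ℝ) * N)) 0| ≤ C * q ^ (2 * l))
    (fun ε C C' hCC h l m hl => (h l m hl).trans
      (mul_le_mul_of_nonneg_right hCC (Real.rpow_nonneg hq0.le _)))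
    (fun ε => exists_bound_of_differentiableAt hq0 hq1 N (differentiableAt_alphaFun hq0 hq1 _))
  refine ⟨√C, Real.sqrt_nonneg C, fun ε l m hl => ?_⟩
  have ht := Real.rpow_pos_of_pos hq0 (((ε : ℤ) : ℝ) * N)
  rw [← sqrt_alphaFun_zero hq0 hq1 hs ht, alphaNorm]
  refine (abs_sqrt_sub_sqrt_le ?_).trans ((Real.sqrt_le_sqrt (h ε l m hl)).trans_eq ?_)
  · rw [alphaFun_zero ht]
    exact div_nonneg (mul_nonneg (qnum_nonneg hq0 hq1 zero_le_two) (sq_nonneg _)) (sq_nonneg _)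
  · rw [Real.sqrt_mul hC, rpow_two_mul hq0, Real.sqrt_sq (Real.rpow_nonneg hq0.le _)]

theorem symCoef_alphaNorm (hq0 : 0 < q) (hq1 : q < 1) (hs : 0 ≤ s) (N : ℝ) :
    SymCoef N q (fun ε l _ => alphaNorm q s N ε l) (√(qnum q 2) / qfac q * s) := by
  obtain ⟨C, hC, h⟩ := exists_alphaNorm_bound hq0 hq1 hs N
  exact symCoef_of_lev hC hq0 h

theorem symCoef_alphaNorm_succ (hq0 : 0 < q) (hq1 : q < 1) (hs : 0 ≤ s) (N : ℝ) :
    SymCoef N q (fun ε l _ => alphaNorm q s N ε (l + 1)) (√(qnum q 2) / qfac q * s) := by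
  obtain ⟨C, hC, h⟩ := exists_alphaNorm_bound hq0 hq1 hs N
  refine symCoef_of_lev hC hq0 fun ε l m hl => (h ε (l + 1) m ?_).trans ?_
  · obtain ⟨⟨a, ha⟩, b, hb⟩ := hl
    exact ⟨⟨a + 1, by push_cast; linarith⟩, b + 1, by push_cast; linarith⟩
  · exact mul_le_mul_of_nonneg_left (Real.rpow_le_rpow_of_exponent_ge hq0 hq1.le (by linarith)) hC

end AlphaBeta

end Podles

end

noncomputable section

namespace Podles

/-! ### The matrix coefficients of the generators -/

section Coefficients

variable {q s N : ℝ}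

/-- A coefficient of `x₁`. -/
def x1Up (q s N : ℝ) (ε : ℤˣ) (l m : ℝ) : ℝ := BPlus q s (((ε : ℤ) : ℝ) * N) l m

/-- A coefficient of `x₁`. -/
def x1Diag (q s N : ℝ) (ε : ℤˣ) (l m : ℝ) : ℝ := BZero q s (((ε : ℤ) : ℝ) * N) l m

/-- A coefficient of `x₁`. -/
def x1Down (q s N : ℝ) (ε : ℤˣ) (l m : ℝ) : ℝ := BMinus q s (((ε : ℤ) : ℝ) * N) l m

/-- A coefficient of `x₁*`. -/
def x1sUp (q s N : ℝ) (ε : ℤˣ) (l m : ℝ) : ℝ := x1Down q s N ε (l + 1) (m + -1)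

/-- A coefficient of `x₁*`. -/
def x1sDiag (q s N : ℝ) (ε : ℤˣ) (l m : ℝ) : ℝ := x1Diag q s N ε l (m + -1)

/-- A coefficient of `x₁*`. -/
def x1sDown (q s N : ℝ) (ε : ℤˣ) (l m : ℝ) : ℝ := x1Up q s N ε (l - 1) (m + -1)

/-- A coefficient of `x₀`. -/
def x0Up (q s N : ℝ) (ε : ℤˣ) (l m : ℝ) : ℝ := APlus q s (((ε : ℤ) : ℝ) * N) l m

/-- A coefficient of `x₀`. -/
def x0Diag (q s N : ℝ) (ε : ℤˣ) (l m : ℝ) : ℝ := AZero q s (((ε : ℤ) : ℝ) * N) l m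

/-- A coefficient of `x₀`. -/
def x0Down (q s N : ℝ) (ε : ℤˣ) (l m : ℝ) : ℝ := x0Up q s N ε (l - 1) m

theorem alphaCoef_eq_alphaNorm (hq0 : 0 < q) (hq1 : q < 1) {l : ℝ} (ε : ℤˣ) (hN : 1 / 2 ≤ |N|)
    (hl : |N| ≤ l) :
    alphaCoef q s (((ε : ℤ) : ℝ) * N) l = q ^ (2 * l) * alphaNorm q s N ε l :=
  alphaCoef_eq hq0 hq1 (by rwa [abs_sign_mul]) (hN.trans hl)

theorem betaCoef_eq_betaNorm (hq0 : 0 < q) (hq1 : q < 1) (ε : ℤˣ) (l : ℝ) :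
    betaCoef q s (((ε : ℤ) : ℝ) * N) l = q ^ (2 * l) * betaNorm q s N ε l :=
  betaCoef_eq hq0 hq1 _ l

theorem qnum_zero (q : ℝ) : qnum q 0 = 0 := by simp [qnum]

/-- One of the factors `[l + M]`, `[l - M]` is `[0]`; hence nothing leads below the lowest level. -/
theorem alphaCoef_abs (q s N : ℝ) (ε : ℤˣ) : alphaCoef q s (((ε : ℤ) : ℝ) * N) |N| = 0 := by
  have h : qnum q (|N| + ((ε : ℤ) : ℝ) * N) * qnum q (|N| - ((ε : ℤ) : ℝ) * N) = 0 := by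
    rcases Int.units_eq_one_or ε with rfl | rfl <;> rcases abs_cases N with ⟨h, -⟩ | ⟨h, -⟩ <;>
      simp [h, qnum_zero]
  rw [alphaCoef, mul_assoc (qnum q 2), h]
  simp

variable {l m : ℝ}

/-- In this and the following formulas the growth of the roots of `q`-numbers is cancelled by the
factor `q^(2l)` of `α` or `β`. A power of `q^(l + m)` remains, times factors tending to constants.
-/
theorem x1Diag_eq (hq0 : 0 < q) (hq1 : q < 1) (ε : ℤˣ) (h : 0 ≤ l - m) :
    x1Diag q s N ε l m = -(√(qnum q 2) * qfac q * q ^ (3 / 2 : ℝ))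
      * ((q ^ (l + m) * qroot q (l - m)) * qroot q (l + m + 1) * betaNorm q s N ε l) := by
  have e : q ^ (m + 2) * q ^ (-(l - m + (l + m + 1)) / 2) * q ^ (2 * l)
      = q ^ (3 / 2 : ℝ) * q ^ (l + m) := by
    rw [← Real.rpow_add hq0, ← Real.rpow_add hq0, ← Real.rpow_add hq0]
    ring_nf
  rw [x1Diag, BZero, betaCoef_eq_betaNorm hq0 hq1, mul_assoc (qnum q 2),
    Real.sqrt_mul (qnum_nonneg hq0 hq1 zero_le_two), sqrt_qnum_mul hq0 hq1 h]
  linear_combination -(√(qnum q 2) * qfac q * (qroot q (l - m) * qroot q (l + m + 1))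
    * betaNorm q s N ε l) * e

theorem x0Diag_eq (hq0 : 0 < q) (hq1 : q < 1) (ε : ℤˣ) : x0Diag q s N ε l m = qfac q * ((1 + q ^ 2 * (q ^ (2 * l)) ^ 2
      - (1 + q ^ 2) * (q ^ (l + m) * q ^ (l + m))) * betaNorm q s N ε l) := by
  have e1 := (Real.rpow_pos_of_pos hq0 l).ne'
  have e2 := (Real.rpow_pos_of_pos hq0 m).ne'
  rw [x0Diag, AZero, betaCoef_eq_betaNorm hq0 hq1, qnum_two hq0 hq1, qnum_eq, qnum_eq,
    rpow_two_mul hq0, Real.rpow_add hq0, Real.rpow_add hq0, Real.rpow_neg hq0.le,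
    Real.rpow_neg hq0.le, Real.rpow_sub hq0, rpow_two_mul hq0, Real.rpow_one]
  field_simp
  ring

/-- Here all powers of `q` depending on `l` and `m` cancel, so the limit need not vanish; this
transition keeps `l - m`, as `IsTri.decay_Y` requires. -/
theorem x1Up_eq (hq0 : 0 < q) (hq1 : q < 1) (hN : 1 / 2 ≤ |N|) (ε : ℤˣ)
    (hl : |N| ≤ l) (h : 0 ≤ l + m + 1) :
    x1Up q s N ε l m = qfac q * q ^ (1 / 2 : ℝ)
      * (qroot q (l + m + 1) * qroot q (l + m + 2) * alphaNorm q s N ε (l + 1)) := by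
  have e : q ^ (-l + m) * q ^ (-(l + m + 1 + (l + m + 2)) / 2) * q ^ (2 * (l + 1))
      = q ^ (1 / 2 : ℝ) := by
    rw [← Real.rpow_add hq0, ← Real.rpow_add hq0]
    ring_nf
  rw [x1Up, BPlus, alphaCoef_eq_alphaNorm hq0 hq1 ε hN (by linarith), sqrt_qnum_mul hq0 hq1 h]
  linear_combination (qfac q * (qroot q (l + m + 1) * qroot q (l + m + 2))
    * alphaNorm q s N ε (l + 1)) * e

theorem x1sDown_eq (hq0 : 0 < q) (hq1 : q < 1) (hN : 1 / 2 ≤ |N|) (ε : ℤˣ)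
    (hl : |N| ≤ l) (h : 0 ≤ l + m) :
    x1sDown q s N ε l m = qfac q * q ^ (1 / 2 : ℝ)
      * (qroot q (l + m + 0) * qroot q (l + m + -1) * alphaNorm q s N ε l) := by
  have e : q ^ (-(l - 1) + (m + -1)) * q ^ (-(l + m + 0 + (l + m + -1)) / 2) * q ^ (2 * l)
      = q ^ (1 / 2 : ℝ) := by
    rw [← Real.rpow_add hq0, ← Real.rpow_add hq0]
    ring_nf
  rw [x1sDown, x1Up, BPlus, sub_add_cancel, alphaCoef_eq_alphaNorm hq0 hq1 ε hN hl,
    mul_comm (qnum q _), show l - 1 + (m + -1) + 2 = l + m + 0 by ring,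
    show l - 1 + (m + -1) + 1 = l + m + -1 by ring, sqrt_qnum_mul hq0 hq1 (by linarith)]
  linear_combination (qfac q * (qroot q (l + m + 0) * qroot q (l + m + -1))
    * alphaNorm q s N ε l) * e

theorem x1Down_eq (hq0 : 0 < q) (hq1 : q < 1) (hN : 1 / 2 ≤ |N|) (ε : ℤˣ)
    (hl : |N| ≤ l) (h : 0 ≤ l - m) :
    x1Down q s N ε l m = -(qfac q * q ^ (3 / 2 : ℝ))
      * ((q ^ (l + m) * qroot q (l - m)) * (q ^ (l + m) * qroot q (l - m + -1))
        * alphaNorm q s N ε l) := by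
  have e : q ^ (l + m + 1) * q ^ (-(l - m + (l - m - 1)) / 2) * q ^ (2 * l)
      = q ^ (3 / 2 : ℝ) * (q ^ (l + m) * q ^ (l + m)) := by
    rw [← Real.rpow_add hq0, ← Real.rpow_add hq0, ← Real.rpow_add hq0, ← Real.rpow_add hq0]
    ring_nf
  rw [x1Down, BMinus, alphaCoef_eq_alphaNorm hq0 hq1 ε hN hl, sqrt_qnum_mul hq0 hq1 h,
    ← sub_eq_add_neg]
  linear_combination -(qfac q * (qroot q (l - m) * qroot q (l - m - 1))
    * alphaNorm q s N ε l) * e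

theorem x0Up_eq (hq0 : 0 < q) (hq1 : q < 1) (hN : 1 / 2 ≤ |N|) (ε : ℤˣ)
    (hl : |N| ≤ l + 1) (h : 0 ≤ l - m + 1) :
    x0Up q s N ε l m = √(qnum q 2) * qfac q * q
      * ((q ^ (l + m) * qroot q (l - m + 1)) * qroot q (l + m + 1)
        * alphaNorm q s N ε (l + 1)) := by
  have e : q ^ m * q ^ (-(l - m + 1 + (l + m + 1)) / 2) * q ^ (2 * (l + 1))
      = q * q ^ (l + m) := by
    nth_rw 4 [← Real.rpow_one q]
    rw [← Real.rpow_add hq0, ← Real.rpow_add hq0, ← Real.rpow_add hq0]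
    ring_nf
  rw [x0Up, APlus, alphaCoef_eq_alphaNorm hq0 hq1 ε hN hl, mul_assoc (qnum q 2),
    Real.sqrt_mul (qnum_nonneg hq0 hq1 zero_le_two), sqrt_qnum_mul hq0 hq1 h]
  linear_combination (√(qnum q 2) * qfac q * (qroot q (l - m + 1) * qroot q (l + m + 1))
    * alphaNorm q s N ε (l + 1)) * e

/-! ### Symbols of the coefficients -/

theorem symCoef_x1Diag (hq0 : 0 < q) (hq1 : q < 1) : SymCoef N q (x1Diag q s N) 0 := by
  have h := (((symCoef_rpow_mul_qroot_sub (N := N) hq0 hq1 0).mul hq0 hq1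
    (symCoef_qroot_add hq0 hq1 1)).mul hq0 hq1 (symCoef_betaNorm (s := s) hq0 hq1 N)).const_mul
    hq0 hq1 (-(√(qnum q 2) * qfac q * q ^ (3 / 2 : ℝ)))
  simp only [zero_mul, mul_zero, add_zero] at h
  exact h.congr fun ε l m hl => x1Diag_eq hq0 hq1 ε (label_ineqs hl).2.2.2

theorem symCoef_x1sDiag (hq0 : 0 < q) (hq1 : q < 1) : SymCoef N q (x1sDiag q s N) 0 := by
  have h := (((symCoef_rpow_mul_qroot_sub (N := N) hq0 hq1 1).mul hq0 hq1
    (symCoef_qroot_add hq0 hq1 0)).mul hq0 hq1 (symCoef_betaNorm (s := s) hq0 hq1 N)).const_mul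
    hq0 hq1 (-(√(qnum q 2) * qfac q * q ^ (3 / 2 : ℝ) / q))
  simp only [zero_mul, mul_zero] at h
  refine h.congr fun ε l m hl => ?_
  rw [x1sDiag, x1Diag_eq hq0 hq1 ε (by linarith [(label_ineqs hl).2.2.2]),
    show l + (m + -1) + 1 = l + m + 0 by ring, show l - (m + -1) = l - m + 1 by ring,
    show l + (m + -1) = l + m - 1 by ring, Real.rpow_sub hq0, Real.rpow_one]
  ring

theorem symCoef_x0Diag (hq0 : 0 < q) (hq1 : q < 1) :
    SymCoef N q (x0Diag q s N) (1 - s ^ 2) := by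
  have h1 : SymCoef N q (fun _ l _ => 1 + q ^ 2 * (q ^ (2 * l)) ^ 2) 1 :=
    symCoef_of_lev (g := fun _ l => 1 + q ^ 2 * (q ^ (2 * l)) ^ 2) (C := 1) zero_le_one hq0
      fun ε l m hl => by
        rw [add_sub_cancel_left, ← rpow_two_mul hq0, ← Real.rpow_two, ← Real.rpow_add hq0, one_mul,
          abs_of_nonneg (Real.rpow_nonneg hq0.le _)]
        exact Real.rpow_le_rpow_of_exponent_ge hq0 hq1.le (by linarith [(label_ineqs hl).2.1])
  have h := ((h1.add ((((symCoef_rpow (N := N) hq0).mul hq0 hq1 (symCoef_rpow hq0)).const_mul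
    hq0 hq1 (-(1 + q ^ 2))))).mul hq0 hq1 (symCoef_betaNorm (s := s) hq0 hq1 N)).const_mul
    hq0 hq1 (qfac q)
  simp only [mul_zero, add_zero, one_mul,
    mul_div_cancel₀ _ (qfac_pos hq0 hq1).ne'] at h
  refine h.congr fun ε l m hl => ?_
  rw [x0Diag_eq hq0 hq1]
  ring

theorem symCoef_x1Up (hq0 : 0 < q) (hq1 : q < 1) (hs : 0 ≤ s) (hN : 1 / 2 ≤ |N|) :
    ∃ P, SymCoef N q (x1Up q s N) P :=
  ⟨_, ((((symCoef_qroot_add (N := N) hq0 hq1 1).mul hq0 hq1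
    (symCoef_qroot_add hq0 hq1 2)).mul hq0 hq1 (symCoef_alphaNorm_succ hq0 hq1 hs N)).const_mul
    hq0 hq1 (qfac q * q ^ (1 / 2 : ℝ))).congr fun ε l m hl =>
      x1Up_eq hq0 hq1 hN ε (label_ineqs hl).1 (by linarith [(label_ineqs hl).2.2.1])⟩

theorem symCoef_x1sDown (hq0 : 0 < q) (hq1 : q < 1) (hs : 0 ≤ s) (hN : 1 / 2 ≤ |N|) :
    ∃ P, SymCoef N q (x1sDown q s N) P :=
  ⟨_, ((((symCoef_qroot_add (N := N) hq0 hq1 0).mul hq0 hq1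
    (symCoef_qroot_add hq0 hq1 (-1))).mul hq0 hq1 (symCoef_alphaNorm hq0 hq1 hs N)).const_mul
    hq0 hq1 (qfac q * q ^ (1 / 2 : ℝ))).congr fun ε _ _ hl =>
      x1sDown_eq hq0 hq1 hN ε (label_ineqs hl).1 (label_ineqs hl).2.2.1⟩

theorem symCoef_x1Down (hq0 : 0 < q) (hq1 : q < 1) (hs : 0 ≤ s) (hN : 1 / 2 ≤ |N|) :
    SymCoef N q (x1Down q s N) 0 := by
  have h := (((symCoef_rpow_mul_qroot_sub (N := N) hq0 hq1 0).mul hq0 hq1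
    (symCoef_rpow_mul_qroot_sub hq0 hq1 (-1))).mul hq0 hq1
    (symCoef_alphaNorm hq0 hq1 hs N)).const_mul hq0 hq1 (-(qfac q * q ^ (3 / 2 : ℝ)))
  simp only [zero_mul, mul_zero, add_zero] at h
  exact h.congr fun ε l m hl =>
    x1Down_eq hq0 hq1 hN ε (label_ineqs hl).1 (label_ineqs hl).2.2.2

theorem symCoef_x1sUp (hq0 : 0 < q) (hq1 : q < 1) (hs : 0 ≤ s) (hN : 1 / 2 ≤ |N|) :
    SymCoef N q (x1sUp q s N) 0 := by
  have h := (((symCoef_rpow_mul_qroot_sub (N := N) hq0 hq1 2).mul hq0 hq1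
    (symCoef_rpow_mul_qroot_sub hq0 hq1 1)).mul hq0 hq1
    (symCoef_alphaNorm_succ hq0 hq1 hs N)).const_mul hq0 hq1 (-(qfac q * q ^ (3 / 2 : ℝ)))
  simp only [zero_mul, mul_zero] at h
  refine h.congr fun ε l m hl => ?_
  obtain ⟨i1, -, -, i3⟩ := label_ineqs hl
  rw [x1sUp, x1Down_eq hq0 hq1 hN ε (by linarith) (by linarith),
    show l + 1 + (m + -1) = l + m by ring, show l + 1 - (m + -1) + -1 = l - m + 1 by ring,
    show l + 1 - (m + -1) = l - m + 2 by ring]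

theorem symCoef_x0Up (hq0 : 0 < q) (hq1 : q < 1) (hs : 0 ≤ s) (hN : 1 / 2 ≤ |N|) :
    SymCoef N q (x0Up q s N) 0 := by
  have h := (((symCoef_rpow_mul_qroot_sub (N := N) hq0 hq1 1).mul hq0 hq1
    (symCoef_qroot_add hq0 hq1 1)).mul hq0 hq1
    (symCoef_alphaNorm_succ hq0 hq1 hs N)).const_mul hq0 hq1 (√(qnum q 2) * qfac q * q)
  simp only [zero_mul, mul_zero] at h
  exact h.congr fun ε l m hl =>
    x0Up_eq hq0 hq1 hN ε (by linarith [(label_ineqs hl).1]) (by linarith [(label_ineqs hl).2.2.2])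

theorem symCoef_x0Down (hq0 : 0 < q) (hq1 : q < 1) (hs : 0 ≤ s) (hN : 1 / 2 ≤ |N|) :
    SymCoef N q (x0Down q s N) 0 := by
  have h := (((symCoef_rpow_mul_qroot_sub (N := N) hq0 hq1 0).mul hq0 hq1
    (symCoef_qroot_add hq0 hq1 0)).mul hq0 hq1
    (symCoef_alphaNorm hq0 hq1 hs N)).const_mul hq0 hq1 (√(qnum q 2) * qfac q)
  simp only [zero_mul, mul_zero] at h
  refine h.congr fun ε l m hl => ?_
  obtain ⟨i1, -, -, i3⟩ := label_ineqs hl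
  rw [x0Down, x0Up_eq hq0 hq1 hN ε (by linarith) (by linarith), sub_add_cancel,
    show l - 1 - m + 1 = l - m + 0 by ring, show l - 1 + m + 1 = l + m + 0 by ring,
    show l - 1 + m = l + m - 1 by ring, Real.rpow_sub hq0, Real.rpow_one]
  field_simp

/-! ### Vanishing of the coefficients at the boundary -/

section Boundary

variable [hN : Fact (∃ k : ℤ, N = (k : ℝ) / 2)]

/-- A lowering transition leaves the range only if `l = |N|`, where `α` vanishes, or if `l + m` or
`l - m` is zero, where a root of `[0]` appears. -/
theorem vanishing_x0 : Vanishing N 0 (x0Up q s N) (x0Diag q s N) (x0Down q s N) := by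
  refine ⟨fun ε l m hl hn => ?_, fun ε l m hl hn => absurd (by rwa [add_zero]) hn,
    fun ε l m hl hn => ?_⟩
  · obtain ⟨⟨a, ha⟩, ⟨b, hb⟩, c, hc⟩ := isLabel_iff.1 hl
    exact absurd (isLabel_iff.2 ⟨⟨a + 1, by push_cast; linarith⟩, ⟨b + 1, by push_cast; linarith⟩,
      c + 1, by push_cast; linarith⟩) hn
  · obtain ⟨⟨a, ha⟩, ⟨b, hb⟩, c, hc⟩ := isLabel_iff.1 hl
    have e1 : l - 1 - m + 1 = c := by linarith
    have e2 : l - 1 + m + 1 = b := by linarith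
    rw [x0Down, x0Up, APlus, sub_add_cancel, e1, e2]
    rcases a with _ | a
    · rw [show l = |N| by push_cast at ha; linarith, alphaCoef_abs, mul_zero]
    rcases b with _ | b
    · simp [qnum_zero]
    rcases c with _ | c
    · simp [qnum_zero]
    push_cast at ha hb hc
    exact absurd (isLabel_iff.2 ⟨⟨a, by linarith⟩, ⟨b, by linarith⟩, c, by linarith⟩) hn

theorem vanishing_x1 : Vanishing N 1 (x1Up q s N) (x1Diag q s N) (x1Down q s N) := by
  refine ⟨fun ε l m hl hn => ?_, fun ε l m hl hn => ?_, fun ε l m hl hn => ?_⟩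
  · obtain ⟨⟨a, ha⟩, ⟨b, hb⟩, c, hc⟩ := isLabel_iff.1 hl
    exact absurd (isLabel_iff.2 ⟨⟨a + 1, by push_cast; linarith⟩, ⟨b + 2, by push_cast; linarith⟩,
      c, by linarith⟩) hn
  · rw [x1Diag, BZero, (isLabel_Y_iff hl).1 hn]
    simp [qnum_zero]
  · obtain ⟨⟨a, ha⟩, ⟨b, hb⟩, c, hc⟩ := isLabel_iff.1 hl
    rw [x1Down, BMinus, hc]
    rcases a with _ | a
    · rw [show l = |N| by push_cast at ha; linarith, alphaCoef_abs, mul_zero]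
    rcases c with _ | _ | c
    · simp [qnum_zero]
    · simp [qnum_zero]
    push_cast at ha hb hc
    exact absurd (isLabel_iff.2 ⟨⟨a, by linarith⟩, ⟨b, by linarith⟩, c, by linarith⟩) hn

theorem vanishing_x1s : Vanishing N (-1) (x1sUp q s N) (x1sDiag q s N) (x1sDown q s N) := by
  refine ⟨fun ε l m hl hn => ?_, fun ε l m hl hn => ?_, fun ε l m hl hn => ?_⟩
  · exact absurd (isLabel_V hl) hn
  · obtain ⟨⟨a, ha⟩, ⟨b, hb⟩, c, hc⟩ := isLabel_iff.1 hl
    have e : l + (m + -1) + 1 = b := by linarith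
    rw [x1sDiag, x1Diag, BZero, e]
    rcases b with _ | b
    · simp [qnum_zero]
    push_cast at hb
    exact absurd (isLabel_iff.2 ⟨⟨a, ha⟩, ⟨b, by linarith⟩, c + 1, by push_cast; linarith⟩) hn
  · obtain ⟨⟨a, ha⟩, ⟨b, hb⟩, c, hc⟩ := isLabel_iff.1 hl
    have e : l - 1 + (m + -1) + 1 = b - 1 := by linarith
    have e' : l - 1 + (m + -1) + 2 = b := by linarith
    rw [x1sDown, x1Up, BPlus, e, e', sub_add_cancel]
    rcases a with _ | a
    · rw [show l = |N| by push_cast at ha; linarith, alphaCoef_abs, mul_zero]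
    rcases b with _ | _ | b
    · simp [qnum_zero]
    · simp [qnum_zero]
    push_cast at ha hb hc
    exact absurd (isLabel_iff.2 ⟨⟨a, by linarith⟩, ⟨b, by linarith⟩, c, by linarith⟩) hn

theorem exists_isTri_of_symCoef {e P Z Q : ℝ} {p z n : ℤˣ → ℝ → ℝ → ℝ} (hq0 : 0 < q) (hq1 : q < 1)
    (he : |e| ≤ 1) (hp : SymCoef N q p P) (hz : SymCoef N q z Z) (hn : SymCoef N q n Q) :
    ∃ T : Spinors N →L[ℂ] Spinors N, IsTri T e p z n := by
  obtain ⟨C₁, h₁⟩ := hp.bounded hq0 hq1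
  obtain ⟨C₂, h₂⟩ := hz.bounded hq0 hq1
  obtain ⟨C₃, h₃⟩ := hn.bounded hq0 hq1
  exact exists_isTri (C := max C₁ (max C₂ C₃)) he
    (fun ε l m hl => (h₁ ε l m hl).trans (le_max_left _ _))
    (fun ε l m hl => (h₂ ε l m hl).trans ((le_max_left _ _).trans (le_max_right _ _)))
    (fun ε l m hl => (h₃ ε l m hl).trans ((le_max_right _ _).trans (le_max_right _ _)))

theorem exists_x0 (hq0 : 0 < q) (hq1 : q < 1) (hs : 0 ≤ s) (h2 : 1 / 2 ≤ |N|) :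
    ∃ T : Spinors N →L[ℂ] Spinors N, IsTri T 0 (x0Up q s N) (x0Diag q s N) (x0Down q s N) ∧
      HasScalarSymbol T := by
  have h₁ := symCoef_x0Up hq0 hq1 hs h2
  have h₂ := symCoef_x0Diag (s := s) (N := N) hq0 hq1
  have h₃ := symCoef_x0Down hq0 hq1 hs h2
  obtain ⟨T, hT⟩ := exists_isTri_of_symCoef hq0 hq1 (abs_zero.trans_le zero_le_one) h₁ h₂ h₃
  exact ⟨T, hT, hT.hasScalarSymbol hq0 hq1 (by simp) vanishing_x0 h₁ h₂ h₃ (Or.inl rfl)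
    (Or.inr rfl) (Or.inl rfl)⟩

theorem exists_x1 (hq0 : 0 < q) (hq1 : q < 1) (hs : 0 ≤ s) (h2 : 1 / 2 ≤ |N|) :
    ∃ T : Spinors N →L[ℂ] Spinors N, IsTri T 1 (x1Up q s N) (x1Diag q s N) (x1Down q s N) ∧
      HasScalarSymbol T := by
  obtain ⟨P, h₁⟩ := symCoef_x1Up hq0 hq1 hs h2
  have h₂ := symCoef_x1Diag (s := s) (N := N) hq0 hq1
  have h₃ := symCoef_x1Down hq0 hq1 hs h2
  obtain ⟨T, hT⟩ := exists_isTri_of_symCoef hq0 hq1 abs_one.le h₁ h₂ h₃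
  exact ⟨T, hT, hT.hasScalarSymbol hq0 hq1 (by simp) vanishing_x1 h₁ h₂ h₃ (Or.inr rfl)
    (Or.inl rfl) (Or.inl rfl)⟩

theorem exists_x1s (hq0 : 0 < q) (hq1 : q < 1) (hs : 0 ≤ s) (h2 : 1 / 2 ≤ |N|) :
    ∃ T : Spinors N →L[ℂ] Spinors N, IsTri T (-1) (x1sUp q s N) (x1sDiag q s N) (x1sDown q s N) ∧
      HasScalarSymbol T := by
  have h₁ := symCoef_x1sUp hq0 hq1 hs h2
  have h₂ := symCoef_x1sDiag (s := s) (N := N) hq0 hq1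
  obtain ⟨P, h₃⟩ := symCoef_x1sDown hq0 hq1 hs h2
  have he : |(-1 : ℝ)| ≤ 1 := by simp
  obtain ⟨T, hT⟩ := exists_isTri_of_symCoef hq0 hq1 he h₁ h₂ h₃
  exact ⟨T, hT, hT.hasScalarSymbol hq0 hq1 he vanishing_x1s h₁ h₂ h₃ (Or.inl rfl)
    (Or.inl rfl) (Or.inr rfl)⟩

end Boundary

end Coefficients

end Podles

end

/-! ### Scalar identities behind the defining relations -/

noncomputable section

namespace Podles

/-! ### Recursion relations for the coefficients `α` and `β` -/

section Recursion

variable {q s M l : ℝ}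

/-- The diagonal coefficient `[2l] - q^(l+m+1) [2] [l-m]` of `x₀`, up to `β`, at `m → ∞`. -/
def lamInf (q x : ℝ) : ℝ := qfac q * (x⁻¹ ^ 2 + q ^ 2 * x ^ 2)

theorem lamInf_rpow (hq0 : 0 < q) (l : ℝ) :
    lamInf q (q ^ l) = qfac q * ((q ^ (2 * l))⁻¹ + q ^ 2 * q ^ (2 * l)) := by
  rw [lamInf, inv_pow, rpow_two_mul hq0]

theorem qfac_mul (hq0 : 0 < q) (hq1 : q < 1) : qfac q * (1 - q ^ 2) = q := by
  have h := (inv_sub_self_pos hq0 hq1).ne'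
  rw [qfac, inv_mul_eq_iff_eq_mul₀ h]
  field_simp

theorem qfac_eq (hq0 : 0 < q) (hq1 : q < 1) : qfac q = q / (1 - q ^ 2) := by
  have : 1 - q ^ 2 ≠ 0 := by nlinarith
  rw [eq_div_iff this, qfac_mul hq0 hq1]

theorem qnum_of_rpow {z X : ℝ} (hq0 : 0 < q) (h : q ^ z = X) : qnum q z = qfac q * (X⁻¹ - X) := by
  rw [qnum_eq, Real.rpow_neg hq0.le, h]

theorem one_sub_rpow_mul_ne_zero (hq0 : 0 < q) (hq1 : q < 1) (hl : 0 < l) (k : ℕ) :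
    1 - (q ^ (2 * l)) ^ 2 * q ^ k ≠ 0 := by
  have h1 : q ^ (2 * l) < 1 := Real.rpow_lt_one hq0.le hq1 (by linarith)
  have h0 := Real.rpow_pos_of_pos hq0 (2 * l)
  have h2 : q ^ k ≤ 1 := pow_le_one₀ hq0.le hq1.le
  have h3 : (q ^ (2 * l)) ^ 2 < 1 := by nlinarith
  have h4 : 0 < q ^ k := pow_pos hq0 k
  nlinarith [sq_nonneg (q ^ (2 * l))]

/-- A rational identity in `q`, `s`, `q^M` and `q^(2l)`. It is what the components of the relations
that change `l` by one require. -/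
theorem betaCoef_succ_sub (hq0 : 0 < q) (hq1 : q < 1) (hl : 0 < l) :
    q ^ 2 * (qnum q (2 * l + 4) * betaCoef q s M (l + 1) - qnum q (2 * l) * betaCoef q s M l)
      = (1 - q ^ 2) * (1 - s ^ 2) := by
  have hk := (qfac_pos hq0 hq1).ne'
  have ht := (Real.rpow_pos_of_pos hq0 M).ne'
  have hu := (Real.rpow_pos_of_pos hq0 (2 * l)).ne'
  have e0 := one_sub_rpow_mul_ne_zero hq0 hq1 hl 0
  have e4 := one_sub_rpow_mul_ne_zero hq0 hq1 hl 4
  have e8 := one_sub_rpow_mul_ne_zero hq0 hq1 hl 8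
  have hn : qnum q (2 * l + 4)
      = qfac q * (q ^ (2 * l) * q ^ 4)⁻¹ * (1 - (q ^ (2 * l)) ^ 2 * q ^ 8) := by
    exact_mod_cast qnum_two_mul_add hq0 l 4
  have hs : q ^ (2 * (l + 1)) = q ^ (2 * l) * q ^ 2 := by
    rw [mul_add, Real.rpow_add hq0, mul_one, Real.rpow_two]
  rw [betaCoef_eq hq0 hq1, betaCoef_eq hq0 hq1, hs, hn, qnum_two_mul hq0, betaFun, betaFun]
  generalize q ^ (2 * l) = u at *
  generalize q ^ M = t at *
  generalize qfac q = k at *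
  rw [pow_zero, mul_one] at e0
  rw [show (u * q ^ 2) ^ 2 * q ^ 4 = u ^ 2 * q ^ 8 by ring,
    show (u * q ^ 2) ^ 2 = u ^ 2 * q ^ 4 by ring]
  -- Naming the denominators keeps them unexpanded while they are cleared; they are restored
  -- afterwards for the polynomial check.
  generalize h0 : 1 - u ^ 2 = d0 at *
  generalize h4 : 1 - u ^ 2 * q ^ 4 = d4 at *
  generalize h8 : 1 - u ^ 2 * q ^ 8 = d8 at *
  field_simp
  rw [← h0, ← h4]
  ring

/-- `[2l - 1] [2l + 1] α_l²`. -/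
def gammaFun (q s t u : ℝ) : ℝ :=
  qnum q 2 * ((1 - u * t ^ 2) * (1 - u / t ^ 2)) * ((u * t + s ^ 2 / t) * (u * s ^ 2 / t + t))
    / (1 - u ^ 2) ^ 2

/-- Multiplying by `[2l - 1][2l + 1]` removes the denominator that vanishes at `l = 1/2`. At that
level `|M| = 1/2`, and both sides are zero. -/
theorem qnum_mul_alphaCoef_sq (hq0 : 0 < q) (hq1 : q < 1) (hM : |M| ≤ l) (h2 : 1 / 2 ≤ |M|) :
    qnum q (2 * l - 1) * qnum q (2 * l + 1) * alphaCoef q s M l ^ 2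
      = gammaFun q s (q ^ M) (q ^ (2 * l)) := by
  have hk := (qfac_pos hq0 hq1).ne'
  have hu := (Real.rpow_pos_of_pos hq0 (2 * l)).ne'
  have hl : 1 / 2 ≤ l := h2.trans hM
  rcases hl.eq_or_lt with rfl | hl'
  · have hu : q ^ (2 * (1 / 2 : ℝ)) = q := by norm_num
    have h0 : (1 - q * (q ^ M) ^ 2) * (1 - q / (q ^ M) ^ 2) = 0 := by
      rw [← rpow_two_mul hq0]
      rcases abs_cases M with ⟨h, -⟩ | ⟨h, -⟩
      · rw [show 2 * M = 1 by linarith, Real.rpow_one, div_self hq0.ne']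
        ring
      · rw [show 2 * M = -1 by linarith, Real.rpow_neg_one, mul_inv_cancel₀ hq0.ne']
        ring
    rw [gammaFun, hu, h0, show 2 * (1 / 2 : ℝ) - 1 = 0 by norm_num, qnum_zero]
    ring
  · have hZ : 1 - (q ^ (2 * l)) ^ 2 / q ^ 2 ≠ 0 := by
      rw [← rpow_two_mul hq0, ← Real.rpow_two, ← Real.rpow_sub hq0]
      exact (one_sub_rpow_pos hq0 hq1 (by linarith)).ne'
    have e2 := one_sub_rpow_mul_ne_zero hq0 hq1 (by linarith : 0 < l) 2
    have h1 := qnum_two_mul_add hq0 l 1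
    rw [Nat.cast_one, pow_one, mul_one] at h1
    rw [alphaCoef_sq hq0 hq1 hM hl, h1, qnum_two_mul_sub_one hq0, alphaFun, gammaFun]
    generalize q ^ (2 * l) = u at *
    generalize 1 - u ^ 2 / q ^ 2 = Z at *
    generalize 1 - u ^ 2 * q ^ 2 = W at *
    field_simp

set_option maxRecDepth 4000 in
theorem gammaFun_succ_sub (hq0 : 0 < q) (hq1 : q < 1) (hl : 0 < l) :
    gammaFun q s (q ^ M) (q ^ (2 * (l + 1))) - gammaFun q s (q ^ M) (q ^ (2 * l))
      = qnum q (2 * l + 1) * (betaCoef q s M l * (1 - q ^ 2)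
        * (lamInf q (q ^ l) * betaCoef q s M l - (1 - s ^ 2))) := by
  have ht := (Real.rpow_pos_of_pos hq0 M).ne'
  have hu := (Real.rpow_pos_of_pos hq0 (2 * l)).ne'
  have e0 := one_sub_rpow_mul_ne_zero hq0 hq1 hl 0
  have e4 := one_sub_rpow_mul_ne_zero hq0 hq1 hl 4
  have hs : q ^ (2 * (l + 1)) = q ^ (2 * l) * q ^ 2 := by
    rw [mul_add, Real.rpow_add hq0, mul_one, Real.rpow_two]
  have h1 : qnum q (2 * l + 1)
      = qfac q * (q ^ (2 * l) * q)⁻¹ * (1 - (q ^ (2 * l)) ^ 2 * q ^ 2) := by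
    have := qnum_two_mul_add hq0 l 1
    rwa [Nat.cast_one, pow_one] at this
  have hq2 : 1 - q ^ 2 ≠ 0 := by nlinarith
  rw [betaCoef_eq hq0 hq1, hs, h1, lamInf_rpow hq0, betaFun, gammaFun,
    gammaFun, qnum_two hq0 hq1, qfac_eq hq0 hq1]
  generalize q ^ (2 * l) = u at *
  generalize q ^ M = t at *
  rw [pow_zero, mul_one] at e0
  rw [show (u * q ^ 2) ^ 2 = u ^ 2 * q ^ 4 by ring]
  generalize h0 : 1 - u ^ 2 = d0 at *
  generalize h4 : 1 - u ^ 2 * q ^ 4 = d4 at *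
  generalize h2 : 1 - q ^ 2 = d2 at *
  field_simp
  rw [← h0, ← h4, ← h2]
  ring

-- The last summand is the constant term of the quadratic relations between `x₀`, `x₁` and `x₁*`;
-- the identity fixes the value that the recursion for `α²` leaves free.
set_option maxRecDepth 4000 in
theorem gammaFun_eq (hq0 : 0 < q) (hq1 : q < 1) (hl : 0 < l) :
    q ^ 2 * qnum q 2 * gammaFun q s (q ^ M) (q ^ (2 * l))
      = (1 + q ^ 2) * q ^ 3 * q ^ (2 * l) * betaCoef q s M l
          * (lamInf q (q ^ l) * betaCoef q s M l - (1 - s ^ 2))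
        + (1 + q ^ 2) ^ 2 * q ^ 2 * qfac q ^ 2 * betaCoef q s M l ^ 2
        - lamInf q (q ^ l) ^ 2 * betaCoef q s M l ^ 2
        + (1 - q ^ 2) * (1 - s ^ 2) * lamInf q (q ^ l) * betaCoef q s M l
        + (1 + q ^ 2 * s ^ 2) * (q ^ 2 + s ^ 2) := by
  have ht := (Real.rpow_pos_of_pos hq0 M).ne'
  have hu := (Real.rpow_pos_of_pos hq0 (2 * l)).ne'
  have e0 := one_sub_rpow_mul_ne_zero hq0 hq1 hl 0
  have e4 := one_sub_rpow_mul_ne_zero hq0 hq1 hl 4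
  have hq2 : 1 - q ^ 2 ≠ 0 := by nlinarith
  rw [betaCoef_eq hq0 hq1, lamInf_rpow hq0, betaFun, gammaFun,
    qnum_two hq0 hq1, qfac_eq hq0 hq1]
  generalize q ^ (2 * l) = u at *
  generalize q ^ M = t at *
  rw [pow_zero, mul_one] at e0
  generalize h0 : 1 - u ^ 2 = d0 at *
  generalize h4 : 1 - u ^ 2 * q ^ 4 = d4 at *
  generalize h2 : 1 - q ^ 2 = d2 at *
  field_simp
  rw [← h0, ← h4, ← h2]
  ring

end Recursion

end Podles

end

noncomputable section

namespace Podles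

/-! ### The relations of the Podleś sphere -/

section Relations

variable {q s M l m : ℝ}

theorem rpow_add_one (hq0 : 0 < q) (z : ℝ) : q ^ (z + 1) = q * q ^ z := by
  rw [Real.rpow_add hq0, Real.rpow_one, mul_comm]

theorem rpow_sub_one (hq0 : 0 < q) (z : ℝ) : q ^ (z - 1) = q ^ z / q := by
  rw [Real.rpow_sub hq0, Real.rpow_one]

theorem rpow_div_rpow_sub_one (hq0 : 0 < q) (l m : ℝ) :
    q ^ m / q ^ (l - 1) = q * (q ^ m / q ^ l) := by
  rw [rpow_sub_one hq0, div_div_eq_mul_div]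
  ring

theorem rpow_two_mul_add_one (hq0 : 0 < q) (l : ℝ) : q ^ (2 * l + 1) = q * (q ^ l) ^ 2 := by
  rw [rpow_add_one hq0, rpow_two_mul hq0]

theorem rpow_two_mul_add_three (hq0 : 0 < q) (l : ℝ) : q ^ (2 * l + 3) = q ^ 3 * (q ^ l) ^ 2 := by
  rw [Real.rpow_add hq0, rpow_two_mul hq0, mul_comm]
  norm_cast

theorem rpow_two_mul_add_four (hq0 : 0 < q) (l : ℝ) : q ^ (2 * l + 4) = q ^ 4 * (q ^ l) ^ 2 := by
  rw [Real.rpow_add hq0, rpow_two_mul hq0, mul_comm]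
  norm_cast

theorem rpow_two_mul_sub_one (hq0 : 0 < q) (l : ℝ) : q ^ (2 * l - 1) = (q ^ l) ^ 2 / q := by
  rw [rpow_sub_one hq0, rpow_two_mul hq0]

theorem rpow_add_add_one (hq0 : 0 < q) (l m : ℝ) :
    q ^ (l + m + 1) = q * (q ^ l * q ^ m) := by
  rw [rpow_add_one hq0, Real.rpow_add hq0]

theorem rpow_add_add_two (hq0 : 0 < q) (l m : ℝ) :
    q ^ (l + m + 2) = q ^ 2 * (q ^ l * q ^ m) := by
  rw [Real.rpow_add hq0, Real.rpow_add hq0, Real.rpow_two, mul_comm]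

theorem rpow_add_sub_one (hq0 : 0 < q) (l m : ℝ) :
    q ^ (l + m - 1) = q ^ l * q ^ m / q := by
  rw [rpow_sub_one hq0, Real.rpow_add hq0]

theorem rpow_sub_add_one (hq0 : 0 < q) (l m : ℝ) :
    q ^ (l - m + 1) = q * (q ^ l / q ^ m) := by
  rw [rpow_add_one hq0, Real.rpow_sub hq0]

theorem rpow_sub_add_two (hq0 : 0 < q) (l m : ℝ) :
    q ^ (l - m + 2) = q ^ 2 * (q ^ l / q ^ m) := by
  rw [Real.rpow_add hq0, Real.rpow_sub hq0, Real.rpow_two, mul_comm]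

theorem rpow_sub_sub_one (hq0 : 0 < q) (l m : ℝ) :
    q ^ (l - m - 1) = q ^ l / q ^ m / q := by
  rw [rpow_sub_one hq0, Real.rpow_sub hq0]

/-- The functions `gammaFun` at `l + 1` and at `l` share the factor `[2l + 1]`, which is nonzero and
cancels. -/
theorem alphaCoef_sq_succ_sub (hq0 : 0 < q) (hq1 : q < 1) (hM : |M| ≤ l) (h2 : 1 / 2 ≤ |M|) :
    qnum q (2 * l + 3) * alphaCoef q s M (l + 1) ^ 2 - qnum q (2 * l - 1) * alphaCoef q s M l ^ 2
      = betaCoef q s M l * (1 - q ^ 2)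
        * (lamInf q (q ^ l) * betaCoef q s M l - (1 - s ^ 2)) := by
  have hl : 0 < l := by linarith
  have h1 := qnum_mul_alphaCoef_sq (s := s) hq0 hq1 hM h2
  have h1' := qnum_mul_alphaCoef_sq (s := s) hq0 hq1 (by linarith : |M| ≤ l + 1) h2
  rw [show 2 * (l + 1) - 1 = 2 * l + 1 by ring, show 2 * (l + 1) + 1 = 2 * l + 3 by ring] at h1'
  refine mul_left_cancel₀ (qnum_pos hq0 hq1 (by linarith : 0 < 2 * l + 1)).ne' ?_
  rw [← gammaFun_succ_sub hq0 hq1 hl, ← h1, ← h1']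
  ring

/-- The square root of a `q`-number. -/
def rt (q x : ℝ) : ℝ := √(qnum q x)

theorem rt_mul_self (hq0 : 0 < q) (hq1 : q < 1) {z X : ℝ} (hz : 0 ≤ z) (h : q ^ z = X) :
    rt q z * rt q z = qfac q * (X⁻¹ - X) := by
  rw [rt, Real.mul_self_sqrt (qnum_nonneg hq0 hq1 hz), qnum_of_rpow hq0 h]

theorem rt_two_mul_self (hq0 : 0 < q) (hq1 : q < 1) : rt q 2 * rt q 2 = q + q⁻¹ := by
  rw [rt, Real.mul_self_sqrt (qnum_nonneg hq0 hq1 zero_le_two), qnum_two hq0 hq1]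

/-- The free parameters allow each argument to be supplied in normal form, so that equal roots
arising at different labels become syntactically equal. The next four lemmas have the same purpose.
-/
theorem BPlus_eq_rt {Z b b' l' : ℝ} (hq0 : 0 < q) (hq1 : q < 1) (hZ : q ^ m / q ^ l = Z)
    (hb : l + m + 1 = b) (hb' : l + m + 2 = b') (hl : l + 1 = l') (h : 0 ≤ b') :
    BPlus q s M l m = Z * (rt q b * rt q b') * alphaCoef q s M l' := by
  rw [BPlus, hb, hb', hl, Real.sqrt_mul' _ (qnum_nonneg hq0 hq1 h), Real.rpow_add hq0,
    Real.rpow_neg hq0.le, ← hZ, rt, rt]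
  ring

theorem BZero_eq_rt {Z b c l' : ℝ} (hq0 : 0 < q) (hq1 : q < 1) (hZ : q ^ 2 * q ^ m = Z)
    (hc : l - m = c) (hb : l + m + 1 = b) (hl : l = l') (h : 0 ≤ c) :
    BZero q s M l m = -Z * (rt q 2 * rt q c * rt q b) * betaCoef q s M l' := by
  rw [BZero, hb, hc, hl, mul_assoc (qnum q 2), Real.sqrt_mul (qnum_nonneg hq0 hq1 zero_le_two),
    Real.sqrt_mul (qnum_nonneg hq0 hq1 h), Real.rpow_add hq0, Real.rpow_two, ← hZ, rt, rt, rt]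
  ring

theorem BMinus_eq_rt {Z c c' l' : ℝ} (hq0 : 0 < q) (hq1 : q < 1) (hZ : q * q ^ l * q ^ m = Z)
    (hc : l - m = c) (hc' : l - m - 1 = c') (hl : l = l') (h : 0 ≤ c) :
    BMinus q s M l m = -Z * (rt q c * rt q c') * alphaCoef q s M l' := by
  rw [BMinus, hc', hc, Real.sqrt_mul (qnum_nonneg hq0 hq1 h), Real.rpow_add hq0,
    Real.rpow_add hq0, Real.rpow_one, ← hZ, hl, rt, rt]
  ring

theorem APlus_eq_rt {Y b c l' : ℝ} (hq0 : 0 < q) (hq1 : q < 1) (hY : q ^ m = Y)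
    (hc : l - m + 1 = c) (hb : l + m + 1 = b) (hl : l + 1 = l') (h : 0 ≤ c) :
    APlus q s M l m = Y * (rt q 2 * rt q c * rt q b) * alphaCoef q s M l' := by
  rw [APlus, hb, hc, hl, mul_assoc (qnum q 2), Real.sqrt_mul (qnum_nonneg hq0 hq1 zero_le_two),
    Real.sqrt_mul (qnum_nonneg hq0 hq1 h), hY, rt, rt, rt]
  ring

theorem AZero_eq_lamInf {X Y l' : ℝ} (hq0 : 0 < q) (hq1 : q < 1) (hX : q ^ l = X)
    (hY : q ^ m = Y) (hl : l = l') :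
    AZero q s M l m
      = (lamInf q X - qfac q * (1 + q ^ 2) * Y ^ 2) * betaCoef q s M l' := by
  subst hX hY hl
  have e1 := (Real.rpow_pos_of_pos hq0 l).ne'
  have e2 := (Real.rpow_pos_of_pos hq0 m).ne'
  rw [AZero, lamInf, qnum_two hq0 hq1, qnum_eq, qnum_eq, Real.rpow_neg hq0.le,
    Real.rpow_neg hq0.le, Real.rpow_sub hq0, rpow_two_mul hq0, Real.rpow_add hq0,
    Real.rpow_add hq0, Real.rpow_one]
  field_simp
  ring

/-! The coefficients of `x₀ x₁ - q² x₁ x₀ - (1 - q²) (1 - s²) x₁`. -/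

theorem x0_x1_add_two (hq0 : 0 < q) (hq1 : q < 1) (hb : 0 ≤ l + m) (hc : 0 ≤ l - m) :
    BPlus q s M l m * APlus q s M (l + 1) (m + 1)
      + -q ^ 2 * (APlus q s M l m * BPlus q s M (l + 1) m) = 0 := by
  have hx := (Real.rpow_pos_of_pos hq0 l).ne'
  rw [BPlus_eq_rt hq0 hq1 rfl rfl rfl rfl (by linarith : 0 ≤ l + m + 2),
    APlus_eq_rt hq0 hq1 (rpow_add_one hq0 m) (by ring : _ = l - m + 1) (by ring : _ = l + m + 3)
      (by ring : _ = l + 2) (by linarith),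
    APlus_eq_rt hq0 hq1 rfl rfl rfl rfl (by linarith : 0 ≤ l - m + 1),
    BPlus_eq_rt (l := l + 1) hq0 hq1 rfl (by ring : _ = l + m + 2) (by ring : _ = l + m + 3)
      (by ring : _ = l + 2) (by linarith), rpow_add_one hq0]
  field_simp
  ring

/-- After a common product of roots is removed, the coefficients of `β_{l+1}` and `β_l` are
proportional to `[2l + 4]` and `[2l]`, and the recursion for `β` concludes. -/
theorem x0_x1_add_one (hq0 : 0 < q) (hq1 : q < 1) (hl : 0 < l) (hb : 0 ≤ l + m)
    (hc : 0 ≤ l - m) :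
    BPlus q s M l m * AZero q s M (l + 1) (m + 1) + BZero q s M l m * APlus q s M l (m + 1)
      + -q ^ 2 * (APlus q s M l m * BZero q s M (l + 1) m + AZero q s M l m * BPlus q s M l m)
      + -((1 - q ^ 2) * (1 - s ^ 2)) * BPlus q s M l m = 0 := by
  have hx := (Real.rpow_pos_of_pos hq0 l).ne'
  have hy := (Real.rpow_pos_of_pos hq0 m).ne'
  have R := betaCoef_succ_sub (s := s) (M := M) hq0 hq1 hl
  rw [qnum_of_rpow hq0 (rpow_two_mul_add_four hq0 l), qnum_of_rpow hq0 (rpow_two_mul hq0 l)] at R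
  have h22 := rt_two_mul_self hq0 hq1
  have hC0 := rt_mul_self hq0 hq1 hc (Real.rpow_sub hq0 l m)
  have hC1 := rt_mul_self hq0 hq1 (by linarith) (rpow_sub_add_one hq0 l m)
  rw [BPlus_eq_rt hq0 hq1 rfl rfl rfl rfl (by linarith : 0 ≤ l + m + 2),
    AZero_eq_lamInf hq0 hq1 (rpow_add_one hq0 l) (rpow_add_one hq0 m) rfl,
    BZero_eq_rt hq0 hq1 rfl rfl rfl rfl hc,
    APlus_eq_rt hq0 hq1 (rpow_add_one hq0 m) (by ring : _ = l - m) (by ring : _ = l + m + 2)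
      rfl hc,
    APlus_eq_rt hq0 hq1 rfl rfl rfl rfl (by linarith : 0 ≤ l - m + 1),
    BZero_eq_rt (l := l + 1) hq0 hq1 rfl (by ring : _ = l - m + 1) (by ring : _ = l + m + 2) rfl
      (by linarith), AZero_eq_lamInf hq0 hq1 rfl rfl rfl]
  generalize q ^ l = x at *
  generalize q ^ m = y at *
  have k₁ : y / x * (lamInf q (q * x) - qfac q * (1 + q ^ 2) * (q * y) ^ 2)
      + q ^ 4 * y ^ 2 * (rt q 2 * rt q 2) * (rt q (l - m + 1) * rt q (l - m + 1))
      = y / x * q ^ 2 * (qfac q * ((q ^ 4 * x ^ 2)⁻¹ - q ^ 4 * x ^ 2)) := by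
    rw [h22, hC1, lamInf]
    field_simp
    ring
  have k₂ : q ^ 2 * (y / x) * (lamInf q x - qfac q * (1 + q ^ 2) * y ^ 2)
      + q ^ 3 * y ^ 2 * (rt q 2 * rt q 2) * (rt q (l - m) * rt q (l - m))
      = y / x * q ^ 2 * (qfac q * ((x ^ 2)⁻¹ - x ^ 2)) := by
    rw [h22, hC0, lamInf]
    field_simp
    ring
  linear_combination (rt q (l + m + 1) * rt q (l + m + 2) * alphaCoef q s M (l + 1))
    * (betaCoef q s M (l + 1) * k₁ - betaCoef q s M l * k₂ + y / x * R)

/-- Here the coefficients of `α_{l+1}²` and `α_l²` are proportional to `[2l + 3]` and `[2l - 1]`, so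
the recursion for `α²` applies. -/
theorem x0_x1_zero (hq0 : 0 < q) (hq1 : q < 1) (hM : |M| ≤ l) (h2 : 1 / 2 ≤ |M|) (hb : 0 ≤ l + m)
    (hc : 0 ≤ l - m - 1) :
    BPlus q s M l m * APlus q s M l (m + 1) + BZero q s M l m * AZero q s M l (m + 1)
      + BMinus q s M l m * APlus q s M (l - 1) (m + 1)
      + -q ^ 2 * (APlus q s M l m * BMinus q s M (l + 1) m + AZero q s M l m * BZero q s M l m
        + APlus q s M (l - 1) m * BPlus q s M (l - 1) m)
      + -((1 - q ^ 2) * (1 - s ^ 2)) * BZero q s M l m = 0 := by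
  have hx := (Real.rpow_pos_of_pos hq0 l).ne'
  have hy := (Real.rpow_pos_of_pos hq0 m).ne'
  have R := alphaCoef_sq_succ_sub (s := s) hq0 hq1 hM h2
  rw [qnum_of_rpow hq0 (rpow_two_mul_add_three hq0 l),
    qnum_of_rpow hq0 (rpow_two_mul_sub_one hq0 l)] at R
  have hB2 := rt_mul_self hq0 hq1 (by linarith) (rpow_add_add_two hq0 l m)
  have hB0 := rt_mul_self hq0 hq1 hb (Real.rpow_add hq0 l m)
  have hC1 := rt_mul_self hq0 hq1 (by linarith) (rpow_sub_add_one hq0 l m)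
  have hCm := rt_mul_self hq0 hq1 hc (rpow_sub_sub_one hq0 l m)
  rw [BPlus_eq_rt hq0 hq1 rfl rfl rfl rfl (by linarith : 0 ≤ l + m + 2),
    APlus_eq_rt hq0 hq1 (rpow_add_one hq0 m) (by ring : _ = l - m) (by ring : _ = l + m + 2)
      rfl (by linarith),
    BZero_eq_rt hq0 hq1 rfl rfl rfl rfl (by linarith : 0 ≤ l - m),
    AZero_eq_lamInf hq0 hq1 rfl (rpow_add_one hq0 m) rfl,
    BMinus_eq_rt hq0 hq1 rfl rfl rfl rfl (by linarith : 0 ≤ l - m),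
    APlus_eq_rt hq0 hq1 (rpow_add_one hq0 m) (by ring : _ = l - m - 1) (by ring : _ = l + m + 1)
      (by ring : _ = l) (by linarith),
    APlus_eq_rt hq0 hq1 rfl rfl rfl rfl (by linarith : 0 ≤ l - m + 1),
    BMinus_eq_rt (l := l + 1) hq0 hq1 rfl (by ring : _ = l - m + 1) (by ring : _ = l - m) rfl
      (by linarith),
    AZero_eq_lamInf hq0 hq1 rfl rfl rfl,
    APlus_eq_rt (l := l - 1) hq0 hq1 rfl (by ring : _ = l - m) (by ring : _ = l + m)
      (by ring : _ = l) (by linarith),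
    BPlus_eq_rt (l := l - 1) hq0 hq1 (rpow_div_rpow_sub_one hq0 l m) (by ring : _ = l + m)
      (by ring : _ = l + m + 1) (by ring : _ = l) (by linarith), rpow_add_one hq0 l]
  generalize q ^ l = x at *
  generalize q ^ m = y at *
  have k₁ : q * (y / x) * (rt q (l + m + 2) * rt q (l + m + 2))
      + q ^ 4 * x * y * (rt q (l - m + 1) * rt q (l - m + 1))
      = q ^ 2 * (qfac q * ((q ^ 3 * x ^ 2)⁻¹ - q ^ 3 * x ^ 2)) := by
    rw [hB2, hC1]
    field_simp
    ring
  have k₂ : q ^ 2 * x * y * (rt q (l - m - 1) * rt q (l - m - 1))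
      + q ^ 3 * (y / x) * (rt q (l + m) * rt q (l + m))
      = q ^ 2 * (qfac q * ((x ^ 2 / q)⁻¹ - x ^ 2 / q)) := by
    rw [hB0, hCm]
    field_simp
    ring
  linear_combination (rt q 2 * rt q (l - m) * rt q (l + m + 1) * y)
    * (alphaCoef q s M (l + 1) ^ 2 * k₁ - alphaCoef q s M l ^ 2 * k₂ + q ^ 2 * R)

theorem x0_x1_sub_one (hq0 : 0 < q) (hq1 : q < 1) (hl : 0 < l - 1) (hb : 0 ≤ l + m)
    (hc : 0 ≤ l - m - 1) :
    BZero q s M l m * APlus q s M (l - 1) (m + 1) + BMinus q s M l m * AZero q s M (l - 1) (m + 1)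
      + -q ^ 2 * (AZero q s M l m * BMinus q s M l m + APlus q s M (l - 1) m * BZero q s M (l - 1) m)
      + -((1 - q ^ 2) * (1 - s ^ 2)) * BMinus q s M l m = 0 := by
  have hx := (Real.rpow_pos_of_pos hq0 l).ne'
  have hy := (Real.rpow_pos_of_pos hq0 m).ne'
  have R := betaCoef_succ_sub (s := s) (M := M) hq0 hq1 hl
  rw [sub_add_cancel, qnum_of_rpow hq0 (rpow_two_mul_add_four hq0 (l - 1)),
    qnum_of_rpow hq0 (rpow_two_mul hq0 (l - 1)), rpow_sub_one hq0 l] at R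
  have h22 := rt_two_mul_self hq0 hq1
  have hB0 := rt_mul_self hq0 hq1 hb (Real.rpow_add hq0 l m)
  have hB1 := rt_mul_self hq0 hq1 (by linarith) (rpow_add_add_one hq0 l m)
  rw [BZero_eq_rt hq0 hq1 rfl rfl rfl rfl (by linarith : 0 ≤ l - m),
    APlus_eq_rt hq0 hq1 (rpow_add_one hq0 m) (by ring : _ = l - m - 1) (by ring : _ = l + m + 1)
      (by ring : _ = l) (by linarith),
    BMinus_eq_rt hq0 hq1 rfl rfl rfl rfl (by linarith : 0 ≤ l - m),
    AZero_eq_lamInf hq0 hq1 (rpow_sub_one hq0 l) (rpow_add_one hq0 m) rfl,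
    AZero_eq_lamInf hq0 hq1 rfl rfl rfl,
    APlus_eq_rt (l := l - 1) hq0 hq1 rfl (by ring : _ = l - m) (by ring : _ = l + m)
      (by ring : _ = l) (by linarith),
    BZero_eq_rt (l := l - 1) hq0 hq1 rfl (by ring : _ = l - m - 1) (by ring : _ = l + m) rfl
      (by linarith)]
  generalize q ^ l = x at *
  generalize q ^ m = y at *
  have k₁ : -(q ^ 3 * y ^ 2) * (rt q 2 * rt q 2) * (rt q (l + m + 1) * rt q (l + m + 1))
      + q ^ 3 * x * y * (lamInf q x - qfac q * (1 + q ^ 2) * y ^ 2)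
      = -(q ^ 3 * x * y) * (qfac q * ((q ^ 4 * (x / q) ^ 2)⁻¹ - q ^ 4 * (x / q) ^ 2)) := by
    rw [h22, hB1, lamInf]
    field_simp
    ring
  have k₂ : -(q * x * y) * (lamInf q (x / q) - qfac q * (1 + q ^ 2) * (q * y) ^ 2)
      + q ^ 4 * y ^ 2 * (rt q 2 * rt q 2) * (rt q (l + m) * rt q (l + m))
      = q ^ 3 * x * y * (qfac q * (((x / q) ^ 2)⁻¹ - (x / q) ^ 2)) := by
    rw [h22, hB0, lamInf]
    field_simp
    ring
  linear_combination (rt q (l - m) * rt q (l - m - 1) * alphaCoef q s M l)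
    * (betaCoef q s M l * k₁ + betaCoef q s M (l - 1) * k₂ - q * x * y * R)

theorem x0_x1_sub_two (hq0 : 0 < q) (hq1 : q < 1) (hc : 0 ≤ l - m - 2) :
    BMinus q s M l m * APlus q s M (l - 1 - 1) (m + 1)
      + -q ^ 2 * (APlus q s M (l - 1) m * BMinus q s M (l - 1) m) = 0 := by
  rw [BMinus_eq_rt hq0 hq1 rfl rfl rfl rfl (by linarith : 0 ≤ l - m),
    APlus_eq_rt hq0 hq1 (rpow_add_one hq0 m) (by ring : _ = l - m - 2) (by ring : _ = l + m)
      (by ring : _ = l - 1) hc,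
    APlus_eq_rt (l := l - 1) hq0 hq1 rfl (by ring : _ = l - m) (by ring : _ = l + m)
      (by ring : _ = l) (by linarith),
    BMinus_eq_rt (l := l - 1) hq0 hq1 rfl (by ring : _ = l - m - 1) (by ring : _ = l - m - 2) rfl
      (by linarith), rpow_sub_one hq0]
  field_simp
  ring

end Relations

end Podles

end

/-! ### The two quadratic relations -/

noncomputable section

namespace Podles

section Relations

variable {q s M l m : ℝ}

theorem rpow_add_neg_one (hq0 : 0 < q) (z : ℝ) : q ^ (z + -1) = q ^ z / q := by
  rw [← sub_eq_add_neg, rpow_sub_one hq0]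

theorem rpow_add_one_mul_rpow_add_neg_one (hq0 : 0 < q) (l m : ℝ) :
    q * q ^ (l + 1) * q ^ (m + -1) = q * q ^ l * q ^ m := by
  rw [rpow_add_one hq0, rpow_add_neg_one hq0]
  field_simp

theorem sq_mul_rpow_add_neg_one (hq0 : 0 < q) (m : ℝ) : q ^ 2 * q ^ (m + -1) = q * q ^ m := by
  rw [rpow_add_neg_one hq0]
  field_simp

theorem rpow_add_neg_one_div (hq0 : 0 < q) (l m : ℝ) :
    q ^ (m + -1) / q ^ (l - 1) = q ^ m / q ^ l := by
  rw [rpow_add_neg_one hq0, rpow_sub_one hq0]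
  field_simp

/-- At `z = 0` the number `[z - 1]` is negative and its root is `0`, so squaring does not recover
it; the factor `[z]` is zero there and saves the identity. -/
theorem rt_mul_rt_sub_one (hq0 : 0 < q) (hq1 : q < 1) {z X : ℝ} (hz : z = 0 ∨ 1 ≤ z)
    (h : q ^ (z - 1) = X) :
    rt q z * rt q z * (rt q (z - 1) * rt q (z - 1)) = rt q z * rt q z * (qfac q * (X⁻¹ - X)) := by
  rcases hz with rfl | hz
  · rw [rt, qnum_zero, Real.sqrt_zero]
    ring
  · rw [rt_mul_self hq0 hq1 (by linarith) h]

/-- `q² [2] [2l - 1] [2l + 1] α_l²` as a polynomial in `β_l`. -/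
theorem alphaCoef_sq_eq_betaCoef (hq0 : 0 < q) (hq1 : q < 1) (hM : |M| ≤ l) (h2 : 1 / 2 ≤ |M|) :
    q ^ 2 * (rt q 2 * rt q 2) * (qnum q (2 * l - 1) * qnum q (2 * l + 1) * alphaCoef q s M l ^ 2)
      = (1 + q ^ 2) * q ^ 3 * (q ^ l) ^ 2 * betaCoef q s M l
          * (lamInf q (q ^ l) * betaCoef q s M l - (1 - s ^ 2))
        + (1 + q ^ 2) ^ 2 * q ^ 2 * qfac q ^ 2 * betaCoef q s M l ^ 2
        - lamInf q (q ^ l) ^ 2 * betaCoef q s M l ^ 2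
        + (1 - q ^ 2) * (1 - s ^ 2) * lamInf q (q ^ l) * betaCoef q s M l
        + (1 + q ^ 2 * s ^ 2) * (q ^ 2 + s ^ 2) := by
  rw [qnum_mul_alphaCoef_sq hq0 hq1 hM h2, rt_two_mul_self hq0 hq1, ← qnum_two hq0 hq1,
    gammaFun_eq hq0 hq1 (by linarith), rpow_two_mul hq0]

/-! The coefficients of `q [2] x₁ x₁* + x₀² - (1 - q²) (1 - s²) x₀ - (1 + q² s²) (q² + s²)`. -/

theorem x1_x1s_add_two (hq0 : 0 < q) (hq1 : q < 1) (hb : 0 ≤ l + m) (hc : 0 ≤ l - m) :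
    (1 + q ^ 2) * (BMinus q s M (l + 1) (m + -1) * BPlus q s M (l + 1) (m + -1))
      + APlus q s M l m * APlus q s M (l + 1) m = 0 := by
  have hx := (Real.rpow_pos_of_pos hq0 l).ne'
  have h22 := rt_two_mul_self hq0 hq1
  rw [BMinus_eq_rt hq0 hq1 (rpow_add_one_mul_rpow_add_neg_one hq0 l m) (by ring : _ = l - m + 2)
      (by ring : _ = l - m + 1) rfl (by linarith),
    BPlus_eq_rt hq0 hq1 rfl (by ring : _ = l + m + 1) (by ring : _ = l + m + 2)
      (by ring : _ = l + 2) (by linarith),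
    APlus_eq_rt hq0 hq1 rfl rfl rfl rfl (by linarith : 0 ≤ l - m + 1),
    APlus_eq_rt (l := l + 1) hq0 hq1 rfl (by ring : _ = l - m + 2) (by ring : _ = l + m + 2)
      (by ring : _ = l + 2) (by linarith), rpow_add_one hq0, rpow_add_neg_one hq0]
  generalize q ^ l = x at *
  generalize q ^ m = y at *
  have k : (1 + q ^ 2) * (q * x * y * (y / q / (q * x))) = y ^ 2 * (rt q 2 * rt q 2) := by
    rw [h22]
    field_simp
    ring
  linear_combination -(rt q (l - m + 2) * rt q (l - m + 1) * rt q (l + m + 1) * rt q (l + m + 2)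
    * alphaCoef q s M (l + 1) * alphaCoef q s M (l + 2)) * k

theorem x1_x1s_add_one (hq0 : 0 < q) (hq1 : q < 1) (hl : 0 < l) (hb : 0 ≤ l + m)
    (hc : 0 ≤ l - m) :
    (1 + q ^ 2) * (BMinus q s M (l + 1) (m + -1) * BZero q s M (l + 1) (m + -1)
        + BZero q s M l (m + -1) * BPlus q s M l (m + -1))
      + (APlus q s M l m * AZero q s M (l + 1) m + AZero q s M l m * APlus q s M l m)
      + -((1 - q ^ 2) * (1 - s ^ 2)) * APlus q s M l m = 0 := by
  have hx := (Real.rpow_pos_of_pos hq0 l).ne'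
  have hy := (Real.rpow_pos_of_pos hq0 m).ne'
  have R := betaCoef_succ_sub (s := s) (M := M) hq0 hq1 hl
  rw [qnum_of_rpow hq0 (rpow_two_mul_add_four hq0 l), qnum_of_rpow hq0 (rpow_two_mul hq0 l)] at R
  have hB0 := rt_mul_self hq0 hq1 hb (Real.rpow_add hq0 l m)
  have hC2 := rt_mul_self hq0 hq1 (by linarith) (rpow_sub_add_two hq0 l m)
  rw [BMinus_eq_rt hq0 hq1 (rpow_add_one_mul_rpow_add_neg_one hq0 l m) (by ring : _ = l - m + 2)
      (by ring : _ = l - m + 1) rfl (by linarith),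
    BZero_eq_rt (l := l + 1) hq0 hq1 (sq_mul_rpow_add_neg_one hq0 m) (by ring : _ = l - m + 2)
      (by ring : _ = l + m + 1) rfl (by linarith),
    BZero_eq_rt hq0 hq1 (sq_mul_rpow_add_neg_one hq0 m) (by ring : _ = l - m + 1)
      (by ring : _ = l + m) rfl (by linarith),
    BPlus_eq_rt hq0 hq1 rfl (by ring : _ = l + m) (by ring : _ = l + m + 1)
      rfl (by linarith),
    APlus_eq_rt hq0 hq1 rfl rfl rfl rfl (by linarith : 0 ≤ l - m + 1),
    AZero_eq_lamInf hq0 hq1 (rpow_add_one hq0 l) rfl rfl,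
    AZero_eq_lamInf hq0 hq1 rfl rfl rfl, rpow_add_neg_one hq0]
  generalize q ^ l = x at *
  generalize q ^ m = y at *
  have k₁ : (1 + q ^ 2) * (q ^ 2 * x * y) * (rt q (l - m + 2) * rt q (l - m + 2))
      + (lamInf q (q * x) - qfac q * (1 + q ^ 2) * y ^ 2)
      = q ^ 2 * (qfac q * ((q ^ 4 * x ^ 2)⁻¹ - q ^ 4 * x ^ 2)) := by
    rw [hC2, lamInf]
    field_simp
    ring
  have k₂ : (1 + q ^ 2) * (q * (y / q / x)) * (rt q (l + m) * rt q (l + m))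
      - (lamInf q x - qfac q * (1 + q ^ 2) * y ^ 2)
      = q ^ 2 * (qfac q * ((x ^ 2)⁻¹ - x ^ 2)) := by
    rw [hB0, lamInf]
    field_simp
    ring
  linear_combination (y * rt q 2 * rt q (l - m + 1) * rt q (l + m + 1) * alphaCoef q s M (l + 1))
    * (betaCoef q s M (l + 1) * k₁ - betaCoef q s M l * k₂ + R)

/-- The recursion eliminates `α_{l+1}²`; what multiplies `α_l²` then becomes the left side of
`alphaCoef_sq_eq_betaCoef`. The remaining polynomial in `β_l` vanishes identically. -/
theorem x1_x1s_zero (hq0 : 0 < q) (hq1 : q < 1) (hM : |M| ≤ l) (h2 : 1 / 2 ≤ |M|)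
    (hb' : l + m = 0 ∨ 1 ≤ l + m) (hc : 0 ≤ l - m) :
    (1 + q ^ 2) * (BMinus q s M (l + 1) (m + -1) * BMinus q s M (l + 1) (m + -1)
        + BZero q s M l (m + -1) * BZero q s M l (m + -1)
        + BPlus q s M (l - 1) (m + -1) * BPlus q s M (l - 1) (m + -1))
      + (APlus q s M l m * APlus q s M l m + AZero q s M l m * AZero q s M l m
        + APlus q s M (l - 1) m * APlus q s M (l - 1) m)
      + -((1 - q ^ 2) * (1 - s ^ 2)) * AZero q s M l m
      + -((1 + q ^ 2 * s ^ 2) * (q ^ 2 + s ^ 2)) * 1 = 0 := by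
  have hb : 0 ≤ l + m := hb'.elim ge_of_eq zero_le_one.trans
  have hx := (Real.rpow_pos_of_pos hq0 l).ne'
  have hy := (Real.rpow_pos_of_pos hq0 m).ne'
  have hq2 : 1 - q ^ 2 ≠ 0 := by nlinarith
  have R := alphaCoef_sq_succ_sub (s := s) hq0 hq1 hM h2
  have R' := alphaCoef_sq_eq_betaCoef (s := s) hq0 hq1 hM h2
  rw [qnum_of_rpow hq0 (rpow_two_mul_add_three hq0 l),
    qnum_of_rpow hq0 (rpow_two_mul_sub_one hq0 l)] at R
  rw [qnum_of_rpow hq0 (rpow_two_mul_add_one hq0 l),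
    qnum_of_rpow hq0 (rpow_two_mul_sub_one hq0 l)] at R'
  have h22 := rt_two_mul_self hq0 hq1
  have hB0 := rt_mul_self hq0 hq1 hb (Real.rpow_add hq0 l m)
  have hB1 := rt_mul_self hq0 hq1 (by linarith) (rpow_add_add_one hq0 l m)
  have hC0 := rt_mul_self hq0 hq1 hc (Real.rpow_sub hq0 l m)
  have hC1 := rt_mul_self hq0 hq1 (by linarith) (rpow_sub_add_one hq0 l m)
  have hC2 := rt_mul_self hq0 hq1 (by linarith) (rpow_sub_add_two hq0 l m)
  have hB0m : rt q (l + m) * rt q (l + m) * (rt q (l + m - 1) * rt q (l + m - 1))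
      = rt q (l + m) * rt q (l + m)
        * (qfac q * ((q ^ l * q ^ m / q)⁻¹ - q ^ l * q ^ m / q)) := by
    exact rt_mul_rt_sub_one hq0 hq1 hb' (rpow_add_sub_one hq0 l m)
  rw [BMinus_eq_rt hq0 hq1 (rpow_add_one_mul_rpow_add_neg_one hq0 l m) (by ring : _ = l - m + 2)
      (by ring : _ = l - m + 1) rfl (by linarith),
    BZero_eq_rt hq0 hq1 (sq_mul_rpow_add_neg_one hq0 m) (by ring : _ = l - m + 1)
      (by ring : _ = l + m) rfl (by linarith),
    BPlus_eq_rt hq0 hq1 (rpow_add_neg_one_div hq0 l m) (by ring : _ = l + m - 1)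
      (by ring : _ = l + m) (by ring : _ = l) (by linarith),
    APlus_eq_rt hq0 hq1 rfl rfl rfl rfl (by linarith : 0 ≤ l - m + 1),
    AZero_eq_lamInf hq0 hq1 rfl rfl rfl,
    APlus_eq_rt (l := l - 1) hq0 hq1 rfl (by ring : _ = l - m) (by ring : _ = l + m)
      (by ring : _ = l) (by linarith)]
  generalize q ^ l = x at *
  generalize q ^ m = y at *
  generalize rt q (l + m) = b0 at *
  generalize rt q (l + m + 1) = b1 at *
  generalize rt q (l + m - 1) = bm at *
  generalize rt q (l - m) = c0 at *
  generalize rt q (l - m + 1) = c1 at *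
  generalize rt q (l - m + 2) = c2 at *
  generalize rt q 2 = r at *
  generalize alphaCoef q s M l = a at *
  generalize alphaCoef q s M (l + 1) = a' at *
  generalize betaCoef q s M l = b at *
  have hk := qfac_eq hq0 hq1
  have k₁ : (1 + q ^ 2) * (q * x * y) ^ 2 * (c2 * c2) + y ^ 2 * (r * r) * (b1 * b1)
      = (r * r) * (q ^ 2 * x * y) * (qfac q * ((q ^ 3 * x ^ 2)⁻¹ - q ^ 3 * x ^ 2)) := by
    rw [h22, hC2, hB1]
    field_simp
    ring
  have k₂ : (1 + q ^ 2) * (y / x) ^ 2 * (b0 * b0 * (bm * bm)) + y ^ 2 * (r * r) * (c0 * c0) * (b0 * b0)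
      = (b0 * b0) * (r * r) * (q * (y / x)) * (qfac q * ((x ^ 2 / q)⁻¹ - x ^ 2 / q)) := by
    rw [hB0m, h22, hC0]
    field_simp
    ring
  have k₃ : (r * r) * (q ^ 2 * x * y) * (c1 * c1) + (b0 * b0) * (r * r) * (q * (y / x))
      = q ^ 2 * (r * r) * (qfac q * ((q * x ^ 2)⁻¹ - q * x ^ 2)) := by
    rw [hB0, hC1, h22]
    field_simp
    ring
  have k₄ : (r * r) * (q ^ 2 * x * y) * (c1 * c1) * (1 - q ^ 2) * lamInf q x
      + (1 + q ^ 2) * (q * y) ^ 2 * (r * r) * (c1 * c1) * (b0 * b0)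
      + (lamInf q x - qfac q * (1 + q ^ 2) * y ^ 2) ^ 2
      + (1 + q ^ 2) * q ^ 3 * x ^ 2 * lamInf q x + (1 + q ^ 2) ^ 2 * q ^ 2 * qfac q ^ 2
      - lamInf q x ^ 2 = 0 := by
    rw [hB0, hC1, h22, lamInf, hk]
    field_simp
    ring
  have k₅ : (r * r) * (q ^ 2 * x * y) * (c1 * c1) * (1 - q ^ 2)
      + (1 - q ^ 2) * (lamInf q x - qfac q * (1 + q ^ 2) * y ^ 2)
      + (1 + q ^ 2) * q ^ 3 * x ^ 2 - (1 - q ^ 2) * lamInf q x = 0 := by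
    rw [hC1, h22, lamInf, hk]
    field_simp
    ring
  -- `k₁` and `k₂` collect the coefficients of `α_{l+1}²` and `α_l²`, `k₃` joins the two
  -- contributions to `α_l²` after elimination, and `k₄`, `k₅` are the parts quadratic and linear in
  -- `β_l`.
  linear_combination (a' ^ 2 * (c1 * c1)) * k₁ + a ^ 2 * k₂
    + ((r * r) * (q ^ 2 * x * y) * (c1 * c1)) * R
    + (a ^ 2 * (qfac q * ((x ^ 2 / q)⁻¹ - x ^ 2 / q))) * k₃ + R' + b ^ 2 * k₄
    - b * (1 - s ^ 2) * k₅

/-! The coefficients of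
`q [2] x₁* x₁ + q⁴ x₀² + q² (1 - q²) (1 - s²) x₀ - (1 + q² s²) (q² + s²)`. -/

theorem x1s_x1_add_two (hq0 : 0 < q) (hq1 : q < 1) (hb : 0 ≤ l + m) (hc : 0 ≤ l - m) :
    (1 + q ^ 2) * (BPlus q s M l m * BMinus q s M (l + 1 + 1) m)
      + q ^ 4 * (APlus q s M l m * APlus q s M (l + 1) m) = 0 := by
  have hx := (Real.rpow_pos_of_pos hq0 l).ne'
  have h22 := rt_two_mul_self hq0 hq1
  rw [BPlus_eq_rt hq0 hq1 rfl rfl rfl rfl (by linarith : 0 ≤ l + m + 2),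
    BMinus_eq_rt (l := l + 1 + 1) hq0 hq1 rfl (by ring : _ = l - m + 2)
      (by ring : _ = l - m + 1) (by ring : _ = l + 2) (by linarith),
    APlus_eq_rt hq0 hq1 rfl rfl rfl rfl (by linarith : 0 ≤ l - m + 1),
    APlus_eq_rt (l := l + 1) hq0 hq1 rfl (by ring : _ = l - m + 2) (by ring : _ = l + m + 2)
      (by ring : _ = l + 2) (by linarith), rpow_add_one hq0, rpow_add_one hq0]
  generalize q ^ l = x at *
  generalize q ^ m = y at *
  have k : (1 + q ^ 2) * (y / x * (q * (q * (q * x)) * y)) = q ^ 4 * y ^ 2 * (rt q 2 * rt q 2) := by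
    rw [h22]
    field_simp
    ring
  linear_combination -(rt q (l - m + 2) * rt q (l - m + 1) * rt q (l + m + 1) * rt q (l + m + 2)
    * alphaCoef q s M (l + 1) * alphaCoef q s M (l + 2)) * k

theorem x1s_x1_add_one (hq0 : 0 < q) (hq1 : q < 1) (hl : 0 < l) (hb : 0 ≤ l + m)
    (hc : 0 ≤ l - m) :
    (1 + q ^ 2) * (BPlus q s M l m * BZero q s M (l + 1) m + BZero q s M l m * BMinus q s M (l + 1) m)
      + q ^ 4 * (APlus q s M l m * AZero q s M (l + 1) m + AZero q s M l m * APlus q s M l m)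
      + q ^ 2 * ((1 - q ^ 2) * (1 - s ^ 2)) * APlus q s M l m = 0 := by
  have hx := (Real.rpow_pos_of_pos hq0 l).ne'
  have hy := (Real.rpow_pos_of_pos hq0 m).ne'
  have R := betaCoef_succ_sub (s := s) (M := M) hq0 hq1 hl
  rw [qnum_of_rpow hq0 (rpow_two_mul_add_four hq0 l), qnum_of_rpow hq0 (rpow_two_mul hq0 l)] at R
  have hB2 := rt_mul_self hq0 hq1 (by linarith) (rpow_add_add_two hq0 l m)
  have hC0 := rt_mul_self hq0 hq1 hc (Real.rpow_sub hq0 l m)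
  rw [BPlus_eq_rt hq0 hq1 rfl rfl rfl rfl (by linarith : 0 ≤ l + m + 2),
    BZero_eq_rt (l := l + 1) hq0 hq1 rfl (by ring : _ = l - m + 1) (by ring : _ = l + m + 2) rfl
      (by linarith),
    BZero_eq_rt hq0 hq1 rfl rfl rfl rfl hc,
    BMinus_eq_rt (l := l + 1) hq0 hq1 rfl (by ring : _ = l - m + 1) (by ring : _ = l - m) rfl
      (by linarith),
    APlus_eq_rt hq0 hq1 rfl rfl rfl rfl (by linarith : 0 ≤ l - m + 1),
    AZero_eq_lamInf hq0 hq1 (rpow_add_one hq0 l) rfl rfl,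
    AZero_eq_lamInf hq0 hq1 rfl rfl rfl, rpow_add_one hq0 l]
  generalize q ^ l = x at *
  generalize q ^ m = y at *
  have k₁ : (1 + q ^ 2) * (q ^ 2 * (y / x)) * (rt q (l + m + 2) * rt q (l + m + 2))
      - q ^ 4 * (lamInf q (q * x) - qfac q * (1 + q ^ 2) * y ^ 2)
      = q ^ 4 * (qfac q * ((q ^ 4 * x ^ 2)⁻¹ - q ^ 4 * x ^ 2)) := by
    rw [hB2, lamInf]
    field_simp
    ring
  have k₂ : (1 + q ^ 2) * (q ^ 4 * x * y) * (rt q (l - m) * rt q (l - m))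
      + q ^ 4 * (lamInf q x - qfac q * (1 + q ^ 2) * y ^ 2)
      = q ^ 4 * (qfac q * ((x ^ 2)⁻¹ - x ^ 2)) := by
    rw [hC0, lamInf]
    field_simp
    ring
  linear_combination (y * rt q 2 * rt q (l - m + 1) * rt q (l + m + 1) * alphaCoef q s M (l + 1))
    * (-betaCoef q s M (l + 1) * k₁ + betaCoef q s M l * k₂ - q ^ 2 * R)

/-- The elimination is that of `x1_x1s_zero`, with the roles of the edges `l + m = 0` and `l - m =
0` exchanged. -/
theorem x1s_x1_zero (hq0 : 0 < q) (hq1 : q < 1) (hM : |M| ≤ l) (h2 : 1 / 2 ≤ |M|)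
    (hb : 0 ≤ l + m) (hc' : l - m = 0 ∨ 1 ≤ l - m) :
    (1 + q ^ 2) * (BPlus q s M l m * BPlus q s M l m + BZero q s M l m * BZero q s M l m
        + BMinus q s M l m * BMinus q s M l m)
      + q ^ 4 * (APlus q s M l m * APlus q s M l m + AZero q s M l m * AZero q s M l m
        + APlus q s M (l - 1) m * APlus q s M (l - 1) m)
      + q ^ 2 * ((1 - q ^ 2) * (1 - s ^ 2)) * AZero q s M l m
      + -((1 + q ^ 2 * s ^ 2) * (q ^ 2 + s ^ 2)) * 1 = 0 := by
  have hc : 0 ≤ l - m := hc'.elim ge_of_eq zero_le_one.trans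
  have hx := (Real.rpow_pos_of_pos hq0 l).ne'
  have hy := (Real.rpow_pos_of_pos hq0 m).ne'
  have hq2 : 1 - q ^ 2 ≠ 0 := by nlinarith
  have R := alphaCoef_sq_succ_sub (s := s) hq0 hq1 hM h2
  have R' := alphaCoef_sq_eq_betaCoef (s := s) hq0 hq1 hM h2
  rw [qnum_of_rpow hq0 (rpow_two_mul_add_three hq0 l),
    qnum_of_rpow hq0 (rpow_two_mul_sub_one hq0 l)] at R
  rw [qnum_of_rpow hq0 (rpow_two_mul_add_one hq0 l),
    qnum_of_rpow hq0 (rpow_two_mul_sub_one hq0 l)] at R'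
  have h22 := rt_two_mul_self hq0 hq1
  have hB0 := rt_mul_self hq0 hq1 hb (Real.rpow_add hq0 l m)
  have hB1 := rt_mul_self hq0 hq1 (by linarith) (rpow_add_add_one hq0 l m)
  have hB2 := rt_mul_self hq0 hq1 (by linarith) (rpow_add_add_two hq0 l m)
  have hC0 := rt_mul_self hq0 hq1 hc (Real.rpow_sub hq0 l m)
  have hC1 := rt_mul_self hq0 hq1 (by linarith) (rpow_sub_add_one hq0 l m)
  have hC0m := rt_mul_rt_sub_one hq0 hq1 hc' (rpow_sub_sub_one hq0 l m)
  rw [BPlus_eq_rt hq0 hq1 rfl rfl rfl rfl (by linarith : 0 ≤ l + m + 2),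
    BZero_eq_rt hq0 hq1 rfl rfl rfl rfl hc, BMinus_eq_rt hq0 hq1 rfl rfl rfl rfl hc,
    APlus_eq_rt hq0 hq1 rfl rfl rfl rfl (by linarith : 0 ≤ l - m + 1),
    AZero_eq_lamInf hq0 hq1 rfl rfl rfl,
    APlus_eq_rt (l := l - 1) hq0 hq1 rfl (by ring : _ = l - m) (by ring : _ = l + m)
      (by ring : _ = l) (by linarith)]
  generalize q ^ l = x at *
  generalize q ^ m = y at *
  generalize rt q (l + m) = b0 at *
  generalize rt q (l + m + 1) = b1 at *
  generalize rt q (l + m + 2) = b2 at *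
  generalize rt q (l - m) = c0 at *
  generalize rt q (l - m + 1) = c1 at *
  generalize rt q (l - m - 1) = cm at *
  generalize rt q 2 = r at *
  generalize alphaCoef q s M l = a at *
  generalize alphaCoef q s M (l + 1) = a' at *
  generalize betaCoef q s M l = b at *
  have hk := qfac_eq hq0 hq1
  have k₁ : (1 + q ^ 2) * (y / x) ^ 2 * (b2 * b2) + q ^ 4 * y ^ 2 * (r * r) * (c1 * c1)
      = (r * r) * (q ^ 2 * (y / x)) * (qfac q * ((q ^ 3 * x ^ 2)⁻¹ - q ^ 3 * x ^ 2)) := by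
    rw [h22, hB2, hC1]
    field_simp
    ring
  have k₂ : (1 + q ^ 2) * (q * x * y) ^ 2 * (c0 * c0 * (cm * cm))
      + q ^ 4 * y ^ 2 * (r * r) * (c0 * c0) * (b0 * b0)
      = (c0 * c0) * (r * r) * (q ^ 3 * x * y) * (qfac q * ((x ^ 2 / q)⁻¹ - x ^ 2 / q)) := by
    rw [hC0m, h22, hB0]
    field_simp
    ring
  have k₃ : (r * r) * (q ^ 2 * (y / x)) * (b1 * b1) + (c0 * c0) * (r * r) * (q ^ 3 * x * y)
      = q ^ 2 * (r * r) * (qfac q * ((q * x ^ 2)⁻¹ - q * x ^ 2)) := by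
    rw [hB1, hC0, h22]
    field_simp
    ring
  have k₄ : (r * r) * (q ^ 2 * (y / x)) * (b1 * b1) * (1 - q ^ 2) * lamInf q x
      + (1 + q ^ 2) * (q ^ 2 * y) ^ 2 * (r * r) * (c0 * c0) * (b1 * b1)
      + q ^ 4 * (lamInf q x - qfac q * (1 + q ^ 2) * y ^ 2) ^ 2
      + (1 + q ^ 2) * q ^ 3 * x ^ 2 * lamInf q x + (1 + q ^ 2) ^ 2 * q ^ 2 * qfac q ^ 2
      - lamInf q x ^ 2 = 0 := by
    rw [hB1, hC0, h22, lamInf, hk]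
    field_simp
    ring
  have k₅ : (r * r) * (q ^ 2 * (y / x)) * (b1 * b1) * (1 - q ^ 2)
      - q ^ 2 * (1 - q ^ 2) * (lamInf q x - qfac q * (1 + q ^ 2) * y ^ 2)
      + (1 + q ^ 2) * q ^ 3 * x ^ 2 - (1 - q ^ 2) * lamInf q x = 0 := by
    rw [hB1, h22, lamInf, hk]
    field_simp
    ring
  linear_combination (a' ^ 2 * (b1 * b1)) * k₁ + a ^ 2 * k₂
    + ((r * r) * (q ^ 2 * (y / x)) * (b1 * b1)) * R
    + (a ^ 2 * (qfac q * ((x ^ 2 / q)⁻¹ - x ^ 2 / q))) * k₃ + R' + b ^ 2 * k₄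
    - b * (1 - s ^ 2) * k₅

end Relations

/-! ### Operator relations from the scalar identities -/

section Operators

variable {q s N : ℝ} [hN : Fact (∃ k : ℤ, N = (k : ℝ) / 2)] {T₀ T₁ T₁' : Spinors N →L[ℂ] Spinors N}

theorem eq_zero_or_one_le_add {l m : ℝ} (h : IsLabel N (l, m)) : l + m = 0 ∨ 1 ≤ l + m := by
  obtain ⟨-, ⟨b, hb⟩, -⟩ := isLabel_iff.1 h
  rw [hb]
  rcases b with _ | b
  · simp
  · right
    push_cast
    linarith [(Nat.cast_nonneg b : (0 : ℝ) ≤ b)]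

theorem eq_zero_or_one_le_sub {l m : ℝ} (h : IsLabel N (l, m)) : l - m = 0 ∨ 1 ≤ l - m := by
  obtain ⟨-, -, b, hb⟩ := isLabel_iff.1 h
  rw [hb]
  rcases b with _ | b
  · simp
  · right
    push_cast
    linarith [(Nat.cast_nonneg b : (0 : ℝ) ≤ b)]

theorem x0_mul_x1 (hq0 : 0 < q) (hq1 : q < 1) (h2 : 1 / 2 ≤ |N|)
    (h₀ : IsTri T₀ 0 (x0Up q s N) (x0Diag q s N) (x0Down q s N))
    (h₁ : IsTri T₁ 1 (x1Up q s N) (x1Diag q s N) (x1Down q s N)) :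
    T₀ * T₁ + ((-q ^ 2 : ℝ) : ℂ) • (T₁ * T₀)
      + ((-((1 - q ^ 2) * (1 - s ^ 2)) : ℝ) : ℂ) • T₁ = 0 := by
  refine (((h₀.mul h₁ vanishing_x1 (f := 1) (by ring)).add
    ((h₁.mul h₀ vanishing_x0 (f := 1) (by ring)).smul _)).add (h₁.isPenta.smul _)).eq_zero
    (fun ε l m hl hl' => ?_) (fun ε l m hl hl' => ?_) (fun ε l m hl hl' => ?_)
    (fun ε l m hl hl' => ?_) (fun ε l m hl hl' => ?_) <;>
    simp only [Pi.add_apply, Pi.smul_apply, smul_eq_mul, add_zero, mul_zero, x0Down,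
      add_sub_cancel_right, x0Up, x0Diag, x1Up, x1Diag, x1Down] <;>
    obtain ⟨i1, -, i2, i3⟩ := label_ineqs hl <;> obtain ⟨j1, -, j2, j3⟩ := label_ineqs hl' <;>
    -- The scalar identities are applied with `M = εN`, so the bounds must be stated for `|εN|`.
    rw [← abs_sign_mul ε] at i1 j1 h2
  · exact x0_x1_add_two hq0 hq1 i2 i3
  · exact x0_x1_add_one hq0 hq1 (by linarith) i2 i3
  · exact x0_x1_zero hq0 hq1 i1 h2 i2 (by linarith)
  · exact x0_x1_sub_one hq0 hq1 (by linarith) i2 (by linarith)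
  · exact x0_x1_sub_two hq0 hq1 (by linarith)

theorem x1_mul_x1s (hq0 : 0 < q) (hq1 : q < 1) (h2 : 1 / 2 ≤ |N|)
    (h₀ : IsTri T₀ 0 (x0Up q s N) (x0Diag q s N) (x0Down q s N))
    (h₁ : IsTri T₁ 1 (x1Up q s N) (x1Diag q s N) (x1Down q s N))
    (h₁' : IsTri T₁' (-1) (x1sUp q s N) (x1sDiag q s N) (x1sDown q s N)) :
    ((1 + q ^ 2 : ℝ) : ℂ) • (T₁ * T₁') + T₀ * T₀ + ((-((1 - q ^ 2) * (1 - s ^ 2)) : ℝ) : ℂ) • T₀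
      + ((-((1 + q ^ 2 * s ^ 2) * (q ^ 2 + s ^ 2)) : ℝ) : ℂ) • 1 = 0 := by
  refine (((((h₁.mul h₁' vanishing_x1s (f := 0) (by ring)).smul _).add
    (h₀.mul h₀ vanishing_x0 (f := 0) (by ring))).add (h₀.isPenta.smul _)).add
    (isPenta_one.smul _)).eq_zero
    (fun ε l m hl hl' => ?_) (fun ε l m hl hl' => ?_) (fun ε l m hl hl' => ?_)
    (fun ε l m hl hl' => ?_) (fun ε l m hl hl' => ?_) <;>
    simp only [Pi.add_apply, Pi.smul_apply, smul_eq_mul, add_zero, mul_zero, x0Down,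
      add_sub_cancel_right, x0Up, x0Diag, x1Up, x1Diag, x1Down, x1sUp, x1sDiag, x1sDown,
      Pi.zero_apply, Pi.one_apply] <;>
    obtain ⟨i1, -, i2, i3⟩ := label_ineqs hl <;> obtain ⟨j1, -, j2, j3⟩ := label_ineqs hl' <;>
    rw [← abs_sign_mul ε] at i1 j1 h2
  · exact x1_x1s_add_two hq0 hq1 i2 i3
  · exact x1_x1s_add_one hq0 hq1 (by linarith) i2 i3
  · exact x1_x1s_zero hq0 hq1 i1 h2 (eq_zero_or_one_le_add hl) i3
  -- The operator is self-adjoint, so the lowering components are the raising ones read from a lower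
  -- level.
  · have := x1_x1s_add_one (s := s) (M := ((ε : ℤ) : ℝ) * N) hq0 hq1
      (by linarith : 0 < l - 1) (by linarith : 0 ≤ l - 1 + m) (by linarith)
    rw [sub_add_cancel] at this
    linear_combination this
  · have := x1_x1s_add_two (s := s) (M := ((ε : ℤ) : ℝ) * N) hq0 hq1
      (by linarith : 0 ≤ l - 1 - 1 + m) (by linarith)
    rw [sub_add_cancel] at this
    linear_combination this

theorem x1s_mul_x1 (hq0 : 0 < q) (hq1 : q < 1) (h2 : 1 / 2 ≤ |N|)
    (h₀ : IsTri T₀ 0 (x0Up q s N) (x0Diag q s N) (x0Down q s N))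
    (h₁ : IsTri T₁ 1 (x1Up q s N) (x1Diag q s N) (x1Down q s N))
    (h₁' : IsTri T₁' (-1) (x1sUp q s N) (x1sDiag q s N) (x1sDown q s N)) :
    ((1 + q ^ 2 : ℝ) : ℂ) • (T₁' * T₁) + ((q ^ 4 : ℝ) : ℂ) • (T₀ * T₀)
      + ((q ^ 2 * ((1 - q ^ 2) * (1 - s ^ 2)) : ℝ) : ℂ) • T₀
      + ((-((1 + q ^ 2 * s ^ 2) * (q ^ 2 + s ^ 2)) : ℝ) : ℂ) • 1 = 0 := by
  refine (((((h₁'.mul h₁ vanishing_x1 (f := 0) (by ring)).smul _).add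
    ((h₀.mul h₀ vanishing_x0 (f := 0) (by ring)).smul _)).add (h₀.isPenta.smul _)).add
    (isPenta_one.smul _)).eq_zero
    (fun ε l m hl hl' => ?_) (fun ε l m hl hl' => ?_) (fun ε l m hl hl' => ?_)
    (fun ε l m hl hl' => ?_) (fun ε l m hl hl' => ?_) <;>
    simp only [Pi.add_apply, Pi.smul_apply, smul_eq_mul, add_zero, mul_zero, x0Down,
      add_sub_cancel_right, x0Up, x0Diag, x1Up, x1Diag, x1Down, x1sUp, x1sDiag, x1sDown,
      Pi.zero_apply, Pi.one_apply, sub_add_cancel, add_neg_cancel_right] <;>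
    obtain ⟨i1, -, i2, i3⟩ := label_ineqs hl <;> obtain ⟨j1, -, j2, j3⟩ := label_ineqs hl' <;>
    rw [← abs_sign_mul ε] at i1 j1 h2
  · exact x1s_x1_add_two hq0 hq1 i2 i3
  · exact x1s_x1_add_one hq0 hq1 (by linarith) i2 i3
  · exact x1s_x1_zero hq0 hq1 i1 h2 i2 (eq_zero_or_one_le_sub hl)
  · have := x1s_x1_add_one (s := s) (M := ((ε : ℤ) : ℝ) * N) hq0 hq1
      (by linarith : 0 < l - 1) (by linarith : 0 ≤ l - 1 + m) (by linarith)
    rw [sub_add_cancel] at this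
    linear_combination this
  · have := x1s_x1_add_two (s := s) (M := ((ε : ℤ) : ℝ) * N) hq0 hq1
      (by linarith : 0 ≤ l - 1 - 1 + m) (by linarith)
    rw [sub_add_cancel, sub_add_cancel] at this
    linear_combination this

end Operators

end Podles

end

noncomputable section

namespace Podles

/-! ### An operator whose zeta function has a pole at `1` -/

section Residue

variable {q s N : ℝ}

/-- For a coefficient independent of `m` one may take `m = l`, where the approximating function is
already within `O(q^(2l))` of its limit. -/
theorem SymCoef.abs_sub_le_rpow {g : ℤˣ → ℝ → ℝ} {a : ℝ} (hq0 : 0 < q) (hq1 : q < 1)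
    (h : SymCoef N q (fun ε l _ => g ε l) a) :
    ∃ C, 0 ≤ C ∧ ∀ ε l m, IsLabel N (l, m) → |g ε l - a| ≤ C * q ^ l := by
  obtain ⟨f, C, hC, hb⟩ := h
  refine ⟨2 * C, by positivity, fun ε l m hl => ?_⟩
  obtain ⟨-, i1, -, -⟩ := label_ineqs hl
  have hl' : IsLabel N (l, l) := ⟨hl.1, 0, by simp [abs_of_nonneg i1]⟩
  obtain ⟨h1, h2⟩ := hb ε l l hl'
  have h3 : C * q ^ (l + l) ≤ C * q ^ l :=
    mul_le_mul_of_nonneg_left (Real.rpow_le_rpow_of_exponent_ge hq0 hq1.le (by linarith)) hC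
  have := abs_sub_le (g ε l) (f (l + l)) a
  dsimp only at h1
  linarith

theorem exists_lower_bound {g : ℤˣ → ℝ → ℝ} {a : ℝ} (hq0 : 0 < q) (hq1 : q < 1) (ha : 0 < a)
    (h : SymCoef N q (fun ε l _ => g ε l) a) :
    ∃ j₀ : ℝ, ∀ ε l m, IsLabel N (l, m) → j₀ ≤ l → a / 2 ≤ g ε l := by
  obtain ⟨C, hC, hb⟩ := h.abs_sub_le_rpow hq0 hq1
  have ht : Tendsto (fun x : ℝ => C * q ^ x) atTop (𝓝 (C * 0)) :=
    (tendsto_rpow_atTop_of_base_lt_one q (by linarith) hq1).const_mul C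
  rw [mul_zero] at ht
  obtain ⟨j₀, hj⟩ := eventually_atTop.1 (ht.eventually (ge_mem_nhds (half_pos ha)))
  refine ⟨j₀, fun ε l m hl hlj => ?_⟩
  have h1 := (abs_le.1 (hb ε l m hl)).1
  have h2 := hj l hlj
  linarith

/-- At the bottom `m = -l` one has `l + m = 0`, so `q^(l + m)` does not decay and the limit differs
from the one for large `l + m`. -/
theorem symCoef_x0Diag_bottom (hq0 : 0 < q) (hq1 : q < 1) :
    SymCoef N q (fun ε l _ => x0Diag q s N ε l (-l)) (-q ^ 2 * (1 - s ^ 2)) := by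
  have h1 : SymCoef N q (fun _ l _ => -q ^ 2 + q ^ 2 * (q ^ (2 * l)) ^ 2) (-q ^ 2) :=
    symCoef_of_lev (g := fun _ l => -q ^ 2 + q ^ 2 * (q ^ (2 * l)) ^ 2) (C := 1) zero_le_one hq0
      fun ε l m hl => by
        rw [add_sub_cancel_left, ← rpow_two_mul hq0, ← Real.rpow_two, ← Real.rpow_add hq0, one_mul,
          abs_of_nonneg (Real.rpow_nonneg hq0.le _)]
        exact Real.rpow_le_rpow_of_exponent_ge hq0 hq1.le (by linarith [(label_ineqs hl).2.1])
  have h := (h1.mul hq0 hq1 (symCoef_betaNorm (s := s) hq0 hq1 N)).const_mul hq0 hq1 (qfac q)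
  rw [← mul_assoc, mul_comm (qfac q), mul_assoc, mul_div_cancel₀ _ (qfac_pos hq0 hq1).ne'] at h
  refine h.congr fun ε l m hl => ?_
  rw [x0Diag_eq hq0 hq1, add_neg_cancel, Real.rpow_zero]
  ring

theorem symCoef_x0Up_bottom (hq0 : 0 < q) (hq1 : q < 1) (hs : 0 ≤ s) (hN : 1 / 2 ≤ |N|) :
    SymCoef N q (fun ε l _ => x0Up q s N ε l (-l))
      (√(qnum q 2) * qfac q * q * (1 * qroot q 1 * (√(qnum q 2) / qfac q * s))) := by
  have h1 : SymCoef N q (fun _ l _ => qroot q (2 * l + 1)) 1 :=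
    symCoef_of_lev (g := fun _ l => qroot q (2 * l + 1)) (C := 1) zero_le_one hq0
      fun ε l m hl => by
        rw [one_mul]
        exact (abs_qroot_sub_one_le hq0 _).trans (Real.rpow_le_rpow_of_exponent_ge hq0 hq1.le
          (by linarith [(label_ineqs hl).2.1]))
  refine (((h1.mul hq0 hq1 (symCoef_const hq0 _)).mul hq0 hq1
    (symCoef_alphaNorm_succ hq0 hq1 hs N)).const_mul hq0 hq1 _).congr fun ε l m hl => ?_
  obtain ⟨i1, i2, -, -⟩ := label_ineqs hl
  rw [x0Up_eq hq0 hq1 hN ε (by linarith) (by linarith), add_neg_cancel, Real.rpow_zero, zero_add,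
    show l - -l + 1 = 2 * l + 1 by ring]
  ring

/-- The first square is that of `(1 + q²)(1 - s²)`, positive unless `s = 1`; in that case the second
one, proportional to `s²`, is positive. -/
theorem x0_bottom_limit_pos (hq0 : 0 < q) (hq1 : q < 1) (hs0 : 0 ≤ s) (hs1 : s ≤ 1) :
    0 < (1 - s ^ 2 + -1 * (-q ^ 2 * (1 - s ^ 2))) * (1 - s ^ 2 + -1 * (-q ^ 2 * (1 - s ^ 2)))
      + √(qnum q 2) * qfac q * q * (1 * qroot q 1 * (√(qnum q 2) / qfac q * s))
        * (√(qnum q 2) * qfac q * q * (1 * qroot q 1 * (√(qnum q 2) / qfac q * s))) := by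
  rcases hs1.eq_or_lt with rfl | hs
  · have h1 : 0 < √(qnum q 2) := Real.sqrt_pos.2 (qnum_pos hq0 hq1 two_pos)
    have h2 := qfac_pos hq0 hq1
    have h3 : 0 < qroot q 1 := Real.sqrt_pos.2 (one_sub_rpow_pos hq0 hq1 (by norm_num))
    have h4 : 0 < √(qnum q 2) * qfac q * q * (1 * qroot q 1 * (√(qnum q 2) / qfac q * 1)) := by
      positivity
    exact add_pos_of_nonneg_of_pos (mul_self_nonneg _) (mul_pos h4 h4)
  · have h1 : 0 < 1 - s ^ 2 := by nlinarith
    have h2 : 0 < 1 - s ^ 2 + -1 * (-q ^ 2 * (1 - s ^ 2)) := by nlinarith [sq_nonneg q]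
    exact add_pos_of_pos_of_nonneg (mul_pos h2 h2) (mul_self_nonneg _)

theorem IsPenta.ent_self {T : Spinors N →L[ℂ] Spinors N} {c₂ c₁ c₀ d₁ d₂ : ℤˣ → ℝ → ℝ → ℝ}
    (h : IsPenta T 0 c₂ c₁ c₀ d₁ d₂) (i : Idx N) : ent T i i = c₀ i.2 (lev i) (mag i) := by
  classical
  rw [ent, stdBasis_eq_ket, h _ _ _ (isLabel_idx i), add_zero]
  change (c₂ i.2 (lev i) (mag i) : ℂ) * ket N (lev i + 2) (mag i) i.2 i
    + (c₁ i.2 (lev i) (mag i) : ℂ) * ket N (lev i + 1) (mag i) i.2 i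
    + (c₀ i.2 (lev i) (mag i) : ℂ) * ket N (lev i) (mag i) i.2 i
    + (d₁ i.2 (lev i) (mag i) : ℂ) * ket N (lev i - 1) (mag i) i.2 i
    + (d₂ i.2 (lev i) (mag i) : ℂ) * ket N (lev i - 2) (mag i) i.2 i = _
  have e1 : lev i ≠ lev i - 1 := (sub_one_lt _).ne'
  have e2 : lev i ≠ lev i - 2 := (sub_lt_self _ two_pos).ne'
  simp only [ket_apply]
  simp [e1, e2]

variable [hN : Fact (∃ k : ℤ, N = (k : ℝ) / 2)] {T₀ : Spinors N →L[ℂ] Spinors N}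

/-- `S` represents `q[2]A`. Subtracting the limit `1 - s²` of the diagonal makes all coefficients
decay in `l + m`, and squaring makes the diagonal entries sums of squares, so no cancellation can
occur. -/
theorem exists_residue_sq (hq0 : 0 < q) (hq1 : q < 1) (hs0 : 0 ≤ s) (hs1 : s ≤ 1)
    (h2 : 1 / 2 ≤ |N|) (h₀ : IsTri T₀ 0 (x0Up q s N) (x0Diag q s N) (x0Down q s N))
    {S : Spinors N →L[ℂ] Spinors N} (hS : S = ((1 - s ^ 2 : ℝ) : ℂ) • 1 + ((-1 : ℝ) : ℂ) • T₀)
    (hsym : HasSymbol (S * S)) :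
    ∃ a b, b ≠ 0 ∧ HasPoleExpansion (SpecTriple.zeta (basis N) (diracAbs N) (S * S)) a b := by
  set z : ℤˣ → ℝ → ℝ → ℝ := fun ε l m => 1 - s ^ 2 + -1 * x0Diag q s N ε l m with hz
  have hST : IsTri S 0 (fun ε l m => -1 * x0Up q s N ε l m) z
      (fun ε l m => -1 * x0Down q s N ε l m) := by
    intro l m ε hl
    rw [hS]
    change ((1 - s ^ 2 : ℝ) : ℂ) • ket N l m ε + ((-1 : ℝ) : ℂ) • T₀ (ket N l m ε) = _
    rw [h₀ l m ε hl, hz, add_zero]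
    push_cast
    module
  have hv : Vanishing N 0 (fun ε l m => -1 * x0Up q s N ε l m) z
      (fun ε l m => -1 * x0Down q s N ε l m) :=
    ⟨fun ε l m h h' => by simp [vanishing_x0.up ε l m h h'],
      fun ε l m h h' => absurd (by rwa [add_zero]) h',
      fun ε l m h h' => by simp [vanishing_x0.down ε l m h h']⟩
  have hent : ∀ i, ent (S * S) i i = ((x0Up q s N i.2 (lev i) (mag i) ^ 2
      + z i.2 (lev i) (mag i) ^ 2 + x0Down q s N i.2 (lev i) (mag i) ^ 2 : ℝ) : ℂ) := by
    intro i
    rw [(hST.mul hST hv (add_zero 0).symm).ent_self i]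
    simp only [add_zero, x0Down, add_sub_cancel_right]
    congr 1
    ring
  have hz0 : SymCoef N q z 0 := by
    have h := (symCoef_const hq0 (1 - s ^ 2)).add
      ((symCoef_x0Diag (s := s) (N := N) hq0 hq1).const_mul hq0 hq1 (-1))
    rwa [show 1 - s ^ 2 + -1 * (1 - s ^ 2) = 0 by ring] at h
  have hsum := (((symCoef_x0Up hq0 hq1 hs0 h2).mul hq0 hq1 (symCoef_x0Up hq0 hq1 hs0 h2)).add
    (hz0.mul hq0 hq1 hz0)).add ((symCoef_x0Down hq0 hq1 hs0 h2).mul hq0 hq1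
      (symCoef_x0Down hq0 hq1 hs0 h2))
  rw [mul_zero, add_zero, add_zero] at hsum
  obtain ⟨C, hC, hb⟩ := hsum.abs_le_of_zero hq0 hq1
  have hzb : SymCoef N q (fun ε l _ => z ε l (-l)) (1 - s ^ 2 + -1 * (-q ^ 2 * (1 - s ^ 2))) :=
    (symCoef_const hq0 (1 - s ^ 2)).add ((symCoef_x0Diag_bottom hq0 hq1).const_mul hq0 hq1 (-1))
  have hpb := symCoef_x0Up_bottom hq0 hq1 hs0 h2
  have hpos := x0_bottom_limit_pos hq0 hq1 hs0 hs1
  obtain ⟨j₀, hj⟩ := exists_lower_bound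
    (g := fun ε l => z ε l (-l) * z ε l (-l) + x0Up q s N ε l (-l) * x0Up q s N ε l (-l))
    hq0 hq1 hpos ((hzb.mul hq0 hq1 hzb).add (hpb.mul hq0 hq1 hpb))
  have hr1 : √q < 1 := by rw [Real.sqrt_lt' one_pos]; simpa using hq1
  refine hsym.exists_residue_ne_zero (j₀ := j₀) hC (Real.sqrt_pos.2 hq0) hr1 (half_pos hpos)
    (fun i => ?_) (fun i => ?_) fun i hi hji => ?_
  · rw [hent, Complex.norm_real, Real.norm_eq_abs, sq, sq, sq]
    exact hb i.2 (lev i) (mag i) (isLabel_idx i)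
  · rw [hent, Complex.ofReal_re]
    positivity
  -- On the bottom line two of the three squares already have a positive limit; the third is
  -- dropped.
  · have := hj i.2 (lev i) (mag i) (isLabel_idx i) hji
    rw [hent, Complex.ofReal_re, eq_neg_of_add_eq_zero_right hi]
    nlinarith [sq_nonneg (x0Down q s N i.2 (lev i) (-lev i))]

end Residue

end Podles

end

noncomputable section

namespace Podles

/-! ### The spinor representation -/

section Relations

variable {R : Type} [Ring R] [Algebra ℂ R] {q s b : ℂ} {t₀ t₁ t₁' : R}

/-- The operators representing the generators, in terms of those representing `x₀`, `x₁`, `x₁*`. -/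
def opGen (q s b : ℂ) (t₀ t₁ t₁' : R) : Gen → R
  | .A => (1 + q ^ 2)⁻¹ • ((1 - s ^ 2) • 1 - t₀)
  | .B => b • t₁
  | .Bstar => b • t₁'

theorem opGen_A_mul_B (h : t₀ * t₁ + (-q ^ 2) • (t₁ * t₀) + (-((1 - q ^ 2) * (1 - s ^ 2))) • t₁ = 0) :
    opGen q s b t₀ t₁ t₁' .A * opGen q s b t₀ t₁ t₁' .B
      = q ^ 2 • (opGen q s b t₀ t₁ t₁' .B * opGen q s b t₀ t₁ t₁' .A) := by
  simp only [opGen, sub_mul, mul_sub, smul_mul_assoc, mul_smul_comm, one_mul, mul_one]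
  linear_combination (norm := module) (-((1 + q ^ 2)⁻¹ * b)) • h

/-- Substituting `A` and `B` in terms of `x₀` and `x₁` turns the defining relation into `(1 + q²)⁻²`
times the quadratic one. -/
theorem opGen_B_mul_Bstar (hq : 1 + q ^ 2 ≠ 0) (hb : b * b = (1 + q ^ 2)⁻¹)
    (h : (1 + q ^ 2) • (t₁ * t₁') + t₀ * t₀ + (-((1 - q ^ 2) * (1 - s ^ 2))) • t₀
      + (-((1 + q ^ 2 * s ^ 2) * (q ^ 2 + s ^ 2))) • 1 = 0) :
    opGen q s b t₀ t₁ t₁' .B * opGen q s b t₀ t₁ t₁' .Bstar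
      + (opGen q s b t₀ t₁ t₁' .A + s ^ 2 • 1) * (opGen q s b t₀ t₁ t₁' .A - 1) = 0 := by
  simp only [opGen, add_mul, sub_mul, mul_sub, smul_mul_assoc, mul_smul_comm, one_mul, mul_one,
    smul_sub, smul_smul, hb]
  linear_combination (norm := skip) ((1 + q ^ 2)⁻¹ ^ 2) • h
  match_scalars <;> field_simp <;> ring

theorem opGen_Bstar_mul_B (hq : 1 + q ^ 2 ≠ 0) (hb : b * b = (1 + q ^ 2)⁻¹)
    (h : (1 + q ^ 2) • (t₁' * t₁) + q ^ 4 • (t₀ * t₀) + (q ^ 2 * ((1 - q ^ 2) * (1 - s ^ 2))) • t₀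
      + (-((1 + q ^ 2 * s ^ 2) * (q ^ 2 + s ^ 2))) • 1 = 0) :
    opGen q s b t₀ t₁ t₁' .Bstar * opGen q s b t₀ t₁ t₁' .B
      + (q ^ 2 • opGen q s b t₀ t₁ t₁' .A + s ^ 2 • 1) * (q ^ 2 • opGen q s b t₀ t₁ t₁' .A - 1)
      = 0 := by
  simp only [opGen, add_mul, sub_mul, mul_sub, smul_mul_assoc, mul_smul_comm, one_mul, mul_one,
    smul_sub, smul_smul, hb]
  linear_combination (norm := skip) ((1 + q ^ 2)⁻¹ ^ 2) • h
  match_scalars <;> field_simp <;> ring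

end Relations

/-! ### The universal property of the coordinate `*`-algebra -/

section Extension

variable {q s : ℝ} {R : Type} [Ring R] [Algebra ℂ R]

theorem algebra_induction {P : Alg q s → Prop} (h₁ : ∀ c : ℂ, P (algebraMap ℂ _ c))
    (hg : ∀ g, P (gen q s g)) (hm : ∀ x y, P x → P y → P (x * y))
    (ha : ∀ x y, P x → P y → P (x + y)) (x : Alg q s) : P x := by
  obtain ⟨y, rfl⟩ := RingQuot.mkAlgHom_surjective ℂ (Rel q s) x
  induction y using FreeAlgebra.induction with
  | grade0 c => rw [AlgHom.commutes]; exact h₁ c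
  | grade1 g => exact hg g
  | mul x y hx hy => rw [map_mul]; exact hm _ _ hx hy
  | add x y hx hy => rw [map_add]; exact ha _ _ hx hy

theorem star_algebraMap_alg (c : ℂ) :
    star (algebraMap ℂ (Alg q s) c) = algebraMap ℂ (Alg q s) (starRingEnd ℂ c) := by
  change ConjOp.out (starHom q s (algebraMap ℂ _ c)) = _
  rw [AlgHom.commutes, ConjOp.out_algebraMap]

variable [StarRing R] [StarModule ℂ R]

/-- A `*`-homomorphism out of `𝒜(S²_qs)` is given by images of the generators satisfying the
relations. -/
theorem exists_starAlgHom (f : Gen → R) (hstar : ∀ g, star (f g) = f g.adj)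
    (hAB : f .A * f .B = (q : ℂ) ^ 2 • (f .B * f .A))
    (hBB' : f .B * f .Bstar + (f .A + (s : ℂ) ^ 2 • 1) * (f .A - 1) = 0)
    (hB'B : f .Bstar * f .B
      + ((q : ℂ) ^ 2 • f .A + (s : ℂ) ^ 2 • 1) * ((q : ℂ) ^ 2 • f .A - 1) = 0) :
    ∃ π : Alg q s →⋆ₐ[ℂ] R, ∀ g, π (gen q s g) = f g := by
  have hrel : ∀ ⦃x y : Free⦄, Rel q s x y → FreeAlgebra.lift ℂ f x = FreeAlgebra.lift ℂ f y := by
    intro x y h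
    cases h with
    | AB => simpa using hAB
    | BstarA =>
      -- The fourth relation is the adjoint of the first, so it need not be assumed.
      have h := congrArg star hAB
      rw [star_mul, star_smul, star_mul, hstar, hstar] at h
      simpa [Gen.adj] using h
    | BBstar => simpa using hBB'
    | BstarB => simpa using hB'B
  set φ : Alg q s →ₐ[ℂ] R := RingQuot.liftAlgHom ℂ ⟨FreeAlgebra.lift ℂ f, hrel⟩ with hφ
  have hgen : ∀ g, φ (gen q s g) = f g := by
    intro g
    rw [hφ, gen, RingQuot.liftAlgHom_mkAlgHom_apply, FreeAlgebra.lift_ι_apply]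
  have hφs : ∀ x, φ (star x) = star (φ x) := by
    refine algebra_induction (fun c => ?_) (fun g => ?_) (fun x y hx hy => ?_) fun x y hx hy => ?_
    · rw [star_algebraMap_alg, AlgHom.commutes, AlgHom.commutes, Algebra.algebraMap_eq_smul_one,
        Algebra.algebraMap_eq_smul_one, star_smul, star_one]
      rfl
    · rw [star_gen, hgen, hgen, hstar]
    · rw [star_mul, map_mul, map_mul, hx, hy, star_mul]
    · rw [star_add, map_add, map_add, hx, hy, star_add]
  exact ⟨{ φ with map_star' := hφs }, hgen⟩

end Extension

/-! ### The grading and the Dirac operator on basis vectors -/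

section Grading

variable {q s N : ℝ}

theorem dirac_ket {l m : ℝ} (ε : ℤˣ) (h : IsLabel N (l, m)) :
    ∃ hd : ket N l m ε ∈ (dirac N).domain,
      dirac N ⟨ket N l m ε, hd⟩ = ((l - |N| + 1 : ℝ) : ℂ) • ket N l m (-ε) := by
  rw [ket_of_isLabel h, ket_of_isLabel h]
  exact ⟨stdBasis_mem_domain _, weightedShift_stdBasis (fun _ => rfl) flip_flip _⟩

/-- `γ` is the grading of `ℋ_N ⊕ ℋ_{-N}`, equal to `1` on `ℋ_{-N}` and `-1` on `ℋ_N`. -/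
def IsGradingOp (γ : Spinors N →L[ℂ] Spinors N) : Prop :=
  ∀ v i, γ v i = -((i.2 : ℤ) : ℂ) * v i

theorem IsGradingOp.apply_ket {γ : Spinors N →L[ℂ] Spinors N} (h : IsGradingOp γ) (l m : ℝ) (ε : ℤˣ) :
    γ (ket N l m ε) = (-((ε : ℤ) : ℂ)) • ket N l m ε := by
  classical
  refine lp.ext (funext fun i => ?_)
  rw [h]
  change _ = -((ε : ℤ) : ℂ) * ket N l m ε i
  rw [ket_apply]
  split_ifs with hi
  · rw [hi.2.2]
  · simp

theorem exists_isGradingOp : ∃ γ : Spinors N →L[ℂ] Spinors N, IsGradingOp γ :=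
  exists_diagonal (fun i : Idx N => -((i.2 : ℤ) : ℂ)) (C := 1) fun i => by
    rcases Int.units_eq_one_or i.2 with hi | hi <;> simp [hi]

/-- Tridiagonal operators preserve the sign `ε`, on which alone `γ` depends. -/
theorem IsTri.commute {T γ : Spinors N →L[ℂ] Spinors N} {e : ℝ} {p z n : ℤˣ → ℝ → ℝ → ℝ}
    (h : IsTri T e p z n) (hγ : IsGradingOp γ) : Commute T γ := by
  refine op_ext_ket fun l m ε hl => ?_
  change T (γ (ket N l m ε)) = γ (T (ket N l m ε))
  rw [hγ.apply_ket, map_smul, h l m ε hl]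
  simp only [map_add, map_smul, hγ.apply_ket]
  module

theorem IsGradingOp.isGrading {γ : Spinors N →L[ℂ] Spinors N} (h : IsGradingOp γ)
    {π : Alg q s →⋆ₐ[ℂ] (Spinors N →L[ℂ] Spinors N)} (hπ : ∀ a, Commute (π a) γ) :
    SpecTriple.IsGrading π (dirac N) γ where
  selfAdjoint := by
    refine ent_ext fun i j => ?_
    rw [ent_star, ent, ent, h, h]
    rcases eq_or_ne i j with rfl | hij
    · simp [stdBasis_apply_self]
    · rw [stdBasis_apply_ne hij, stdBasis_apply_ne hij.symm]; simp
  sq_eq_one := by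
    refine ContinuousLinearMap.ext fun v => lp.ext (funext fun i => ?_)
    change γ (γ v) i = v i
    rw [h, h]
    rcases Int.units_eq_one_or i.2 with hi | hi <;> simp [hi]
  anticomm v := by
    have key : ∀ i, (eigenvalue N i : ℂ) * γ (v : Spinors N) (flip N i)
        = (-γ (dirac N v)) i := by
      intro i
      change _ = -(γ (dirac N v) i)
      rw [h, h]
      change _ = -(_ * ((eigenvalue N i : ℂ) * (v : Spinors N) (flip N i)))
      simp [flip]
      ring
    have hd : γ (v : Spinors N) ∈ (dirac N).domain :=
      memℓp_of_apply_eq key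
    exact ⟨hd, lp.ext (funext key)⟩
  comm := hπ

end Grading

/-! ### The representation and the spectral triple -/

section Representation

variable {q s N : ℝ} [hN : Fact (∃ k : ℤ, N = (k : ℝ) / 2)]

theorem q_mul_qnum_two (hq0 : 0 < q) (hq1 : q < 1) : q * qnum q 2 = 1 + q ^ 2 := by
  rw [qnum_two hq0 hq1]; field_simp; ring

/-- `q[2] = 1 + q²` fixes the normalization `B = (1 + q²)^(-1/2) x₁`. Properties stable under the
algebra operations are checked on the generators only. -/
theorem exists_spinorRep (hq0 : 0 < q) (hq1 : q < 1) (hs : 0 ≤ s) (h2 : 1 / 2 ≤ |N|) :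
    ∃ π : Alg q s →⋆ₐ[ℂ] (Spinors N →L[ℂ] Spinors N),
      IsSpinorRep q s N π ∧ (∀ a, HasScalarSymbol (π a)) ∧
      (∀ γ, IsGradingOp γ → ∀ a, Commute (π a) γ) ∧
      IsTri (π (x0 q s)) 0 (x0Up q s N) (x0Diag q s N) (x0Down q s N) := by
  obtain ⟨T₀, h₀, s₀⟩ := exists_x0 hq0 hq1 hs h2
  obtain ⟨T₁, h₁, s₁⟩ := exists_x1 hq0 hq1 hs h2
  obtain ⟨T₁', h₁', s₁'⟩ := exists_x1s hq0 hq1 hs h2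
  have hc0 : (0 : ℝ) < 1 + q ^ 2 := by positivity
  have hr0 : √(1 + q ^ 2) ≠ 0 := (Real.sqrt_pos.2 hc0).ne'
  have hc : (1 + (q : ℂ) ^ 2) ≠ 0 := by exact_mod_cast hc0.ne'
  set b : ℂ := (((√(1 + q ^ 2))⁻¹ : ℝ) : ℂ) with hbdef
  have hb : b * b = (1 + (q : ℂ) ^ 2)⁻¹ := by
    rw [hbdef, ← Complex.ofReal_mul, ← mul_inv, Real.mul_self_sqrt hc0.le]
    push_cast; rfl
  have e₀ : star T₀ = T₀ := h₀.star_eq (by simp) h₀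
    (fun ε l m _ => by simp [x0Down]) (fun ε l m _ => by simp)
    fun ε l m _ => by simp [x0Down]
  -- `T₁'` was built from the transposed coefficients, so it is the adjoint by construction.
  have e₁ : star T₁ = T₁' := h₁.star_eq rfl h₁' (fun _ _ _ _ => rfl) (fun _ _ _ _ => rfl)
    fun _ _ _ _ => rfl
  have e₁' : star T₁' = T₁ := by rw [← e₁, star_star]
  have r₁ := x0_mul_x1 hq0 hq1 h2 h₀ h₁
  have r₂ := x1_mul_x1s hq0 hq1 h2 h₀ h₁ h₁'
  have r₃ := x1s_mul_x1 hq0 hq1 h2 h₀ h₁ h₁'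
  push_cast at r₁ r₂ r₃
  obtain ⟨π, hπ⟩ := exists_starAlgHom (q := q) (s := s) (opGen q s b T₀ T₁ T₁')
    (fun g => by
      cases g with
      | A =>
        simp only [opGen, Gen.adj, star_smul, star_sub, star_one, e₀]
        congr 1
        · simp
        · simp
      | B => simp only [opGen, Gen.adj, star_smul, e₁]; simp [hbdef]
      | Bstar => simp only [opGen, Gen.adj, star_smul, e₁']; simp [hbdef])
    (opGen_A_mul_B r₁) (opGen_B_mul_Bstar hc hb r₂) (opGen_Bstar_mul_B hc hb r₃)
  have hx0 : π (x0 q s) = T₀ := by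
    rw [x0, map_add, map_smul, map_smul, map_one, hπ, opGen, q_mul_qnum_two hq0 hq1]
    push_cast
    match_scalars <;> field_simp
    ring
  have hx1 : π (x1 q s) = T₁ := by
    rw [x1, map_smul, hπ, opGen, q_mul_qnum_two hq0 hq1, smul_smul, hbdef, ← Complex.ofReal_mul,
      mul_inv_cancel₀ hr0, Complex.ofReal_one, one_smul]
  refine ⟨π, ⟨fun l m ε hl => ?_, fun l m ε hl => ?_⟩, ?_, fun γ hγ => ?_, ?_⟩
  · rw [hx1, h₁ l m ε hl]; rfl
  · rw [hx0, h₀ l m ε hl, add_zero]; rfl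
  · refine algebra_induction (fun c => ?_) (fun g => ?_) (fun x y hx hy => ?_) fun x y hx hy => ?_
    · rw [Algebra.algebraMap_eq_smul_one, map_smul, map_one]
      exact HasScalarSymbol.one.smul c
    · rw [hπ]
      cases g with
      | A =>
        rw [opGen, sub_eq_add_neg, ← neg_one_smul ℂ T₀]
        exact ((HasScalarSymbol.one.smul _).add (s₀.smul _)).smul _
      | B => exact s₁.smul _
      | Bstar => exact s₁'.smul _
    · rw [map_mul]; exact hx.mul hy
    · rw [map_add]; exact hx.add hy
  · refine algebra_induction (fun c => ?_) (fun g => ?_) (fun x y hx hy => ?_) fun x y hx hy => ?_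
    · rw [Algebra.algebraMap_eq_smul_one, map_smul, map_one]
      exact (Commute.one_left γ).smul_left c
    · rw [hπ]
      cases g with
      | A => exact (((Commute.one_left γ).smul_left _).sub_left (h₀.commute hγ)).smul_left _
      | B => exact (h₁.commute hγ).smul_left b
      | Bstar => exact (h₁'.commute hγ).smul_left b
    · rw [map_mul]; exact hx.mul_left hy
    · rw [map_add]; exact hx.add_left hy
  · rw [hx0]; exact h₀

theorem exists_residue_ne_zero_spinorRep (hq0 : 0 < q) (hq1 : q < 1) (hs0 : 0 ≤ s) (hs1 : s ≤ 1)
    (h2 : 1 / 2 ≤ |N|) {π : Alg q s →⋆ₐ[ℂ] (Spinors N →L[ℂ] Spinors N)}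
    (hπ : ∀ a, HasScalarSymbol (π a))
    (h₀ : IsTri (π (x0 q s)) 0 (x0Up q s N) (x0Diag q s N) (x0Down q s N)) :
    ∃ T ∈ SpecTriple.Psi0 π (dirac N) (diracAbs N), ∃ a b, b ≠ 0 ∧
      HasPoleExpansion (SpecTriple.zeta (basis N) (diracAbs N) T) a b := by
  set a : Alg q s := ((1 - s ^ 2 : ℝ) : ℂ) • 1 + ((-1 : ℝ) : ℂ) • x0 q s with ha
  have hS : π a = ((1 - s ^ 2 : ℝ) : ℂ) • 1 + ((-1 : ℝ) : ℂ) • π (x0 q s) := by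
    rw [ha, map_add, map_smul, map_smul, map_one]
  exact ⟨π a * π a, mul_mem (Algebra.subset_adjoin (.of a)) (Algebra.subset_adjoin (.of a)),
    exists_residue_sq hq0 hq1 hs0 hs1 h2 h₀ hS ((hπ a).mul (hπ a)).toHasSymbol⟩

theorem isSpectralTriple_of_hasScalarSymbol {𝒜 : Type} [Ring 𝒜] [StarRing 𝒜] [Algebra ℂ 𝒜]
    {π : 𝒜 →⋆ₐ[ℂ] (Spinors N →L[ℂ] Spinors N)} (hπ : ∀ a, HasScalarSymbol (π a)) :
    SpecTriple.IsSpectralTriple π (dirac N) where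
  dense := dense_weightedShift_domain
  selfAdjoint := isSelfAdjoint_weightedShift (fun _ => rfl) flip_flip
  compact_resolvent := exists_compact_resolvent (fun _ => rfl) flip_flip one_le_eigenvalue
    tendsto_eigenvalue
  bounded_comm a := let ⟨S, _, h⟩ := (hπ a).exists_isComm_dirac; ⟨S, h⟩

end Representation

end Podles

end

theorem mainTheorem2 (q s N : ℝ) (hq0 : 0 < q) (hq1 : q < 1) (hs0 : 0 ≤ s) (hs1 : s ≤ 1)
    (hN : ∃ k : ℤ, N = (k : ℝ) / 2) (hN0 : N ≠ 0) :
    ∃ (π : Podles.Alg q s →⋆ₐ[ℂ] (Podles.Spinors N →L[ℂ] Podles.Spinors N))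
      (γ : Podles.Spinors N →L[ℂ] Podles.Spinors N),
      Podles.IsSpinorRep q s N π ∧
      (∀ (l m : ℝ) (ε : ℤˣ), Podles.IsLabel N (l, m) →
        γ (Podles.ket N l m ε) = (-((ε : ℤ) : ℂ)) • Podles.ket N l m ε) ∧
      (∀ (l m : ℝ) (ε : ℤˣ), Podles.IsLabel N (l, m) →
        ∃ h : Podles.ket N l m ε ∈ (Podles.dirac N).domain,
          Podles.dirac N ⟨Podles.ket N l m ε, h⟩
            = ((l - |N| + 1 : ℝ) : ℂ) • Podles.ket N l m (-ε)) ∧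
      SpecTriple.IsAbs (Podles.dirac N) (Podles.diracAbs N) ∧
      SpecTriple.IsSpectralTriple π (Podles.dirac N) ∧
      SpecTriple.IsGrading π (Podles.dirac N) γ ∧
      SpecTriple.IsRegular π (Podles.dirac N) (Podles.diracAbs N) ∧
      SpecTriple.IsMetricDim (Podles.diracAbs N) 2 ∧
      SpecTriple.IsDimensionSpectrum (Podles.basis N) π (Podles.dirac N) (Podles.diracAbs N) 2
        {1, 2} ∧
      SpecTriple.HasSimplePoles (Podles.basis N) π (Podles.dirac N) (Podles.diracAbs N) 2 := by
  have := Fact.mk hN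
  -- With `N ≠ 0` every level satisfies `l ≥ 1/2`, so the factor `[2l]` in the denominators of `α`
  -- and `β` never vanishes.
  have h2 := Podles.half_le_abs hN hN0
  obtain ⟨π, hrep, hsym, hcomm, h₀⟩ := Podles.exists_spinorRep (q := q) (s := s) hq0 hq1 hs0 h2
  obtain ⟨γ, hγ⟩ := Podles.exists_isGradingOp (N := N)
  exact ⟨π, γ, hrep, fun l m ε _ => hγ.apply_ket l m ε, fun l m ε h => Podles.dirac_ket ε h,
    Podles.isAbs_weightedShift (fun i => zero_le_one.trans (Podles.one_le_eigenvalue i))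
      (fun _ => rfl) Podles.flip_flip,
    Podles.isSpectralTriple_of_hasScalarSymbol hsym, hγ.isGrading (hcomm γ hγ),
    Podles.isRegular_of_hasScalarSymbol hsym, Podles.isMetricDim_two,
    Podles.isDimensionSpectrum_of_hasScalarSymbol hsym
      (Podles.exists_residue_ne_zero_spinorRep hq0 hq1 hs0 hs1 h2 hsym h₀),
    Podles.hasSimplePoles_of_hasScalarSymbol hsym⟩
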